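/- Let $f\in C^2$ with $f(0)=f(1)=0$, $f'(0)=1$ and $f''<0$ on $[0,1]$, and let $K>0$. There is a constant $C>0$, depending only on $f$ and $K$, such that the following holds. Let $\kappa,v_0,H>0$ and $l=\kappa/v_0$. Let $u=(u_1,u_2)(x,y)$ be a $C^1$ divergence-free vector field on the strip $\Omega=\mathbb R\times[0,H]$ (continuous up to the boundary), with $u_1$ and $\nabla u$ bounded and $\int_0^H u_1(x,y)\,dy=0$ for all $x$. Let $0\le T(x,y,t)\le 1$ be a classical solution for $t>0$, continuous up to $t=0$, of $$T_t+u\cdot\nabla T=\kappa\Delta T+\frac{v_0^2}{4\kappa}f(T)$$ in $\Omega$, either with Neumann conditions $T_y=0$ at $y=0,H$, in which case $u_2=0$ at $y=0,H$, or with $T$ and $u$ extended to the plane as $H$-periodic functions of $y$. Assume that for some $\lambda>0$ the initial data satisfy $T(x,y,0)=1-O(e^{\lambda x})$ for $x<0$ and $T(x,y,0)=O(e^{-\lambda x})$ for $x>0$. Let $$V(t)=\int_\Omega T_t(x,y,t)\,\frac{dx\,dy}{H},\qquad \langle V\rangle_\tau=\frac1\tau\int_0^\tau V(t)\,dt .$$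 Suppose that there are finitely many tubes $D_j^+$ and finitely many tubes $D_j^-$ in $\Omega$ (modulo $H$ in $y$ in the periodic case), at least one of each kind, with pairwise disjoint interiors, with the following properties. Each tube $D_j=D_j^\pm$ carries one-to-one $C^2$ orthogonal coordinates $(\rho,\theta)$ with $\rho\in[c_j-h_j,c_j+h_j]$, $h_j>0$, $\theta\in\mathbb R$, and $dx^2+dy^2=E_1^2\,d\rho^2+E_2^2\,d\theta^2$ (where $c_j,h_j,E_1,E_2$ depend on the tube). In its interior $\rho$ is constant on the streamlines of $u$, $x\to\pm\infty$ along each streamline as $\theta\to\pm\infty$, and $u\cdot\nabla\theta>0$ in $D_j^+$, $u\cdot\nabla\theta<0$ in $D_j^-$; thus $D_j^+$ runs from $x=-\infty$ to $x=+\infty$ and $D_j^-$ runs back. Moreover, with $\omega=E_2/E_1$, $$K^{-1}\le E_1,E_2,|\omega|\le K,\qquad \left|\frac{\partial\omega}{\partial\rho}\right|\le\frac{K}{h_j}.$$ No assumption is made on the streamlines outside the tubes. Let $G(h,\xi)=\frac12(h-|\xi|)^2-(\frac h2-|\xi|)^2$ for $|\xi|<\frac h2$, $G(h,\xi)=\frac12(h-|\xi|)^2$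 for $\frac h2\le|\xi|<h$, and $$\mu_\pm[a,b]=\sum_j\int_{D_j^\pm\cap\{a\le x\le b\}}E_1E_2\,\frac{G(h_j,\rho-c_j)}{H(h_j^2+l^2)}\,d\rho\,d\theta .$$ Suppose that there are a partition $\dots<x_{-1}<x_0<x_1<\dots$ of the real axis ($x_i\to\pm\infty$ as $i\to\pm\infty$), with $x_{i+1}-x_i\le L$ for all $i$, and a number $m_0$ such that $\mu_+[x_i,x_{i+1}]/\mu_-[x_i,x_{i+1}]=m_0$ for all $i\in\mathbb Z$. Then for every $\tau\ge\max\left[\frac{\kappa}{v_0^2},\frac{H+L}{v_0}\right]$, $T_t(\cdot,\cdot,t)$ is integrable over $\Omega$ for almost every $t\in(0,\tau)$, $V$ is integrable on $(0,\tau)$, and $$\langle V\rangle_\tau\ge C\left(\frac{1}{1+m_0}\sum_{D_j^+}\Big(1+\frac{l^2}{h_j^2}\Big)^{-1}\int_{c_j-h_j/2}^{c_j+h_j/2}|u|\,E_1\,\frac{d\rho}{H}+\frac{1}{1+m_0^{-1}}\sum_{D_j^-}\Big(1+\frac{l^2}{h_j^2}\Big)^{-1}\int_{c_j-h_j/2}^{c_j+h_j/2}|u|\,E_1\,\frac{d\rho}{H}\right),$$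 where, in each tube, the integral may be taken along any level set of $\theta$. -/

import Mathlib

open MeasureTheory Set Filter
open scoped Topology

noncomputable section

namespace Percolating

/-- Lateral boundary conditions on the strip of width `H`. -/
inductive BC where
  | neumann
  | periodic

/-- The values of `y` on which all functions live: the closed cross-section `[0, H]` for Neumann
conditions, the whole line (on which everything is `H`-periodic) for periodic conditions. -/
def BC.cross (bc : BC) (H : ℝ) : Set ℝ :=
  match bc with
  | .neumann => Icc 0 H
  | .periodic => univ

/-- The interior of the cross-section. -/
def BC.crossInt (bc : BC) (H : ℝ) : Set ℝ :=
  match bc with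
  | .neumann => Ioo 0 H
  | .periodic => univ

/-- When two points of the plane are the same point of the domain: equality for Neumann
conditions, equality modulo the period `H` in `y` for periodic conditions. -/
def BC.SamePoint (bc : BC) (H x y x' y' : ℝ) : Prop :=
  match bc with
  | .neumann => x = x' ∧ y = y'
  | .periodic => x = x' ∧ ∃ k : ℤ, y' = y + k * H

/-- Concave KPP reaction. -/
structure IsKPP (f : ℝ → ℝ) : Prop where
  contDiff : ContDiff ℝ 2 f
  zero : f 0 = 0
  one : f 1 = 0
  deriv_zero : deriv f 0 = 1
  concave : ∀ s ∈ Icc (0 : ℝ) 1, deriv (deriv f) s < 0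

/-- The advecting velocity `u = (u₁, u₂)`: `C¹`, divergence free, with `u₁` and `∇u` bounded, with
zero total flow through every cross-section, and tangential to the boundary (Neumann) or
`H`-periodic in `y` (periodic). -/
structure IsFlow (bc : BC) (H : ℝ) (u₁ u₂ : ℝ → ℝ → ℝ) : Prop where
  continuousOn₁ : ContinuousOn (fun p : ℝ × ℝ => u₁ p.1 p.2) (univ ×ˢ bc.cross H)
  continuousOn₂ : ContinuousOn (fun p : ℝ × ℝ => u₂ p.1 p.2) (univ ×ˢ bc.cross H)
  contDiffOn₁ : ContDiffOn ℝ 1 (fun p : ℝ × ℝ => u₁ p.1 p.2) (univ ×ˢ bc.crossInt H)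
  contDiffOn₂ : ContDiffOn ℝ 1 (fun p : ℝ × ℝ => u₂ p.1 p.2) (univ ×ˢ bc.crossInt H)
  div_free : ∀ x, ∀ y ∈ bc.crossInt H,
    deriv (fun x' => u₁ x' y) x + deriv (fun y' => u₂ x y') y = 0
  bounded₁ : ∃ M, ∀ x, ∀ y ∈ bc.cross H, |u₁ x y| ≤ M
  bounded_grad : ∃ M, ∀ x, ∀ y ∈ bc.crossInt H,
    |deriv (fun x' => u₁ x' y) x| ≤ M ∧ |deriv (fun y' => u₁ x y') y| ≤ M ∧
    |deriv (fun x' => u₂ x' y) x| ≤ M ∧ |deriv (fun y' => u₂ x y') y| ≤ M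
  zero_mean : ∀ x, ∫ y in (0 : ℝ)..H, u₁ x y = 0
  boundary :
    match bc with
    | .neumann => ∀ x, u₂ x 0 = 0 ∧ u₂ x H = 0
    | .periodic => ∀ x y, u₁ x (y + H) = u₁ x y ∧ u₂ x (y + H) = u₂ x y

/-- Partial derivative in `t` of a function of `(x, y, t)`. -/
def dt (T : ℝ → ℝ → ℝ → ℝ) : ℝ → ℝ → ℝ → ℝ := fun x y t => deriv (fun t' => T x y t') t

/-- Partial derivative in `x`. -/
def dx (T : ℝ → ℝ → ℝ → ℝ) : ℝ → ℝ → ℝ → ℝ := fun x y t => deriv (fun x' => T x' y t) x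

/-- Partial derivative in `y`, taken within the cross-section `Y`, hence one-sided at the ends of
`[0, H]`. -/
def dy (Y : Set ℝ) (T : ℝ → ℝ → ℝ → ℝ) : ℝ → ℝ → ℝ → ℝ :=
  fun x y t => derivWithin (fun y' => T x y' t) Y y

/-- Continuity of a function of `(x, y, t)` in the three variables jointly. -/
def JointlyContinuousOn (T : ℝ → ℝ → ℝ → ℝ) (Y I : Set ℝ) : Prop :=
  ContinuousOn (fun p : ℝ × ℝ × ℝ => T p.1 p.2.1 p.2.2) (univ ×ˢ Y ×ˢ I)

/-- `T` has a derivative in `t` and two derivatives in each of `x` and `y`, all continuous up to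
the lateral boundary for `t > 0`, and is itself continuous up to `t = 0`. -/
structure IsRegular (Y : Set ℝ) (T : ℝ → ℝ → ℝ → ℝ) : Prop where
  cont : JointlyContinuousOn T Y (Ici 0)
  diff_t : ∀ x, ∀ y ∈ Y, ∀ t > 0, DifferentiableAt ℝ (fun t' => T x y t') t
  diff_x : ∀ x, ∀ y ∈ Y, ∀ t > 0, DifferentiableAt ℝ (fun x' => T x' y t) x
  diff_y : ∀ x, ∀ y ∈ Y, ∀ t > 0, DifferentiableWithinAt ℝ (fun y' => T x y' t) Y y
  diff_xx : ∀ x, ∀ y ∈ Y, ∀ t > 0, DifferentiableAt ℝ (fun x' => dx T x' y t) x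
  diff_yy : ∀ x, ∀ y ∈ Y, ∀ t > 0, DifferentiableWithinAt ℝ (fun y' => dy Y T x y' t) Y y
  cont_t : JointlyContinuousOn (dt T) Y (Ioi 0)
  cont_x : JointlyContinuousOn (dx T) Y (Ioi 0)
  cont_y : JointlyContinuousOn (dy Y T) Y (Ioi 0)
  cont_xx : JointlyContinuousOn (dx (dx T)) Y (Ioi 0)
  cont_yy : JointlyContinuousOn (dy Y (dy Y T)) Y (Ioi 0)

/-- `T` is a classical solution, with values in `[0, 1]` and localized initial data, of
`T_t + u · ∇T = κ ΔT + v₀² / (4κ) f(T)`. -/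
structure IsSolution (bc : BC) (κ v₀ H : ℝ) (f : ℝ → ℝ) (u₁ u₂ : ℝ → ℝ → ℝ)
    (T : ℝ → ℝ → ℝ → ℝ) : Prop where
  regular : IsRegular (bc.cross H) T
  range : ∀ x, ∀ y ∈ bc.cross H, ∀ t ≥ 0, T x y t ∈ Icc (0 : ℝ) 1
  pde : ∀ x, ∀ y ∈ bc.cross H, ∀ t > 0,
    dt T x y t + (u₁ x y * dx T x y t + u₂ x y * dy (bc.cross H) T x y t)
      = κ * (dx (dx T) x y t + dy (bc.cross H) (dy (bc.cross H) T) x y t)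
        + v₀ ^ 2 / (4 * κ) * f (T x y t)
  boundary :
    match bc with
    | .neumann => ∀ x, ∀ t > 0,
        dy (bc.cross H) T x 0 t = 0 ∧ dy (bc.cross H) T x H t = 0
    | .periodic => ∀ x y, ∀ t ≥ 0, T x (y + H) t = T x y t
  localized : ∃ lam > 0, ∃ A, ∀ x, ∀ y ∈ bc.cross H,
    (x < 0 → 1 - T x y 0 ≤ A * Real.exp (lam * x)) ∧
    (0 < x → T x y 0 ≤ A * Real.exp (-lam * x))

/-- The bulk burning rate `V(t) = ∫ T_t dx dy / H` over the strip `ℝ × [0, H]`. -/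
def bulkRate (H : ℝ) (T : ℝ → ℝ → ℝ → ℝ) (t : ℝ) : ℝ :=
  (∫ p in (univ : Set ℝ) ×ˢ Icc 0 H, dt T p.1 p.2 t) / H

/-- The time average of the bulk burning rate over `[0, τ]`. -/
def meanBulkRate (H : ℝ) (T : ℝ → ℝ → ℝ → ℝ) (τ : ℝ) : ℝ :=
  (1 / τ) * ∫ t in (0 : ℝ)..τ, bulkRate H T t

/-- A tube given by curvilinear coordinates: `(ρ, θ) ↦ (X ρ θ, Y ρ θ)` is the inverse of the change
of coordinates `(x, y) ↦ (ρ, θ)`, with `ρ` between `c - h` and `c + h` and `θ` in `ℝ`. -/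
structure Tube where
  c : ℝ
  h : ℝ
  X : ℝ → ℝ → ℝ
  Y : ℝ → ℝ → ℝ

namespace Tube

/-- The open coordinate strip `c - h < ρ < c + h`, `θ ∈ ℝ`. -/
def coords (D : Tube) : Set (ℝ × ℝ) := Ioo (D.c - D.h) (D.c + D.h) ×ˢ univ

/-- Derivative of the parametrization. -/
def Xρ (D : Tube) (ρ θ : ℝ) : ℝ := deriv (fun r => D.X r θ) ρ

/-- Derivative of the parametrization. -/
def Yρ (D : Tube) (ρ θ : ℝ) : ℝ := deriv (fun r => D.Y r θ) ρ

/-- Derivative of the parametrization. -/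
def Xθ (D : Tube) (ρ θ : ℝ) : ℝ := deriv (fun s => D.X ρ s) θ

/-- Derivative of the parametrization. -/
def Yθ (D : Tube) (ρ θ : ℝ) : ℝ := deriv (fun s => D.Y ρ s) θ

/-- The metric coefficient of `ρ`: `dx² + dy² = E₁² dρ² + E₂² dθ²` for orthogonal coordinates. -/
def E₁ (D : Tube) (ρ θ : ℝ) : ℝ := √(D.Xρ ρ θ ^ 2 + D.Yρ ρ θ ^ 2)

/-- The metric coefficient of `θ`. -/
def E₂ (D : Tube) (ρ θ : ℝ) : ℝ := √(D.Xθ ρ θ ^ 2 + D.Yθ ρ θ ^ 2)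

/-- The ratio of the metric coefficients. -/
def ω (D : Tube) (ρ θ : ℝ) : ℝ := D.E₂ ρ θ / D.E₁ ρ θ

/-- Two tubes have no common interior point in the domain. -/
def Apart (bc : BC) (H : ℝ) (D D' : Tube) : Prop :=
  ∀ p ∈ D.coords, ∀ q ∈ D'.coords,
    ¬ bc.SamePoint H (D.X p.1 p.2) (D.Y p.1 p.2) (D'.X q.1 q.2) (D'.Y q.1 q.2)

/-- `D` is a tube of streamlines of `u`, with `C²` orthogonal coordinates controlled by `K`, and
running from `x = -∞` to `x = +∞` if `σ = 1`, from `x = +∞` to `x = -∞` if `σ = -1`.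
As `∇ρ = (X_ρ, Y_ρ) / E₁²` and `∇θ = (X_θ, Y_θ) / E₂²`, the field `streamline` says `u · ∇ρ = 0`,
and `direction` says that `u · ∇θ` has the sign of `σ`. -/
structure IsStreamTube (bc : BC) (H : ℝ) (u₁ u₂ : ℝ → ℝ → ℝ) (K σ : ℝ) (D : Tube) : Prop where
  h_pos : 0 < D.h
  contDiffOn_X : ContDiffOn ℝ 2 (fun p : ℝ × ℝ => D.X p.1 p.2) D.coords
  contDiffOn_Y : ContDiffOn ℝ 2 (fun p : ℝ × ℝ => D.Y p.1 p.2) D.coords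
  mem_strip : ∀ p ∈ D.coords, D.Y p.1 p.2 ∈ bc.cross H
  injective : ∀ p ∈ D.coords, ∀ q ∈ D.coords,
    bc.SamePoint H (D.X p.1 p.2) (D.Y p.1 p.2) (D.X q.1 q.2) (D.Y q.1 q.2) → p = q
  orthogonal : ∀ p ∈ D.coords,
    D.Xρ p.1 p.2 * D.Xθ p.1 p.2 + D.Yρ p.1 p.2 * D.Yθ p.1 p.2 = 0
  streamline : ∀ p ∈ D.coords,
    u₁ (D.X p.1 p.2) (D.Y p.1 p.2) * D.Xρ p.1 p.2
      + u₂ (D.X p.1 p.2) (D.Y p.1 p.2) * D.Yρ p.1 p.2 = 0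
  direction : ∀ p ∈ D.coords,
    0 < σ * (u₁ (D.X p.1 p.2) (D.Y p.1 p.2) * D.Xθ p.1 p.2
      + u₂ (D.X p.1 p.2) (D.Y p.1 p.2) * D.Yθ p.1 p.2)
  tendsto_right : ∀ ρ ∈ Ioo (D.c - D.h) (D.c + D.h), Tendsto (D.X ρ) atTop atTop
  tendsto_left : ∀ ρ ∈ Ioo (D.c - D.h) (D.c + D.h), Tendsto (D.X ρ) atBot atBot
  bound_E₁ : ∀ p ∈ D.coords, K⁻¹ ≤ D.E₁ p.1 p.2 ∧ D.E₁ p.1 p.2 ≤ K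
  bound_E₂ : ∀ p ∈ D.coords, K⁻¹ ≤ D.E₂ p.1 p.2 ∧ D.E₂ p.1 p.2 ≤ K
  bound_ω : ∀ p ∈ D.coords, K⁻¹ ≤ |D.ω p.1 p.2| ∧ |D.ω p.1 p.2| ≤ K
  bound_ωρ : ∀ p ∈ D.coords, |deriv (fun r => D.ω r p.2) p.1| ≤ K / D.h

end Tube

/-- The averaging kernel `G(h, ξ)`, supported in `|ξ| ≤ h`. -/
def G (h ξ : ℝ) : ℝ :=
  if |ξ| < h / 2 then (h - |ξ|) ^ 2 / 2 - (h / 2 - |ξ|) ^ 2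
  else if |ξ| < h then (h - |ξ|) ^ 2 / 2
  else 0

/-- The measure `μ[a, b]` of the part of the tubes `D j` in the rectangle `a ≤ x ≤ b`, with
`l` the reaction length. -/
def tubeMeasure {N : ℕ} (H l : ℝ) (D : Fin N → Tube) (a b : ℝ) : ℝ :=
  ∑ j, ∫ p in {p ∈ (D j).coords | (D j).X p.1 p.2 ∈ Icc a b},
    (D j).E₁ p.1 p.2 * (D j).E₂ p.1 p.2
      * (G (D j).h (p.1 - (D j).c) / (H * ((D j).h ^ 2 + l ^ 2)))

/-- The sum of the weighted fluxes through the middles of the tubes `D j`, computed along the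
level sets `θ = s j`. -/
def fluxSum {N : ℕ} (H l : ℝ) (u₁ u₂ : ℝ → ℝ → ℝ) (D : Fin N → Tube) (s : Fin N → ℝ) : ℝ :=
  ∑ j, (1 + l ^ 2 / (D j).h ^ 2)⁻¹ *
    ∫ ρ in ((D j).c - (D j).h / 2)..((D j).c + (D j).h / 2),
      √(u₁ ((D j).X ρ (s j)) ((D j).Y ρ (s j)) ^ 2 + u₂ ((D j).X ρ (s j)) ((D j).Y ρ (s j)) ^ 2)
        * (D j).E₁ ρ (s j) / H

/-- The flow `u` percolates: finitely many tubes `Dp j` run from `x = -∞` to `x = +∞` and finitely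
many tubes `Dm j` run back, at least one of each, without overlap. -/
structure IsPercolating (bc : BC) (H : ℝ) (u₁ u₂ : ℝ → ℝ → ℝ) (K : ℝ) {Np Nm : ℕ}
    (Dp : Fin Np → Tube) (Dm : Fin Nm → Tube) : Prop where
  Np_pos : 0 < Np
  Nm_pos : 0 < Nm
  tube_p : ∀ j, (Dp j).IsStreamTube bc H u₁ u₂ K 1
  tube_m : ∀ j, (Dm j).IsStreamTube bc H u₁ u₂ K (-1)
  apart_p : ∀ i j, i ≠ j → (Dp i).Apart bc H (Dp j)
  apart_m : ∀ i j, i ≠ j → (Dm i).Apart bc H (Dm j)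
  apart_pm : ∀ i j, (Dp i).Apart bc H (Dm j)

/-- A partition `⋯ < x₋₁ < x₀ < x₁ < ⋯` of the real axis into intervals of length at most `L`. -/
structure IsPartition (x : ℤ → ℝ) (L : ℝ) : Prop where
  strictMono : StrictMono x
  tendsto_right : Tendsto x atTop atTop
  tendsto_left : Tendsto x atBot atBot
  step_le : ∀ i, x (i + 1) - x i ≤ L

end Percolating

end

noncomputable section

namespace Percolating

/-! ### The reaction term -/

/-! Write `c = v₀² / (4κ)`, `a = 4c = v₀² / κ`, `l = κ / v₀` and `q = T (1 - T)`. Concavity makes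
`f(T)` comparable to `q`. Integrating the equation over the strip removes diffusion, and also
advection, because `u₁` has mean zero on every cross-section. Hence `V = (c / H) ∫ f(T)`, and it
suffices to bound the fluxes by `Λ = ∫∫ q` (`integral_time_deriv`, `bulk`). Testing with `1/2 - T`
bounds `κ ∫∫ |∇T|²` by `c Λ` and one value of `∫ q` at a late time (`energy_box`). So between
suitable times the energy density `Q = a q + κ |∇T|²` has space-time integral at most `B`, a
multiple of `a Λ`, and `Q` is what all error terms are compared with.

In a tube the equation reads `E₁ E₂ T_t + σ F(ρ) T_θ = κ ((ω T_ρ)_ρ + (ω⁻¹ T_θ)_θ) + c E₁ E₂ f(T)`,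
where the flux density `F = |u| E₁` does not depend on `θ` by incompressibility (`flux_eq`,
`coord_weak`). Along every streamline `T` passes from 1 to 0 as `θ` increases. Integrating against
`G(h, ρ - c)` therefore turns advection into `-σ ∫ F G`, and the flux equals `σ d/dt ∫ E₁ E₂ G T`
plus diffusion and reaction terms. The delicate term is `∫ ω G' T_ρ`, since `∫ |T_ρ|` over an
infinite tube is not controlled by `∫ Q`. Here `1 = (1 - 6q) + 6q` is inserted: `(1 - 6q) T_ρ` is
the `ρ`-derivative of `S(T) = q (1 - 2T)`, which is integrated by parts and satisfies `|S(T)| ≤ q`,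
while `q |T_ρ|` yields to Young's inequality (`diffusion_ρ_le`). The total error is at most a
constant times `(h² + l²) ∫ Q`, which explains the normalization of the averaging measures
(`eventually_flux_le`).

Summing over disjoint tubes counts the energy only once. With `ΔT = T(t₁) - T(t₀)` and `μ±`
normalized without the factor `1/H`, the fluxes of the tubes `D⁺` are bounded by `∫ ΔT dμ₊ + C B`
and those of `D⁻` by `-∫ ΔT dμ₋ + C B` (`sum_flux_le`). Adding `m₀` times the second to the first
leaves `∫ ΔT dμ₊ - m₀ ∫ ΔT dμ₋`, in which constants on each cell of the partition cancel, so only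
the oscillation of `T` on cells matters (`partition_cell`). To measure it by `Q`, replace `T` by
`Φ(T) = 3T² - 2T³`: one has `|T - Φ(T)| ≤ q` and `|∇Φ(T)| = 6 q |∇T|`, which is at most a constant
times `Q / v₀`. An `L¹` Poincaré inequality on cells (`poincare_box`) then gives an error of order
`(1/a + (L + H) / v₀) ∫ Q` at the times `t₀` and `t₁`. These are chosen with `∫ Q ≤ 8 B / τ`
(`exists_good_times`), and the lower bound on `τ` makes the error a multiple of `B` (`flux_le`).

All integrations over infinite domains rest on the exponential localization of the front up to time
`τ`, obtained by comparison with exponentials (`exists_decay`), and on local `L²` bounds of `T_t`,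
which also give its integrability at almost every time. -/

lemma IsKPP.exists_bounds {f : ℝ → ℝ} (hf : IsKPP f) :
    ∃ m > 0, ∃ Mf > 0, ∀ s ∈ Icc (0 : ℝ) 1,
      m * (s * (1 - s)) ≤ f s ∧ f s ≤ Mf * (s * (1 - s)) := by
  have h1 : ContDiff ℝ 1 (deriv f) :=
    ((contDiff_succ_iff_deriv (n := 1)).1
      (by rw [one_add_one_eq_two]; exact hf.contDiff)).2.2
  have hd0 : Differentiable ℝ f := hf.contDiff.differentiable (by norm_num)
  have hd1 : Differentiable ℝ (deriv f) := h1.differentiable (by norm_num)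
  have hc : Continuous (deriv (deriv f)) := h1.continuous_deriv le_rfl
  obtain ⟨a, ha, hamax⟩ := isCompact_Icc.exists_isMaxOn (nonempty_Icc.2 zero_le_one)
    (hc.continuousOn (s := Icc (0 : ℝ) 1))
  obtain ⟨b, hb, hbmin⟩ := isCompact_Icc.exists_isMinOn (nonempty_Icc.2 zero_le_one)
    (hc.continuousOn (s := Icc (0 : ℝ) 1))
  -- If `σ f'' + 2k ≤ 0`, then `σ f - k s (1 - s)` is concave and vanishes at 0 and 1, hence is
  -- nonnegative in between. The signs `σ = ±1`, with `k` given by half the extreme values of `f''`,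
  -- produce the two bounds.
  have key : ∀ k σ : ℝ, (∀ s ∈ Icc (0 : ℝ) 1, σ * deriv (deriv f) s + 2 * k ≤ 0) →
      ∀ s ∈ Icc (0 : ℝ) 1, k * (s * (1 - s)) ≤ σ * f s := by
    intro k σ hk s hs
    have hD : deriv (fun s => σ * f s - k * (s * (1 - s))) =
        fun s => σ * deriv f s - k * (1 - 2 * s) := by
      funext s
      have : HasDerivAt (fun s => σ * f s - k * (s * (1 - s)))
          (σ * deriv f s - k * (1 * (1 - s) + s * (0 - 1))) s :=
        (((hd0 s).hasDerivAt).const_mul σ).sub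
          (((hasDerivAt_id s).mul ((hasDerivAt_const s (1 : ℝ)).sub (hasDerivAt_id s))).const_mul k)
      rw [this.deriv]; ring
    have hD2 : ∀ s, HasDerivAt (fun s => σ * deriv f s - k * (1 - 2 * s))
        (σ * deriv (deriv f) s - k * (0 - 2 * 1)) s := fun s =>
      (((hd1 s).hasDerivAt).const_mul σ).sub
        (((hasDerivAt_const s (1 : ℝ)).sub ((hasDerivAt_id s).const_mul 2)).const_mul k)
    have hconc : ConcaveOn ℝ (Icc (0 : ℝ) 1) (fun s => σ * f s - k * (s * (1 - s))) := by
      apply concaveOn_of_deriv2_nonpos (convex_Icc _ _)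
      · exact Continuous.continuousOn
          ((continuous_const.mul hd0.continuous).sub (by fun_prop))
      · exact fun x _ => DifferentiableAt.differentiableWithinAt
          ((((hd0 x).const_mul σ)).sub (by fun_prop))
      · rw [hD]; exact fun x _ => (hD2 x).differentiableAt.differentiableWithinAt
      · intro x hx
        simp only [Function.iterate_succ, Function.iterate_zero, Function.comp_apply, id]
        rw [hD, (hD2 x).deriv]
        have := hk x (interior_subset hx)
        linarith
    have := hconc.2 (left_mem_Icc.2 zero_le_one) (right_mem_Icc.2 zero_le_one)
      (sub_nonneg.2 hs.2) hs.1 (by ring)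
    simp [hf.zero, hf.one] at this
    linarith
  refine ⟨-deriv (deriv f) a / 2, by linarith [hf.concave a ha], -deriv (deriv f) b / 2,
    by linarith [hf.concave b hb], fun s hs => ⟨?_, ?_⟩⟩
  · have := key (-deriv (deriv f) a / 2) 1 (fun s hs => by
      have : deriv (deriv f) s ≤ deriv (deriv f) a := hamax hs
      linarith) s hs
    linarith
  · have := key (deriv (deriv f) b / 2) (-1) (fun s hs => by
      have : deriv (deriv f) b ≤ deriv (deriv f) s := hbmin hs
      linarith) s hs
    linarith

/-! ### Cutoff functions -/

/-- A compactly supported `C²` function together with its first two derivatives. -/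
structure IsCutoff (φ φ₁ φ₂ : ℝ → ℝ) (R : ℝ) : Prop where
  has₁ : ∀ x, HasDerivAt φ (φ₁ x) x
  has₂ : ∀ x, HasDerivAt φ₁ (φ₂ x) x
  cont₂ : Continuous φ₂
  zero : ∀ x, R < |x| → φ x = 0 ∧ φ₁ x = 0 ∧ φ₂ x = 0

lemma IsCutoff.cont {φ φ₁ φ₂ : ℝ → ℝ} {R : ℝ} (h : IsCutoff φ φ₁ φ₂ R) : Continuous φ :=
  continuous_iff_continuousAt.2 fun x => (h.has₁ x).continuousAt

lemma IsCutoff.cont₁ {φ φ₁ φ₂ : ℝ → ℝ} {R : ℝ} (h : IsCutoff φ φ₁ φ₂ R) : Continuous φ₁ :=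
  continuous_iff_continuousAt.2 fun x => (h.has₂ x).continuousAt

lemma IsCutoff.sq {φ φ₁ φ₂ : ℝ → ℝ} {R : ℝ} (h : IsCutoff φ φ₁ φ₂ R) :
    IsCutoff (fun x => φ x * φ x) (fun x => φ₁ x * φ x + φ x * φ₁ x)
      (fun x => φ₂ x * φ x + φ₁ x * φ₁ x + (φ₁ x * φ₁ x + φ x * φ₂ x)) R where
  has₁ x := (h.has₁ x).mul (h.has₁ x)
  has₂ x := ((h.has₂ x).mul (h.has₁ x)).add ((h.has₁ x).mul (h.has₂ x))
  cont₂ := by have := h.cont; have := h.cont₁; have := h.cont₂; fun_prop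
  zero x hx := by simp [h.zero x hx]

/-- One profile, scaled and translated, provides all cutoffs in `x` and in `θ`. The vanishing of
`χ₁` on `|x| < 1` ensures that along a tube the derivative of the cutoff meets only the far field,
where `T` is close to 0 or 1. -/
lemma exists_bump : ∃ (χ χ₁ χ₂ : ℝ → ℝ) (C : ℝ), 0 < C ∧ IsCutoff χ χ₁ χ₂ 2 ∧
    (∀ x, 0 ≤ χ x ∧ χ x ≤ 1 ∧ |χ₁ x| ≤ C ∧ |χ₂ x| ≤ C) ∧
    (∀ x, |x| ≤ 1 → χ x = 1) ∧ (∀ x, |x| < 1 → χ₁ x = 0) := by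
  let b : ContDiffBump (0 : ℝ) := ⟨1, 2, one_pos, one_lt_two⟩
  have hb : ContDiff ℝ 2 (b : ℝ → ℝ) := b.contDiff
  have h1 : ContDiff ℝ 1 (deriv b) :=
    ((contDiff_succ_iff_deriv (n := 1)).1 (by rw [one_add_one_eq_two]; exact hb)).2.2
  have hd0 : Differentiable ℝ b := hb.differentiable (by norm_num)
  have hd1 : Differentiable ℝ (deriv b) := h1.differentiable (by norm_num)
  have hc : Continuous (deriv (deriv b)) := h1.continuous_deriv le_rfl
  have hz : ∀ x : ℝ, 2 < |x| → (b : ℝ → ℝ) =ᶠ[𝓝 x] fun _ => 0 := fun x hx => by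
    filter_upwards [(isOpen_lt continuous_const continuous_abs).mem_nhds hx] with y hy
    exact b.zero_of_le_dist (by simpa [Real.dist_eq, b] using le_of_lt hy)
  have hz1 : ∀ x : ℝ, 2 < |x| → deriv b =ᶠ[𝓝 x] fun _ => 0 := fun x hx => by
    filter_upwards [(isOpen_lt continuous_const continuous_abs).mem_nhds hx] with y hy
    rw [(hz y hy).deriv_eq]; simp
  have hz2 : ∀ x : ℝ, 2 < |x| → deriv (deriv b) x = 0 := fun x hx => by
    rw [(hz1 x hx).deriv_eq]; simp
  obtain ⟨C1, hC1⟩ := (isCompact_Icc (a := (-2 : ℝ)) (b := 2)).exists_bound_of_continuousOn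
    hd1.continuous.continuousOn
  obtain ⟨C2, hC2⟩ := (isCompact_Icc (a := (-2 : ℝ)) (b := 2)).exists_bound_of_continuousOn
    hc.continuousOn
  refine ⟨b, deriv b, deriv (deriv b), 1 + |C1| + |C2|, by positivity,
    ⟨fun x => (hd0 x).hasDerivAt, fun x => (hd1 x).hasDerivAt, hc, fun x hx =>
      ⟨(hz x hx).self_of_nhds, (hz1 x hx).self_of_nhds, hz2 x hx⟩⟩,
    fun x => ⟨b.nonneg, b.le_one, ?_, ?_⟩, fun x hx => ?_, fun x hx => ?_⟩
  · by_cases hx : 2 < |x|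
    · rw [(hz1 x hx).self_of_nhds]; simp only [abs_zero]; positivity
    · have := hC1 x (abs_le.1 (not_lt.1 hx))
      rw [Real.norm_eq_abs] at this
      linarith [le_abs_self C1, abs_nonneg C2]
  · by_cases hx : 2 < |x|
    · rw [hz2 x hx]; simp only [abs_zero]; positivity
    · have := hC2 x (abs_le.1 (not_lt.1 hx))
      rw [Real.norm_eq_abs] at this
      linarith [le_abs_self C2, abs_nonneg C1]
  · exact b.one_of_mem_closedBall (by simpa [Real.dist_eq, b] using hx)
  · have : (b : ℝ → ℝ) =ᶠ[𝓝 x] fun _ => 1 := by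
      filter_upwards [(isOpen_lt continuous_abs continuous_const).mem_nhds hx] with y hy
      exact b.one_of_mem_closedBall (by simpa [Real.dist_eq, b] using le_of_lt hy)
    rw [this.deriv_eq]; simp

lemma IsCutoff.scale {φ φ₁ φ₂ : ℝ → ℝ} {R : ℝ} (h : IsCutoff φ φ₁ φ₂ R) {r : ℝ} (hr : 0 < r)
    (a : ℝ) :
    IsCutoff (fun x => φ ((x - a) / r)) (fun x => φ₁ ((x - a) / r) / r)
      (fun x => φ₂ ((x - a) / r) / r / r) (R * r + |a|) where
  has₁ x := by
    exact ((h.has₁ ((x - a) / r)).comp x (((hasDerivAt_id x).sub_const a).div_const r)).congr_deriv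
      (by ring)
  has₂ x := by
    exact (((h.has₂ ((x - a) / r)).comp x
      (((hasDerivAt_id x).sub_const a).div_const r)).div_const r).congr_deriv (by ring)
  cont₂ := by have := h.cont₂; fun_prop
  zero x hx := by
    have : R < |(x - a) / r| := by
      rw [abs_div, abs_of_pos hr, lt_div_iff₀ hr]
      linarith [abs_sub_abs_le_abs_sub x a]
    simp [h.zero _ this]

/-! ### The averaging kernel as a quadratic spline -/

lemma hasDerivAt_max_sq (s : ℝ) : HasDerivAt (fun s : ℝ => (max s 0) ^ 2) (2 * max s 0) s := by
  rcases lt_trichotomy s 0 with hs | hs | hs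
  · have : (fun s : ℝ => (max s 0) ^ 2) =ᶠ[𝓝 s] fun _ => 0 := by
      filter_upwards [eventually_lt_nhds hs] with y hy
      simp [max_eq_right hy.le]
    rw [max_eq_right hs.le]
    simpa using (hasDerivAt_const s (0 : ℝ)).congr_of_eventuallyEq this
  · subst hs
    rw [hasDerivAt_iff_isLittleO_nhds_zero]
    simp only [zero_add, max_self, mul_zero, smul_zero, sub_zero, ne_eq, OfNat.ofNat_ne_zero,
      not_false_eq_true, zero_pow]
    refine Asymptotics.IsBigO.trans_isLittleO (g := fun h : ℝ => h ^ 2) ?_ ?_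
    · refine Asymptotics.IsBigO.of_bound 1 (Eventually.of_forall fun h => ?_)
      simp only [Real.norm_eq_abs, abs_pow, one_mul, sq_abs]
      rcases le_total h 0 with hh | hh <;> simp [hh, sq_nonneg]
    · exact Asymptotics.isLittleO_pow_id (by norm_num)
  · have : (fun s : ℝ => (max s 0) ^ 2) =ᶠ[𝓝 s] fun s => s ^ 2 := by
      filter_upwards [eventually_gt_nhds hs] with y hy
      simp [max_eq_left (le_of_lt hy)]
    rw [max_eq_left hs.le]
    simpa using (hasDerivAt_pow 2 s).congr_of_eventuallyEq this

/-- The derivative of the averaging kernel. -/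
def Gd (h ξ : ℝ) : ℝ :=
  max (ξ + h) 0 - 2 * max (ξ + h / 2) 0 + 2 * max (ξ - h / 2) 0 - max (ξ - h) 0

/-- The second derivative of the averaging kernel, away from its jumps. -/
def Gdd (h ξ : ℝ) : ℝ := if |ξ| < h / 2 then -1 else if |ξ| < h then 1 else 0

/-- As a combination of truncated squares with knots at `±h` and `±h/2`, the kernel is visibly `C¹`
with piecewise constant second derivative. It vanishes with its first derivative at `|ξ| = h`, so
integrations by parts across a tube leave no boundary terms. -/
lemma G_eq {h : ℝ} (hh : 0 < h) (ξ : ℝ) : G h ξ = (max (ξ + h) 0) ^ 2 / 2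
    - (max (ξ + h / 2) 0) ^ 2 + (max (ξ - h / 2) 0) ^ 2 - (max (ξ - h) 0) ^ 2 / 2 := by
  unfold G
  rcases le_total 0 ξ with h0 | h0
  · rw [abs_of_nonneg h0, max_eq_left (by linarith : 0 ≤ ξ + h),
      max_eq_left (by linarith : 0 ≤ ξ + h / 2)]
    split_ifs with h1 h2
    · rw [max_eq_right (by linarith), max_eq_right (by linarith)]; ring
    · rw [max_eq_left (by linarith), max_eq_right (by linarith)]; ring
    · rw [max_eq_left (by linarith), max_eq_left (by linarith)]; ring
  · rw [abs_of_nonpos h0, max_eq_right (by linarith : ξ - h ≤ 0),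
      max_eq_right (by linarith : ξ - h / 2 ≤ 0)]
    split_ifs with h1 h2
    · rw [max_eq_left (by linarith), max_eq_left (by linarith)]; ring
    · rw [max_eq_left (by linarith), max_eq_right (by linarith)]; ring
    · rw [max_eq_right (by linarith), max_eq_right (by linarith)]; ring

lemma hasDerivAt_G {h : ℝ} (hh : 0 < h) (ξ : ℝ) : HasDerivAt (G h) (Gd h ξ) ξ := by
  have e : G h = fun ξ => (max (ξ + h) 0) ^ 2 / 2 - (max (ξ + h / 2) 0) ^ 2
      + (max (ξ - h / 2) 0) ^ 2 - (max (ξ - h) 0) ^ 2 / 2 := funext (G_eq hh)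
  rw [e]
  have k : ∀ a : ℝ, HasDerivAt (fun ξ : ℝ => (max (ξ + a) 0) ^ 2) (2 * max (ξ + a) 0) ξ :=
    fun a => (hasDerivAt_max_sq (ξ + a)).comp_add_const ξ a
  have := ((((k h).div_const 2).sub (k (h / 2))).add (k (-(h / 2)))).sub ((k (-h)).div_const 2)
  simp only [← sub_eq_add_neg] at this
  exact this.congr_deriv (by unfold Gd; ring)

lemma continuous_Gd (h : ℝ) : Continuous (Gd h) := by unfold Gd; fun_prop

lemma continuous_G {h : ℝ} (hh : 0 < h) : Continuous (G h) :=
  continuous_iff_continuousAt.2 fun ξ => (hasDerivAt_G hh ξ).continuousAt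

lemma Gd_eq {h : ℝ} (hh : 0 < h) (ξ : ℝ) : Gd h ξ =
    if |ξ| < h / 2 then -ξ else if h ≤ |ξ| then 0 else if 0 ≤ ξ then ξ - h else ξ + h := by
  unfold Gd
  rcases le_total 0 ξ with h0 | h0
  · rw [abs_of_nonneg h0, max_eq_left (by linarith : 0 ≤ ξ + h),
      max_eq_left (by linarith : 0 ≤ ξ + h / 2)]
    split_ifs with h1 h2
    · rw [max_eq_right (by linarith), max_eq_right (by linarith)]; ring
    · rw [max_eq_left (by linarith), max_eq_left (by linarith)]; ring
    · rw [max_eq_left (by linarith), max_eq_right (by linarith)]; ring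
  · rw [abs_of_nonpos h0, max_eq_right (by linarith : ξ - h ≤ 0),
      max_eq_right (by linarith : ξ - h / 2 ≤ 0)]
    split_ifs with h1 h2 h3
    · rw [max_eq_left (by linarith), max_eq_left (by linarith)]; ring
    · rw [max_eq_right (by linarith), max_eq_right (by linarith)]; ring
    · rw [max_eq_left (by linarith), max_eq_right (by linarith)]; linarith
    · rw [max_eq_left (by linarith), max_eq_right (by linarith)]; ring

lemma abs_Gd_le {h : ℝ} (hh : 0 < h) (ξ : ℝ) : |Gd h ξ| ≤ h / 2 := by
  rw [Gd_eq hh]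
  split_ifs with h1 h2 h3
  · rw [abs_neg]; exact h1.le
  · rw [abs_zero]; linarith
  · rw [abs_of_nonneg h3] at h1 h2
    rw [abs_le]; constructor <;> linarith
  · rw [abs_of_neg (not_le.1 h3)] at h1 h2
    rw [abs_le]; constructor <;> linarith

lemma Gd_zero {h : ℝ} (hh : 0 < h) {ξ : ℝ} (hξ : h ≤ |ξ|) : Gd h ξ = 0 := by
  rw [Gd_eq hh, if_neg (by linarith), if_pos hξ]

lemma G_zero {h : ℝ} (hh : 0 < h) {ξ : ℝ} (hξ : h ≤ |ξ|) : G h ξ = 0 := by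
  rw [G, if_neg (by linarith), if_neg (by linarith)]

lemma G_nonneg {h : ℝ} (hh : 0 < h) (ξ : ℝ) : 0 ≤ G h ξ := by
  unfold G
  have := abs_nonneg ξ
  split_ifs with h1 h2
  · nlinarith
  · positivity
  · exact le_rfl

lemma G_pos {h : ℝ} (hh : 0 < h) {ξ : ℝ} (hξ : |ξ| < h) : 0 < G h ξ := by
  unfold G
  have := abs_nonneg ξ
  split_ifs with h1
  · nlinarith
  · have : 0 < h - |ξ| := by linarith
    positivity

lemma G_le {h : ℝ} (hh : 0 < h) (ξ : ℝ) : G h ξ ≤ h ^ 2 / 4 := by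
  unfold G
  have := abs_nonneg ξ
  split_ifs with h1 h2
  · nlinarith
  · nlinarith
  · positivity

/-- The kernel decreases in `|ξ|`, so on the middle half of the tube it is least at `|ξ| = h/2`.
Working with `h' < h` keeps away from the edges of the tube, where nothing is assumed; the bound
tends to `h² / 8` as `h'` tends to `h`. -/
lemma le_G {h h' ξ : ℝ} (hh : 0 < h) (hh' : h / 2 < h') (hl : h' ≤ h) (hξ : |ξ| ≤ h / 2) :
    (h' - h / 2) ^ 2 / 2 ≤ G h' ξ := by
  unfold G
  have := abs_nonneg ξ
  split_ifs with h1 h2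
  · nlinarith
  · nlinarith
  · linarith

lemma continuousAt_G_left {h : ℝ} (hh : 0 < h) (ξ : ℝ) :
    ContinuousAt (fun h' => G h' ξ) h := by
  have : (fun h' => G h' ξ) =ᶠ[𝓝 h] fun h => (max (ξ + h) 0) ^ 2 / 2
    - (max (ξ + h / 2) 0) ^ 2 + (max (ξ - h / 2) 0) ^ 2 - (max (ξ - h) 0) ^ 2 / 2 := by
    filter_upwards [eventually_gt_nhds hh] with h' hh'
    exact G_eq hh' ξ
  refine ContinuousAt.congr ?_ this.symm
  fun_prop

lemma abs_Gdd_le (h ξ : ℝ) : |Gdd h ξ| ≤ 1 := by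
  unfold Gdd; split_ifs <;> simp

lemma measurable_Gdd (h : ℝ) : Measurable (Gdd h) := by
  unfold Gdd
  refine Measurable.ite ?_ measurable_const (Measurable.ite ?_ measurable_const measurable_const)
  · exact measurableSet_lt measurable_norm measurable_const
  · exact measurableSet_lt measurable_norm measurable_const

lemma hasDerivAt_max {s : ℝ} (hs : s ≠ 0) :
    HasDerivAt (fun s : ℝ => max s 0) (if 0 < s then 1 else 0) s := by
  rcases hs.lt_or_gt with hs | hs
  · have : (fun s : ℝ => max s 0) =ᶠ[𝓝 s] fun _ => 0 := by
      filter_upwards [eventually_lt_nhds hs] with y hy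
      simp [max_eq_right hy.le]
    rw [if_neg (by linarith)]
    exact (hasDerivAt_const s (0 : ℝ)).congr_of_eventuallyEq this
  · have : (fun s : ℝ => max s 0) =ᶠ[𝓝 s] fun s => s := by
      filter_upwards [eventually_gt_nhds hs] with y hy
      simp [max_eq_left (le_of_lt hy)]
    rw [if_pos hs]
    exact (hasDerivAt_id s).congr_of_eventuallyEq this

lemma hasDerivAt_Gd {h ξ : ℝ} (hh : 0 < h) (h1 : ξ ≠ -h) (h2 : ξ ≠ -(h / 2)) (h3 : ξ ≠ h / 2)
    (h4 : ξ ≠ h) : HasDerivAt (Gd h) (Gdd h ξ) ξ := by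
  have k : ∀ a : ℝ, ξ + a ≠ 0 →
      HasDerivAt (fun ξ : ℝ => max (ξ + a) 0) (if 0 < ξ + a then 1 else 0) ξ :=
    fun a ha => (hasDerivAt_max ha).comp_add_const ξ a
  have := (((k h (fun h => h1 (by linarith))).sub ((k (h / 2)
    (fun h => h2 (by linarith))).const_mul 2)).add
    ((k (-(h / 2)) (fun h => h3 (by linarith))).const_mul 2)).sub
    (k (-h) (fun h => h4 (by linarith)))
  simp only [← sub_eq_add_neg] at this
  refine this.congr_deriv ?_
  unfold Gdd
  rcases le_total 0 ξ with h0 | h0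
  · rw [abs_of_nonneg h0, if_pos (by linarith : 0 < ξ + h), if_pos (by linarith : 0 < ξ + h / 2)]
    split_ifs <;> first | (norm_num; done) | (exfalso; grind)
  · rw [abs_of_nonpos h0, if_neg (by linarith : ¬ 0 < ξ - h), if_neg (by linarith : ¬ 0 < ξ - h / 2)]
    split_ifs <;> first | (norm_num; done) | (exfalso; grind)

/-! ### Integrals depending on a parameter -/

lemma continuousOn_setIntegral_of_isCompact {s : Set (ℝ × ℝ)} (hs : IsCompact s) {I : Set ℝ}
    (hI : IsOpen I) {F : ℝ × ℝ → ℝ → ℝ}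
    (hF : ContinuousOn (fun z : (ℝ × ℝ) × ℝ => F z.1 z.2) (s ×ˢ I)) :
    ContinuousOn (fun t => ∫ p in s, F p t) I := by
  intro t ht
  obtain ⟨ε, hε, hεI⟩ := Metric.isOpen_iff.1 hI t ht
  have hsub : Metric.closedBall t (ε / 2) ⊆ I :=
    (Metric.closedBall_subset_ball (by linarith)).trans hεI
  obtain ⟨C, hC⟩ := (hs.prod (isCompact_closedBall t (ε / 2))).exists_bound_of_continuousOn
    (hF.mono (prod_mono_right hsub))
  refine ContinuousAt.continuousWithinAt ?_
  have hnear : ∀ᶠ t' in 𝓝 t, t' ∈ Metric.closedBall t (ε / 2) :=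
    Metric.closedBall_mem_nhds t (by linarith)
  refine continuousAt_of_dominated (bound := fun _ => C) ?_ ?_ ?_ ?_
  · filter_upwards [hnear] with t' ht'
    have : ContinuousOn (fun p => F p t') s :=
      hF.comp (f := fun p => (p, t')) (by fun_prop) fun p hp => ⟨hp, hsub ht'⟩
    exact this.aestronglyMeasurable hs.measurableSet
  · filter_upwards [hnear] with t' ht'
    filter_upwards [ae_restrict_mem hs.measurableSet] with p hp
    exact hC (p, t') ⟨hp, ht'⟩
  · exact integrableOn_const hs.measure_lt_top.ne
  · filter_upwards [ae_restrict_mem hs.measurableSet] with p hp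
    have : ContinuousOn (fun t' => F p t') I :=
      hF.comp (f := fun t' => (p, t')) (by fun_prop) fun t' ht' => ⟨hp, ht'⟩
    exact this.continuousAt (hI.mem_nhds ht)

lemma hasDerivAt_setIntegral_of_isCompact {s : Set (ℝ × ℝ)} (hs : IsCompact s) {I : Set ℝ}
    (hI : IsOpen I) {F F' : ℝ × ℝ → ℝ → ℝ}
    (hF : ContinuousOn (fun z : (ℝ × ℝ) × ℝ => F z.1 z.2) (s ×ˢ I))
    (hF' : ContinuousOn (fun z : (ℝ × ℝ) × ℝ => F' z.1 z.2) (s ×ˢ I))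
    (hd : ∀ p ∈ s, ∀ t ∈ I, HasDerivAt (F p) (F' p t) t) {t : ℝ} (ht : t ∈ I) :
    HasDerivAt (fun t => ∫ p in s, F p t) (∫ p in s, F' p t) t := by
  obtain ⟨ε, hε, hεI⟩ := Metric.isOpen_iff.1 hI t ht
  have hsub : Metric.closedBall t (ε / 2) ⊆ I :=
    (Metric.closedBall_subset_ball (by linarith)).trans hεI
  obtain ⟨C, hC⟩ := (hs.prod (isCompact_closedBall t (ε / 2))).exists_bound_of_continuousOn
    (hF'.mono (prod_mono_right hsub))
  have hnear : Metric.closedBall t (ε / 2) ∈ 𝓝 t :=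
    Metric.closedBall_mem_nhds t (by linarith)
  have hsl : ∀ t' ∈ I, ContinuousOn (fun p => F p t') s := fun t' ht' =>
    hF.comp (f := fun p => (p, t')) (by fun_prop) fun p hp => ⟨hp, ht'⟩
  have hsl' : ∀ t' ∈ I, ContinuousOn (fun p => F' p t') s := fun t' ht' =>
    hF'.comp (f := fun p => (p, t')) (by fun_prop) fun p hp => ⟨hp, ht'⟩
  refine (hasDerivAt_integral_of_dominated_loc_of_deriv_le (μ := volume.restrict s)
    (F := fun t p => F p t) (F' := fun t p => F' p t)
    (bound := fun _ => C) hnear ?_ ?_ ?_ ?_ ?_ ?_).2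
  · filter_upwards [hnear] with t' ht'
    exact (hsl t' (hsub ht')).aestronglyMeasurable hs.measurableSet
  · exact (hsl t ht).integrableOn_compact hs
  · exact (hsl' t ht).aestronglyMeasurable hs.measurableSet
  · filter_upwards [ae_restrict_mem hs.measurableSet] with p hp t' ht'
    exact hC (p, t') ⟨hp, ht'⟩
  · exact integrableOn_const hs.measure_lt_top.ne
  · filter_upwards [ae_restrict_mem hs.measurableSet] with p hp t' ht'
    exact hd p hp t' (hsub ht')

/-! ### Integrals over the strip -/

/-- The closed strip `ℝ × [0, H]`. -/
abbrev strip (H : ℝ) : Set (ℝ × ℝ) := univ ×ˢ Icc 0 H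

lemma measurableSet_strip (H : ℝ) : MeasurableSet (strip H) :=
  MeasurableSet.univ.prod measurableSet_Icc

lemma restrict_strip (H : ℝ) : (volume.restrict (strip H) : Measure (ℝ × ℝ)) =
    (volume : Measure ℝ).prod (volume.restrict (Icc 0 H)) := by
  rw [Measure.volume_eq_prod, ← Measure.prod_restrict, Measure.restrict_univ]

lemma restrict_strip_eq_Ioo (H : ℝ) : (volume.restrict (strip H) : Measure (ℝ × ℝ)) =
    volume.restrict (univ ×ˢ Ioo 0 H) := by
  rw [Measure.volume_eq_prod, ← Measure.prod_restrict, ← Measure.prod_restrict,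
    restrict_Ioo_eq_restrict_Icc]

lemma ae_mem_Ioo (H : ℝ) : ∀ᵐ p ∂(volume.restrict (strip H) : Measure (ℝ × ℝ)),
    p.2 ∈ Ioo 0 H := by
  rw [restrict_strip_eq_Ioo]
  filter_upwards [ae_restrict_mem (MeasurableSet.univ.prod measurableSet_Ioo)] with p hp
  exact hp.2

lemma isCompact_box (R H : ℝ) : IsCompact (Icc (-R) R ×ˢ Icc (0 : ℝ) H) :=
  isCompact_Icc.prod isCompact_Icc

lemma box_subset_strip (R H : ℝ) : Icc (-R) R ×ˢ Icc (0 : ℝ) H ⊆ strip H :=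
  prod_mono_left (subset_univ _)

lemma integrableOn_strip_of_continuousOn {H R : ℝ} {F : ℝ × ℝ → ℝ}
    (hF : ContinuousOn F (strip H)) (hz : ∀ p, R < |p.1| → F p = 0) :
    IntegrableOn F (strip H) := by
  refine IntegrableOn.of_forall_sdiff_eq_zero (s := Icc (-R) R ×ˢ Icc 0 H)
    ((hF.mono (box_subset_strip R H)).integrableOn_compact (isCompact_box R H))
    (measurableSet_strip H) fun p hp => hz p ?_
  by_contra h
  exact hp.2 ⟨abs_le.1 (not_lt.1 h), hp.1.2⟩

lemma integrableOn_strip_of_bounded {H R B : ℝ} {F : ℝ × ℝ → ℝ}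
    (hF : ContinuousOn F (univ ×ˢ Ioo 0 H)) (hB : ∀ p ∈ (univ : Set ℝ) ×ˢ Ioo 0 H, |F p| ≤ B)
    (hz : ∀ p, R < |p.1| → F p = 0) : IntegrableOn F (strip H) := by
  rw [IntegrableOn, restrict_strip_eq_Ioo]
  refine IntegrableOn.of_forall_sdiff_eq_zero (s := Icc (-R) R ×ˢ Ioo 0 H) ?_
    (MeasurableSet.univ.prod measurableSet_Ioo) fun p hp => hz p ?_
  · have hm : MeasurableSet (Icc (-R) R ×ˢ Ioo (0 : ℝ) H) :=
      measurableSet_Icc.prod measurableSet_Ioo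
    refine IntegrableOn.of_bound (C := B) ?_ ?_ ?_
    · exact (measure_mono (prod_mono_right Ioo_subset_Icc_self)).trans_lt
        (isCompact_box R H).measure_lt_top
    · exact (hF.mono (prod_mono_left (subset_univ _))).aestronglyMeasurable hm
    · filter_upwards [ae_restrict_mem hm] with p hp
      exact hB p ⟨mem_univ _, hp.2⟩
  · by_contra h
    exact hp.2 ⟨abs_le.1 (not_lt.1 h), hp.1.2⟩

lemma setIntegral_strip_eq_box {H R : ℝ} {F : ℝ × ℝ → ℝ} (hz : ∀ p, R < |p.1| → F p = 0) :
    ∫ p in strip H, F p = ∫ p in Icc (-R) R ×ˢ Icc 0 H, F p := by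
  refine (setIntegral_eq_of_subset_of_forall_sdiff_eq_zero (measurableSet_strip H)
    (box_subset_strip R H) fun p hp => hz p ?_)
  by_contra h
  exact hp.2 ⟨abs_le.1 (not_lt.1 h), hp.1.2⟩

/-- Integrability of the derivative need not be assumed: the integral of a non-integrable function
is 0 by convention. This disposes of exceptional slices when Fubini's theorem is applied on the
strip. -/
lemma integral_eq_zero_of_hasDerivAt {f f' : ℝ → ℝ} (hf : ∀ x, HasDerivAt f (f' x) x)
    {R : ℝ} (hz : ∀ x, R < |x| → f x = 0) : ∫ x, f' x = 0 := by
  by_cases h : Integrable f'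
  · have hc : Continuous f := continuous_iff_continuousAt.2 fun x => (hf x).continuousAt
    refine integral_eq_zero_of_hasDerivAt_of_integrable hf h ?_
    refine hc.integrable_of_hasCompactSupport ?_
    refine HasCompactSupport.intro (isCompact_Icc (a := -R) (b := R)) fun x hx => hz x ?_
    by_contra h
    exact hx (abs_le.1 (not_lt.1 h))
  · exact integral_undef h

lemma integral_strip_dx {H R : ℝ} {F F' : ℝ × ℝ → ℝ}
    (hF : ∀ x, ∀ y ∈ Ioo 0 H, HasDerivAt (fun x => F (x, y)) (F' (x, y)) x)
    (hint : IntegrableOn F' (strip H)) (hz : ∀ p, R < |p.1| → F p = 0) :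
    ∫ p in strip H, F' p = 0 := by
  rw [IntegrableOn, restrict_strip] at hint
  rw [restrict_strip, integral_prod_symm _ hint, integral_Icc_eq_integral_Ioo]
  refine setIntegral_eq_zero_of_forall_eq_zero fun y hy => ?_
  exact integral_eq_zero_of_hasDerivAt (fun x => hF x y hy) (R := R) fun x hx => hz (x, y) hx

lemma integral_strip_dy {H : ℝ} (hH : 0 < H) {F F' : ℝ × ℝ → ℝ}
    (hc : ∀ x, ContinuousOn (fun y => F (x, y)) (Icc 0 H))
    (hF : ∀ x, ∀ y ∈ Ioo 0 H, HasDerivAt (fun y => F (x, y)) (F' (x, y)) y)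
    (hint : IntegrableOn F' (strip H)) (hb : ∀ x, F (x, 0) = F (x, H)) :
    ∫ p in strip H, F' p = 0 := by
  rw [IntegrableOn, restrict_strip] at hint
  rw [restrict_strip, integral_prod _ hint]
  refine integral_eq_zero_of_ae (Eventually.of_forall fun x => ?_)
  simp only [Pi.zero_apply]
  by_cases h : IntegrableOn (fun y => F' (x, y)) (Icc 0 H)
  · rw [integral_Icc_eq_integral_Ioc, ← intervalIntegral.integral_of_le hH.le,
      intervalIntegral.integral_eq_sub_of_hasDerivAt_of_le hH.le (hc x) (hF x) ?_, hb, sub_self]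
    exact (intervalIntegrable_iff_integrableOn_Icc_of_le hH.le).2 h
  · exact integral_undef h

/-! ### Flows on the strip -/

/-- Divergence-free flow on the closed strip; `w = ∂₁u₁ = -∂₂u₂`. -/
structure StripFlow (H M : ℝ) (u₁ u₂ w : ℝ → ℝ → ℝ) : Prop where
  cont₁ : ContinuousOn (fun p : ℝ × ℝ => u₁ p.1 p.2) (strip H)
  cont₂ : ContinuousOn (fun p : ℝ × ℝ => u₂ p.1 p.2) (strip H)
  cont_w : ContinuousOn (fun p : ℝ × ℝ => w p.1 p.2) (univ ×ˢ Ioo 0 H)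
  has₁ : ∀ x, ∀ y ∈ Ioo 0 H, HasDerivAt (fun x => u₁ x y) (w x y) x
  has₂ : ∀ x, ∀ y ∈ Ioo 0 H, HasDerivAt (fun y => u₂ x y) (-w x y) y
  bdd₁ : ∀ x, ∀ y ∈ Icc 0 H, |u₁ x y| ≤ M
  bdd₂ : ∀ x, ∀ y ∈ Ioo 0 H, |u₂ x y| ≤ M * (1 + |x|)
  bdd_w : ∀ x, ∀ y ∈ Ioo 0 H, |w x y| ≤ M
  zero_mean : ∀ x, ∫ y in Icc 0 H, u₁ x y = 0

/-- `u · ∇` is skew symmetric on the strip. -/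
lemma StripFlow.integral_transport {H M : ℝ} {u₁ u₂ w : ℝ → ℝ → ℝ} (hu : StripFlow H M u₁ u₂ w)
    (hH : 0 < H) {φ φ₁ : ℝ → ℝ} {R : ℝ} (hφ : ∀ x, HasDerivAt φ (φ₁ x) x) (hφ₁ : Continuous φ₁)
    (hz : ∀ x, R < |x| → φ x = 0 ∧ φ₁ x = 0) {a ax ay : ℝ × ℝ → ℝ}
    (ha : ContinuousOn a (strip H)) (hax : ContinuousOn ax (strip H))
    (hay : ContinuousOn ay (strip H))
    (hdx : ∀ x, ∀ y ∈ Ioo 0 H, HasDerivAt (fun x => a (x, y)) (ax (x, y)) x)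
    (hdy : ∀ x, ∀ y ∈ Ioo 0 H, HasDerivAt (fun y => a (x, y)) (ay (x, y)) y)
    (hb : ∀ x, a (x, 0) * u₂ x 0 = a (x, H) * u₂ x H) :
    ∫ p in strip H, φ p.1 * (u₁ p.1 p.2 * ax p + u₂ p.1 p.2 * ay p)
      = -∫ p in strip H, φ₁ p.1 * u₁ p.1 p.2 * a p := by
  have hφc : Continuous φ := continuous_iff_continuousAt.2 fun x => (hφ x).continuousAt
  have hφs : ContinuousOn (fun p : ℝ × ℝ => φ p.1) (strip H) := by fun_prop
  have hφ₁s : ContinuousOn (fun p : ℝ × ℝ => φ₁ p.1) (strip H) := by fun_prop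
  have h1 := hu.cont₁
  have h2 := hu.cont₂
  have i1 : IntegrableOn (fun p : ℝ × ℝ => φ₁ p.1 * u₁ p.1 p.2 * a p) (strip H) :=
    integrableOn_strip_of_continuousOn (R := R) ((hφ₁s.mul h1).mul ha)
      fun p hp => by simp [hz p.1 hp]
  have i2 : IntegrableOn (fun p : ℝ × ℝ => φ p.1 * (u₁ p.1 p.2 * ax p)) (strip H) :=
    integrableOn_strip_of_continuousOn (R := R) (hφs.mul (h1.mul hax))
      fun p hp => by simp [hz p.1 hp]
  have i3 : IntegrableOn (fun p : ℝ × ℝ => φ p.1 * (u₂ p.1 p.2 * ay p)) (strip H) :=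
    integrableOn_strip_of_continuousOn (R := R) (hφs.mul (h2.mul hay))
      fun p hp => by simp [hz p.1 hp]
  -- Nothing is known about `w` on the boundary of the strip, so this integrability comes from its
  -- bound and not from continuity on a compact box.
  have i4 : IntegrableOn (fun p : ℝ × ℝ => φ p.1 * w p.1 p.2 * a p) (strip H) := by
    have hsub : (univ : Set ℝ) ×ˢ Ioo 0 H ⊆ strip H := prod_mono_right Ioo_subset_Icc_self
    obtain ⟨B, hB⟩ := (isCompact_box R H).exists_bound_of_continuousOn
      ((hφs.mul ha).mono (box_subset_strip R H))
    refine integrableOn_strip_of_bounded (R := R) (B := |B| * M)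
      (((hφs.mono hsub).mul hu.cont_w).mul (ha.mono hsub)) (fun p hp => ?_)
      fun p hp => by simp [hz p.1 hp]
    have hw := hu.bdd_w p.1 p.2 hp.2
    by_cases hR : R < |p.1|
    · simp only [hz p.1 hR, zero_mul, abs_zero]
      exact mul_nonneg (abs_nonneg _) ((abs_nonneg _).trans hw)
    · have hB' := hB p ⟨abs_le.1 (not_lt.1 hR), Ioo_subset_Icc_self hp.2⟩
      rw [Real.norm_eq_abs] at hB'
      have : φ p.1 * w p.1 p.2 * a p = (φ p.1 * a p) * w p.1 p.2 := by ring
      rw [this, abs_mul]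
      exact mul_le_mul (hB'.trans (le_abs_self B)) hw (abs_nonneg _) (abs_nonneg _)
  have e1 : ∫ p in strip H, (φ₁ p.1 * u₁ p.1 p.2 * a p + φ p.1 * w p.1 p.2 * a p
      + φ p.1 * (u₁ p.1 p.2 * ax p)) = 0 := by
    refine integral_strip_dx (R := R) (F := fun p => φ p.1 * u₁ p.1 p.2 * a p)
      (fun x y hy => ?_) ((i1.add i4).add i2) fun p hp => by simp [hz p.1 hp]
    exact (((hφ x).mul (hu.has₁ x y hy)).mul (hdx x y hy)).congr_deriv
      (by simp only [Pi.mul_apply]; ring)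
  -- The divergence condition is used here: the two integrals of `φ w a` have opposite signs in `e1`
  -- and `e2` and cancel in the sum.
  have e2 : ∫ p in strip H, (φ p.1 * (u₂ p.1 p.2 * ay p) - φ p.1 * w p.1 p.2 * a p) = 0 := by
    refine integral_strip_dy hH (F := fun p => φ p.1 * (u₂ p.1 p.2 * a p))
      (fun x => ?_) (fun x y hy => ?_) (i3.sub i4) fun x => ?_
    · have : ContinuousOn (fun p : ℝ × ℝ => φ p.1 * (u₂ p.1 p.2 * a p)) (strip H) :=
        hφs.mul (h2.mul ha)
      exact this.comp (f := fun y => (x, y)) (by fun_prop) fun y hy => ⟨mem_univ _, hy⟩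
    · exact (((hu.has₂ x y hy).mul (hdy x y hy)).const_mul (φ x)).congr_deriv (by ring)
    · simp only; rw [mul_comm (u₂ x 0), mul_comm (u₂ x H), hb]
  have e1' := integral_add (μ := volume.restrict (strip H)) (i1.add i4) i2
  have e1'' := integral_add (μ := volume.restrict (strip H)) i1 i4
  have e2' := integral_sub (μ := volume.restrict (strip H)) i3 i4
  have e3 := integral_add (μ := volume.restrict (strip H)) i2 i3
  simp only [Pi.add_apply] at e1' e1''
  simp only [mul_add]
  rw [e3]
  linarith

/-! ### One-sided derivative tests -/

lemma deriv_nonneg_of_eventually_le_left {k : ℝ → ℝ} {k' t : ℝ} (hk : HasDerivAt k k' t)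
    (hle : ∀ᶠ s in 𝓝[<] t, k s ≤ k t) : 0 ≤ k' := by
  have h := (hasDerivWithinAt_iff_tendsto_slope' (notMem_Iio.2 le_rfl)).1
    (hk.hasDerivWithinAt (s := Iio t))
  refine ge_of_tendsto h ?_
  filter_upwards [hle, self_mem_nhdsWithin] with s hs hst
  rw [slope_def_field]
  exact div_nonneg_of_nonpos (by linarith) (by simpa using (mem_Iio.1 hst).le)

lemma deriv_nonpos_of_max_left {g : ℝ → ℝ} {g' a b : ℝ} (hab : a < b)
    (hg : HasDerivWithinAt g g' (Icc a b) a) (hle : ∀ y ∈ Icc a b, g y ≤ g a) : g' ≤ 0 := by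
  have h := (hasDerivWithinAt_iff_tendsto_slope' (notMem_Ioi.2 le_rfl)).1
    (hg.mono_of_mem_nhdsWithin (Icc_mem_nhdsGT hab))
  refine le_of_tendsto h ?_
  filter_upwards [Ioo_mem_nhdsGT hab] with s hs
  rw [slope_def_field]
  exact div_nonpos_of_nonpos_of_nonneg (by linarith [hle s ⟨hs.1.le, hs.2.le⟩])
    (by linarith [hs.1])

lemma deriv_nonneg_of_max_right {g : ℝ → ℝ} {g' a b : ℝ} (hab : a < b)
    (hg : HasDerivWithinAt g g' (Icc a b) b) (hle : ∀ y ∈ Icc a b, g y ≤ g b) : 0 ≤ g' := by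
  have h := (hasDerivWithinAt_iff_tendsto_slope' (notMem_Iio.2 le_rfl)).1
    (hg.mono_of_mem_nhdsWithin (Icc_mem_nhdsLT hab))
  refine ge_of_tendsto h ?_
  filter_upwards [Ioo_mem_nhdsLT hab] with s hs
  rw [slope_def_field]
  exact div_nonneg_of_nonpos (by linarith [hle s ⟨hs.1.le, hs.2.le⟩]) (by linarith [hs.2])

/-- The maximum may lie at an endpoint, provided the first derivative vanishes there, as the lateral
boundary conditions will guarantee. If `g₂ > 0`, then `g₁ y` has the sign of `y - z` near `z`, and
the mean value theorem contradicts maximality on whichever side is available. -/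
lemma second_deriv_nonpos_of_max {g g₁ : ℝ → ℝ} {g₂ a b z : ℝ} (hab : a < b)
    (hg : ∀ y ∈ Icc a b, HasDerivWithinAt g (g₁ y) (Icc a b) y) (hz : z ∈ Icc a b)
    (hg₁ : HasDerivWithinAt g₁ g₂ (Icc a b) z) (h0 : g₁ z = 0)
    (hle : ∀ y ∈ Icc a b, g y ≤ g z) : g₂ ≤ 0 := by
  by_contra! hpos
  have h := hasDerivWithinAt_iff_tendsto_slope.1 hg₁
  have h' := (mem_nhdsWithin.1 (h (Ioi_mem_nhds hpos)))
  obtain ⟨o, ho, hzo, hsub⟩ := h'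
  obtain ⟨δ, hδ, hδo⟩ := Metric.isOpen_iff.1 ho z hzo
  have hsl : ∀ y ∈ Icc a b, y ≠ z → |y - z| < δ → 0 < g₁ y / (y - z) := fun y hy hyz hd => by
    have : y ∈ slope g₁ z ⁻¹' Ioi 0 := hsub ⟨hδo (by simpa [Real.dist_eq] using hd), hy, hyz⟩
    simpa [slope_def_field, h0] using this
  have hda : ∀ y ∈ Ioo a b, HasDerivAt g (g₁ y) y := fun y hy =>
    (hg y ⟨hy.1.le, hy.2.le⟩).hasDerivAt (Icc_mem_nhds hy.1 hy.2)
  have hc : ContinuousOn g (Icc a b) := fun y hy => (hg y hy).continuousWithinAt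
  rcases hz.2.lt_or_eq with hzb | hzb
  · obtain ⟨y, hy1, hy2⟩ := exists_between (lt_min hzb (lt_add_of_pos_right z hδ))
    have hyb := hy2.trans_le (min_le_left _ _)
    have hyd := hy2.trans_le (min_le_right _ _)
    obtain ⟨s, hs, hs'⟩ := exists_hasDerivAt_eq_slope g g₁ hy1
      (hc.mono (Icc_subset_Icc hz.1 hyb.le)) fun s hs => hda s
        ⟨hz.1.trans_lt hs.1, hs.2.trans hyb⟩
    have h1 := hsl s ⟨hz.1.trans hs.1.le, (hs.2.trans hyb).le⟩ hs.1.ne'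
      (by rw [abs_of_pos (by linarith [hs.1])]; linarith [hs.2])
    have h2 : g₁ s ≤ 0 := by
      rw [hs']
      exact div_nonpos_of_nonpos_of_nonneg
        (by linarith [hle y ⟨hz.1.trans hy1.le, hyb.le⟩]) (by linarith)
    exact absurd h1 (not_lt.2 (div_nonpos_of_nonpos_of_nonneg h2 (by linarith [hs.1])))
  · have haz : a < z := by rw [hzb]; exact hab
    obtain ⟨y, hy1, hy2⟩ := exists_between (max_lt haz (sub_lt_self z hδ))
    have hya := (le_max_left _ _).trans_lt hy1
    have hyd := (le_max_right _ _).trans_lt hy1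
    obtain ⟨s, hs, hs'⟩ := exists_hasDerivAt_eq_slope g g₁ hy2
      (hc.mono (Icc_subset_Icc hya.le hz.2)) fun s hs => hda s
        ⟨hya.trans hs.1, hs.2.trans_le hz.2⟩
    have h1 := hsl s ⟨(hya.trans hs.1).le, hs.2.le.trans hz.2⟩ hs.2.ne
      (by rw [abs_of_neg (by linarith [hs.2])]; linarith [hs.1])
    have h2 : 0 ≤ g₁ s := by
      rw [hs']
      exact div_nonneg (by linarith [hle y ⟨hya.le, hy2.le.trans hz.2⟩]) (by linarith)
    exact absurd h1 (not_lt.2 (div_nonpos_of_nonneg_of_nonpos h2 (by linarith [hs.2])))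

/-! ### Comparison with an exponential -/

/-- Comparison with `W = exp (b t) (A exp (-lam x) + ε exp (lam x))`, then `ε → 0`. The `ε` term
makes contact with the bounded function `Z` possible only on a compact set, so there is a first
contact. There `Zy = 0`, so `u₂`, which may be unbounded, plays no role, and the summand 1 in `b`
makes the differential inequality fail strictly. The sign of `lam` is free, so the same statement
serves both ends of the strip. -/
lemma le_exp_barrier {H κ c M lam A : ℝ} (hH : 0 < H) (hκ : 0 < κ) (hlam : lam ≠ 0)
    (hA : 0 < A) {u₁ u₂ : ℝ → ℝ → ℝ} {Z Zt Zx Zy Zxx Zyy : ℝ → ℝ → ℝ → ℝ}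
    (hcont : ContinuousOn (fun z : (ℝ × ℝ) × ℝ => Z z.1.1 z.1.2 z.2) (strip H ×ˢ Ici 0))
    (ht : ∀ x, ∀ y ∈ Icc 0 H, ∀ t > 0, HasDerivAt (fun s => Z x y s) (Zt x y t) t)
    (hx : ∀ x, ∀ y ∈ Icc 0 H, ∀ t > 0, HasDerivAt (fun s => Z s y t) (Zx x y t) x)
    (hxx : ∀ x, ∀ y ∈ Icc 0 H, ∀ t > 0, HasDerivAt (fun s => Zx s y t) (Zxx x y t) x)
    (hy : ∀ x, ∀ y ∈ Icc 0 H, ∀ t > 0,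
      HasDerivWithinAt (fun s => Z x s t) (Zy x y t) (Icc 0 H) y)
    (hyy : ∀ x, ∀ y ∈ Icc 0 H, ∀ t > 0,
      HasDerivWithinAt (fun s => Zy x s t) (Zyy x y t) (Icc 0 H) y)
    (hle : ∀ x, ∀ y ∈ Icc 0 H, ∀ t ≥ 0, Z x y t ≤ 1)
    (hpde : ∀ x, ∀ y ∈ Icc 0 H, ∀ t > 0, Zt x y t + (u₁ x y * Zx x y t + u₂ x y * Zy x y t)
      ≤ κ * (Zxx x y t + Zyy x y t) + c * Z x y t)
    (hb : ∀ x t, 0 < t → (Zy x 0 t = 0 ∧ Zy x H t = 0) ∨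
      (Z x 0 t = Z x H t ∧ Zy x 0 t = Zy x H t))
    (hM : ∀ x, ∀ y ∈ Icc 0 H, |u₁ x y| ≤ M)
    (h0 : ∀ x, ∀ y ∈ Icc 0 H, Z x y 0 ≤ A * Real.exp (-lam * x)) (hc : 0 ≤ c) :
    ∀ x, ∀ y ∈ Icc 0 H, ∀ t ≥ 0,
      Z x y t ≤ A * Real.exp ((|lam| * M + κ * lam ^ 2 + c + 1) * t - lam * x) := by
  set b := |lam| * M + κ * lam ^ 2 + c + 1 with hbdef
  have hM0 : 0 ≤ M := (abs_nonneg _).trans (hM 0 0 ⟨le_rfl, hH.le⟩)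
  have hb0 : 0 < b := by positivity
  suffices key : ∀ ε > 0, ∀ x, ∀ y ∈ Icc 0 H, ∀ t ≥ 0,
      Z x y t < Real.exp (b * t) * (A * Real.exp (-lam * x) + ε * Real.exp (lam * x)) by
    intro x y hy t ht
    refine le_of_forall_pos_le_add fun δ hδ => ?_
    have := key (δ / (Real.exp (b * t) * Real.exp (lam * x))) (by positivity) x y hy t ht
    have e1 : A * Real.exp (b * t - lam * x) = Real.exp (b * t) * (A * Real.exp (-lam * x)) := by
      rw [sub_eq_add_neg, Real.exp_add, neg_mul]; ring
    have e2 : Real.exp (b * t) * (δ / (Real.exp (b * t) * Real.exp (lam * x)) * Real.exp (lam * x))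
        = δ := by
      field_simp
    rw [mul_add, e2, ← e1] at this
    exact this.le
  intro ε hε x₁ y₁ hy₁ t₁ ht₁
  by_contra! hbad
  set W : ℝ → ℝ → ℝ := fun x t =>
    Real.exp (b * t) * (A * Real.exp (-lam * x) + ε * Real.exp (lam * x)) with hW
  have hWpos : ∀ x t, 0 < W x t := fun x t => by positivity
  -- Contact forces `W ≤ 1`; then each of the two exponentials is at most 1, one bounding `x` from
  -- above and the other from below.
  obtain ⟨R, hR⟩ : ∃ R, ∀ x t, 0 ≤ t → W x t ≤ 1 → |x| ≤ R := by
    refine ⟨(|Real.log A| + |Real.log ε|) / |lam|, fun x t ht hWx => ?_⟩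
    have h1 : 1 ≤ Real.exp (b * t) := Real.one_le_exp (by positivity)
    have h2 : A * Real.exp (-lam * x) + ε * Real.exp (lam * x) ≤ 1 := by
      refine le_trans ?_ hWx
      exact le_mul_of_one_le_left (by positivity) h1
    have h3 : A * Real.exp (-lam * x) ≤ 1 := by
      have : 0 < ε * Real.exp (lam * x) := by positivity
      linarith
    have h4 : ε * Real.exp (lam * x) ≤ 1 := by
      have : 0 < A * Real.exp (-lam * x) := by positivity
      linarith
    have h5 : Real.log A + -lam * x ≤ 0 := by
      have := Real.log_nonpos (by positivity) h3
      rwa [Real.log_mul hA.ne' (Real.exp_pos _).ne', Real.log_exp] at this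
    have h6 : Real.log ε + lam * x ≤ 0 := by
      have := Real.log_nonpos (by positivity) h4
      rwa [Real.log_mul hε.ne' (Real.exp_pos _).ne', Real.log_exp] at this
    rw [le_div_iff₀ (abs_pos.2 hlam), ← abs_mul, mul_comm, abs_le]
    constructor
    · linarith [neg_abs_le (Real.log A), abs_nonneg (Real.log ε)]
    · linarith [neg_abs_le (Real.log ε), abs_nonneg (Real.log A)]
  have hWc : Continuous fun z : (ℝ × ℝ) × ℝ => W z.1.1 z.2 := by
    simp only [hW]; fun_prop
  set box : Set ((ℝ × ℝ) × ℝ) := (Icc (-R) R ×ˢ Icc 0 H) ×ˢ Icc 0 t₁ with hbox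
  have hboxc : IsCompact box := (isCompact_box R H).prod isCompact_Icc
  have hboxs : box ⊆ strip H ×ˢ Ici 0 :=
    prod_mono (box_subset_strip R H) fun t ht => ht.1
  set Bad : Set ((ℝ × ℝ) × ℝ) :=
    box ∩ (fun z : (ℝ × ℝ) × ℝ => Z z.1.1 z.1.2 z.2 - W z.1.1 z.2) ⁻¹' Ici 0 with hBad
  have hBadc : IsCompact Bad := by
    refine hboxc.of_isClosed_subset ?_ inter_subset_left
    exact ((hcont.mono hboxs).sub hWc.continuousOn).preimage_isClosed_of_isClosed
      hboxc.isClosed isClosed_Ici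
  have hmemBad : ∀ x, ∀ y ∈ Icc 0 H, ∀ t ∈ Icc 0 t₁, W x t ≤ Z x y t → ((x, y), t) ∈ Bad :=
    fun x y hy t ht h => ⟨⟨⟨abs_le.1 (hR x t ht.1 (h.trans (hle x y hy t ht.1))), hy⟩, ht⟩,
      sub_nonneg.2 h⟩
  -- First contact: `t` is minimized over the compact set of points where the comparison fails.
  obtain ⟨⟨⟨x, y⟩, t⟩, hz, hmin⟩ := hBadc.exists_isMinOn
    ⟨_, hmemBad x₁ y₁ hy₁ t₁ ⟨ht₁, le_rfl⟩ hbad⟩ continuous_snd.continuousOn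
  have hyI : y ∈ Icc 0 H := hz.1.1.2
  have htI : t ∈ Icc 0 t₁ := hz.1.2
  have hZW : W x t ≤ Z x y t := sub_nonneg.1 hz.2
  have ht0 : 0 < t := by
    rcases htI.1.eq_or_lt with h | h
    · exfalso
      rw [← h] at hZW
      have := h0 x y hyI
      have h2 : 0 < ε * Real.exp (lam * x) := by positivity
      simp only [hW, mul_zero, Real.exp_zero, one_mul] at hZW
      linarith
    · exact h
  have hbefore : ∀ x', ∀ y' ∈ Icc 0 H, ∀ s, 0 ≤ s → s < t → Z x' y' s < W x' s := by
    intro x' y' hy' s hs hst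
    by_contra! hcon
    have : t ≤ s := hmin (hmemBad x' y' hy' s ⟨hs, hst.le.trans htI.2⟩ hcon)
    linarith
  have hev : ∀ᶠ s in 𝓝[<] t, 0 ≤ s ∧ s < t := by
    filter_upwards [Ioo_mem_nhdsLT ht0] with s hs using ⟨hs.1.le, hs.2⟩
  have hat : ∀ x', ∀ y' ∈ Icc 0 H, Z x' y' t ≤ W x' t := by
    intro x' y' hy'
    have c1 : Tendsto (fun s => Z x' y' s) (𝓝[<] t) (𝓝 (Z x' y' t)) :=
      (ht x' y' hy' t ht0).continuousAt.tendsto.mono_left nhdsWithin_le_nhds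
    have c2 : Tendsto (fun s => W x' s) (𝓝[<] t) (𝓝 (W x' t)) := by
      have : Continuous fun s => W x' s := by simp only [hW]; fun_prop
      exact this.continuousAt.tendsto.mono_left nhdsWithin_le_nhds
    refine le_of_tendsto_of_tendsto c1 c2 ?_
    filter_upwards [hev] with s hs
    exact (hbefore x' y' hy' s hs.1 hs.2).le
  have heq : Z x y t = W x t := le_antisymm (hat x y hyI) hZW
  -- derivatives of the barrier
  have hE1 : ∀ s, HasDerivAt (fun s => Real.exp (-lam * s)) (-lam * Real.exp (-lam * s)) s :=
    fun s => (((hasDerivAt_id s).const_mul (-lam)).exp).congr_deriv (by simp; ring)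
  have hE2 : ∀ s, HasDerivAt (fun s => Real.exp (lam * s)) (lam * Real.exp (lam * s)) s :=
    fun s => (((hasDerivAt_id s).const_mul lam).exp).congr_deriv (by simp; ring)
  have hWt : HasDerivAt (fun s => W x s) (b * W x t) t := by
    have : HasDerivAt (fun s => Real.exp (b * s)) (b * Real.exp (b * t)) t :=
      (((hasDerivAt_id t).const_mul b).exp).congr_deriv (by simp; ring)
    exact (this.mul_const _).congr_deriv (by simp only [hW]; ring)
  set Wx : ℝ → ℝ := fun s =>
    Real.exp (b * t) * (A * (-lam * Real.exp (-lam * s)) + ε * (lam * Real.exp (lam * s)))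
  have hWx : ∀ s, HasDerivAt (fun s => W s t) (Wx s) s := fun s =>
    (((hE1 s).const_mul A).add ((hE2 s).const_mul ε)).const_mul _
  have hWxx : ∀ s, HasDerivAt Wx (lam ^ 2 * W s t) s := fun s =>
    (((((hE1 s).const_mul (-lam)).const_mul A).add
      (((hE2 s).const_mul lam).const_mul ε)).const_mul _).congr_deriv (by simp only [hW]; ring)
  have hWxle : |Wx x| ≤ |lam| * W x t := by
    have e : Wx x = lam * (Real.exp (b * t) * (ε * Real.exp (lam * x) - A * Real.exp (-lam * x))) := by
      simp only [Wx]; ring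
    rw [e, abs_mul]
    refine mul_le_mul_of_nonneg_left ?_ (abs_nonneg _)
    rw [abs_mul, abs_of_pos (Real.exp_pos _)]
    refine mul_le_mul_of_nonneg_left ?_ (Real.exp_pos _).le
    have p1 : 0 < A * Real.exp (-lam * x) := by positivity
    have p2 : 0 < ε * Real.exp (lam * x) := by positivity
    rw [abs_le]; constructor <;> linarith
  -- first and second order conditions
  have hZt : b * W x t ≤ Zt x y t := by
    have := deriv_nonneg_of_eventually_le_left ((ht x y hyI t ht0).sub hWt) (by
      filter_upwards [hev] with s hs
      have := hbefore x y hyI s hs.1 hs.2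
      simp only [Pi.sub_apply]
      linarith)
    linarith
  have hZx : Zx x y t = Wx x := by
    have hl : IsLocalMax ((fun s => Z s y t) - fun s => W s t) x :=
      Eventually.of_forall fun s => by
        have := hat s y hyI
        simp only [Pi.sub_apply]; linarith
    have := hl.hasDerivAt_eq_zero ((hx x y hyI t ht0).sub (hWx x))
    linarith
  have hZxx : Zxx x y t ≤ lam ^ 2 * W x t := by
    have := second_deriv_nonpos_of_max (g := (fun s => Z s y t) - fun s => W s t)
      (g₁ := (fun s => Zx s y t) - Wx) (a := x - 1) (b := x + 1) (z := x) (by linarith)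
      (fun s _ => ((hx s y hyI t ht0).sub (hWx s)).hasDerivWithinAt)
      ⟨by linarith, by linarith⟩ (((hxx x y hyI t ht0).sub (hWxx x)).hasDerivWithinAt)
      (by simp [hZx]) fun s _ => by
        have := hat s y hyI
        simp only [Pi.sub_apply]; linarith
    linarith
  have hmaxy : ∀ y' ∈ Icc 0 H, Z x y' t ≤ Z x y t := fun y' hy' => by
    rw [heq]; exact hat x y' hy'
  -- Only the ends of `[0, H]` need care. Under Neumann conditions the derivative vanishes there.
  -- Under periodic conditions the maximum is attained at both ends, so the one-sided derivatives at
  -- 0 and `H` have opposite signs, and they are equal.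
  have hZy : Zy x y t = 0 := by
    have h0I : (0 : ℝ) ∈ Icc 0 H := ⟨le_rfl, hH.le⟩
    have hHI : H ∈ Icc 0 H := ⟨hH.le, le_rfl⟩
    have ends : (y = 0 ∨ y = H) → Zy x y t = 0 := by
      intro hy0
      rcases hb x t ht0 with ⟨e1, e2⟩ | ⟨e1, e2⟩
      · rcases hy0 with rfl | rfl <;> assumption
      · have m0 : ∀ y' ∈ Icc 0 H, Z x y' t ≤ Z x 0 t := by
          rcases hy0 with rfl | rfl
          · exact hmaxy
          · rw [e1]; exact hmaxy
        have mH : ∀ y' ∈ Icc 0 H, Z x y' t ≤ Z x H t := by rw [← e1]; exact m0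
        have q1 := deriv_nonpos_of_max_left hH (hy x 0 h0I t ht0) m0
        have q2 := deriv_nonneg_of_max_right hH (hy x H hHI t ht0) mH
        rcases hy0 with rfl | rfl <;> linarith
    rcases hyI.1.eq_or_lt with h | h
    · exact ends (Or.inl h.symm)
    rcases hyI.2.eq_or_lt with h' | h'
    · exact ends (Or.inr h')
    · have hn : Icc 0 H ∈ 𝓝 y := Icc_mem_nhds h h'
      have hl : IsLocalMax (fun s => Z x s t) y := by
        filter_upwards [hn] with s hs using hmaxy s hs
      exact hl.hasDerivAt_eq_zero ((hy x y hyI t ht0).hasDerivAt hn)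
  have hZyy : Zyy x y t ≤ 0 := second_deriv_nonpos_of_max hH
    (fun s hs => hy x s hs t ht0) hyI (hyy x y hyI t ht0) hZy hmaxy
  -- At the contact point the equation gives `b W ≤ (|lam| M + κ lam² + c) W`, whereas `b` exceeds
  -- this coefficient by 1 and `W > 0`.
  have hp := hpde x y hyI t ht0
  rw [hZy, hZx, heq, mul_zero, add_zero] at hp
  have h1 : -(u₁ x y * Wx x) ≤ M * (|lam| * W x t) := by
    refine (neg_le_abs _).trans ?_
    rw [abs_mul]
    exact mul_le_mul (hM x y hyI) hWxle (abs_nonneg _) hM0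
  have h2 : κ * (Zxx x y t + Zyy x y t) ≤ κ * (lam ^ 2 * W x t) :=
    mul_le_mul_of_nonneg_left (by linarith) hκ.le
  have h3 := hWpos x t
  have : b * W x t = |lam| * M * W x t + κ * lam ^ 2 * W x t + c * W x t + W x t := by
    rw [hbdef]; ring
  nlinarith

/-! ### Solutions on the strip -/

/-- Classical solution on the closed strip with named derivatives. -/
structure StripSol (H κ c : ℝ) (f : ℝ → ℝ) (u₁ u₂ : ℝ → ℝ → ℝ)
    (T Tt Tx Ty Txx Tyy : ℝ → ℝ → ℝ → ℝ) : Prop where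
  cont₀ : ContinuousOn (fun z : (ℝ × ℝ) × ℝ => T z.1.1 z.1.2 z.2) (strip H ×ˢ Ici 0)
  cont_t : ContinuousOn (fun z : (ℝ × ℝ) × ℝ => Tt z.1.1 z.1.2 z.2) (strip H ×ˢ Ioi 0)
  cont_x : ContinuousOn (fun z : (ℝ × ℝ) × ℝ => Tx z.1.1 z.1.2 z.2) (strip H ×ˢ Ioi 0)
  cont_y : ContinuousOn (fun z : (ℝ × ℝ) × ℝ => Ty z.1.1 z.1.2 z.2) (strip H ×ˢ Ioi 0)
  cont_xx : ContinuousOn (fun z : (ℝ × ℝ) × ℝ => Txx z.1.1 z.1.2 z.2) (strip H ×ˢ Ioi 0)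
  cont_yy : ContinuousOn (fun z : (ℝ × ℝ) × ℝ => Tyy z.1.1 z.1.2 z.2) (strip H ×ˢ Ioi 0)
  has_t : ∀ x, ∀ y ∈ Icc 0 H, ∀ t > 0, HasDerivAt (fun s => T x y s) (Tt x y t) t
  has_x : ∀ x, ∀ y ∈ Icc 0 H, ∀ t > 0, HasDerivAt (fun s => T s y t) (Tx x y t) x
  has_xx : ∀ x, ∀ y ∈ Icc 0 H, ∀ t > 0, HasDerivAt (fun s => Tx s y t) (Txx x y t) x
  has_y : ∀ x, ∀ y ∈ Icc 0 H, ∀ t > 0,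
    HasDerivWithinAt (fun s => T x s t) (Ty x y t) (Icc 0 H) y
  has_yy : ∀ x, ∀ y ∈ Icc 0 H, ∀ t > 0,
    HasDerivWithinAt (fun s => Ty x s t) (Tyy x y t) (Icc 0 H) y
  range : ∀ x, ∀ y ∈ Icc 0 H, ∀ t ≥ 0, T x y t ∈ Icc (0 : ℝ) 1
  pde : ∀ x, ∀ y ∈ Icc 0 H, ∀ t > 0, Tt x y t + (u₁ x y * Tx x y t + u₂ x y * Ty x y t)
    = κ * (Txx x y t + Tyy x y t) + c * f (T x y t)
  bdry : (∀ x t, 0 < t → Ty x 0 t = 0 ∧ Ty x H t = 0 ∧ u₂ x 0 = 0 ∧ u₂ x H = 0) ∨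
    (∀ x t, 0 < t → T x 0 t = T x H t ∧ Ty x 0 t = Ty x H t ∧ u₂ x 0 = u₂ x H)

lemma BC.Icc_subset_cross (bc : BC) (H : ℝ) : Icc 0 H ⊆ bc.cross H := by
  cases bc
  · exact subset_rfl
  · exact subset_univ _

lemma BC.Ioo_subset_crossInt (bc : BC) (H : ℝ) : Ioo 0 H ⊆ bc.crossInt H := by
  cases bc
  · exact subset_rfl
  · exact subset_univ _

lemma BC.crossInt_subset_cross (bc : BC) (H : ℝ) : bc.crossInt H ⊆ bc.cross H := by
  cases bc
  · exact Ioo_subset_Icc_self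
  · exact subset_rfl

lemma BC.isOpen_crossInt (bc : BC) (H : ℝ) : IsOpen (bc.crossInt H) := by
  cases bc
  · exact isOpen_Ioo
  · exact isOpen_univ

lemma BC.isOpen_univ_prod_crossInt (bc : BC) (H : ℝ) :
    IsOpen ((univ : Set ℝ) ×ˢ bc.crossInt H) :=
  isOpen_univ.prod (bc.isOpen_crossInt H)

lemma hasDerivAt_partial {g : ℝ → ℝ → ℝ} {s : Set (ℝ × ℝ)} (hs : IsOpen s)
    (hg : ContDiffOn ℝ 1 (fun p : ℝ × ℝ => g p.1 p.2) s) :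
    (∀ p ∈ s, HasDerivAt (fun x => g x p.2) (fderiv ℝ (fun p : ℝ × ℝ => g p.1 p.2) p (1, 0)) p.1) ∧
    (∀ p ∈ s, HasDerivAt (fun y => g p.1 y) (fderiv ℝ (fun p : ℝ × ℝ => g p.1 p.2) p (0, 1)) p.2) ∧
    ContinuousOn (fun p => fderiv ℝ (fun p : ℝ × ℝ => g p.1 p.2) p (1, 0)) s ∧
    ContinuousOn (fun p => fderiv ℝ (fun p : ℝ × ℝ => g p.1 p.2) p (0, 1)) s := by
  have hd : ∀ p ∈ s, HasFDerivAt (fun p : ℝ × ℝ => g p.1 p.2)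
      (fderiv ℝ (fun p : ℝ × ℝ => g p.1 p.2) p) p := fun p hp =>
    ((hg.contDiffAt (hs.mem_nhds hp)).differentiableAt one_ne_zero).hasFDerivAt
  have hc := hg.continuousOn_fderiv_of_isOpen hs le_rfl
  refine ⟨fun p hp => ?_, fun p hp => ?_, hc.clm_apply continuousOn_const,
    hc.clm_apply continuousOn_const⟩
  · exact HasFDerivAt.comp_hasDerivAt (f := fun x => (x, p.2)) p.1 (hd p hp)
      ((hasDerivAt_id p.1).prodMk (hasDerivAt_const _ _))
  · exact HasFDerivAt.comp_hasDerivAt (f := fun y => (p.1, y)) p.2 (hd p hp)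
      ((hasDerivAt_const _ _).prodMk (hasDerivAt_id p.2))

lemma IsFlow.stripFlow {bc : BC} {H : ℝ} {u₁ u₂ : ℝ → ℝ → ℝ} (h : IsFlow bc H u₁ u₂) (hH : 0 < H) :
    ∃ M > 0, StripFlow H M u₁ u₂ (fun x y => deriv (fun x' => u₁ x' y) x) := by
  obtain ⟨M₁, hM₁⟩ := h.bounded₁
  obtain ⟨M₂, hM₂⟩ := h.bounded_grad
  have hcr := bc.Icc_subset_cross H
  have hci := bc.Ioo_subset_crossInt H
  have ho := bc.isOpen_univ_prod_crossInt H
  have c1 : ContinuousOn (fun p : ℝ × ℝ => u₁ p.1 p.2) (strip H) :=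
    h.continuousOn₁.mono (prod_mono_right hcr)
  have c2 : ContinuousOn (fun p : ℝ × ℝ => u₂ p.1 p.2) (strip H) :=
    h.continuousOn₂.mono (prod_mono_right hcr)
  obtain ⟨M₃, hM₃⟩ := (isCompact_box 0 H).exists_bound_of_continuousOn
    (c2.mono (box_subset_strip 0 H))
  obtain ⟨a1, -, a3, -⟩ := hasDerivAt_partial ho h.contDiffOn₁
  obtain ⟨b1, b2, -, -⟩ := hasDerivAt_partial ho h.contDiffOn₂
  have hM : ∀ m ∈ ({M₁, M₂, M₃} : Set ℝ), m ≤ 1 + |M₁| + |M₂| + |M₃| := by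
    intro m hm
    have := abs_nonneg M₁; have := abs_nonneg M₂; have := abs_nonneg M₃
    rcases hm with rfl | rfl | rfl <;> linarith [le_abs_self m]
  refine ⟨1 + |M₁| + |M₂| + |M₃|, by positivity, c1, c2, ?_, ?_, ?_, ?_, ?_, ?_, ?_⟩
  · refine (a3.mono (prod_mono_right hci)).congr fun p hp => ?_
    exact (a1 p ⟨mem_univ _, hci hp.2⟩).deriv
  · intro x y hy
    exact (a1 (x, y) ⟨mem_univ _, hci hy⟩).differentiableAt.hasDerivAt
  · intro x y hy
    have := (b2 (x, y) ⟨mem_univ _, hci hy⟩).differentiableAt.hasDerivAt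
    refine this.congr_deriv ?_
    have := h.div_free x y (hci hy)
    simp only at *
    linarith
  · intro x y hy
    exact (hM₁ x y (hcr hy)).trans (hM _ (by simp))
  · intro x y hy
    -- Only the gradient of `u₂` is bounded. The mean value inequality from the section `x = 0`,
    -- where `u₂` is bounded by compactness, gives linear growth in `x`.
    have hd : ∀ s ∈ (univ : Set ℝ), HasDerivWithinAt (fun s => u₂ s y)
        (deriv (fun s => u₂ s y) s) univ s := fun s _ =>
      (b1 (s, y) ⟨mem_univ _, hci hy⟩).differentiableAt.hasDerivAt.hasDerivWithinAt
    have := convex_univ.norm_image_sub_le_of_norm_hasDerivWithin_le hd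
      (fun s _ => (hM₂ s y (hci hy)).2.2.1) (mem_univ 0) (mem_univ x)
    simp only [Real.norm_eq_abs, sub_zero] at this
    have h3 := hM₃ (0, y) ⟨by simp, Ioo_subset_Icc_self hy⟩
    simp only [Real.norm_eq_abs] at h3
    have h4 := hM M₂ (by simp)
    have h5 := hM M₃ (by simp)
    have h6 := abs_sub_abs_le_abs_sub (u₂ x y) (u₂ 0 y)
    have h7 := mul_le_mul_of_nonneg_right h4 (abs_nonneg x)
    nlinarith
  · intro x y hy
    exact (hM₂ x y (hci hy)).1.trans (hM _ (by simp))
  · intro x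
    rw [integral_Icc_eq_integral_Ioc, ← intervalIntegral.integral_of_le hH.le]
    exact h.zero_mean x

lemma JointlyContinuousOn.strip {A : ℝ → ℝ → ℝ → ℝ} {Y I : Set ℝ} (h : JointlyContinuousOn A Y I)
    {s : Set ℝ} (hs : s ⊆ Y) :
    ContinuousOn (fun z : (ℝ × ℝ) × ℝ => A z.1.1 z.1.2 z.2) ((univ ×ˢ s) ×ˢ I) :=
  ContinuousOn.comp (g := fun p : ℝ × ℝ × ℝ => A p.1 p.2.1 p.2.2)
    (f := fun z : (ℝ × ℝ) × ℝ => (z.1.1, z.1.2, z.2)) h (by fun_prop)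
    fun z hz => ⟨mem_univ _, hs hz.1.2, hz.2⟩

/-- For estimates on the strip the two boundary conditions can now be treated together: they enter
through the alternative `bdry`, either form of which removes the boundary terms in every integration
by parts in `y`. -/
lemma IsSolution.stripSol {bc : BC} {κ v₀ H : ℝ} {f : ℝ → ℝ} {u₁ u₂ : ℝ → ℝ → ℝ}
    {T : ℝ → ℝ → ℝ → ℝ} (h : IsSolution bc κ v₀ H f u₁ u₂ T) (hu : IsFlow bc H u₁ u₂) :
    StripSol H κ (v₀ ^ 2 / (4 * κ)) f u₁ u₂ T (dt T) (dx T) (dy (bc.cross H) T) (dx (dx T))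
      (dy (bc.cross H) (dy (bc.cross H) T)) := by
  have hcr := bc.Icc_subset_cross H
  have r := h.regular
  refine ⟨r.cont.strip hcr, r.cont_t.strip hcr, r.cont_x.strip hcr, r.cont_y.strip hcr,
    r.cont_xx.strip hcr, r.cont_yy.strip hcr, fun x y hy t ht => (r.diff_t x y (hcr hy) t ht).hasDerivAt,
    fun x y hy t ht => (r.diff_x x y (hcr hy) t ht).hasDerivAt,
    fun x y hy t ht => (r.diff_xx x y (hcr hy) t ht).hasDerivAt,
    fun x y hy t ht => (r.diff_y x y (hcr hy) t ht).hasDerivWithinAt.mono hcr,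
    fun x y hy t ht => (r.diff_yy x y (hcr hy) t ht).hasDerivWithinAt.mono hcr,
    fun x y hy t ht => h.range x y (hcr hy) t ht, fun x y hy t ht => h.pde x y (hcr hy) t ht, ?_⟩
  have hb := h.boundary
  have hub := hu.boundary
  cases bc
  · left
    intro x t ht
    exact ⟨(hb x t ht).1, (hb x t ht).2, (hub x).1, (hub x).2⟩
  · right
    intro x t ht
    simp only at hb hub
    refine ⟨?_, ?_, ?_⟩
    · have := hb x 0 t ht.le; rw [zero_add] at this; exact this.symm
    · simp only [dy, BC.cross, derivWithin_univ]
      have : (fun y' => T x y' t) = fun y' => T x (y' + H) t := by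
        funext y'; exact (hb x y' t ht.le).symm
      conv_lhs => rw [this, deriv_comp_add_const (f := fun y' => T x y' t), zero_add]
    · have := (hub x 0).2; rw [zero_add] at this; exact this.symm

/-! ### Weak formulation -/

section Weak

variable {H κ c M : ℝ} {f : ℝ → ℝ} {u₁ u₂ w : ℝ → ℝ → ℝ} {T Tt Tx Ty Txx Tyy : ℝ → ℝ → ℝ → ℝ}

lemma slice_continuousOn {A : ℝ → ℝ → ℝ → ℝ} {s : Set (ℝ × ℝ)} {I : Set ℝ}
    (h : ContinuousOn (fun z : (ℝ × ℝ) × ℝ => A z.1.1 z.1.2 z.2) (s ×ˢ I)) {t : ℝ} (ht : t ∈ I) :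
    ContinuousOn (fun p : ℝ × ℝ => A p.1 p.2 t) s :=
  h.comp (f := fun p : ℝ × ℝ => (p, t)) (by fun_prop) fun _ hp => ⟨hp, ht⟩

lemma StripSol.cont (hs : StripSol H κ c f u₁ u₂ T Tt Tx Ty Txx Tyy) :
    ContinuousOn (fun z : (ℝ × ℝ) × ℝ => T z.1.1 z.1.2 z.2) (strip H ×ˢ Ioi 0) :=
  hs.cont₀.mono (prod_mono_right Ioi_subset_Ici_self)

lemma hasDerivAt_strip {R : ℝ} {F F' : ℝ × ℝ → ℝ → ℝ}
    (hF : ContinuousOn (fun z : (ℝ × ℝ) × ℝ => F z.1 z.2) (strip H ×ˢ Ioi 0))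
    (hF' : ContinuousOn (fun z : (ℝ × ℝ) × ℝ => F' z.1 z.2) (strip H ×ˢ Ioi 0))
    (hd : ∀ p ∈ strip H, ∀ t > 0, HasDerivAt (F p) (F' p t) t)
    (hz : ∀ p t, R < |p.1| → F p t = 0 ∧ F' p t = 0) {t : ℝ} (ht : 0 < t) :
    HasDerivAt (fun t => ∫ p in strip H, F p t) (∫ p in strip H, F' p t) t := by
  rw [funext fun t => setIntegral_strip_eq_box (H := H) fun p hp => (hz p t hp).1,
    setIntegral_strip_eq_box (H := H) fun p hp => (hz p t hp).2]
  have hsub := prod_mono_left (t := Ioi (0 : ℝ)) (box_subset_strip R H)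
  exact hasDerivAt_setIntegral_of_isCompact (isCompact_box R H) isOpen_Ioi (hF.mono hsub)
    (hF'.mono hsub) (fun p hp t ht => hd p (box_subset_strip R H hp) t ht) ht

lemma continuousOn_strip {R : ℝ} {F : ℝ × ℝ → ℝ → ℝ}
    (hF : ContinuousOn (fun z : (ℝ × ℝ) × ℝ => F z.1 z.2) (strip H ×ˢ Ioi 0))
    (hz : ∀ p t, R < |p.1| → F p t = 0) :
    ContinuousOn (fun t => ∫ p in strip H, F p t) (Ioi 0) := by
  rw [funext fun t => setIntegral_strip_eq_box (H := H) fun p hp => hz p t hp]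
  exact continuousOn_setIntegral_of_isCompact (isCompact_box R H) isOpen_Ioi
    (hF.mono (prod_mono_left (box_subset_strip R H)))

/-- Testing the equation with `η(T) φ(x)`, at a fixed time. -/
lemma StripSol.weak (hs : StripSol H κ c f u₁ u₂ T Tt Tx Ty Txx Tyy) (hu : StripFlow H M u₁ u₂ w)
    (hH : 0 < H) (hf : Continuous f) {N η η' : ℝ → ℝ} (hN : ∀ s, HasDerivAt N (η s) s)
    (hη : ∀ s, HasDerivAt η (η' s) s) (hη' : Continuous η') {φ φ₁ φ₂ : ℝ → ℝ} {R : ℝ}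
    (hφ : IsCutoff φ φ₁ φ₂ R) {t : ℝ} (ht : 0 < t) :
    ∫ p in strip H, η (T p.1 p.2 t) * Tt p.1 p.2 t * φ p.1 =
    ∫ p in strip H, (-(κ * (η' (T p.1 p.2 t) * (Tx p.1 p.2 t ^ 2 + Ty p.1 p.2 t ^ 2) * φ p.1))
      + N (T p.1 p.2 t) * (κ * φ₂ p.1 + u₁ p.1 p.2 * φ₁ p.1)
      + c * (η (T p.1 p.2 t) * f (T p.1 p.2 t) * φ p.1)) := by
  have hNc : Continuous N := continuous_iff_continuousAt.2 fun s => (hN s).continuousAt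
  have hηc : Continuous η := continuous_iff_continuousAt.2 fun s => (hη s).continuousAt
  have ht' : t ∈ Ioi (0 : ℝ) := ht
  have cT := slice_continuousOn hs.cont ht'
  have ct := slice_continuousOn hs.cont_t ht'
  have cx := slice_continuousOn hs.cont_x ht'
  have cy := slice_continuousOn hs.cont_y ht'
  have cxx := slice_continuousOn hs.cont_xx ht'
  have cyy := slice_continuousOn hs.cont_yy ht'
  have c1 := hu.cont₁
  have c2 := hu.cont₂
  have cN := hNc.comp_continuousOn' cT
  have cη := hηc.comp_continuousOn' cT
  have cη' := hη'.comp_continuousOn' cT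
  have cf := hf.comp_continuousOn' cT
  have p0 : ContinuousOn (fun p : ℝ × ℝ => φ p.1) (strip H) := by
    have := hφ.cont; fun_prop
  have p1 : ContinuousOn (fun p : ℝ × ℝ => φ₁ p.1) (strip H) := by
    have := hφ.cont₁; fun_prop
  have p2 : ContinuousOn (fun p : ℝ × ℝ => φ₂ p.1) (strip H) := by
    have := hφ.cont₂; fun_prop
  have hz := hφ.zero
  have hint : ∀ {F : ℝ × ℝ → ℝ}, ContinuousOn F (strip H) → (∀ p, R < |p.1| → F p = 0) →
      IntegrableOn F (strip H) := fun h1 h2 => integrableOn_strip_of_continuousOn h1 h2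
  -- the four integrals that vanish
  have i1 : IntegrableOn (fun p : ℝ × ℝ => η' (T p.1 p.2 t) * Tx p.1 p.2 t ^ 2 * φ p.1
      + η (T p.1 p.2 t) * Txx p.1 p.2 t * φ p.1 + η (T p.1 p.2 t) * Tx p.1 p.2 t * φ₁ p.1)
      (strip H) := hint ((((cη'.mul (cx.pow 2)).mul p0).add ((cη.mul cxx).mul p0)).add ((cη.mul cx).mul p1))
      fun p hp => by simp [hz p.1 hp]
  have e1 := integral_strip_dx (R := R)
    (F := fun p => η (T p.1 p.2 t) * Tx p.1 p.2 t * φ p.1) (fun x y hy => by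
      have hyI := Ioo_subset_Icc_self hy
      exact ((((hη _).comp x (hs.has_x x y hyI t ht)).mul (hs.has_xx x y hyI t ht)).mul
        (hφ.has₁ x)).congr_deriv (by simp only [Function.comp_apply, Pi.mul_apply]; ring)) i1
    fun p hp => by simp [hz p.1 hp]
  have i2 : IntegrableOn (fun p : ℝ × ℝ => η (T p.1 p.2 t) * Tx p.1 p.2 t * φ₁ p.1
      + N (T p.1 p.2 t) * φ₂ p.1) (strip H) := hint (((cη.mul cx).mul p1).add (cN.mul p2))
      fun p hp => by simp [hz p.1 hp]
  have e2 := integral_strip_dx (R := R)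
    (F := fun p => N (T p.1 p.2 t) * φ₁ p.1) (fun x y hy => by
      have hyI := Ioo_subset_Icc_self hy
      exact ((hN _).comp x (hs.has_x x y hyI t ht)).mul (hφ.has₂ x)) i2
    fun p hp => by simp [hz p.1 hp]
  have hT : ∀ x, ∀ y ∈ Ioo 0 H, HasDerivAt (fun s => T x s t) (Ty x y t) y := fun x y hy =>
    (hs.has_y x y (Ioo_subset_Icc_self hy) t ht).hasDerivAt (Icc_mem_nhds hy.1 hy.2)
  have hTy : ∀ x, ∀ y ∈ Ioo 0 H, HasDerivAt (fun s => Ty x s t) (Tyy x y t) y := fun x y hy =>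
    (hs.has_yy x y (Ioo_subset_Icc_self hy) t ht).hasDerivAt (Icc_mem_nhds hy.1 hy.2)
  have i3 : IntegrableOn (fun p : ℝ × ℝ => η' (T p.1 p.2 t) * Ty p.1 p.2 t ^ 2 * φ p.1
      + η (T p.1 p.2 t) * Tyy p.1 p.2 t * φ p.1) (strip H) :=
    hint (((cη'.mul (cy.pow 2)).mul p0).add ((cη.mul cyy).mul p0))
      fun p hp => by simp [hz p.1 hp]
  have e3 := integral_strip_dy hH
    (F := fun p => η (T p.1 p.2 t) * Ty p.1 p.2 t * φ p.1) (fun x => by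
      have : ContinuousOn (fun p : ℝ × ℝ => η (T p.1 p.2 t) * Ty p.1 p.2 t * φ p.1) (strip H) :=
        (cη.mul cy).mul p0
      exact this.comp (f := fun y => (x, y)) (by fun_prop) fun y hy => ⟨mem_univ _, hy⟩)
    (fun x y hy => (((((hη _).comp y (hT x y hy)).mul (hTy x y hy))).mul_const (φ x)).congr_deriv
      (by simp only [Function.comp_apply]; ring)) i3
    fun x => by
      rcases hs.bdry with h | h
      · simp [(h x t ht).1, (h x t ht).2.1]
      · simp only [(h x t ht).1, (h x t ht).2.1]
  have e4 := hu.integral_transport hH hφ.has₁ hφ.cont₁ (fun x hx => ⟨(hz x hx).1, (hz x hx).2.1⟩)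
    (a := fun p => N (T p.1 p.2 t)) (ax := fun p => η (T p.1 p.2 t) * Tx p.1 p.2 t)
    (ay := fun p => η (T p.1 p.2 t) * Ty p.1 p.2 t) cN (cη.mul cx) (cη.mul cy)
    (fun x y hy => (hN _).comp x (hs.has_x x y (Ioo_subset_Icc_self hy) t ht))
    (fun x y hy => (hN _).comp y (hT x y hy))
    (fun x => by
      rcases hs.bdry with h | h
      · simp [(h x t ht).2.2]
      · simp only [(h x t ht).1, (h x t ht).2.2])
  have i4 : IntegrableOn (fun p : ℝ × ℝ => φ p.1 * (u₁ p.1 p.2 * (η (T p.1 p.2 t) * Tx p.1 p.2 t)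
      + u₂ p.1 p.2 * (η (T p.1 p.2 t) * Ty p.1 p.2 t))) (strip H) :=
    hint (p0.mul ((c1.mul (cη.mul cx)).add (c2.mul (cη.mul cy))))
      fun p hp => by simp [hz p.1 hp]
  have i5 : IntegrableOn (fun p : ℝ × ℝ => φ₁ p.1 * u₁ p.1 p.2 * N (T p.1 p.2 t)) (strip H) :=
    hint ((p1.mul c1).mul cN)
      fun p hp => by simp [hz p.1 hp]
  have iL : IntegrableOn (fun p : ℝ × ℝ => η (T p.1 p.2 t) * Tt p.1 p.2 t * φ p.1) (strip H) :=
    hint ((cη.mul ct).mul p0)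
      fun p hp => by simp [hz p.1 hp]
  have iR : IntegrableOn (fun p : ℝ × ℝ =>
      (-(κ * (η' (T p.1 p.2 t) * (Tx p.1 p.2 t ^ 2 + Ty p.1 p.2 t ^ 2) * φ p.1))
      + N (T p.1 p.2 t) * (κ * φ₂ p.1 + u₁ p.1 p.2 * φ₁ p.1)
      + c * (η (T p.1 p.2 t) * f (T p.1 p.2 t) * φ p.1))) (strip H) :=
    hint ((((continuousOn_const.mul ((cη'.mul ((cx.pow 2).add (cy.pow 2))).mul p0)).neg).add (cN.mul ((continuousOn_const.mul p2).add (c1.mul p1)))).add (continuousOn_const.mul ((cη.mul cf).mul p0)))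
      fun p hp => by simp [hz p.1 hp]
  have e4' : ∫ p in strip H, (φ p.1 * (u₁ p.1 p.2 * (η (T p.1 p.2 t) * Tx p.1 p.2 t)
      + u₂ p.1 p.2 * (η (T p.1 p.2 t) * Ty p.1 p.2 t)) + φ₁ p.1 * u₁ p.1 p.2 * N (T p.1 p.2 t))
      = 0 := by
    rw [integral_add i4 i5, e4]; ring
  -- The difference of the two sides equals `κ` times the first divergence, minus `κ` times the
  -- second, plus `κ` times the third, minus the transport identity. Pointwise this is the equation
  -- multiplied by `η(T) φ`.
  rw [← sub_eq_zero, ← integral_sub iL iR]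
  have hcomb := integral_add (μ := volume.restrict (strip H))
    ((i1.const_mul κ).sub (i2.const_mul κ)) ((i3.const_mul κ).sub (i4.add i5))
  have hs1 := integral_sub (μ := volume.restrict (strip H)) (i1.const_mul κ) (i2.const_mul κ)
  have hs2 := integral_sub (μ := volume.restrict (strip H)) (i3.const_mul κ) (i4.add i5)
  simp only [Pi.sub_apply, Pi.add_apply] at hcomb hs1 hs2
  rw [hs1, hs2] at hcomb
  simp only [integral_const_mul, e1, e2, e3, e4', mul_zero, sub_zero, add_zero] at hcomb
  rw [← hcomb]
  refine setIntegral_congr_fun (measurableSet_strip H) fun p hp => ?_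
  have := hs.pde p.1 p.2 hp.2 t ht
  have h2 : Tt p.1 p.2 t = κ * (Txx p.1 p.2 t + Tyy p.1 p.2 t) + c * f (T p.1 p.2 t)
      - (u₁ p.1 p.2 * Tx p.1 p.2 t + u₂ p.1 p.2 * Ty p.1 p.2 t) := by linarith
  simp only [h2]
  ring

end Weak

/-- Exponential localization of the front up to time `τ`. -/
structure Decay (H τ A lam : ℝ) (T : ℝ → ℝ → ℝ → ℝ) : Prop where
  A_pos : 0 < A
  lam_pos : 0 < lam
  right : ∀ x, ∀ y ∈ Icc 0 H, ∀ t ∈ Icc 0 τ, T x y t ≤ A * Real.exp (-lam * x)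
  left : ∀ x, ∀ y ∈ Icc 0 H, ∀ t ∈ Icc 0 τ, 1 - T x y t ≤ A * Real.exp (lam * x)

/-! ### Exponential localization and local energy bounds -/

section Energy

variable {H κ c M m Mf : ℝ} {f : ℝ → ℝ} {u₁ u₂ w : ℝ → ℝ → ℝ}
  {T Tt Tx Ty Txx Tyy : ℝ → ℝ → ℝ → ℝ}

/-- The barrier applies to `T`, because `f(T) ≤ Mf T`, and with the opposite rate to `1 - T`,
because `f(T) ≥ 0`. Restricting to `t ≤ τ` absorbs the growth in time into the constant. -/
lemma StripSol.exists_decay (hs : StripSol H κ c f u₁ u₂ T Tt Tx Ty Txx Tyy)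
    (hu : StripFlow H M u₁ u₂ w) (hH : 0 < H) (hκ : 0 < κ) (hc : 0 < c) (hMf : 0 < Mf)
    (hf : ∀ s ∈ Icc (0 : ℝ) 1, 0 ≤ f s ∧ f s ≤ Mf * (s * (1 - s)))
    (hloc : ∃ lam > 0, ∃ A, ∀ x, ∀ y ∈ Icc 0 H,
      (x < 0 → 1 - T x y 0 ≤ A * Real.exp (lam * x)) ∧
      (0 < x → T x y 0 ≤ A * Real.exp (-lam * x))) (τ : ℝ) :
    ∃ A lam, Decay H τ A lam T := by
  obtain ⟨lam, hlam, A₀, hA₀⟩ := hloc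
  set A := max A₀ 1
  have hA : 0 < A := lt_max_of_lt_right one_pos
  have hM0 : 0 ≤ M := (abs_nonneg _).trans (hu.bdd₁ 0 0 ⟨le_rfl, hH.le⟩)
  -- On the half-line where the initial hypothesis gives no decay, the exponential is at least 1;
  -- since `A ≥ 1`, the trivial bounds on `T` suffice there.
  have hbig : ∀ v : ℝ, 0 ≤ v → 1 ≤ A * Real.exp v := fun v hv => by
    have h1 : 1 ≤ A := le_max_right _ _
    have h2 := Real.one_le_exp hv
    nlinarith
  have hfl : ∀ x, ∀ y ∈ Icc 0 H, ∀ t > 0, c * f (T x y t) ≤ c * Mf * T x y t ∧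
      0 ≤ c * f (T x y t) := fun x y hy t ht => by
    have hr := hs.range x y hy t ht.le
    obtain ⟨h1, h2⟩ := hf _ hr
    refine ⟨?_, mul_nonneg hc.le h1⟩
    rw [mul_assoc]
    refine mul_le_mul_of_nonneg_left (h2.trans ?_) hc.le
    refine mul_le_mul_of_nonneg_left ?_ hMf.le
    nlinarith [hr.1, hr.2]
  have hR := le_exp_barrier (c := c * Mf) (M := M) (lam := lam) (A := A) hH hκ hlam.ne' hA
    hs.cont₀ hs.has_t hs.has_x hs.has_xx hs.has_y hs.has_yy
    (fun x y hy t ht => (hs.range x y hy t ht).2)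
    (fun x y hy t ht => by have := hs.pde x y hy t ht; linarith [(hfl x y hy t ht).1])
    (fun x t ht => by
      rcases hs.bdry with h | h
      · exact Or.inl ⟨(h x t ht).1, (h x t ht).2.1⟩
      · exact Or.inr ⟨(h x t ht).1, (h x t ht).2.1⟩)
    hu.bdd₁ (fun x y hy => by
      rcases lt_or_ge 0 x with hx | hx
      · exact ((hA₀ x y hy).2 hx).trans
          (mul_le_mul_of_nonneg_right (le_max_left _ _) (Real.exp_pos _).le)
      · exact (hs.range x y hy 0 le_rfl).2.trans (hbig _ (by nlinarith)))
    (by positivity)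
  have hL := le_exp_barrier (c := c * Mf) (M := M) (lam := -lam) (A := A) hH hκ
    (neg_ne_zero.2 hlam.ne') hA (Z := fun x y t => 1 - T x y t) (Zt := fun x y t => -Tt x y t)
    (Zx := fun x y t => -Tx x y t) (Zy := fun x y t => -Ty x y t)
    (Zxx := fun x y t => -Txx x y t) (Zyy := fun x y t => -Tyy x y t)
    (continuousOn_const.sub hs.cont₀) (fun x y hy t ht => (hs.has_t x y hy t ht).const_sub 1)
    (fun x y hy t ht => (hs.has_x x y hy t ht).const_sub 1)
    (fun x y hy t ht => (hs.has_xx x y hy t ht).neg)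
    (fun x y hy t ht => (hs.has_y x y hy t ht).const_sub 1)
    (fun x y hy t ht => (hs.has_yy x y hy t ht).neg)
    (fun x y hy t ht => by linarith [(hs.range x y hy t ht).1])
    (u₁ := u₁) (u₂ := u₂)
    (fun x y hy t ht => by
      have h1 := hs.pde x y hy t ht
      have h2 := (hfl x y hy t ht).2
      have h3 : 0 ≤ c * Mf * (1 - T x y t) :=
        mul_nonneg (by positivity) (by linarith [(hs.range x y hy t ht.le).2])
      linarith)
    (fun x t ht => by
      rcases hs.bdry with h | h
      · exact Or.inl ⟨by simp [(h x t ht).1], by simp [(h x t ht).2.1]⟩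
      · exact Or.inr ⟨by rw [(h x t ht).1], by rw [(h x t ht).2.1]⟩)
    hu.bdd₁ (fun x y hy => by
      rcases lt_or_ge x 0 with hx | hx
      · rw [neg_neg]
        exact ((hA₀ x y hy).1 hx).trans
          (mul_le_mul_of_nonneg_right (le_max_left _ _) (Real.exp_pos _).le)
      · exact (by linarith [(hs.range x y hy 0 le_rfl).1] : 1 - T x y 0 ≤ 1).trans
          (hbig _ (by nlinarith)))
    (by positivity)
  rw [abs_neg, neg_sq] at hL
  rw [abs_of_pos hlam] at hL hR
  set b := lam * M + κ * lam ^ 2 + c * Mf + 1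
  have hb : 0 < b := by positivity
  have hexp : ∀ t ∈ Icc 0 τ, ∀ v, A * Real.exp (b * t - v) ≤ A * Real.exp (b * τ) * Real.exp (-v) :=
    fun t ht v => by
      rw [mul_assoc, ← Real.exp_add]
      refine mul_le_mul_of_nonneg_left (Real.exp_le_exp.2 ?_) hA.le
      nlinarith [ht.2]
  refine ⟨A * Real.exp (b * τ), lam, by positivity, hlam, fun x y hy t ht => ?_,
    fun x y hy t ht => ?_⟩
  · refine (hR x y hy t ht.1).trans ((hexp t ht _).trans (le_of_eq ?_))
    rw [neg_mul]
  · refine (hL x y hy t ht.1).trans ((hexp t ht _).trans (le_of_eq ?_))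
    rw [neg_mul, neg_neg]

lemma abs_setIntegral_strip_le {a r B : ℝ} (hH : 0 < H) (hr : 0 ≤ r) {F : ℝ × ℝ → ℝ}
    (hB : ∀ p ∈ strip H, |p.1 - a| ≤ r → |F p| ≤ B) (hz : ∀ p, r < |p.1 - a| → F p = 0) :
    |∫ p in strip H, F p| ≤ B * (2 * r * H) := by
  have hsub : Icc (a - r) (a + r) ×ˢ Icc 0 H ⊆ strip H := prod_mono_left (subset_univ _)
  rw [setIntegral_eq_of_subset_of_forall_sdiff_eq_zero (measurableSet_strip H) hsub fun p hp => hz p ?_]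
  · have hv : volume.real (Icc (a - r) (a + r) ×ˢ Icc 0 H) = 2 * r * H := by
      rw [Measure.real, Measure.volume_eq_prod, Measure.prod_prod, Real.volume_Icc,
        Real.volume_Icc, ENNReal.toReal_mul, ENNReal.toReal_ofReal (by linarith),
        ENNReal.toReal_ofReal (by linarith)]
      ring
    rw [← hv]
    refine norm_setIntegral_le_of_norm_le_const (f := F) ?_ fun p hp => ?_
    · exact (isCompact_Icc.prod isCompact_Icc).measure_lt_top
    · refine hB p (hsub hp) (abs_le.2 ⟨?_, ?_⟩) <;> linarith [hp.1.1, hp.1.2]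
  · by_contra h
    have h := abs_le.1 (not_lt.1 h)
    exact hp.2 ⟨⟨by linarith [h.1], by linarith [h.2]⟩, hp.1.2⟩

lemma integral_deriv_Ioi {g g' : ℝ → ℝ} (hg : ∀ t > 0, HasDerivAt g (g' t) t)
    (hc : ContinuousOn g' (Ioi 0)) {a b : ℝ} (ha : 0 < a) (hab : a ≤ b) :
    ∫ t in a..b, g' t = g b - g a := by
  refine intervalIntegral.integral_eq_sub_of_hasDerivAt (fun t ht => hg t ?_) ?_
  · rw [uIcc_of_le hab] at ht; exact ha.trans_le ht.1
  · refine ContinuousOn.intervalIntegrable (hc.mono fun t ht => ?_)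
    rw [uIcc_of_le hab] at ht; exact ha.trans_le ht.1

lemma intervalIntegrable_of_Ioi {g : ℝ → ℝ} (hc : ContinuousOn g (Ioi 0)) {a b : ℝ} (ha : 0 < a)
    (hab : a ≤ b) : IntervalIntegrable g volume a b := by
  refine ContinuousOn.intervalIntegrable (hc.mono fun t ht => ?_)
  rw [uIcc_of_le hab] at ht; exact ha.trans_le ht.1

lemma continuousOn_fst_strip {g : ℝ → ℝ} (hg : Continuous g) :
    ContinuousOn (fun z : (ℝ × ℝ) × ℝ => g z.1.1) (strip H ×ˢ Ioi 0) := by fun_prop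

lemma StripFlow.cont₁' (hu : StripFlow H M u₁ u₂ w) :
    ContinuousOn (fun z : (ℝ × ℝ) × ℝ => u₁ z.1.1 z.1.2) (strip H ×ˢ Ioi 0) :=
  hu.cont₁.comp (f := fun z : (ℝ × ℝ) × ℝ => z.1) (by fun_prop) fun _ hz => hz.1

/-- Energy identity obtained by testing with `η(T) φ(x)`. -/
lemma StripSol.energy (hs : StripSol H κ c f u₁ u₂ T Tt Tx Ty Txx Tyy)
    (hu : StripFlow H M u₁ u₂ w) (hH : 0 < H) (hf : Continuous f) {N η η' : ℝ → ℝ}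
    (hN : ∀ s, HasDerivAt N (η s) s) (hη : ∀ s, HasDerivAt η (η' s) s) (hη' : Continuous η')
    {φ φ₁ φ₂ : ℝ → ℝ} {R : ℝ} (hφ : IsCutoff φ φ₁ φ₂ R) {t₀ t₁ : ℝ} (h0 : 0 < t₀) (h1 : t₀ ≤ t₁) :
    κ * (∫ t in t₀..t₁, ∫ p in strip H,
        η' (T p.1 p.2 t) * (Tx p.1 p.2 t ^ 2 + Ty p.1 p.2 t ^ 2) * φ p.1)
      = (∫ p in strip H, N (T p.1 p.2 t₀) * φ p.1) - (∫ p in strip H, N (T p.1 p.2 t₁) * φ p.1)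
        + ∫ t in t₀..t₁, ∫ p in strip H, (N (T p.1 p.2 t) * (κ * φ₂ p.1 + u₁ p.1 p.2 * φ₁ p.1)
          + c * (η (T p.1 p.2 t) * f (T p.1 p.2 t) * φ p.1)) := by
  have hNc : Continuous N := continuous_iff_continuousAt.2 fun s => (hN s).continuousAt
  have hηc : Continuous η := continuous_iff_continuousAt.2 fun s => (hη s).continuousAt
  have cN := hNc.comp_continuousOn' hs.cont
  have cη := hηc.comp_continuousOn' hs.cont
  have cη' := hη'.comp_continuousOn' hs.cont
  have cf := hf.comp_continuousOn' hs.cont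
  have p0 := continuousOn_fst_strip (H := H) hφ.cont
  have p1 := continuousOn_fst_strip (H := H) hφ.cont₁
  have p2 := continuousOn_fst_strip (H := H) hφ.cont₂
  have hz := hφ.zero
  have cA : ContinuousOn (fun z : (ℝ × ℝ) × ℝ => η' (T z.1.1 z.1.2 z.2) *
      (Tx z.1.1 z.1.2 z.2 ^ 2 + Ty z.1.1 z.1.2 z.2 ^ 2) * φ z.1.1) (strip H ×ˢ Ioi 0) :=
    (cη'.mul ((hs.cont_x.pow 2).add (hs.cont_y.pow 2))).mul p0
  have cB : ContinuousOn (fun z : (ℝ × ℝ) × ℝ => N (T z.1.1 z.1.2 z.2) *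
      (κ * φ₂ z.1.1 + u₁ z.1.1 z.1.2 * φ₁ z.1.1)
      + c * (η (T z.1.1 z.1.2 z.2) * f (T z.1.1 z.1.2 z.2) * φ z.1.1)) (strip H ×ˢ Ioi 0) :=
    (cN.mul ((continuousOn_const.mul p2).add (hu.cont₁'.mul p1))).add
      (continuousOn_const.mul ((cη.mul cf).mul p0))
  have zA : ∀ (p : ℝ × ℝ) (t : ℝ), R < |p.1| → η' (T p.1 p.2 t) *
      (Tx p.1 p.2 t ^ 2 + Ty p.1 p.2 t ^ 2) * φ p.1 = 0 := fun p t hp => by simp [hz p.1 hp]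
  have zB : ∀ (p : ℝ × ℝ) (t : ℝ), R < |p.1| → N (T p.1 p.2 t) *
      (κ * φ₂ p.1 + u₁ p.1 p.2 * φ₁ p.1) + c * (η (T p.1 p.2 t) * f (T p.1 p.2 t) * φ p.1) = 0 :=
    fun p t hp => by simp [hz p.1 hp]
  have cIA := continuousOn_strip (F := fun p t => η' (T p.1 p.2 t) *
      (Tx p.1 p.2 t ^ 2 + Ty p.1 p.2 t ^ 2) * φ p.1) cA zA
  have cIB := continuousOn_strip (F := fun p t => N (T p.1 p.2 t) *
      (κ * φ₂ p.1 + u₁ p.1 p.2 * φ₁ p.1) + c * (η (T p.1 p.2 t) * f (T p.1 p.2 t) * φ p.1)) cB zB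
  have hd : ∀ t > 0, HasDerivAt (fun t => ∫ p in strip H, N (T p.1 p.2 t) * φ p.1)
      (-(κ * ∫ p in strip H, η' (T p.1 p.2 t) * (Tx p.1 p.2 t ^ 2 + Ty p.1 p.2 t ^ 2) * φ p.1)
      + ∫ p in strip H, (N (T p.1 p.2 t) * (κ * φ₂ p.1 + u₁ p.1 p.2 * φ₁ p.1)
          + c * (η (T p.1 p.2 t) * f (T p.1 p.2 t) * φ p.1))) t := by
    intro t ht
    have ht' : t ∈ Ioi (0 : ℝ) := ht
    have := hasDerivAt_strip (H := H) (R := R) (F := fun p t => N (T p.1 p.2 t) * φ p.1)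
      (F' := fun p t => η (T p.1 p.2 t) * Tt p.1 p.2 t * φ p.1) (cN.mul p0)
      ((cη.mul hs.cont_t).mul p0)
      (fun p hp t ht => (((hN _).comp t (hs.has_t p.1 p.2 hp.2 t ht))).mul_const _)
      (fun p t hp => by simp [hz p.1 hp]) ht
    refine this.congr_deriv ?_
    rw [hs.weak hu hH hf hN hη hη' hφ ht]
    have iA : IntegrableOn (fun p : ℝ × ℝ => η' (T p.1 p.2 t) *
        (Tx p.1 p.2 t ^ 2 + Ty p.1 p.2 t ^ 2) * φ p.1) (strip H) :=
      integrableOn_strip_of_continuousOn (cA.comp (f := fun p : ℝ × ℝ => (p, t)) (by fun_prop)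
        fun _ hp => ⟨hp, ht'⟩) fun p hp => zA p t hp
    have iB : IntegrableOn (fun p : ℝ × ℝ => N (T p.1 p.2 t) * (κ * φ₂ p.1 + u₁ p.1 p.2 * φ₁ p.1)
          + c * (η (T p.1 p.2 t) * f (T p.1 p.2 t) * φ p.1)) (strip H) :=
      integrableOn_strip_of_continuousOn (cB.comp (f := fun p : ℝ × ℝ => (p, t)) (by fun_prop)
        fun _ hp => ⟨hp, ht'⟩) fun p hp => zB p t hp
    have := integral_add (iA.const_mul κ).neg iB
    simp only [Pi.neg_apply, integral_neg, integral_const_mul] at this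
    rw [← this]
    refine integral_congr_ae (Eventually.of_forall fun p => ?_)
    simp only; ring
  have hI := integral_deriv_Ioi hd ((cIA.const_smul κ).neg.add cIB) h0 h1
  rw [intervalIntegral.integral_add, intervalIntegral.integral_neg,
    intervalIntegral.integral_const_mul] at hI
  · linarith
  · exact ((intervalIntegrable_of_Ioi cIA h0 h1).const_mul κ).neg
  · exact intervalIntegrable_of_Ioi cIB h0 h1

/-- Local energy bound (Caccioppoli inequality) with exponential decay. -/
lemma StripSol.local_energy (hs : StripSol H κ c f u₁ u₂ T Tt Tx Ty Txx Tyy)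
    (hu : StripFlow H M u₁ u₂ w) (hH : 0 < H) (hκ : 0 < κ) (hc : 0 < c) (hfc : Continuous f)
    (hMf : 0 < Mf) (hf : ∀ s ∈ Icc (0 : ℝ) 1, 0 ≤ f s ∧ f s ≤ Mf * (s * (1 - s)))
    {τ A lam : ℝ} (hD : Decay H τ A lam T) {χ χ₁ χ₂ : ℝ → ℝ} {C₀ : ℝ} (hχ : IsCutoff χ χ₁ χ₂ 2)
    (hχb : ∀ x, 0 ≤ χ x ∧ χ x ≤ 1 ∧ |χ₁ x| ≤ C₀ ∧ |χ₂ x| ≤ C₀) :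
    ∃ C > 0, ∀ a t₀ t₁, 0 < t₀ → t₀ ≤ t₁ → t₁ ≤ τ →
      ∫ t in t₀..t₁, ∫ p in strip H, (Tx p.1 p.2 t ^ 2 + Ty p.1 p.2 t ^ 2) * χ ((p.1 - a) / 2)
        ≤ C * Real.exp (-lam * |a|) := by
  have hA := hD.A_pos
  have hlam := hD.lam_pos
  have hC₀ : 0 ≤ C₀ := (abs_nonneg _).trans (hχb 0).2.2.1
  have hM0 : 0 ≤ M := (abs_nonneg _).trans (hu.bdd₁ 0 0 ⟨le_rfl, hH.le⟩)
  set D := A * Real.exp (4 * lam) with hDdef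
  have hDpos : 0 < D := by positivity
  set B := κ * C₀ + M * C₀ + c * Mf with hB
  have hBpos : 0 < B := by positivity
  refine ⟨(D * (8 * H) + D * B * (8 * H) * |τ|) / κ, by positivity, fun a t₀ t₁ h0 h1 h2 => ?_⟩
  have hcut := hχ.scale two_pos a
  -- The test function is `T - e`, where `e` is the limit of `T` on the side of the strip where `a`
  -- lies. The cutoff is supported in `|x - a| ≤ 4`, which accounts for `exp (4 * lam)` in `D`.
  obtain ⟨e, he, hZ⟩ : ∃ e : ℝ, (e = 0 ∨ e = 1) ∧ ∀ x, ∀ y ∈ Icc 0 H, ∀ t ∈ Icc 0 τ, |x - a| ≤ 4 →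
      |T x y t - e| ≤ D * Real.exp (-lam * |a|) := by
    rcases le_total 0 a with ha | ha
    · refine ⟨0, Or.inl rfl, fun x y hy t ht hx => ?_⟩
      rw [sub_zero, abs_of_nonneg (hs.range x y hy t ht.1).1, abs_of_nonneg ha]
      refine (hD.right x y hy t ht).trans ?_
      rw [hDdef, mul_assoc, ← Real.exp_add]
      refine mul_le_mul_of_nonneg_left (Real.exp_le_exp.2 ?_) hA.le
      nlinarith [(abs_le.1 hx).1]
    · refine ⟨1, Or.inr rfl, fun x y hy t ht hx => ?_⟩
      rw [abs_sub_comm, abs_of_nonneg (by linarith [(hs.range x y hy t ht.1).2]),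
        abs_of_nonpos ha]
      refine (hD.left x y hy t ht).trans ?_
      rw [hDdef, mul_assoc, ← Real.exp_add]
      refine mul_le_mul_of_nonneg_left (Real.exp_le_exp.2 ?_) hA.le
      nlinarith [(abs_le.1 hx).2]
  set E := D * Real.exp (-lam * |a|) with hE
  have hEpos : 0 < E := by positivity
  have hZ1 : ∀ x, ∀ y ∈ Icc 0 H, ∀ t ≥ 0, |T x y t - e| ≤ 1 := fun x y hy t ht => by
    have := hs.range x y hy t ht
    rw [abs_le]
    rcases he with rfl | rfl <;> constructor <;> linarith [this.1, this.2]
  have hen := hs.energy hu hH hfc (N := fun s => (s - e) ^ 2 / 2) (η := fun s => s - e)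
    (η' := fun _ => 1)
    (fun s => ((((hasDerivAt_id s).sub_const e).pow 2).div_const 2).congr_deriv (by simp))
    (fun s => (hasDerivAt_id s).sub_const e) continuous_const hcut h0 h1
  simp only [one_mul] at hen
  have hsupp : ∀ x, 4 < |x - a| → χ ((x - a) / 2) = 0 ∧ χ₁ ((x - a) / 2) = 0 ∧
      χ₂ ((x - a) / 2) = 0 := fun x hx => hχ.zero _ (by
    rw [abs_div, abs_two, lt_div_iff₀ two_pos]; linarith)
  have hN2 : ∀ x, ∀ y ∈ Icc 0 H, ∀ t ∈ Icc 0 τ, |x - a| ≤ 4 →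
      |(T x y t - e) ^ 2 / 2| ≤ E := fun x y hy t ht hx => by
    have h3 := hZ x y hy t ht hx
    have h4 := hZ1 x y hy t ht.1
    rw [abs_of_nonneg (by positivity), ← sq_abs]
    nlinarith [abs_nonneg (T x y t - e)]
  have ht₀ : t₀ ∈ Icc 0 τ := ⟨h0.le, h1.trans h2⟩
  have b1 : ∫ p in strip H, (T p.1 p.2 t₀ - e) ^ 2 / 2 * χ ((p.1 - a) / 2) ≤ E * (8 * H) := by
    refine (le_abs_self _).trans ?_
    have := abs_setIntegral_strip_le (a := a) (r := 4) (B := E) hH (by norm_num)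
      (F := fun p => (T p.1 p.2 t₀ - e) ^ 2 / 2 * χ ((p.1 - a) / 2)) (fun p hp hx => by
        rw [abs_mul, abs_of_nonneg (hχb _).1]
        calc _ ≤ E * 1 := mul_le_mul (hN2 p.1 p.2 hp.2 t₀ ht₀ hx) (hχb _).2.1 (hχb _).1 hEpos.le
          _ = E := mul_one _) (fun p hp => by rw [(hsupp _ hp).1, mul_zero])
    linarith
  have b2 : 0 ≤ ∫ p in strip H, (T p.1 p.2 t₁ - e) ^ 2 / 2 * χ ((p.1 - a) / 2) :=
    setIntegral_nonneg (measurableSet_strip H) fun p _ => mul_nonneg (by positivity) (hχb _).1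
  have b3 : ∀ t ∈ uIoc t₀ t₁, ‖∫ p in strip H, ((T p.1 p.2 t - e) ^ 2 / 2 *
      (κ * (χ₂ ((p.1 - a) / 2) / 2 / 2) + u₁ p.1 p.2 * (χ₁ ((p.1 - a) / 2) / 2))
      + c * ((T p.1 p.2 t - e) * f (T p.1 p.2 t) * χ ((p.1 - a) / 2)))‖ ≤ E * B * (8 * H) := by
    intro t ht
    rw [uIoc_of_le h1] at ht
    have htτ : t ∈ Icc 0 τ := ⟨(h0.trans ht.1).le, ht.2.trans h2⟩
    rw [Real.norm_eq_abs]
    have := abs_setIntegral_strip_le (a := a) (r := 4) (B := E * B) hH (by norm_num)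
      (F := fun p => (T p.1 p.2 t - e) ^ 2 / 2 *
      (κ * (χ₂ ((p.1 - a) / 2) / 2 / 2) + u₁ p.1 p.2 * (χ₁ ((p.1 - a) / 2) / 2))
      + c * ((T p.1 p.2 t - e) * f (T p.1 p.2 t) * χ ((p.1 - a) / 2))) (fun p hp hx => ?_)
      (fun p hp => by simp [hsupp _ hp])
    · linarith
    · obtain ⟨k0, k1, k2, k3⟩ := hχb ((p.1 - a) / 2)
      have q1 := hN2 p.1 p.2 hp.2 t htτ hx
      have q2 := hZ p.1 p.2 hp.2 t htτ hx
      have q3 := hu.bdd₁ p.1 p.2 hp.2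
      have hr := hs.range p.1 p.2 hp.2 t htτ.1
      obtain ⟨q4, q5⟩ := hf _ hr
      have q6 : f (T p.1 p.2 t) ≤ Mf := q5.trans
        (mul_le_of_le_one_right hMf.le (by nlinarith [hr.1, hr.2]))
      have r1 : |κ * (χ₂ ((p.1 - a) / 2) / 2 / 2) + u₁ p.1 p.2 * (χ₁ ((p.1 - a) / 2) / 2)|
          ≤ κ * C₀ + M * C₀ := by
        refine (abs_add_le _ _).trans (add_le_add ?_ ?_)
        · rw [abs_mul, abs_of_pos hκ, abs_div, abs_div, abs_two]
          exact mul_le_mul_of_nonneg_left (by linarith) hκ.le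
        · rw [abs_mul, abs_div, abs_two]
          exact mul_le_mul q3 (by linarith [abs_nonneg (χ₁ ((p.1 - a) / 2))]) (by positivity) hM0
      have r2 : |c * ((T p.1 p.2 t - e) * f (T p.1 p.2 t) * χ ((p.1 - a) / 2))| ≤ c * (E * Mf * 1) := by
        rw [abs_mul, abs_of_pos hc, abs_mul, abs_mul, abs_of_nonneg q4, abs_of_nonneg k0]
        refine mul_le_mul_of_nonneg_left ?_ hc.le
        exact mul_le_mul (mul_le_mul q2 q6 q4 hEpos.le) k1 k0 (by positivity)
      calc _ ≤ |(T p.1 p.2 t - e) ^ 2 / 2| * |κ * (χ₂ ((p.1 - a) / 2) / 2 / 2)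
            + u₁ p.1 p.2 * (χ₁ ((p.1 - a) / 2) / 2)| + c * (E * Mf * 1) := by
            rw [← abs_mul]; exact (abs_add_le _ _).trans (add_le_add le_rfl r2)
        _ ≤ E * (κ * C₀ + M * C₀) + c * (E * Mf * 1) :=
            add_le_add (mul_le_mul q1 r1 (abs_nonneg _) hEpos.le) le_rfl
        _ = E * B := by rw [hB]; ring
  have b4 := intervalIntegral.norm_integral_le_of_norm_le_const b3
  have b5 := (le_abs_self _).trans b4
  have b6 : E * B * (8 * H) * |t₁ - t₀| ≤ E * B * (8 * H) * |τ| := by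
    refine mul_le_mul_of_nonneg_left ?_ (by positivity)
    rw [abs_of_nonneg (by linarith), abs_of_nonneg (by linarith)]
    linarith
  have key : κ * (∫ t in t₀..t₁, ∫ p in strip H,
      (Tx p.1 p.2 t ^ 2 + Ty p.1 p.2 t ^ 2) * χ ((p.1 - a) / 2))
      ≤ E * (8 * H) + E * B * (8 * H) * |τ| := by
    rw [hen]; linarith
  rw [div_mul_eq_mul_div, le_div_iff₀ hκ, mul_comm]
  refine key.trans (le_of_eq ?_)
  rw [hE]; ring

end Energy

lemma integral_lin3 {α : Type*} [MeasurableSpace α] {μ : Measure α} {F₁ F₂ F₃ : α → ℝ}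
    (h₁ : Integrable F₁ μ) (h₂ : Integrable F₂ μ) (h₃ : Integrable F₃ μ) (a b c : ℝ) :
    Integrable (fun p => a * F₁ p + (b * F₂ p + c * F₃ p)) μ ∧
    ∫ p, (a * F₁ p + (b * F₂ p + c * F₃ p)) ∂μ
      = a * (∫ p, F₁ p ∂μ) + (b * (∫ p, F₂ p ∂μ) + c * ∫ p, F₃ p ∂μ) := by
  have i1 := h₁.const_mul a
  have i2 := h₂.const_mul b
  have i3 := h₃.const_mul c
  refine ⟨i1.add (i2.add i3), ?_⟩
  have e1 := integral_add i1 (i2.add i3)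
  have e2 := integral_add i2 i3
  simp only [Pi.add_apply] at e1
  rw [e1, e2, integral_const_mul, integral_const_mul, integral_const_mul]

/-- Pointwise form of the estimate of `T_t`: `a` stands for `T_t`, `(X, Y)` for the gradient, `L`
for the Laplacian, `F` for `f(T)`, `k` and `k'` for the cutoff and its derivative. Eliminating `L`
by the equation reduces the claim to `z² ≤ 2 z (z + s) + s²` with `z = a k` and `s` a sum of three
terms, whence `s²` is at most three times the sum of their squares. -/
lemma sq_time_deriv_le {a X Y F v₁ v₂ k k' κ c U C₀ L : ℝ}
    (hpde : κ * L = a + (v₁ * X + v₂ * Y) - c * F) (h1 : v₁ ^ 2 ≤ U ^ 2) (h2 : v₂ ^ 2 ≤ U ^ 2)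
    (h3 : k' ^ 2 ≤ C₀ ^ 2) (h4 : k ^ 2 ≤ 1) :
    a ^ 2 * (k * k) ≤ -κ * -(a * (2 * L * (k * k) + 2 * X * (k' * k + k * k')))
      + (3 * (2 * U ^ 2 + 4 * κ ^ 2 * C₀ ^ 2) * (X ^ 2 + Y ^ 2) + 3 * c ^ 2 * F ^ 2) := by
  have e2 : -κ * -(a * (2 * L * (k * k) + 2 * X * (k' * k + k * k')))
      = 2 * (a * k) * (a * k + ((v₁ * X + v₂ * Y) * k - c * F * k + 2 * κ * X * k')) := by
    linear_combination (2 * a * k * k) * hpde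
  rw [e2]
  have b1 : (v₁ * X + v₂ * Y) ^ 2 ≤ 2 * U ^ 2 * (X ^ 2 + Y ^ 2) := by
    have : (v₁ * X + v₂ * Y) ^ 2 ≤ (v₁ ^ 2 + v₂ ^ 2) * (X ^ 2 + Y ^ 2) := by
      nlinarith [sq_nonneg (v₁ * Y - v₂ * X)]
    refine this.trans (mul_le_mul_of_nonneg_right (by linarith) (by positivity))
  set P := v₁ * X + v₂ * Y
  have b3 : (P * k) ^ 2 ≤ 2 * U ^ 2 * (X ^ 2 + Y ^ 2) := by
    rw [mul_pow]
    exact (mul_le_of_le_one_right (sq_nonneg _) h4).trans b1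
  have b4 : (c * F * k) ^ 2 ≤ c ^ 2 * F ^ 2 := by
    rw [mul_pow, mul_pow]
    exact mul_le_of_le_one_right (by positivity) h4
  have b5 : (2 * κ * X * k') ^ 2 ≤ 4 * κ ^ 2 * C₀ ^ 2 * (X ^ 2 + Y ^ 2) := by
    have e : (2 * κ * X * k') ^ 2 = 4 * κ ^ 2 * (X ^ 2 * k' ^ 2) := by ring
    have h5 : X ^ 2 * k' ^ 2 ≤ (X ^ 2 + Y ^ 2) * C₀ ^ 2 :=
      mul_le_mul (by linarith [sq_nonneg Y]) h3 (sq_nonneg _) (by positivity)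
    rw [e]
    refine (mul_le_mul_of_nonneg_left h5 (by positivity)).trans (le_of_eq (by ring))
  generalize P * k = p at *
  generalize c * F * k = q at *
  generalize 2 * κ * X * k' = r at *
  have e3 : a ^ 2 * (k * k) = (a * k) ^ 2 := by ring
  rw [e3]
  generalize a * k = z at *
  have b2 : (p - q + r) ^ 2 ≤ 3 * (p ^ 2 + q ^ 2 + r ^ 2) := by
    linarith [sq_nonneg (p + q), sq_nonneg (p - r), sq_nonneg (q + r)]
  nlinarith [sq_nonneg (z + (p - q + r))]

lemma Decay.mul_le {H τ A lam : ℝ} {T : ℝ → ℝ → ℝ → ℝ} (hD : Decay H τ A lam T) {x y t a r : ℝ}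
    (hy : y ∈ Icc 0 H) (ht : t ∈ Icc 0 τ) (hr : T x y t ∈ Icc (0 : ℝ) 1) (hx : |x - a| ≤ r) :
    T x y t * (1 - T x y t) ≤ A * Real.exp (r * lam) * Real.exp (-lam * |a|) := by
  have hlam := hD.lam_pos
  rw [mul_assoc, ← Real.exp_add]
  have hx' := abs_le.1 hx
  rcases le_total 0 a with ha | ha
  · refine (mul_le_of_le_one_right hr.1 (by linarith [hr.1])).trans ((hD.right x y hy t ht).trans ?_)
    rw [abs_of_nonneg ha]
    exact mul_le_mul_of_nonneg_left (Real.exp_le_exp.2 (by nlinarith)) hD.A_pos.le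
  · refine (mul_le_of_le_one_left (by linarith [hr.2]) hr.2).trans ((hD.left x y hy t ht).trans ?_)
    rw [abs_of_nonpos ha]
    exact mul_le_mul_of_nonneg_left (Real.exp_le_exp.2 (by nlinarith)) hD.A_pos.le

/-! ### Local bounds of the time derivative -/

section TimeDerivative

variable {H κ c M m Mf : ℝ} {f : ℝ → ℝ} {u₁ u₂ w : ℝ → ℝ → ℝ}
  {T Tt Tx Ty Txx Tyy : ℝ → ℝ → ℝ → ℝ}

/-- Mixed derivatives such as `T_xt` are not assumed to exist, so `|∇T|²` cannot be differentiated
in time pointwise. Its increment factors as `∇(T(s) - T(t)) · ∇(T(s) + T(t))`, and integration by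
parts leaves the increment of `T` alone without a spatial derivative. -/
lemma StripSol.gradient_increment (hs : StripSol H κ c f u₁ u₂ T Tt Tx Ty Txx Tyy) (hH : 0 < H)
    {ϕ ϕ₁ ϕ₂ : ℝ → ℝ} {R : ℝ} (hϕ : IsCutoff ϕ ϕ₁ ϕ₂ R) {s t : ℝ} (hs0 : 0 < s) (ht0 : 0 < t) :
    (∫ p in strip H, (Tx p.1 p.2 s ^ 2 + Ty p.1 p.2 s ^ 2) * ϕ p.1)
      - ∫ p in strip H, (Tx p.1 p.2 t ^ 2 + Ty p.1 p.2 t ^ 2) * ϕ p.1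
    = ∫ p in strip H, -((T p.1 p.2 s - T p.1 p.2 t) *
        ((Txx p.1 p.2 s + Tyy p.1 p.2 s + (Txx p.1 p.2 t + Tyy p.1 p.2 t)) * ϕ p.1
          + (Tx p.1 p.2 s + Tx p.1 p.2 t) * ϕ₁ p.1)) := by
  have hs' : s ∈ Ioi (0 : ℝ) := hs0
  have ht' : t ∈ Ioi (0 : ℝ) := ht0
  have aT := slice_continuousOn hs.cont hs'
  have ax := slice_continuousOn hs.cont_x hs'
  have ay := slice_continuousOn hs.cont_y hs'
  have axx := slice_continuousOn hs.cont_xx hs'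
  have ayy := slice_continuousOn hs.cont_yy hs'
  have bT := slice_continuousOn hs.cont ht'
  have bx := slice_continuousOn hs.cont_x ht'
  have b_y := slice_continuousOn hs.cont_y ht'
  have bxx := slice_continuousOn hs.cont_xx ht'
  have byy := slice_continuousOn hs.cont_yy ht'
  have p0 : ContinuousOn (fun p : ℝ × ℝ => ϕ p.1) (strip H) := by
    have := hϕ.cont; fun_prop
  have p1 : ContinuousOn (fun p : ℝ × ℝ => ϕ₁ p.1) (strip H) := by
    have := hϕ.cont₁; fun_prop
  have hz := hϕ.zero
  have hint : ∀ {F : ℝ × ℝ → ℝ}, ContinuousOn F (strip H) → (∀ p, R < |p.1| → F p = 0) →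
      IntegrableOn F (strip H) := fun h1 h2 => integrableOn_strip_of_continuousOn h1 h2
  have i1 : IntegrableOn (fun p : ℝ × ℝ =>
      (Tx p.1 p.2 s - Tx p.1 p.2 t) * (Tx p.1 p.2 s + Tx p.1 p.2 t) * ϕ p.1
      + (T p.1 p.2 s - T p.1 p.2 t) * (Txx p.1 p.2 s + Txx p.1 p.2 t) * ϕ p.1
      + (T p.1 p.2 s - T p.1 p.2 t) * (Tx p.1 p.2 s + Tx p.1 p.2 t) * ϕ₁ p.1) (strip H) :=
    hint ((((((ax.sub bx).mul (ax.add bx)).mul p0).add (((aT.sub bT).mul (axx.add bxx)).mul p0))).add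
      (((aT.sub bT).mul (ax.add bx)).mul p1)) fun p hp => by simp [hz p.1 hp]
  have e1 := integral_strip_dx (R := R)
    (F := fun p => (T p.1 p.2 s - T p.1 p.2 t) * (Tx p.1 p.2 s + Tx p.1 p.2 t) * ϕ p.1)
    (fun x y hy => by
      have hyI := Ioo_subset_Icc_self hy
      exact ((((hs.has_x x y hyI s hs0).sub (hs.has_x x y hyI t ht0)).mul
        ((hs.has_xx x y hyI s hs0).add (hs.has_xx x y hyI t ht0))).mul
        (hϕ.has₁ x)).congr_deriv (by
          simp only [Pi.mul_apply, Pi.sub_apply, Pi.add_apply]; ring)) i1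
    fun p hp => by simp [hz p.1 hp]
  have hT : ∀ r > 0, ∀ x, ∀ y ∈ Ioo 0 H, HasDerivAt (fun z => T x z r) (Ty x y r) y :=
    fun r hr x y hy =>
    (hs.has_y x y (Ioo_subset_Icc_self hy) r hr).hasDerivAt (Icc_mem_nhds hy.1 hy.2)
  have hTy : ∀ r > 0, ∀ x, ∀ y ∈ Ioo 0 H, HasDerivAt (fun z => Ty x z r) (Tyy x y r) y :=
    fun r hr x y hy =>
    (hs.has_yy x y (Ioo_subset_Icc_self hy) r hr).hasDerivAt (Icc_mem_nhds hy.1 hy.2)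
  have i2 : IntegrableOn (fun p : ℝ × ℝ =>
      (Ty p.1 p.2 s - Ty p.1 p.2 t) * (Ty p.1 p.2 s + Ty p.1 p.2 t) * ϕ p.1
      + (T p.1 p.2 s - T p.1 p.2 t) * (Tyy p.1 p.2 s + Tyy p.1 p.2 t) * ϕ p.1) (strip H) :=
    hint ((((ay.sub b_y).mul (ay.add b_y)).mul p0).add (((aT.sub bT).mul (ayy.add byy)).mul p0))
      fun p hp => by simp [hz p.1 hp]
  have e2 := integral_strip_dy hH
    (F := fun p => (T p.1 p.2 s - T p.1 p.2 t) * (Ty p.1 p.2 s + Ty p.1 p.2 t) * ϕ p.1)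
    (fun x => by
      have : ContinuousOn (fun p : ℝ × ℝ =>
        (T p.1 p.2 s - T p.1 p.2 t) * (Ty p.1 p.2 s + Ty p.1 p.2 t) * ϕ p.1) (strip H) :=
        ((aT.sub bT).mul (ay.add b_y)).mul p0
      exact this.comp (f := fun y => (x, y)) (by fun_prop) fun y hy => ⟨mem_univ _, hy⟩)
    (fun x y hy => (((((hT s hs0 x y hy).sub (hT t ht0 x y hy)).mul
      ((hTy s hs0 x y hy).add (hTy t ht0 x y hy)))).mul_const (ϕ x)).congr_deriv
      (by simp only [Pi.sub_apply, Pi.add_apply]; ring)) i2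
    fun x => by
      rcases hs.bdry with h | h
      · simp [(h x s hs0).1, (h x s hs0).2.1, (h x t ht0).1, (h x t ht0).2.1]
      · simp only [(h x s hs0).1, (h x s hs0).2.1, (h x t ht0).1, (h x t ht0).2.1]
  have j1 : IntegrableOn (fun p : ℝ × ℝ => (Tx p.1 p.2 s ^ 2 + Ty p.1 p.2 s ^ 2) * ϕ p.1)
      (strip H) := hint (((ax.pow 2).add (ay.pow 2)).mul p0) fun p hp => by simp [hz p.1 hp]
  have j2 : IntegrableOn (fun p : ℝ × ℝ => (Tx p.1 p.2 t ^ 2 + Ty p.1 p.2 t ^ 2) * ϕ p.1)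
      (strip H) := hint (((bx.pow 2).add (b_y.pow 2)).mul p0) fun p hp => by simp [hz p.1 hp]
  have e12 := integral_add (μ := volume.restrict (strip H)) i1 i2
  rw [e1, e2, add_zero] at e12
  have h3 := integral_sub (μ := volume.restrict (strip H)) (j1.sub j2) (i1.add i2)
  simp only [Pi.sub_apply, Pi.add_apply] at h3
  rw [e12, sub_zero] at h3
  rw [← integral_sub j1 j2, ← h3]
  refine integral_congr_ae (Eventually.of_forall fun p => ?_)
  ring

/-- Divide the increment formula by `s - t`. The difference quotients of `T` are bounded by the mean
value inequality on a compact set of points and times, and dominated convergence gives the limit. -/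
lemma StripSol.hasDerivAt_gradient (hs : StripSol H κ c f u₁ u₂ T Tt Tx Ty Txx Tyy) (hH : 0 < H)
    {ϕ ϕ₁ ϕ₂ : ℝ → ℝ} {R : ℝ} (hϕ : IsCutoff ϕ ϕ₁ ϕ₂ R) {t : ℝ} (ht0 : 0 < t) :
    HasDerivAt (fun t => ∫ p in strip H, (Tx p.1 p.2 t ^ 2 + Ty p.1 p.2 t ^ 2) * ϕ p.1)
      (∫ p in strip H, -(Tt p.1 p.2 t * (2 * (Txx p.1 p.2 t + Tyy p.1 p.2 t) * ϕ p.1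
          + 2 * Tx p.1 p.2 t * ϕ₁ p.1))) t := by
  have ht' : t ∈ Ioi (0 : ℝ) := ht0
  have p0 := continuousOn_fst_strip (H := H) hϕ.cont
  have p1 := continuousOn_fst_strip (H := H) hϕ.cont₁
  have hz := hϕ.zero
  have hball : Metric.closedBall t (t / 2) ⊆ Ioi 0 := fun s hs => by
    have := abs_le.1 (by simpa [Real.dist_eq] using hs : |s - t| ≤ t / 2)
    exact mem_Ioi.2 (by linarith [this.1])
  have hball' : Metric.closedBall t (t / 2) ∈ 𝓝 t := Metric.closedBall_mem_nhds t (by linarith)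
  set box := Icc (-R) R ×ˢ Icc 0 H
  have hK := (isCompact_box R H).prod (isCompact_closedBall t (t / 2))
  have hKs : box ×ˢ Metric.closedBall t (t / 2) ⊆ strip H ×ˢ Ioi 0 :=
    prod_mono (box_subset_strip R H) hball
  obtain ⟨B₁, hB₁⟩ := hK.exists_bound_of_continuousOn (hs.cont_t.mono hKs)
  set L : ℝ × ℝ → ℝ → ℝ := fun p s =>
    (Txx p.1 p.2 s + Tyy p.1 p.2 s) * ϕ p.1 + Tx p.1 p.2 s * ϕ₁ p.1 with hL
  have hLc : ContinuousOn (fun z : (ℝ × ℝ) × ℝ => L z.1 z.2) (strip H ×ˢ Ioi 0) :=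
    ((hs.cont_xx.add hs.cont_yy).mul p0).add (hs.cont_x.mul p1)
  obtain ⟨B₂, hB₂⟩ := hK.exists_bound_of_continuousOn (hLc.mono hKs)
  have hLz : ∀ p s, R < |p.1| → L p s = 0 := fun p s hp => by simp [hL, hz p.1 hp]
  rw [hasDerivAt_iff_tendsto_slope]
  have e0 : ∫ p in strip H, -(Tt p.1 p.2 t * (2 * (Txx p.1 p.2 t + Tyy p.1 p.2 t) * ϕ p.1
          + 2 * Tx p.1 p.2 t * ϕ₁ p.1)) = ∫ p in box, -(Tt p.1 p.2 t * (L p t + L p t)) := by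
    rw [← setIntegral_strip_eq_box (H := H) (R := R)
      (F := fun p => -(Tt p.1 p.2 t * (L p t + L p t))) fun p hp => by simp [hLz p t hp]]
    refine integral_congr_ae (Eventually.of_forall fun p => ?_)
    simp only [hL]; ring
  rw [e0]
  have hnear : ∀ᶠ s in 𝓝[≠] t, s ∈ Metric.closedBall t (t / 2) ∧ s ≠ t := by
    filter_upwards [mem_nhdsWithin_of_mem_nhds hball', self_mem_nhdsWithin] with s h1 h2
      using ⟨h1, h2⟩
  have e1 : ∀ᶠ s in 𝓝[≠] t, ∫ p in box, -(slope (fun r => T p.1 p.2 r) t s * (L p s + L p t))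
      = slope (fun t => ∫ p in strip H, (Tx p.1 p.2 t ^ 2 + Ty p.1 p.2 t ^ 2) * ϕ p.1) t s := by
    filter_upwards [hnear] with s hs'
    rw [slope_def_field, hs.gradient_increment hH hϕ (hball hs'.1) ht0, ← integral_div,
      ← setIntegral_strip_eq_box (H := H) (R := R)
      (F := fun p => -(slope (fun r => T p.1 p.2 r) t s * (L p s + L p t)))
        fun p hp => by simp [hLz p _ hp]]
    refine integral_congr_ae (Eventually.of_forall fun p => ?_)
    simp only [hL, slope_def_field]; ring
  refine Tendsto.congr' e1 ?_
  have hbs := box_subset_strip R H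
  have hbm : MeasurableSet box := (isCompact_box R H).measurableSet
  refine tendsto_integral_filter_of_dominated_convergence (fun _ => B₁ * (B₂ + B₂)) ?_ ?_ ?_ ?_
  · filter_upwards [hnear] with s hs'
    have c1 := (slice_continuousOn hs.cont (mem_Ioi.2 (hball hs'.1))).mono hbs
    have c2 := (slice_continuousOn hs.cont ht').mono hbs
    have c3 : ∀ r ∈ Ioi (0 : ℝ), ContinuousOn (fun p => L p r) box := fun r hr =>
      (hLc.comp (f := fun p : ℝ × ℝ => (p, r)) (by fun_prop) fun _ hp => ⟨hp, hr⟩).mono hbs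
    have : ContinuousOn (fun p : ℝ × ℝ => -(slope (fun r => T p.1 p.2 r) t s * (L p s + L p t))) box := by
      simp only [slope_def_field]
      exact (((c1.sub c2).div_const _).mul ((c3 s (hball hs'.1)).add (c3 t ht'))).neg
    exact this.aestronglyMeasurable hbm
  · filter_upwards [hnear] with s hs'
    filter_upwards [ae_restrict_mem hbm] with p hp
    have hpI : p.2 ∈ Icc 0 H := hp.2
    have q1 : |slope (fun r => T p.1 p.2 r) t s| ≤ B₁ := by
      have := (convex_closedBall t (t / 2)).norm_image_sub_le_of_norm_hasDerivWithin_le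
        (f := fun r => T p.1 p.2 r) (f' := fun r => Tt p.1 p.2 r) (C := B₁)
        (fun r hr => (hs.has_t p.1 p.2 hpI r (hball hr)).hasDerivWithinAt)
        (fun r hr => hB₁ (p, r) ⟨hp, hr⟩) (Metric.mem_closedBall_self (by linarith)) hs'.1
      rw [slope_def_field, abs_div, div_le_iff₀ (abs_pos.2 (sub_ne_zero.2 hs'.2))]
      exact this
    have q2 := hB₂ (p, s) ⟨hp, hs'.1⟩
    have q3 := hB₂ (p, t) ⟨hp, Metric.mem_closedBall_self (by linarith)⟩
    rw [norm_neg, norm_mul]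
    exact mul_le_mul q1 ((norm_add_le _ _).trans (add_le_add q2 q3)) (norm_nonneg _)
      ((abs_nonneg _).trans q1)
  · exact integrableOn_const (isCompact_box R H).measure_lt_top.ne
  · filter_upwards [ae_restrict_mem hbm] with p hp
    have q1 := hasDerivAt_iff_tendsto_slope.1 (hs.has_t p.1 p.2 hp.2 t ht0)
    have q2 : Tendsto (fun s => L p s) (𝓝[≠] t) (𝓝 (L p t)) := by
      have : ContinuousOn (fun s => L p s) (Ioi 0) :=
        hLc.comp (f := fun s : ℝ => (p, s)) (by fun_prop) fun _ hr => ⟨hbs hp, hr⟩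
      exact (this.continuousAt (Ioi_mem_nhds ht0)).tendsto.mono_left nhdsWithin_le_nhds
    exact (q1.mul (q2.add tendsto_const_nhds)).neg

set_option maxHeartbeats 1000000 in
/-- Local `L²` bound of the time derivative with exponential decay. -/
lemma StripSol.local_time_deriv (hs : StripSol H κ c f u₁ u₂ T Tt Tx Ty Txx Tyy)
    (hu : StripFlow H M u₁ u₂ w) (hH : 0 < H) (hκ : 0 < κ) (hc : 0 < c) (hfc : Continuous f)
    (hMf : 0 < Mf) (hf : ∀ s ∈ Icc (0 : ℝ) 1, 0 ≤ f s ∧ f s ≤ Mf * (s * (1 - s)))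
    {τ A lam : ℝ} (hD : Decay H τ A lam T) {χ χ₁ χ₂ : ℝ → ℝ} {C₀ : ℝ} (hχ : IsCutoff χ χ₁ χ₂ 2)
    (hχb : ∀ x, 0 ≤ χ x ∧ χ x ≤ 1 ∧ |χ₁ x| ≤ C₀ ∧ |χ₂ x| ≤ C₀) (hχ1 : ∀ x, |x| ≤ 1 → χ x = 1)
    {t₀ : ℝ} (h0 : 0 < t₀) (h1 : t₀ ≤ τ) :
    ∃ C > 0, ∀ a, ∫ t in t₀..τ, ∫ p in strip H, Tt p.1 p.2 t ^ 2 * (χ (p.1 - a) * χ (p.1 - a))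
        ≤ C * ((3 + |a|) ^ 2 * Real.exp (-lam * |a|)) := by
  obtain ⟨C₁, hC₁, hcac⟩ := hs.local_energy hu hH hκ hc hfc hMf hf hD hχ hχb
  have hA := hD.A_pos
  have hlam := hD.lam_pos
  have hC₀ : 0 ≤ C₀ := (abs_nonneg _).trans (hχb 0).2.2.1
  have hM0 : 0 ≤ M := (abs_nonneg _).trans (hu.bdd₁ 0 0 ⟨le_rfl, hH.le⟩)
  have hτ : 0 < τ := h0.trans_le h1
  set D := A * Real.exp (4 * lam) with hDdef
  have hDpos : 0 < D := by positivity
  refine ⟨κ * (C₁ * (2 / t₀)) + 3 * (2 * M ^ 2 + 4 * κ ^ 2 * C₀ ^ 2) * C₁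
    + 3 * c ^ 2 * Mf ^ 2 * D * (8 * H) * τ, by positivity, fun a => ?_⟩
  have hφ' := hχ.scale one_pos a
  simp only [div_one] at hφ'
  have hϕ := hφ'.sq
  have hψ := hχ.scale two_pos a
  set E := Real.exp (-lam * |a|) with hE
  have hEpos : 0 < E := Real.exp_pos _
  have hU1 : 1 ≤ (3 + |a|) ^ 2 := by nlinarith [abs_nonneg a]
  set g : ℝ → ℝ := fun t =>
    ∫ p in strip H, (Tx p.1 p.2 t ^ 2 + Ty p.1 p.2 t ^ 2) * (χ (p.1 - a) * χ (p.1 - a)) with hg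
  have p0 := continuousOn_fst_strip (H := H) hϕ.cont
  have p1 := continuousOn_fst_strip (H := H) hϕ.cont₁
  have pψ := continuousOn_fst_strip (H := H) hψ.cont
  have zϕ := hϕ.zero
  have zψ := hψ.zero
  have cf := hfc.comp_continuousOn' hs.cont
  have cgrad : ContinuousOn (fun z : (ℝ × ℝ) × ℝ => (Tx z.1.1 z.1.2 z.2 ^ 2 + Ty z.1.1 z.1.2 z.2 ^ 2)
      * χ ((z.1.1 - a) / 2)) (strip H ×ˢ Ioi 0) :=
    ((hs.cont_x.pow 2).add (hs.cont_y.pow 2)).mul pψ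
  have ccgrad := continuousOn_strip (H := H) (R := 2 * 2 + |a|) (F := fun p t =>
    (Tx p.1 p.2 t ^ 2 + Ty p.1 p.2 t ^ 2) * χ ((p.1 - a) / 2)) cgrad
    fun p t hp => by simp [zψ p.1 hp]
  have cg : ContinuousOn g (Ioi 0) := fun t ht =>
    (hs.hasDerivAt_gradient hH hϕ ht).continuousAt.continuousWithinAt
  -- The wide cutoff equals 1 on the support of the narrow one, so terms produced by the narrow
  -- cutoff are covered by the local energy bound.
  have hwide : ∀ x, χ (x - a) * χ (x - a) ≤ χ ((x - a) / 2) := fun x => by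
    by_cases hx : |x - a| ≤ 2
    · rw [hχ1 ((x - a) / 2) (by rw [abs_div, abs_two]; linarith)]
      exact mul_le_one₀ (hχb _).2.1 (hχb _).1 (hχb _).2.1
    · rw [(hχ.zero (x - a) (not_le.1 hx)).1, zero_mul]; exact (hχb _).1
  -- an initial time with small gradient
  obtain ⟨s, hsI, hsmin⟩ := (isCompact_Icc (a := t₀ / 2) (b := t₀)).exists_isMinOn
    (nonempty_Icc.2 (by linarith)) (cg.mono fun t ht => by
      exact mem_Ioi.2 (by linarith [ht.1]))
  have hs0 : 0 < s := by linarith [hsI.1]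
  -- The minimum over `[t₀/2, t₀]` is at most the mean over this interval, of length `t₀/2`; this is
  -- the factor `2 / t₀`. The argument never descends to `t = 0`, where derivatives are not
  -- controlled.
  have hgs : g s ≤ C₁ * (2 / t₀) * E := by
    have i1 : ∫ t in (t₀ / 2)..t₀, g s ≤ ∫ t in (t₀ / 2)..t₀, ∫ p in strip H,
        (Tx p.1 p.2 t ^ 2 + Ty p.1 p.2 t ^ 2) * χ ((p.1 - a) / 2) := by
      refine intervalIntegral.integral_mono_on (by linarith) intervalIntegrable_const
        (intervalIntegrable_of_Ioi ccgrad (by linarith) (by linarith)) fun t ht => ?_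
      have htp : t ∈ Ioi (0 : ℝ) := mem_Ioi.2 (by linarith [ht.1])
      refine (hsmin ht : g s ≤ g t).trans ?_
      refine setIntegral_mono_on ?_ ?_ (measurableSet_strip H) fun p _ =>
        mul_le_mul_of_nonneg_left (hwide p.1) (by positivity)
      · exact integrableOn_strip_of_continuousOn (R := 2 * 1 + |a|)
          ((((slice_continuousOn hs.cont_x htp).pow 2).add
          ((slice_continuousOn hs.cont_y htp).pow 2)).mul
          (hϕ.cont.comp_continuousOn' continuousOn_fst)) fun p hp => by
            have := (zϕ p.1 hp).1
            simp only [mul_eq_zero, or_self] at this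
            simp [this]
      · exact integrableOn_strip_of_continuousOn (R := 2 * 2 + |a|)
          ((((slice_continuousOn hs.cont_x htp).pow 2).add
          ((slice_continuousOn hs.cont_y htp).pow 2)).mul
          (hψ.cont.comp_continuousOn' continuousOn_fst)) fun p hp => by simp [zψ p.1 hp]
    have i2 := i1.trans (hcac a (t₀ / 2) t₀ (by linarith) (by linarith) h1)
    rw [intervalIntegral.integral_const, smul_eq_mul] at i2
    have : g s = (t₀ - t₀ / 2) * g s * (2 / t₀) := by field_simp; ring
    rw [this]
    calc _ ≤ C₁ * E * (2 / t₀) := mul_le_mul_of_nonneg_right i2 (by positivity)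
      _ = _ := by ring
  -- the differential inequality
  set U := M * (3 + |a|) with hU
  set B : ℝ × ℝ → ℝ → ℝ := fun p t =>
    3 * (2 * U ^ 2 + 4 * κ ^ 2 * C₀ ^ 2) * ((Tx p.1 p.2 t ^ 2 + Ty p.1 p.2 t ^ 2) * χ ((p.1 - a) / 2))
      + 3 * c ^ 2 * (f (T p.1 p.2 t) ^ 2 * χ ((p.1 - a) / 2)) with hB
  have cft : ContinuousOn (fun z : (ℝ × ℝ) × ℝ => f (T z.1.1 z.1.2 z.2) ^ 2 * χ ((z.1.1 - a) / 2))
      (strip H ×ˢ Ioi 0) := (cf.pow 2).mul pψ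
  have ccft := continuousOn_strip (H := H) (R := 2 * 2 + |a|) (F := fun p t =>
    f (T p.1 p.2 t) ^ 2 * χ ((p.1 - a) / 2)) cft fun p t hp => by simp [zψ p.1 hp]
  have ctt : ContinuousOn (fun z : (ℝ × ℝ) × ℝ => Tt z.1.1 z.1.2 z.2 ^ 2 *
      (χ (z.1.1 - a) * χ (z.1.1 - a))) (strip H ×ˢ Ioi 0) := (hs.cont_t.pow 2).mul p0
  have cctt := continuousOn_strip (H := H) (R := 2 * 1 + |a|) (F := fun p t =>
    Tt p.1 p.2 t ^ 2 * (χ (p.1 - a) * χ (p.1 - a))) ctt fun p t hp => by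
      have := (zϕ p.1 hp).1
      simp only [this, mul_zero]
  set g' : ℝ → ℝ := fun t => ∫ p in strip H,
    -(Tt p.1 p.2 t * (2 * (Txx p.1 p.2 t + Tyy p.1 p.2 t) * (χ (p.1 - a) * χ (p.1 - a))
      + 2 * Tx p.1 p.2 t * (χ₁ (p.1 - a) * χ (p.1 - a) + χ (p.1 - a) * χ₁ (p.1 - a)))) with hg'
  have cg'i : ContinuousOn (fun z : (ℝ × ℝ) × ℝ => -(Tt z.1.1 z.1.2 z.2 *
      (2 * (Txx z.1.1 z.1.2 z.2 + Tyy z.1.1 z.1.2 z.2) * (χ (z.1.1 - a) * χ (z.1.1 - a))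
      + 2 * Tx z.1.1 z.1.2 z.2 * (χ₁ (z.1.1 - a) * χ (z.1.1 - a) + χ (z.1.1 - a) * χ₁ (z.1.1 - a)))))
      (strip H ×ˢ Ioi 0) :=
    (hs.cont_t.mul (((continuousOn_const.mul (hs.cont_xx.add hs.cont_yy)).mul p0).add
      ((continuousOn_const.mul hs.cont_x).mul p1))).neg
  have zg' : ∀ (p : ℝ × ℝ) (t : ℝ), 2 * 1 + |a| < |p.1| → -(Tt p.1 p.2 t *
      (2 * (Txx p.1 p.2 t + Tyy p.1 p.2 t) * (χ (p.1 - a) * χ (p.1 - a))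
      + 2 * Tx p.1 p.2 t * (χ₁ (p.1 - a) * χ (p.1 - a) + χ (p.1 - a) * χ₁ (p.1 - a)))) = 0 :=
    fun p t hp => by
      have e1 := (zϕ p.1 hp).1
      have e2 := (zϕ p.1 hp).2.1
      rw [e1, e2]; ring
  have cg' := continuousOn_strip (H := H) cg'i zg'
  have hderiv : ∀ t > 0, HasDerivAt g (g' t) t := fun t ht => by
    exact hs.hasDerivAt_gradient hH hϕ ht
  have hineq : ∀ t ∈ Icc s τ, (∫ p in strip H, Tt p.1 p.2 t ^ 2 * (χ (p.1 - a) * χ (p.1 - a)))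
      ≤ -κ * g' t + (3 * (2 * U ^ 2 + 4 * κ ^ 2 * C₀ ^ 2) * (∫ p in strip H,
        (Tx p.1 p.2 t ^ 2 + Ty p.1 p.2 t ^ 2) * χ ((p.1 - a) / 2))
        + 3 * c ^ 2 * ∫ p in strip H, f (T p.1 p.2 t) ^ 2 * χ ((p.1 - a) / 2)) := by
    intro t ht
    have ht0 : 0 < t := hs0.trans_le ht.1
    have ht' : t ∈ Ioi (0 : ℝ) := ht0
    have sl : ∀ {F : (ℝ × ℝ) × ℝ → ℝ}, ContinuousOn F (strip H ×ˢ Ioi 0) →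
        ContinuousOn (fun p => F (p, t)) (strip H) := fun hF =>
      hF.comp (f := fun p : ℝ × ℝ => (p, t)) (by fun_prop) fun _ hp => ⟨hp, ht'⟩
    have j1 : IntegrableOn (fun p : ℝ × ℝ => Tt p.1 p.2 t ^ 2 * (χ (p.1 - a) * χ (p.1 - a)))
        (strip H) := integrableOn_strip_of_continuousOn (R := 2 * 1 + |a|)
      (sl ctt) fun p hp => by
        have := (zϕ p.1 hp).1
        simp only [this, mul_zero]
    have j2 : IntegrableOn (fun p : ℝ × ℝ => -(Tt p.1 p.2 t *
      (2 * (Txx p.1 p.2 t + Tyy p.1 p.2 t) * (χ (p.1 - a) * χ (p.1 - a))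
      + 2 * Tx p.1 p.2 t * (χ₁ (p.1 - a) * χ (p.1 - a) + χ (p.1 - a) * χ₁ (p.1 - a)))))
        (strip H) := integrableOn_strip_of_continuousOn (R := 2 * 1 + |a|)
      (sl cg'i) fun p hp => zg' p t hp
    have j3 : IntegrableOn (fun p : ℝ × ℝ => (Tx p.1 p.2 t ^ 2 + Ty p.1 p.2 t ^ 2)
        * χ ((p.1 - a) / 2)) (strip H) := integrableOn_strip_of_continuousOn (R := 2 * 2 + |a|)
      (sl cgrad) fun p hp => by simp [zψ p.1 hp]
    have j4 : IntegrableOn (fun p : ℝ × ℝ => f (T p.1 p.2 t) ^ 2 * χ ((p.1 - a) / 2))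
        (strip H) := integrableOn_strip_of_continuousOn (R := 2 * 2 + |a|)
      (sl cft) fun p hp => by simp [zψ p.1 hp]
    obtain ⟨hcombi, hcomb⟩ := integral_lin3 j2 j3 j4 (-κ)
      (3 * (2 * U ^ 2 + 4 * κ ^ 2 * C₀ ^ 2)) (3 * c ^ 2)
    refine le_trans (integral_mono_ae j1 hcombi ?_) hcomb.le
    filter_upwards [ae_mem_Ioo H] with p hp
    have hpI := Ioo_subset_Icc_self hp
    have hpde := hs.pde p.1 p.2 hpI t ht0
    obtain ⟨k0, k1, k2, k3⟩ := hχb (p.1 - a)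
    have hw := hwide p.1
    by_cases hx : 2 < |p.1 - a|
    · obtain ⟨z1, z2, -⟩ := hχ.zero _ hx
      have k4 := (hχb ((p.1 - a) / 2)).1
      rw [z1, z2]
      have : 0 ≤ 3 * (2 * U ^ 2 + 4 * κ ^ 2 * C₀ ^ 2) *
        ((Tx p.1 p.2 t ^ 2 + Ty p.1 p.2 t ^ 2) * χ ((p.1 - a) / 2)) := by positivity
      have : 0 ≤ 3 * c ^ 2 * (f (T p.1 p.2 t) ^ 2 * χ ((p.1 - a) / 2)) := by positivity
      linarith
    · have hone : χ ((p.1 - a) / 2) = 1 := hχ1 _ (by rw [abs_div, abs_two]; linarith)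
      -- On the support `|x - a| ≤ 2` the linear growth of `u₂` costs a factor `3 + |a|`. Its square
      -- is the polynomial weight in the conclusion, harmless against the exponential.
      have hxa : 1 + |p.1| ≤ 3 + |a| := by
        have := abs_sub_abs_le_abs_sub p.1 a; linarith
      have hUu1 : |u₁ p.1 p.2| ≤ U := by
        refine (hu.bdd₁ p.1 p.2 hpI).trans ?_
        exact le_mul_of_one_le_right hM0 (by linarith [abs_nonneg a])
      have hUu2 : |u₂ p.1 p.2| ≤ U := (hu.bdd₂ p.1 p.2 hp).trans
        (mul_le_mul_of_nonneg_left hxa hM0)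
      rw [hone, mul_one, mul_one]
      exact sq_time_deriv_le (v₁ := u₁ p.1 p.2) (v₂ := u₂ p.1 p.2) (by linarith)
        (sq_le_sq.2 (hUu1.trans (le_abs_self _))) (sq_le_sq.2 (hUu2.trans (le_abs_self _)))
        (sq_le_sq.2 (k2.trans (le_abs_self _))) (pow_le_one₀ k0 k1)
  -- integration in time
  have hsτ : s ≤ τ := hsI.2.trans h1
  obtain ⟨hcombi, hcomb⟩ := integral_lin3
    ((intervalIntegrable_iff_integrableOn_Ioc_of_le hsτ).1 (intervalIntegrable_of_Ioi cg' hs0 hsτ))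
    ((intervalIntegrable_iff_integrableOn_Ioc_of_le hsτ).1 (intervalIntegrable_of_Ioi ccgrad hs0 hsτ))
    ((intervalIntegrable_iff_integrableOn_Ioc_of_le hsτ).1 (intervalIntegrable_of_Ioi ccft hs0 hsτ))
    (-κ) (3 * (2 * U ^ 2 + 4 * κ ^ 2 * C₀ ^ 2)) (3 * c ^ 2)
  have I1 := intervalIntegral.integral_mono_on hsτ (intervalIntegrable_of_Ioi cctt hs0 hsτ)
    ((intervalIntegrable_iff_integrableOn_Ioc_of_le hsτ).2 hcombi) hineq
  rw [intervalIntegral.integral_of_le hsτ (f := fun t => -κ * g' t + _), hcomb,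
    ← intervalIntegral.integral_of_le hsτ, ← intervalIntegral.integral_of_le hsτ,
    ← intervalIntegral.integral_of_le hsτ, integral_deriv_Ioi hderiv cg' hs0 hsτ] at I1
  have hgτ : 0 ≤ g τ := setIntegral_nonneg (measurableSet_strip H) fun p _ =>
    mul_nonneg (by positivity) (mul_self_nonneg _)
  have I2 := hcac a s τ hs0 hsτ le_rfl
  have I3 : ∫ t in s..τ, ∫ p in strip H, f (T p.1 p.2 t) ^ 2 * χ ((p.1 - a) / 2)
      ≤ Mf ^ 2 * D * E * (8 * H) * τ := by
    have hb : ∀ t ∈ uIoc s τ, ‖∫ p in strip H, f (T p.1 p.2 t) ^ 2 * χ ((p.1 - a) / 2)‖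
        ≤ Mf ^ 2 * D * E * (8 * H) := by
      intro t ht
      rw [uIoc_of_le hsτ] at ht
      have htI : t ∈ Icc 0 τ := ⟨(hs0.trans ht.1).le, ht.2⟩
      rw [Real.norm_eq_abs]
      have := abs_setIntegral_strip_le (a := a) (r := 4) (B := Mf ^ 2 * D * E) hH (by norm_num)
        (F := fun p => f (T p.1 p.2 t) ^ 2 * χ ((p.1 - a) / 2)) (fun p hp hx => ?_)
        (fun p hp => by
          rw [(hχ.zero _ (by rw [abs_div, abs_two, lt_div_iff₀ two_pos]; linarith)).1, mul_zero])
      · linarith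
      · have hr := hs.range p.1 p.2 hp.2 t htI.1
        obtain ⟨q4, q5⟩ := hf _ hr
        have hqD : T p.1 p.2 t * (1 - T p.1 p.2 t) ≤ D * E := hD.mul_le hp.2 htI hr hx
        have hq1 : T p.1 p.2 t * (1 - T p.1 p.2 t) ≤ 1 :=
          mul_le_one₀ hr.2 (by linarith [hr.2]) (by linarith [hr.1])
        have hq0 : 0 ≤ T p.1 p.2 t * (1 - T p.1 p.2 t) := mul_nonneg hr.1 (by linarith [hr.2])
        obtain ⟨k0, k1, -⟩ := hχb ((p.1 - a) / 2)
        rw [abs_of_nonneg (by positivity)]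
        have h7 : f (T p.1 p.2 t) ^ 2 ≤ Mf ^ 2 * (D * E) := by
          calc f (T p.1 p.2 t) ^ 2 ≤ (Mf * (T p.1 p.2 t * (1 - T p.1 p.2 t))) ^ 2 :=
                pow_le_pow_left₀ q4 q5 2
            _ = Mf ^ 2 * (T p.1 p.2 t * (1 - T p.1 p.2 t)) ^ 2 := by ring
            _ ≤ Mf ^ 2 * (D * E) := mul_le_mul_of_nonneg_left
              (by rw [sq]; exact (mul_le_of_le_one_right hq0 hq1).trans hqD) (by positivity)
        calc _ ≤ Mf ^ 2 * (D * E) * 1 := mul_le_mul h7 k1 k0 (by positivity)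
          _ = _ := by ring
    have := (le_abs_self _).trans (intervalIntegral.norm_integral_le_of_norm_le_const hb)
    refine this.trans (mul_le_mul_of_nonneg_left ?_ (by positivity))
    rw [abs_of_nonneg (by linarith)]; linarith
  have I4 : ∫ t in t₀..τ, ∫ p in strip H, Tt p.1 p.2 t ^ 2 * (χ (p.1 - a) * χ (p.1 - a))
      ≤ ∫ t in s..τ, ∫ p in strip H, Tt p.1 p.2 t ^ 2 * (χ (p.1 - a) * χ (p.1 - a)) := by
    refine intervalIntegral.integral_mono_interval hsI.2 h1 le_rfl
      (Eventually.of_forall fun t => ?_) (intervalIntegrable_of_Ioi cctt hs0 hsτ)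
    exact setIntegral_nonneg (measurableSet_strip H) fun p _ =>
      mul_nonneg (by positivity) (mul_self_nonneg _)
  have F1 : κ * g s ≤ κ * (C₁ * (2 / t₀)) * ((3 + |a|) ^ 2 * E) := by
    have : κ * g s ≤ κ * (C₁ * (2 / t₀)) * E := by
      rw [mul_assoc κ]; exact mul_le_mul_of_nonneg_left hgs hκ.le
    refine this.trans (mul_le_mul_of_nonneg_left ?_ (by positivity))
    nlinarith
  have F2 : 3 * (2 * U ^ 2 + 4 * κ ^ 2 * C₀ ^ 2) * (∫ t in s..τ, ∫ p in strip H,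
      (Tx p.1 p.2 t ^ 2 + Ty p.1 p.2 t ^ 2) * χ ((p.1 - a) / 2))
      ≤ 3 * (2 * M ^ 2 + 4 * κ ^ 2 * C₀ ^ 2) * C₁ * ((3 + |a|) ^ 2 * E) := by
    refine (mul_le_mul_of_nonneg_left I2 (by positivity)).trans ?_
    have : 3 * (2 * U ^ 2 + 4 * κ ^ 2 * C₀ ^ 2) ≤
        3 * (2 * M ^ 2 + 4 * κ ^ 2 * C₀ ^ 2) * (3 + |a|) ^ 2 := by
      rw [hU, mul_pow]
      have : 4 * κ ^ 2 * C₀ ^ 2 ≤ 4 * κ ^ 2 * C₀ ^ 2 * (3 + |a|) ^ 2 :=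
        le_mul_of_one_le_right (by positivity) hU1
      linarith
    calc _ ≤ 3 * (2 * M ^ 2 + 4 * κ ^ 2 * C₀ ^ 2) * (3 + |a|) ^ 2 * (C₁ * E) :=
          mul_le_mul_of_nonneg_right this (by positivity)
      _ = _ := by ring
  have F3 : 3 * c ^ 2 * (∫ t in s..τ, ∫ p in strip H, f (T p.1 p.2 t) ^ 2 * χ ((p.1 - a) / 2))
      ≤ 3 * c ^ 2 * Mf ^ 2 * D * (8 * H) * τ * ((3 + |a|) ^ 2 * E) := by
    refine (mul_le_mul_of_nonneg_left I3 (by positivity)).trans ?_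
    calc _ = 3 * c ^ 2 * Mf ^ 2 * D * (8 * H) * τ * E := by ring
      _ ≤ _ := mul_le_mul_of_nonneg_left (le_mul_of_one_le_left hEpos.le hU1) (by positivity)
  have F4 : 0 ≤ κ * g τ := mul_nonneg hκ.le hgτ
  refine I4.trans (I1.trans ?_)
  linarith

end TimeDerivative

/-! ### Integrability on the strip from summable local bounds -/

lemma integrableOn_exp_strip (H : ℝ) {lam : ℝ} (hl : 0 < lam) :
    IntegrableOn (fun p : ℝ × ℝ => Real.exp (-lam * |p.1|)) (strip H) := by
  have h1 : Integrable (fun x : ℝ => Real.exp (-lam * |x|)) := by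
    have a1 : IntegrableOn (fun x : ℝ => Real.exp (-lam * |x|)) (Ioi 0) :=
      (exp_neg_integrableOn_Ioi 0 hl).congr_fun
        (fun x hx => by simp only [abs_of_pos (show 0 < x from hx)]) measurableSet_Ioi
    have a2 : IntegrableOn (fun x : ℝ => Real.exp (-lam * |x|)) (Iic 0) :=
      (integrableOn_exp_mul_Iic hl 0).congr_fun
        (fun x hx => by simp only [abs_of_nonpos (show x ≤ 0 from hx)]; congr 1; ring)
        measurableSet_Iic
    have := a2.union a1
    rwa [Iic_union_Ioi, integrableOn_univ] at this
  rw [IntegrableOn, restrict_strip]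
  exact h1.comp_fst _

lemma summable_sq_mul_exp {μ : ℝ} (hμ : 0 < μ) :
    Summable fun n : ℤ => (3 + |(n : ℝ)|) ^ 2 * Real.exp (-μ * |(n : ℝ)|) := by
  have key : Summable fun n : ℕ => (3 + (n : ℝ)) ^ 2 * Real.exp (-μ * (n : ℝ)) := by
    have h2 := Real.summable_pow_mul_exp_neg_nat_mul 2 hμ
    have h1 := (Real.summable_pow_mul_exp_neg_nat_mul 1 hμ).mul_left 6
    have h0 := (Real.summable_pow_mul_exp_neg_nat_mul 0 hμ).mul_left 9
    refine ((h2.add h1).add h0).congr fun n => ?_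
    ring
  refine Summable.of_nat_of_neg ?_ ?_ <;> refine key.congr fun n => ?_ <;> simp

lemma aestronglyMeasurable_strip {H : ℝ} {F : ℝ × ℝ → ℝ} (hF : ContinuousOn F (strip H)) :
    AEStronglyMeasurable F (volume.restrict (strip H)) :=
  hF.aestronglyMeasurable (measurableSet_strip H)

/-- By Tonelli, the space-time integral of the sum of the local pieces is finite, so the sum is
finite at almost every time. The unit neighbourhoods of the integers, where the cutoffs equal 1,
cover the strip. -/
lemma ae_integrableOn_strip {H : ℝ} {F : ℝ × ℝ → ℝ → ℝ}
    (hF : ContinuousOn (fun z : (ℝ × ℝ) × ℝ => F z.1 z.2) (strip H ×ˢ Ioi 0))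
    {χ χ₁ χ₂ : ℝ → ℝ} (hχ : IsCutoff χ χ₁ χ₂ 2) (hχ1 : ∀ x, |x| ≤ 1 → χ x = 1)
    {b : ℤ → ℝ} (hb : Summable b) {t₀ τ : ℝ} (h0 : 0 < t₀) (h1 : t₀ ≤ τ)
    (hFb : ∀ n : ℤ, ∫ t in t₀..τ, ∫ p in strip H, |F p t| * (χ (p.1 - n) * χ (p.1 - n)) ≤ b n) :
    ∀ᵐ t ∂(volume.restrict (Ioc t₀ τ)), IntegrableOn (fun p => F p t) (strip H) := by
  have hzero : ∀ (n : ℤ) (p : ℝ × ℝ), 2 + |(n : ℝ)| < |p.1| → χ (p.1 - n) = 0 := fun n p hp =>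
    (hχ.zero _ (by have := abs_sub_abs_le_abs_sub p.1 n; linarith)).1
  have hcF : ∀ n : ℤ, ContinuousOn (fun z : (ℝ × ℝ) × ℝ =>
      |F z.1 z.2| * (χ (z.1.1 - n) * χ (z.1.1 - n))) (strip H ×ˢ Ioi 0) := fun n => by
    have := hχ.cont
    exact hF.abs.mul (Continuous.continuousOn (by fun_prop))
  set g : ℤ → ℝ → ℝ := fun n t => ∫ p in strip H, |F p t| * (χ (p.1 - n) * χ (p.1 - n)) with hg
  have hgc : ∀ n, ContinuousOn (g n) (Ioi 0) := fun n =>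
    continuousOn_strip (R := 2 + |(n : ℝ)|)
      (F := fun p t => |F p t| * (χ (p.1 - n) * χ (p.1 - n))) (hcF n)
      fun p t hp => by simp [hzero n p hp]
  have hgn : ∀ n t, 0 ≤ g n t := fun n t =>
    integral_nonneg fun p => mul_nonneg (abs_nonneg _) (mul_self_nonneg _)
  have hsub : Ioc t₀ τ ⊆ Ioi 0 := fun t ht => h0.trans ht.1
  have hgm : ∀ n, AEMeasurable (fun t => ENNReal.ofReal (g n t)) (volume.restrict (Ioc t₀ τ)) :=
    fun n => (((hgc n).mono hsub).aemeasurable measurableSet_Ioc).ennreal_ofReal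
  have hgi : ∀ n, ∫⁻ t in Ioc t₀ τ, ENNReal.ofReal (g n t) ≤ ENNReal.ofReal (b n) := fun n => by
    have i1 := (intervalIntegrable_iff_integrableOn_Ioc_of_le h1).1
      (intervalIntegrable_of_Ioi (hgc n) h0 h1)
    rw [← ofReal_integral_eq_lintegral_ofReal i1 (Eventually.of_forall (hgn n)),
      ← intervalIntegral.integral_of_le h1]
    exact ENNReal.ofReal_le_ofReal (hFb n)
  have hfin : ∫⁻ t in Ioc t₀ τ, ∑' n, ENNReal.ofReal (g n t) ≠ ⊤ := by
    rw [lintegral_tsum hgm]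
    exact ne_top_of_le_ne_top hb.tsum_ofReal_ne_top (ENNReal.tsum_le_tsum hgi)
  have hae := ae_lt_top' (AEMeasurable.tsum hgm) hfin
  filter_upwards [hae, ae_restrict_mem measurableSet_Ioc] with t ht htI
  have htp : t ∈ Ioi (0 : ℝ) := hsub htI
  have hFt : ContinuousOn (fun p => F p t) (strip H) :=
    hF.comp (f := fun p : ℝ × ℝ => (p, t)) (by fun_prop) fun p hp => ⟨hp, htp⟩
  refine ⟨aestronglyMeasurable_strip hFt, lt_of_le_of_lt ?_ ht⟩
  have hcov : strip H ⊆ ⋃ n : ℤ, {p | p ∈ strip H ∧ |p.1 - n| ≤ 1} := fun p hp => by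
    refine mem_iUnion.2 ⟨⌊p.1⌋, hp, ?_⟩
    rw [abs_le]
    constructor <;> linarith [Int.floor_le p.1, Int.lt_floor_add_one p.1]
  have hmeas : ∀ n : ℤ, MeasurableSet {p : ℝ × ℝ | p ∈ strip H ∧ |p.1 - n| ≤ 1} := fun n =>
    (measurableSet_strip H).inter (measurableSet_le (f := fun p : ℝ × ℝ => |p.1 - (n : ℝ)|) (measurable_fst.sub_const _).abs
      measurable_const)
  refine (lintegral_mono_set hcov).trans ((lintegral_iUnion_le _ _).trans
    (ENNReal.tsum_le_tsum fun n => ?_))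
  have hct : ContinuousOn (fun p => |F p t| * (χ (p.1 - n) * χ (p.1 - n))) (strip H) :=
    (hcF n).comp (f := fun p : ℝ × ℝ => (p, t)) (by fun_prop) fun p hp => ⟨hp, htp⟩
  rw [hg, ofReal_integral_eq_lintegral_ofReal
    (integrableOn_strip_of_continuousOn (R := 2 + |(n : ℝ)|) hct fun p hp => by simp [hzero n p hp])
    (Eventually.of_forall fun p => mul_nonneg (abs_nonneg _) (mul_self_nonneg _))]
  refine (setLIntegral_mono' (hmeas n) fun p hp => ?_).trans
    (lintegral_mono_set fun p hp => hp.1)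
  · rw [hχ1 _ hp.2, mul_one, mul_one, Real.enorm_eq_ofReal_abs]

/-! ### The bulk burning rate as the total reaction -/

section BulkRate

variable {H κ c M Mf : ℝ} {f : ℝ → ℝ} {u₁ u₂ w : ℝ → ℝ → ℝ}
  {T Tt Tx Ty Txx Tyy : ℝ → ℝ → ℝ → ℝ}

/-- Local `L²` bounds become local `L¹` bounds through `|T_t| ≤ α + α⁻¹ T_t²`, with `α` depending on
the piece. -/
lemma StripSol.ae_integrable_time_deriv (hs : StripSol H κ c f u₁ u₂ T Tt Tx Ty Txx Tyy)
    (hu : StripFlow H M u₁ u₂ w) (hH : 0 < H) (hκ : 0 < κ) (hc : 0 < c) (hfc : Continuous f)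
    (hMf : 0 < Mf) (hf : ∀ s ∈ Icc (0 : ℝ) 1, 0 ≤ f s ∧ f s ≤ Mf * (s * (1 - s)))
    {τ A lam : ℝ} (hD : Decay H τ A lam T) (hτ : 0 < τ) :
    ∀ᵐ t ∂(volume.restrict (Ioc 0 τ)), IntegrableOn (fun p => Tt p.1 p.2 t) (strip H) := by
  obtain ⟨χ, χ₁, χ₂, C₀, -, hχ, hχb, hχ1, -⟩ := exists_bump
  have main : ∀ t₀, 0 < t₀ → t₀ ≤ τ → ∀ᵐ t ∂(volume.restrict (Ioc t₀ τ)),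
      IntegrableOn (fun p => Tt p.1 p.2 t) (strip H) := by
    intro t₀ h0 h1
    obtain ⟨C, hC, hloc⟩ :=
      hs.local_time_deriv hu hH hκ hc hfc hMf hf hD hχ hχb hχ1 h0 h1
    have hl2 : 0 < lam / 2 := half_pos hD.lam_pos
    refine ae_integrableOn_strip (F := fun p t => Tt p.1 p.2 t) hs.cont_t hχ hχ1
      (b := fun n => (4 * H * τ + C) *
        ((3 + |(n : ℝ)|) ^ 2 * Real.exp (-(lam / 2) * |(n : ℝ)|)))
      ((summable_sq_mul_exp hl2).mul_left _) h0 h1 fun n => ?_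
    -- Half of the decay rate: the square of `α` is the exponential in the `L²` bound, so `α` and
    -- `α⁻¹` times that bound both decay like `α` up to a polynomial, and are summable.
    set α := Real.exp (-(lam / 2) * |(n : ℝ)|) with hα
    have hαp : 0 < α := Real.exp_pos _
    have hzero : ∀ p : ℝ × ℝ, 2 + |(n : ℝ)| < |p.1| → χ (p.1 - n) = 0 := fun p hp =>
      (hχ.zero _ (by have := abs_sub_abs_le_abs_sub p.1 n; linarith)).1
    have hk : ContinuousOn (fun z : (ℝ × ℝ) × ℝ => χ (z.1.1 - n) * χ (z.1.1 - n))
        (strip H ×ˢ Ioi 0) := by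
      have := hχ.cont
      exact Continuous.continuousOn (by fun_prop)
    have cA := continuousOn_strip (R := 2 + |(n : ℝ)|)
      (F := fun p t => |Tt p.1 p.2 t| * (χ (p.1 - n) * χ (p.1 - n))) (hs.cont_t.abs.mul hk)
      fun p t hp => by simp [hzero p hp]
    have cB := continuousOn_strip (R := 2 + |(n : ℝ)|)
      (F := fun p t => Tt p.1 p.2 t ^ 2 * (χ (p.1 - n) * χ (p.1 - n)))
      ((hs.cont_t.pow 2).mul hk) fun p t hp => by simp [hzero p hp]
    have hk' : ContinuousOn (fun p : ℝ × ℝ => χ (p.1 - n) * χ (p.1 - n)) (strip H) := by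
      have := hχ.cont
      exact Continuous.continuousOn (by fun_prop)
    have hbd : ∫ p in strip H, χ (p.1 - n) * χ (p.1 - n) ≤ 1 * (2 * 2 * H) :=
      (le_abs_self _).trans (abs_setIntegral_strip_le (a := n) hH (by norm_num)
        (fun p _ _ => by
          obtain ⟨a1, a2, -⟩ := hχb (p.1 - n)
          rw [abs_of_nonneg (mul_self_nonneg _)]
          exact mul_le_one₀ a2 a1 a2)
        fun p hp => by simp [(hχ.zero _ hp).1])
    have hpt : ∀ t ∈ Icc t₀ τ, ∫ p in strip H, |Tt p.1 p.2 t| * (χ (p.1 - n) * χ (p.1 - n))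
        ≤ α * (4 * H) + α⁻¹ * ∫ p in strip H, Tt p.1 p.2 t ^ 2 * (χ (p.1 - n) * χ (p.1 - n)) := by
      intro t ht
      have htp : t ∈ Ioi (0 : ℝ) := h0.trans_le ht.1
      have ct := slice_continuousOn hs.cont_t htp
      have i1 := integrableOn_strip_of_continuousOn (R := 2 + |(n : ℝ)|) (ct.abs.mul hk')
        fun p hp => by simp [hzero p hp]
      have i2 := integrableOn_strip_of_continuousOn (R := 2 + |(n : ℝ)|) (F := fun p =>
        Tt p.1 p.2 t ^ 2 * (χ (p.1 - n) * χ (p.1 - n))) ((ct.pow 2).mul hk')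
        fun p hp => by simp [hzero p hp]
      have i3 := integrableOn_strip_of_continuousOn (R := 2 + |(n : ℝ)|) hk'
        fun p hp => by simp [hzero p hp]
      calc _ ≤ ∫ p in strip H, (α * (χ (p.1 - n) * χ (p.1 - n))
            + α⁻¹ * (Tt p.1 p.2 t ^ 2 * (χ (p.1 - n) * χ (p.1 - n)))) := by
            refine integral_mono i1 ((i3.const_mul _).add (i2.const_mul _)) fun p => ?_
            have e : α * (χ (p.1 - n) * χ (p.1 - n))
                + α⁻¹ * (Tt p.1 p.2 t ^ 2 * (χ (p.1 - n) * χ (p.1 - n)))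
                - |Tt p.1 p.2 t| * (χ (p.1 - n) * χ (p.1 - n))
                = α⁻¹ * (((|Tt p.1 p.2 t| - α / 2) ^ 2 + 3 / 4 * α ^ 2)
                  * (χ (p.1 - n) * χ (p.1 - n))) := by
              rw [← sq_abs (Tt p.1 p.2 t)]
              field_simp
              ring
            have : 0 ≤ α⁻¹ * (((|Tt p.1 p.2 t| - α / 2) ^ 2 + 3 / 4 * α ^ 2)
                  * (χ (p.1 - n) * χ (p.1 - n))) :=
              mul_nonneg (inv_pos.2 hαp).le (mul_nonneg (by positivity) (mul_self_nonneg _))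
            change |Tt p.1 p.2 t| * (χ (p.1 - n) * χ (p.1 - n)) ≤ _
            linarith
        _ = α * (∫ p in strip H, χ (p.1 - n) * χ (p.1 - n))
            + α⁻¹ * ∫ p in strip H, Tt p.1 p.2 t ^ 2 * (χ (p.1 - n) * χ (p.1 - n)) := by
            rw [integral_add (i3.const_mul _) (i2.const_mul _), integral_const_mul,
              integral_const_mul]
        _ ≤ _ := by
            have := mul_le_mul_of_nonneg_left hbd hαp.le
            linarith
    have iA := intervalIntegrable_of_Ioi cA h0 h1
    have iB := intervalIntegrable_of_Ioi cB h0 h1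
    refine (intervalIntegral.integral_mono_on h1 iA
      (intervalIntegrable_const.add (iB.const_mul α⁻¹)) hpt).trans ?_
    rw [intervalIntegral.integral_add intervalIntegrable_const
      (iB.const_mul α⁻¹), intervalIntegral.integral_const, intervalIntegral.integral_const_mul]
    have hE : Real.exp (-lam * |(n : ℝ)|) = α * α := by
      rw [hα, ← Real.exp_add]; congr 1; ring
    have h3 := mul_le_mul_of_nonneg_left (hloc n) (inv_pos.2 hαp).le
    have e3 : α⁻¹ * (C * ((3 + |(n : ℝ)|) ^ 2 * Real.exp (-lam * |(n : ℝ)|)))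
        = C * ((3 + |(n : ℝ)|) ^ 2 * α) := by
      rw [hE]; field_simp
    rw [e3] at h3
    have h4 : (τ - t₀) • (α * (4 * H)) ≤ 4 * H * τ * ((3 + |(n : ℝ)|) ^ 2 * α) := by
      have a1 : (1 : ℝ) ≤ (3 + |(n : ℝ)|) ^ 2 :=
        one_le_pow₀ (by linarith [abs_nonneg (n : ℝ)])
      calc (τ - t₀) • (α * (4 * H)) ≤ τ * (α * (4 * H)) :=
            mul_le_mul_of_nonneg_right (by linarith) (by positivity)
        _ = 4 * H * τ * (1 * α) := by ring
        _ ≤ _ := by gcongr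
    calc _ ≤ _ := add_le_add h4 h3
      _ = _ := by ring
  rw [ae_restrict_iff' measurableSet_Ioc]
  -- The bounds degenerate at `t = 0`, so `(0, τ]` is exhausted by the countably many intervals
  -- `(τ/(k+1), τ]`.
  have hall : ∀ᵐ t : ℝ, ∀ k : ℕ, t ∈ Ioc (τ / (k + 1)) τ →
      IntegrableOn (fun p => Tt p.1 p.2 t) (strip H) := ae_all_iff.2 fun k => by
    have hk : (0 : ℝ) < k + 1 := by positivity
    exact (ae_restrict_iff' measurableSet_Ioc).1
      (main _ (by positivity) (div_le_self hτ.le (by linarith [Nat.cast_nonneg (α := ℝ) k])))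
  filter_upwards [hall] with t ht hI
  obtain ⟨k, hk⟩ := exists_nat_gt (τ / t)
  refine ht k ⟨?_, hI.2⟩
  rw [div_lt_iff₀ (by positivity)]
  rw [div_lt_iff₀ hI.1] at hk
  nlinarith [hI.1]

lemma Decay.mul_le_exp {τ A lam : ℝ} (hD : Decay H τ A lam T)
    (hs : StripSol H κ c f u₁ u₂ T Tt Tx Ty Txx Tyy) {p : ℝ × ℝ} (hp : p ∈ strip H) {t : ℝ}
    (ht : t ∈ Icc 0 τ) :
    T p.1 p.2 t * (1 - T p.1 p.2 t) ≤ A * Real.exp (-lam * |p.1|) := by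
  have := hD.mul_le (x := p.1) (y := p.2) (a := p.1) (r := 0) hp.2 ht
    (hs.range p.1 p.2 hp.2 t ht.1) (by simp)
  simpa using this

lemma Decay.abs_sub_step_le {τ A lam : ℝ} (hD : Decay H τ A lam T)
    (hs : StripSol H κ c f u₁ u₂ T Tt Tx Ty Txx Tyy) {p : ℝ × ℝ} (hp : p ∈ strip H) {t : ℝ}
    (ht : t ∈ Icc 0 τ) :
    |T p.1 p.2 t - (Iio (0 : ℝ)).indicator 1 p.1| ≤ A * Real.exp (-lam * |p.1|) := by
  have hr := hs.range p.1 p.2 hp.2 t ht.1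
  by_cases hx : p.1 < 0
  · have := hD.left p.1 p.2 hp.2 t ht
    rw [indicator_of_mem (show p.1 ∈ Iio 0 from hx), abs_of_neg hx, abs_sub_comm, Pi.one_apply,
      abs_of_nonneg (by linarith [hr.2])]
    simpa using this
  · have := hD.right p.1 p.2 hp.2 t ht
    rw [indicator_of_notMem (show p.1 ∉ Iio 0 from hx), sub_zero, abs_of_nonneg hr.1,
      abs_of_nonneg (not_lt.1 hx)]
    exact this

lemma Decay.integrableOn_comp {τ A lam : ℝ} (hD : Decay H τ A lam T)
    (hs : StripSol H κ c f u₁ u₂ T Tt Tx Ty Txx Tyy) {k : ℝ → ℝ} (hk : Continuous k) {B : ℝ}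
    (hB : 0 ≤ B) (hkB : ∀ s ∈ Icc (0 : ℝ) 1, |k s| ≤ B * (s * (1 - s))) {t : ℝ}
    (ht : t ∈ Icc 0 τ) : IntegrableOn (fun p => k (T p.1 p.2 t)) (strip H) := by
  refine Integrable.mono' (((integrableOn_exp_strip H hD.lam_pos).const_mul A).const_mul B)
    (aestronglyMeasurable_strip (hk.comp_continuousOn'
      (slice_continuousOn hs.cont₀ (show t ∈ Ici 0 from ht.1)))) ?_
  filter_upwards [ae_restrict_mem (measurableSet_strip H)] with p hp
  exact (hkB _ (hs.range p.1 p.2 hp.2 t ht.1)).trans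
    (mul_le_mul_of_nonneg_left (hD.mul_le_exp hs hp ht) hB)

lemma Decay.continuousOn_integral_comp {τ A lam : ℝ} (hD : Decay H τ A lam T)
    (hs : StripSol H κ c f u₁ u₂ T Tt Tx Ty Txx Tyy) {k : ℝ → ℝ} (hk : Continuous k) {B : ℝ}
    (hB : 0 ≤ B) (hkB : ∀ s ∈ Icc (0 : ℝ) 1, |k s| ≤ B * (s * (1 - s))) :
    ContinuousOn (fun t => ∫ p in strip H, k (T p.1 p.2 t)) (Icc 0 τ) := by
  refine continuousOn_of_dominated (bound := fun p => B * (A * Real.exp (-lam * |p.1|)))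
    (fun t ht => (hD.integrableOn_comp hs hk hB hkB ht).aestronglyMeasurable) (fun t ht => ?_)
    (((integrableOn_exp_strip H hD.lam_pos).const_mul A).const_mul B) ?_
  · filter_upwards [ae_restrict_mem (measurableSet_strip H)] with p hp
    exact (hkB _ (hs.range p.1 p.2 hp.2 t ht.1)).trans
      (mul_le_mul_of_nonneg_left (hD.mul_le_exp hs hp ht) hB)
  · filter_upwards [ae_restrict_mem (measurableSet_strip H)] with p hp
    exact hk.comp_continuousOn' (hs.cont₀.comp (f := fun t : ℝ => (p, t)) (by fun_prop)
      fun t ht => ⟨hp, ht.1⟩)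

lemma tendsto_integral_cutoff {F : ℝ × ℝ → ℝ} (hF : IntegrableOn F (strip H))
    {χ χ₁ χ₂ : ℝ → ℝ} (hχ : IsCutoff χ χ₁ χ₂ 2) (hχb : ∀ x, 0 ≤ χ x ∧ χ x ≤ 1)
    (hχ1 : ∀ x, |x| ≤ 1 → χ x = 1) :
    Tendsto (fun n : ℕ => ∫ p in strip H, F p * χ ((p.1 - 0) / ((n : ℝ) + 1))) atTop
      (𝓝 (∫ p in strip H, F p)) := by
  refine tendsto_integral_of_dominated_convergence (fun p => |F p|) (fun n => ?_) hF.abs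
    (fun n => Eventually.of_forall fun p => ?_) (Eventually.of_forall fun p => ?_)
  · have := hχ.cont
    exact hF.aestronglyMeasurable.mul (Continuous.aestronglyMeasurable (by fun_prop))
  · obtain ⟨a1, a2⟩ := hχb ((p.1 - 0) / ((n : ℝ) + 1))
    rw [norm_mul, Real.norm_eq_abs, Real.norm_eq_abs, abs_of_nonneg a1]
    exact mul_le_of_le_one_right (abs_nonneg _) a2
  · refine tendsto_const_nhds.congr' ?_
    obtain ⟨N, hN⟩ := exists_nat_gt |p.1|
    filter_upwards [eventually_ge_atTop N] with n hn
    have hn' : (N : ℝ) ≤ n := by exact_mod_cast hn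
    rw [hχ1, mul_one]
    rw [sub_zero, abs_div, abs_of_pos (show (0 : ℝ) < (n : ℝ) + 1 by positivity),
      div_le_one (by positivity)]
    linarith

/-- Test with a cutoff of width `r → ∞`. Diffusion contributes `O(1/r)`. The advective term `∫ T u₁
φ'` is not small by itself, as `T` tends to 1 on the left; but `u₁` has mean zero on cross-sections,
so `T` may be replaced by its difference with the step function of `x < 0`, which is integrable. -/
lemma StripSol.integral_time_deriv (hs : StripSol H κ c f u₁ u₂ T Tt Tx Ty Txx Tyy)
    (hu : StripFlow H M u₁ u₂ w) (hH : 0 < H) (hκ : 0 < κ) (hfc : Continuous f)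
    (hMf : 0 < Mf) (hf : ∀ s ∈ Icc (0 : ℝ) 1, 0 ≤ f s ∧ f s ≤ Mf * (s * (1 - s)))
    {τ A lam : ℝ} (hD : Decay H τ A lam T) {t : ℝ} (ht0 : 0 < t) (ht : t ≤ τ)
    (hint : IntegrableOn (fun p => Tt p.1 p.2 t) (strip H)) :
    ∫ p in strip H, Tt p.1 p.2 t = c * ∫ p in strip H, f (T p.1 p.2 t) := by
  obtain ⟨χ, χ₁, χ₂, C₀, hC₀, hχ, hχb, hχ1, -⟩ := exists_bump
  have htI : t ∈ Icc 0 τ := ⟨ht0.le, ht⟩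
  have htp : t ∈ Ioi (0 : ℝ) := ht0
  have hχb' : ∀ x, 0 ≤ χ x ∧ χ x ≤ 1 := fun x => ⟨(hχb x).1, (hχb x).2.1⟩
  have hM0 : 0 ≤ M := (abs_nonneg _).trans (hu.bdd₁ 0 0 ⟨le_rfl, hH.le⟩)
  have cT := slice_continuousOn hs.cont htp
  have iE := (integrableOn_exp_strip H hD.lam_pos).const_mul A
  have iF := hD.integrableOn_comp hs hfc hMf.le
    (fun s h => by rw [abs_of_nonneg (hf s h).1]; exact (hf s h).2) htI
  have l1 := tendsto_integral_cutoff hint hχ hχb' hχ1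
  have l2 := (tendsto_integral_cutoff iF hχ hχb' hχ1).const_mul c
  set E := ∫ p in strip H, A * Real.exp (-lam * |p.1|)
  have hE0 : 0 ≤ E := integral_nonneg fun p =>
    mul_nonneg hD.A_pos.le (Real.exp_pos _).le
  -- With `r = n + 1`: diffusion has integrand at most `κ C₀ / r²` on an area `4 r H`, and advection
  -- is at most `M C₀ / r` times the integral `E` of the decay envelope.
  have herr : ∀ n : ℕ, |(∫ p in strip H, Tt p.1 p.2 t * χ ((p.1 - 0) / ((n : ℝ) + 1)))
      - c * ∫ p in strip H, f (T p.1 p.2 t) * χ ((p.1 - 0) / ((n : ℝ) + 1))|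
      ≤ (4 * κ * C₀ * H + M * C₀ * E) / ((n : ℝ) + 1) := by
    intro n
    set r : ℝ := (n : ℝ) + 1
    have hr : 0 < r := by positivity
    have hφ := hχ.scale hr 0
    rw [abs_zero, add_zero] at hφ
    set φ := fun x => χ ((x - 0) / r) with hφd
    set φ₁ := fun x => χ₁ ((x - 0) / r) / r with hφ₁d
    set φ₂ := fun x => χ₂ ((x - 0) / r) / r / r with hφ₂d
    have b1 : ∀ x, |φ₁ x| ≤ C₀ / r := fun x => by
      rw [hφ₁d, abs_div, abs_of_pos hr]
      exact div_le_div_of_nonneg_right (hχb _).2.2.1 hr.le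
    have b2 : ∀ x, |φ₂ x| ≤ C₀ / r / r := fun x => by
      rw [hφ₂d, abs_div, abs_div, abs_of_pos hr]
      exact div_le_div_of_nonneg_right (div_le_div_of_nonneg_right (hχb _).2.2.2 hr.le) hr.le
    have p0 : ContinuousOn (fun p : ℝ × ℝ => φ p.1) (strip H) := by
      have := hφ.cont; fun_prop
    have p1 : ContinuousOn (fun p : ℝ × ℝ => φ₁ p.1) (strip H) := by
      have := hφ.cont₁; fun_prop
    have p2 : ContinuousOn (fun p : ℝ × ℝ => φ₂ p.1) (strip H) := by
      have := hφ.cont₂; fun_prop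
    have hw := hs.weak hu hH hfc (N := id) (η := fun _ => 1) (η' := fun _ => 0)
      (fun s => hasDerivAt_id s) (fun s => hasDerivAt_const s 1) continuous_const hφ ht0
    have j1 : IntegrableOn (fun p : ℝ × ℝ => κ * (T p.1 p.2 t * φ₂ p.1)) (strip H) :=
      (integrableOn_strip_of_continuousOn (R := 2 * r) (cT.mul p2)
        fun p hp => by simp [hφ.zero _ hp]).const_mul κ
    have j4 : IntegrableOn (fun p : ℝ × ℝ => u₁ p.1 p.2 * φ₁ p.1) (strip H) :=
      integrableOn_strip_of_continuousOn (R := 2 * r) (hu.cont₁.mul p1)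
        fun p hp => by simp [hφ.zero _ hp]
    have j2 : IntegrableOn (fun p : ℝ × ℝ => T p.1 p.2 t * (u₁ p.1 p.2 * φ₁ p.1)) (strip H) :=
      integrableOn_strip_of_continuousOn (R := 2 * r) (cT.mul (hu.cont₁.mul p1))
        fun p hp => by simp [hφ.zero _ hp]
    have j3 : IntegrableOn (fun p : ℝ × ℝ => c * (f (T p.1 p.2 t) * φ p.1)) (strip H) :=
      (integrableOn_strip_of_continuousOn (R := 2 * r) ((hfc.comp_continuousOn' cT).mul p0)
        fun p hp => by simp [hφ.zero _ hp]).const_mul c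
    have j5 : IntegrableOn (fun p : ℝ × ℝ => (Iio (0 : ℝ)).indicator (1 : ℝ → ℝ) p.1 *
        (u₁ p.1 p.2 * φ₁ p.1)) (strip H) := by
      refine Integrable.mono' j4.abs ?_ (Eventually.of_forall fun p => ?_)
      · exact (((measurable_one.indicator measurableSet_Iio).comp
          measurable_fst).aestronglyMeasurable).mul j4.aestronglyMeasurable
      · rw [norm_mul]
        refine mul_le_of_le_one_left (abs_nonneg _) ?_
        by_cases hx : p.1 ∈ Iio (0 : ℝ) <;> simp [hx]
    -- For fixed `x` everything except `u₁` is constant in `y`, so integrating in `y` first gives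
    -- zero.
    have hstep : ∫ p in strip H, (Iio (0 : ℝ)).indicator (1 : ℝ → ℝ) p.1 *
        (u₁ p.1 p.2 * φ₁ p.1) = 0 := by
      rw [IntegrableOn, restrict_strip] at j5
      rw [restrict_strip, integral_prod _ j5]
      refine integral_eq_zero_of_ae (Eventually.of_forall fun x => ?_)
      simp only [integral_const_mul, integral_mul_const, hu.zero_mean x, zero_mul, mul_zero,
        Pi.zero_apply]
    have heq : (∫ p in strip H, Tt p.1 p.2 t * φ p.1) - c * ∫ p in strip H, f (T p.1 p.2 t) * φ p.1
        = (∫ p in strip H, κ * (T p.1 p.2 t * φ₂ p.1))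
          + ∫ p in strip H, (T p.1 p.2 t - (Iio (0 : ℝ)).indicator 1 p.1) *
            (u₁ p.1 p.2 * φ₁ p.1) := by
      have e1 : ∫ p in strip H, Tt p.1 p.2 t * φ p.1 =
          ∫ p in strip H, (κ * (T p.1 p.2 t * φ₂ p.1) + T p.1 p.2 t * (u₁ p.1 p.2 * φ₁ p.1)
            + c * (f (T p.1 p.2 t) * φ p.1)) := by
        simp only [one_mul, zero_mul, mul_zero, neg_zero, zero_add, id] at hw
        rw [hw]
        refine integral_congr_ae (Eventually.of_forall fun p => ?_)
        simp only
        ring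
      have e2 : ∫ p in strip H, (T p.1 p.2 t - (Iio (0 : ℝ)).indicator 1 p.1) *
            (u₁ p.1 p.2 * φ₁ p.1) = ∫ p in strip H, T p.1 p.2 t * (u₁ p.1 p.2 * φ₁ p.1) := by
        simp only [sub_mul]
        rw [integral_sub j2 j5, hstep, sub_zero]
      have e3 := integral_add (j1.add j2) j3
      have e4 := integral_add j1 j2
      simp only [Pi.add_apply] at e3
      rw [e1, e2, e3, e4, integral_const_mul c]
      ring
    have n1 : |∫ p in strip H, κ * (T p.1 p.2 t * φ₂ p.1)| ≤ κ * (C₀ / r / r) * (2 * (2 * r) * H) :=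
      abs_setIntegral_strip_le (a := 0) hH (by positivity) (fun p hp _ => by
        have hT := hs.range p.1 p.2 hp.2 t ht0.le
        rw [abs_mul, abs_of_pos hκ, abs_mul, abs_of_nonneg hT.1]
        refine mul_le_mul_of_nonneg_left ?_ hκ.le
        exact (mul_le_of_le_one_left (abs_nonneg _) hT.2).trans (b2 _))
        fun p hp => by rw [sub_zero] at hp; simp [hφ.zero _ hp]
    have n2 : |∫ p in strip H, (T p.1 p.2 t - (Iio (0 : ℝ)).indicator 1 p.1) *
            (u₁ p.1 p.2 * φ₁ p.1)| ≤ M * (C₀ / r) * E := by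
      rw [← integral_const_mul]
      rw [← Real.norm_eq_abs]
      refine norm_integral_le_of_norm_le (iE.const_mul _) ?_
      filter_upwards [ae_restrict_mem (measurableSet_strip H)] with p hp
      rw [norm_mul, mul_comm, norm_mul]
      exact mul_le_mul (mul_le_mul (hu.bdd₁ _ _ hp.2) (b1 _) (abs_nonneg _) hM0)
        (hD.abs_sub_step_le hs hp htI) (abs_nonneg _) (by positivity)
    have e5 : (4 * κ * C₀ * H + M * C₀ * E) / r
        = κ * (C₀ / r / r) * (2 * (2 * r) * H) + M * (C₀ / r) * E := by
      field_simp
      ring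
    rw [e5]
    refine (le_of_eq (congrArg _ heq)).trans ((abs_add_le _ _).trans (add_le_add n1 n2))
  have hz : Tendsto (fun n : ℕ => (4 * κ * C₀ * H + M * C₀ * E) / ((n : ℝ) + 1)) atTop (𝓝 0) :=
    tendsto_const_nhds.div_atTop (tendsto_atTop_add_const_right _ _ tendsto_natCast_atTop_atTop)
  have h0 := le_of_tendsto_of_tendsto' (l1.sub l2).abs hz herr
  exact sub_eq_zero.1 (abs_nonpos_iff.1 h0)

end BulkRate

/-! ### Exhaustion of the strip and selection of times -/

lemma strip_eq_iUnion_box (H : ℝ) :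
    strip H = ⋃ n : ℕ, Icc (-(n : ℝ)) n ×ˢ Icc (0 : ℝ) H := by
  ext p
  simp only [mem_prod, mem_univ, true_and, mem_iUnion, mem_Icc]
  constructor
  · intro h
    obtain ⟨n, hn⟩ := exists_nat_ge |p.1|
    exact ⟨n, abs_le.1 hn, h⟩
  · rintro ⟨n, -, h⟩
    exact h

lemma monotone_box (H : ℝ) :
    Monotone fun n : ℕ => Icc (-(n : ℝ)) n ×ˢ Icc (0 : ℝ) H := fun m n h => by
  have : (m : ℝ) ≤ n := by exact_mod_cast h
  exact prod_mono (Icc_subset_Icc (by linarith) this) le_rfl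

lemma integrableOn_strip_of_box_le {H : ℝ} {F : ℝ × ℝ → ℝ} (hF : ContinuousOn F (strip H))
    (h0 : ∀ p ∈ strip H, 0 ≤ F p) {B : ℝ}
    (hB : ∀ n : ℕ, ∫ p in Icc (-(n : ℝ)) n ×ˢ Icc (0 : ℝ) H, F p ≤ B) :
    IntegrableOn F (strip H) ∧ ∫ p in strip H, F p ≤ B := by
  have hae : 0 ≤ᵐ[volume.restrict (strip H)] F := by
    filter_upwards [ae_restrict_mem (measurableSet_strip H)] with p hp using h0 p hp
  have hm := aestronglyMeasurable_strip hF
  have hle : ∫⁻ p in strip H, ENNReal.ofReal (F p) ≤ ENNReal.ofReal B := by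
    rw [strip_eq_iUnion_box, setLIntegral_iUnion_of_directed _ (monotone_box H).directed_le]
    refine iSup_le fun n => ?_
    have hsub := box_subset_strip (n : ℝ) H
    rw [← ofReal_integral_eq_lintegral_ofReal
      ((hF.mono hsub).integrableOn_compact (isCompact_box _ _))
      (ae_restrict_of_ae_restrict_of_subset hsub hae)]
    exact ENNReal.ofReal_le_ofReal (hB n)
  have hB0 : 0 ≤ B := le_trans (setIntegral_nonneg (measurableSet_Icc.prod measurableSet_Icc)
    fun p hp => h0 p (box_subset_strip _ _ hp)) (hB 0)
  refine ⟨⟨hm, ?_⟩, ?_⟩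
  · rw [hasFiniteIntegral_iff_ofReal hae]
    exact hle.trans_lt ENNReal.ofReal_lt_top
  · rw [integral_eq_lintegral_of_nonneg_ae hae hm]
    exact ENNReal.toReal_le_of_le_ofReal hB0 hle

/-- Some time does at least as well as the average. The integral over the strip is not known to be
finite at any given time, so the average is taken of the supremum over boxes, in extended
nonnegative numbers; finiteness at the selected time comes out of the argument. -/
lemma exists_time_le {H : ℝ} {F : ℝ × ℝ → ℝ → ℝ}
    (hF : ContinuousOn (fun z : (ℝ × ℝ) × ℝ => F z.1 z.2) (strip H ×ˢ Ioi 0))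
    (h0 : ∀ p ∈ strip H, ∀ t > 0, 0 ≤ F p t) {a b B : ℝ} (ha : 0 < a) (hab : a < b)
    (hB : ∀ R, ∫ t in a..b, ∫ p in Icc (-R) R ×ˢ Icc (0 : ℝ) H, F p t ≤ B) :
    ∃ t ∈ Ioc a b, IntegrableOn (fun p => F p t) (strip H) ∧
      ∫ p in strip H, F p t ≤ B / (b - a) := by
  set g : ℕ → ℝ → ℝ := fun n t => ∫ p in Icc (-(n : ℝ)) n ×ˢ Icc (0 : ℝ) H, F p t with hg
  have hsub : Ioc a b ⊆ Ioi 0 := fun t ht => ha.trans ht.1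
  have hgc : ∀ n, ContinuousOn (g n) (Ioi 0) := fun n =>
    continuousOn_setIntegral_of_isCompact (isCompact_box _ _) isOpen_Ioi
      (hF.mono (prod_mono (box_subset_strip _ _) le_rfl))
  have hct : ∀ t > 0, ContinuousOn (fun p => F p t) (strip H) := fun t ht =>
    hF.comp (f := fun p : ℝ × ℝ => (p, t)) (by fun_prop) fun p hp => ⟨hp, ht⟩
  have hmb : ∀ n : ℕ, MeasurableSet (Icc (-(n : ℝ)) n ×ˢ Icc (0 : ℝ) H) := fun n =>
    measurableSet_Icc.prod measurableSet_Icc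
  have hgn : ∀ n, ∀ t > 0, 0 ≤ g n t := fun n t ht =>
    setIntegral_nonneg (hmb n) fun p hp => h0 p (box_subset_strip _ _ hp) t ht
  have hgm : ∀ n, AEMeasurable (fun t => ENNReal.ofReal (g n t)) (volume.restrict (Ioc a b)) :=
    fun n => (((hgc n).mono hsub).aemeasurable measurableSet_Ioc).ennreal_ofReal
  have hmono : ∀ t > 0, Monotone fun n => ENNReal.ofReal (g n t) := fun t ht m n hmn => by
    refine ENNReal.ofReal_le_ofReal (setIntegral_mono_set
      (((hct t ht).mono (box_subset_strip _ _)).integrableOn_compact (isCompact_box _ _)) ?_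
      (monotone_box H hmn).eventuallyLE)
    filter_upwards [ae_restrict_mem (hmb n)] with p hp
    exact h0 p (box_subset_strip _ _ hp) t ht
  have hsup : ∫⁻ t in Ioc a b, ⨆ n, ENNReal.ofReal (g n t) ≤ ENNReal.ofReal B := by
    rw [lintegral_iSup' hgm (by
      filter_upwards [ae_restrict_mem measurableSet_Ioc] with t ht using hmono t (hsub ht))]
    refine iSup_le fun n => ?_
    rw [← ofReal_integral_eq_lintegral_ofReal
      ((intervalIntegrable_iff_integrableOn_Ioc_of_le hab.le).1
        (intervalIntegrable_of_Ioi (hgc n) ha hab.le)) (by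
      filter_upwards [ae_restrict_mem measurableSet_Ioc] with t ht using hgn n t (hsub ht)),
      ← intervalIntegral.integral_of_le hab.le]
    exact ENNReal.ofReal_le_ofReal (hB n)
  have hvol : volume (Ioc a b) = ENNReal.ofReal (b - a) := Real.volume_Ioc
  have hba : 0 < b - a := sub_pos.2 hab
  obtain ⟨t, ht, hle⟩ := exists_le_setLAverage (μ := volume) (s := Ioc a b)
    (f := fun t => ⨆ n, ENNReal.ofReal (g n t))
    (by rw [hvol]; simpa using hab) (by rw [hvol]; exact ENNReal.ofReal_ne_top)
    (AEMeasurable.iSup hgm)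
  have hB0 : 0 ≤ B := by
    refine le_trans ?_ (hB 0)
    refine intervalIntegral.integral_nonneg hab.le fun t ht => ?_
    exact setIntegral_nonneg (measurableSet_Icc.prod measurableSet_Icc)
      fun p hp => h0 p (box_subset_strip _ _ hp) t (ha.trans_le ht.1)
  refine ⟨t, ht, integrableOn_strip_of_box_le (hct t (hsub ht))
    (fun p hp => h0 p hp t (hsub ht)) fun n => ?_⟩
  rw [setLAverage_eq, hvol] at hle
  have h2 : ENNReal.ofReal (g n t) ≤ ENNReal.ofReal (B / (b - a)) := by
    rw [ENNReal.ofReal_div_of_pos hba]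
    exact (le_iSup (fun n => ENNReal.ofReal (g n t)) n).trans
      (hle.trans (ENNReal.div_le_div_right hsup _))
  exact (ENNReal.ofReal_le_ofReal_iff (div_nonneg hB0 hba.le)).1 h2

/-- The energy density `a T (1 - T) + κ |∇T|²`. -/
def density (a κ : ℝ) (T Tx Ty : ℝ → ℝ → ℝ → ℝ) (p : ℝ × ℝ) (t : ℝ) : ℝ :=
  a * (T p.1 p.2 t * (1 - T p.1 p.2 t)) + κ * (Tx p.1 p.2 t ^ 2 + Ty p.1 p.2 t ^ 2)

/-! ### Dissipation bound and good times -/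

section GoodTimes

variable {H κ c M Mf : ℝ} {f : ℝ → ℝ} {u₁ u₂ w : ℝ → ℝ → ℝ}
  {T Tt Tx Ty Txx Tyy : ℝ → ℝ → ℝ → ℝ}

/-- The identity between bulk rate and reaction is available only at almost every time. The reaction
is continuous in time up to `t = 0`, which gives the integrability of the bulk rate. -/
lemma StripSol.bulk (hs : StripSol H κ c f u₁ u₂ T Tt Tx Ty Txx Tyy)
    (hu : StripFlow H M u₁ u₂ w) (hH : 0 < H) (hκ : 0 < κ) (hc : 0 < c) (hfc : Continuous f)
    (hMf : 0 < Mf) (hf : ∀ s ∈ Icc (0 : ℝ) 1, 0 ≤ f s ∧ f s ≤ Mf * (s * (1 - s)))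
    {τ A lam : ℝ} (hD : Decay H τ A lam T) (hτ : 0 < τ) :
    IntervalIntegrable (fun t => (∫ p in strip H, Tt p.1 p.2 t) / H) volume 0 τ ∧
    ∫ t in (0 : ℝ)..τ, (∫ p in strip H, Tt p.1 p.2 t) / H
      = c / H * ∫ t in (0 : ℝ)..τ, ∫ p in strip H, f (T p.1 p.2 t) := by
  have hcont := hD.continuousOn_integral_comp hs hfc hMf.le
    (fun s h => by rw [abs_of_nonneg (hf s h).1]; exact (hf s h).2)
  have hI : IntervalIntegrable (fun t => c / H * ∫ p in strip H, f (T p.1 p.2 t)) volume 0 τ :=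
    (ContinuousOn.intervalIntegrable (by rwa [uIcc_of_le hτ.le])).const_mul _
  have hae : ∀ᵐ t ∂(volume.restrict (uIoc 0 τ)), c / H * (∫ p in strip H, f (T p.1 p.2 t))
      = (∫ p in strip H, Tt p.1 p.2 t) / H := by
    rw [uIoc_of_le hτ.le]
    filter_upwards [hs.ae_integrable_time_deriv hu hH hκ hc hfc hMf hf hD hτ,
      ae_restrict_mem measurableSet_Ioc] with t h1 h2
    rw [hs.integral_time_deriv hu hH hκ hfc hMf hf hD h2.1 h2.2 h1]
    ring
  refine ⟨hI.congr_ae hae, ?_⟩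
  rw [← intervalIntegral.integral_const_mul]
  exact (intervalIntegral.integral_congr_ae_restrict hae).symm

/-- The test function `1/2 - T` has primitive `T (1 - T) / 2`, which decays at both ends of the
strip, and it makes the dissipation appear alone. The contribution at the initial time `a` has a
favourable sign and is dropped. The reaction contributes `c (T - 1/2) f(T) ≤ (c/2) Mf T (1 - T)`,
and the cutoff errors vanish in the limit. -/
lemma StripSol.energy_box (hs : StripSol H κ c f u₁ u₂ T Tt Tx Ty Txx Tyy)
    (hu : StripFlow H M u₁ u₂ w) (hH : 0 < H) (hκ : 0 < κ) (hc : 0 < c) (hfc : Continuous f)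
    (hf : ∀ s ∈ Icc (0 : ℝ) 1, 0 ≤ f s ∧ f s ≤ Mf * (s * (1 - s)))
    {τ A lam : ℝ} (hD : Decay H τ A lam T) {a b : ℝ} (ha : 0 < a) (hab : a ≤ b) (hb : b ≤ τ)
    (R : ℝ) :
    κ * (∫ t in a..b, ∫ p in Icc (-R) R ×ˢ Icc (0 : ℝ) H, (Tx p.1 p.2 t ^ 2 + Ty p.1 p.2 t ^ 2))
      ≤ (1 / 2) * (∫ p in strip H, T p.1 p.2 b * (1 - T p.1 p.2 b))
        + c / 2 * Mf * ∫ t in a..b, ∫ p in strip H, T p.1 p.2 t * (1 - T p.1 p.2 t) := by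
  obtain ⟨χ, χ₁, χ₂, C₀, hC₀, hχ, hχb, hχ1, -⟩ := exists_bump
  have hM0 : 0 ≤ M := (abs_nonneg _).trans (hu.bdd₁ 0 0 ⟨le_rfl, hH.le⟩)
  have hqc : Continuous fun s : ℝ => s * (1 - s) := by fun_prop
  have hqB : ∀ s ∈ Icc (0 : ℝ) 1, |s * (1 - s)| ≤ 1 * (s * (1 - s)) := fun s h => by
    rw [one_mul, abs_of_nonneg (mul_nonneg h.1 (sub_nonneg.2 h.2))]
  have hsubI : ∀ t ∈ Icc a b, t ∈ Icc 0 τ ∧ t ∈ Ioi (0 : ℝ) := fun t ht =>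
    ⟨⟨ha.le.trans ht.1, ht.2.trans hb⟩, ha.trans_le ht.1⟩
  set E := ∫ p in strip H, A * Real.exp (-lam * |p.1|)
  have hE0 : 0 ≤ E := integral_nonneg fun p =>
    mul_nonneg hD.A_pos.le (Real.exp_pos _).le
  have iE := (integrableOn_exp_strip H hD.lam_pos).const_mul A
  have hq0 : ∀ p ∈ strip H, ∀ t, 0 ≤ t → 0 ≤ T p.1 p.2 t * (1 - T p.1 p.2 t) := fun p hp t ht =>
    mul_nonneg (hs.range p.1 p.2 hp.2 t ht).1 (sub_nonneg.2 (hs.range p.1 p.2 hp.2 t ht).2)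
  have iq : ∀ t ∈ Icc 0 τ, IntegrableOn (fun p => T p.1 p.2 t * (1 - T p.1 p.2 t)) (strip H) :=
    fun t ht => hD.integrableOn_comp hs hqc zero_le_one hqB ht
  have hcq : ContinuousOn (fun t => ∫ p in strip H, T p.1 p.2 t * (1 - T p.1 p.2 t)) (Icc 0 τ) :=
    hD.continuousOn_integral_comp hs hqc zero_le_one hqB
  have herr : ∀ᶠ n : ℕ in atTop, κ * (∫ t in a..b, ∫ p in Icc (-R) R ×ˢ Icc (0 : ℝ) H,
      (Tx p.1 p.2 t ^ 2 + Ty p.1 p.2 t ^ 2))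
      ≤ ((1 / 2) * (∫ p in strip H, T p.1 p.2 b * (1 - T p.1 p.2 b))
        + c / 2 * Mf * ∫ t in a..b, ∫ p in strip H, T p.1 p.2 t * (1 - T p.1 p.2 t))
        + (b - a) * ((κ * C₀ + M * C₀) * E) / ((n : ℝ) + 1) := by
    obtain ⟨N, hN⟩ := exists_nat_gt R
    filter_upwards [eventually_ge_atTop N] with n hn
    have hn' : R ≤ (n : ℝ) + 1 := by
      have : (N : ℝ) ≤ n := by exact_mod_cast hn
      linarith
    set r : ℝ := (n : ℝ) + 1
    have hr : 0 < r := by positivity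
    have hr1 : 1 ≤ r := by
      have := Nat.cast_nonneg (α := ℝ) n
      linarith
    have hφ := hχ.scale hr 0
    rw [abs_zero, add_zero] at hφ
    set φ := fun x => χ ((x - 0) / r) with hφd
    set φ₁ := fun x => χ₁ ((x - 0) / r) / r with hφ₁d
    set φ₂ := fun x => χ₂ ((x - 0) / r) / r / r with hφ₂d
    have b0 : ∀ x, 0 ≤ φ x ∧ φ x ≤ 1 := fun x => ⟨(hχb _).1, (hχb _).2.1⟩
    have b1 : ∀ x, |φ₁ x| ≤ C₀ / r := fun x => by
      rw [hφ₁d, abs_div, abs_of_pos hr]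
      exact div_le_div_of_nonneg_right (hχb _).2.2.1 hr.le
    have b2 : ∀ x, |φ₂ x| ≤ C₀ / r := fun x => by
      rw [hφ₂d, abs_div, abs_div, abs_of_pos hr]
      exact (div_le_self (by positivity) hr1).trans
        (div_le_div_of_nonneg_right (hχb _).2.2.2 hr.le)
    have hen := hs.energy hu hH hfc (N := fun s => s * (1 - s) / 2) (η := fun s => 1 / 2 - s)
      (η' := fun _ => -1)
      (fun s => (((hasDerivAt_id s).mul ((hasDerivAt_id s).const_sub 1)).div_const 2).congr_deriv
        (by simp only [id]; ring))
      (fun s => (hasDerivAt_id s).const_sub _) continuous_const hφ ha hab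
    have cφ := continuousOn_fst_strip (H := H) hφ.cont
    have cφ₁ := continuousOn_fst_strip (H := H) hφ.cont₁
    have cφ₂ := continuousOn_fst_strip (H := H) hφ.cont₂
    have cG := continuousOn_strip (R := 2 * r)
      (F := fun p t => (Tx p.1 p.2 t ^ 2 + Ty p.1 p.2 t ^ 2) * φ p.1)
      (((hs.cont_x.pow 2).add (hs.cont_y.pow 2)).mul cφ) fun p t hp => by simp [hφ.zero _ hp]
    have cB := continuousOn_setIntegral_of_isCompact (isCompact_box R H) isOpen_Ioi
      (F := fun p t => Tx p.1 p.2 t ^ 2 + Ty p.1 p.2 t ^ 2)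
      (((hs.cont_x.pow 2).add (hs.cont_y.pow 2)).mono (prod_mono (box_subset_strip _ _) le_rfl))
    have cE := continuousOn_strip (R := 2 * r)
      (F := fun p t => T p.1 p.2 t * (1 - T p.1 p.2 t) / 2 * (κ * φ₂ p.1 + u₁ p.1 p.2 * φ₁ p.1)
          + c * ((1 / 2 - T p.1 p.2 t) * f (T p.1 p.2 t) * φ p.1))
      ((((hqc.comp_continuousOn' hs.cont).div_const 2).mul ((continuousOn_const.mul cφ₂).add
        (hu.cont₁'.mul cφ₁))).add (continuousOn_const.mul (((continuousOn_const.sub hs.cont).mul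
          (hfc.comp_continuousOn' hs.cont)).mul cφ))) fun p t hp => by simp [hφ.zero _ hp]
    -- the box integral is controlled by the cut-off integral
    have s1 : ∫ t in a..b, ∫ p in Icc (-R) R ×ˢ Icc (0 : ℝ) H,
        (Tx p.1 p.2 t ^ 2 + Ty p.1 p.2 t ^ 2)
        ≤ ∫ t in a..b, ∫ p in strip H, (Tx p.1 p.2 t ^ 2 + Ty p.1 p.2 t ^ 2) * φ p.1 := by
      refine intervalIntegral.integral_mono_on hab (intervalIntegrable_of_Ioi cB ha hab)
        (intervalIntegrable_of_Ioi cG ha hab) fun t ht => ?_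
      have htp := (hsubI t ht).2
      have hc2 : ContinuousOn (fun p : ℝ × ℝ => (Tx p.1 p.2 t ^ 2 + Ty p.1 p.2 t ^ 2) * φ p.1)
          (strip H) := (((slice_continuousOn hs.cont_x htp).pow 2).add
        ((slice_continuousOn hs.cont_y htp).pow 2)).mul (by have := hφ.cont; fun_prop)
      have hmb : MeasurableSet (Icc (-R) R ×ˢ Icc (0 : ℝ) H) :=
        measurableSet_Icc.prod measurableSet_Icc
      have e : ∫ p in Icc (-R) R ×ˢ Icc (0 : ℝ) H, (Tx p.1 p.2 t ^ 2 + Ty p.1 p.2 t ^ 2)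
          = ∫ p in Icc (-R) R ×ˢ Icc (0 : ℝ) H,
            (Tx p.1 p.2 t ^ 2 + Ty p.1 p.2 t ^ 2) * φ p.1 := by
        refine setIntegral_congr_fun hmb fun p hp => ?_
        have h1 : φ p.1 = 1 := hχ1 _ (by
          rw [sub_zero, abs_div, abs_of_pos hr, div_le_one hr]
          exact (abs_le.2 hp.1).trans hn')
        simp only [h1, mul_one]
      rw [e]
      refine setIntegral_mono_set (integrableOn_strip_of_continuousOn (R := 2 * r) hc2
        fun p hp => by simp [hφ.zero _ hp]) (Eventually.of_forall fun p => ?_)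
        (box_subset_strip _ _).eventuallyLE
      exact mul_nonneg (by positivity) (b0 _).1
    have s2 : -∫ t in a..b, ∫ p in strip H,
        (T p.1 p.2 t * (1 - T p.1 p.2 t) / 2 * (κ * φ₂ p.1 + u₁ p.1 p.2 * φ₁ p.1)
          + c * ((1 / 2 - T p.1 p.2 t) * f (T p.1 p.2 t) * φ p.1))
        ≤ c / 2 * Mf * (∫ t in a..b, ∫ p in strip H, T p.1 p.2 t * (1 - T p.1 p.2 t))
          + (b - a) * ((κ * C₀ + M * C₀) * E) / r := by
      have iQ : IntervalIntegrable (fun t => ∫ p in strip H, T p.1 p.2 t * (1 - T p.1 p.2 t))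
          volume a b := ContinuousOn.intervalIntegrable (by
        rw [uIcc_of_le hab]; exact hcq.mono fun t ht => (hsubI t ht).1)
      have e : c / 2 * Mf * (∫ t in a..b, ∫ p in strip H, T p.1 p.2 t * (1 - T p.1 p.2 t))
          + (b - a) * ((κ * C₀ + M * C₀) * E) / r
          = ∫ t in a..b, (c / 2 * Mf * (∫ p in strip H, T p.1 p.2 t * (1 - T p.1 p.2 t))
            + (κ * C₀ + M * C₀) * E / r) := by
        rw [intervalIntegral.integral_add (iQ.const_mul _) intervalIntegrable_const,
          intervalIntegral.integral_const, intervalIntegral.integral_const_mul, smul_eq_mul]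
        ring
      rw [e, ← intervalIntegral.integral_neg]
      refine intervalIntegral.integral_mono_on hab (intervalIntegrable_of_Ioi cE ha hab).neg
        ((iQ.const_mul _).add intervalIntegrable_const) fun t ht => ?_
      obtain ⟨htI, htp⟩ := hsubI t ht
      have hEr : (κ * C₀ + M * C₀) * E / r = ∫ p in strip H,
          (κ * C₀ + M * C₀) / r * (A * Real.exp (-lam * |p.1|)) := by
        rw [integral_const_mul]; ring
      rw [hEr, ← integral_const_mul, ← integral_neg,
        ← integral_add ((iq t htI).const_mul _) (iE.const_mul _)]
      have hce : IntegrableOn (fun p : ℝ × ℝ =>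
          T p.1 p.2 t * (1 - T p.1 p.2 t) / 2 * (κ * φ₂ p.1 + u₁ p.1 p.2 * φ₁ p.1)
          + c * ((1 / 2 - T p.1 p.2 t) * f (T p.1 p.2 t) * φ p.1)) (strip H) := by
        have cT := slice_continuousOn hs.cont htp
        have p0 : ContinuousOn (fun p : ℝ × ℝ => φ p.1) (strip H) := by
          have := hφ.cont; fun_prop
        have p1 : ContinuousOn (fun p : ℝ × ℝ => φ₁ p.1) (strip H) := by
          have := hφ.cont₁; fun_prop
        have p2 : ContinuousOn (fun p : ℝ × ℝ => φ₂ p.1) (strip H) := by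
          have := hφ.cont₂; fun_prop
        exact integrableOn_strip_of_continuousOn (R := 2 * r)
          ((((hqc.comp_continuousOn' cT).div_const 2).mul ((continuousOn_const.mul p2).add
          (hu.cont₁.mul p1))).add (continuousOn_const.mul (((continuousOn_const.sub cT).mul
          (hfc.comp_continuousOn' cT)).mul p0))) fun p hp => by simp [hφ.zero _ hp]
      refine setIntegral_mono_on hce.neg (((iq t htI).const_mul _).add (iE.const_mul _))
        (measurableSet_strip H) fun p hp => ?_
      have hT := hs.range p.1 p.2 hp.2 t htI.1
      obtain ⟨f0, f1⟩ := hf _ hT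
      have hqe := hD.mul_le_exp hs hp htI
      have hqn := hq0 p hp t htI.1
      set q := T p.1 p.2 t * (1 - T p.1 p.2 t)
      have a1 : -(q / 2 * (κ * φ₂ p.1 + u₁ p.1 p.2 * φ₁ p.1))
          ≤ (κ * C₀ + M * C₀) / r * (A * Real.exp (-lam * |p.1|)) := by
        have h1 : |κ * φ₂ p.1 + u₁ p.1 p.2 * φ₁ p.1| ≤ (κ * C₀ + M * C₀) / r := by
          refine (abs_add_le _ _).trans ?_
          rw [abs_mul, abs_mul, abs_of_pos hκ, add_div, mul_div_assoc, mul_div_assoc]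
          exact add_le_add (mul_le_mul_of_nonneg_left (b2 _) hκ.le)
            (mul_le_mul (hu.bdd₁ p.1 p.2 hp.2) (b1 _) (abs_nonneg _) hM0)
        calc -(q / 2 * (κ * φ₂ p.1 + u₁ p.1 p.2 * φ₁ p.1))
            ≤ |q / 2 * (κ * φ₂ p.1 + u₁ p.1 p.2 * φ₁ p.1)| := neg_le_abs _
          _ = q / 2 * |κ * φ₂ p.1 + u₁ p.1 p.2 * φ₁ p.1| := by
              rw [abs_mul, abs_of_nonneg (by positivity)]
          _ ≤ (A * Real.exp (-lam * |p.1|)) * ((κ * C₀ + M * C₀) / r) :=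
              mul_le_mul (by linarith) h1 (abs_nonneg _) (by linarith)
          _ = _ := mul_comm _ _
      have a2 : -(c * ((1 / 2 - T p.1 p.2 t) * f (T p.1 p.2 t) * φ p.1)) ≤ c / 2 * Mf * q := by
        have h1 : f (T p.1 p.2 t) * φ p.1 ≤ Mf * q :=
          (mul_le_of_le_one_right f0 (b0 _).2).trans f1
        have h2 : 0 ≤ f (T p.1 p.2 t) * φ p.1 := mul_nonneg f0 (b0 _).1
        have h3 : (T p.1 p.2 t - 1 / 2) * (f (T p.1 p.2 t) * φ p.1)
            ≤ 1 / 2 * (f (T p.1 p.2 t) * φ p.1) :=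
          mul_le_mul_of_nonneg_right (by linarith [hT.2]) h2
        calc _ = c * ((T p.1 p.2 t - 1 / 2) * (f (T p.1 p.2 t) * φ p.1)) := by ring
          _ ≤ c * (1 / 2 * (Mf * q)) := mul_le_mul_of_nonneg_left (by linarith) hc.le
          _ = _ := by ring
      simp only [neg_add]
      linarith
    have s3 : ∫ p in strip H, T p.1 p.2 b * (1 - T p.1 p.2 b) / 2 * φ p.1
        ≤ 1 / 2 * ∫ p in strip H, T p.1 p.2 b * (1 - T p.1 p.2 b) := by
      have hbI := (hsubI b ⟨hab, le_rfl⟩).1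
      have cT := slice_continuousOn hs.cont (hsubI b ⟨hab, le_rfl⟩).2
      have p0 : ContinuousOn (fun p : ℝ × ℝ => φ p.1) (strip H) := by
        have := hφ.cont; fun_prop
      rw [← integral_const_mul]
      refine setIntegral_mono_on (integrableOn_strip_of_continuousOn (R := 2 * r)
        (((hqc.comp_continuousOn' cT).div_const 2).mul p0) fun p hp => by simp [hφ.zero _ hp])
        ((iq b hbI).const_mul _) (measurableSet_strip H) fun p hp => ?_
      have := hq0 p hp b hbI.1
      calc _ ≤ T p.1 p.2 b * (1 - T p.1 p.2 b) / 2 :=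
            mul_le_of_le_one_right (by positivity) (b0 _).2
        _ = _ := by ring
    have s4 : 0 ≤ ∫ p in strip H, T p.1 p.2 a * (1 - T p.1 p.2 a) / 2 * φ p.1 :=
      setIntegral_nonneg (measurableSet_strip H) fun p hp =>
        mul_nonneg (div_nonneg (hq0 p hp a ha.le) zero_le_two) (b0 _).1
    have s5 : ∫ t in a..b, ∫ p in strip H, -1 * (Tx p.1 p.2 t ^ 2 + Ty p.1 p.2 t ^ 2) * φ p.1
        = -∫ t in a..b, ∫ p in strip H, (Tx p.1 p.2 t ^ 2 + Ty p.1 p.2 t ^ 2) * φ p.1 := by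
      rw [← intervalIntegral.integral_neg]
      simp only [← integral_neg, neg_mul, one_mul]
    rw [s5] at hen
    have s6 := mul_le_mul_of_nonneg_left s1 hκ.le
    linarith
  have hz : Tendsto (fun n : ℕ => ((1 / 2) * (∫ p in strip H, T p.1 p.2 b * (1 - T p.1 p.2 b))
        + c / 2 * Mf * ∫ t in a..b, ∫ p in strip H, T p.1 p.2 t * (1 - T p.1 p.2 t))
        + (b - a) * ((κ * C₀ + M * C₀) * E) / ((n : ℝ) + 1)) atTop (𝓝 (((1 / 2) *
        (∫ p in strip H, T p.1 p.2 b * (1 - T p.1 p.2 b))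
        + c / 2 * Mf * ∫ t in a..b, ∫ p in strip H, T p.1 p.2 t * (1 - T p.1 p.2 t)) + 0)) :=
    tendsto_const_nhds.add (tendsto_const_nhds.div_atTop
      (tendsto_atTop_add_const_right _ _ tendsto_natCast_atTop_atTop))
  rw [add_zero] at hz
  exact ge_of_tendsto hz herr

lemma StripSol.continuousOn_density (hs : StripSol H κ c f u₁ u₂ T Tt Tx Ty Txx Tyy) (a : ℝ) :
    ContinuousOn (fun z : (ℝ × ℝ) × ℝ => density a κ T Tx Ty z.1 z.2) (strip H ×ˢ Ioi 0) :=
  (continuousOn_const.mul (hs.cont.mul (continuousOn_const.sub hs.cont))).add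
    (continuousOn_const.mul ((hs.cont_x.pow 2).add (hs.cont_y.pow 2)))

lemma StripSol.density_nonneg (hs : StripSol H κ c f u₁ u₂ T Tt Tx Ty Txx Tyy) (hκ : 0 < κ)
    {a : ℝ} (ha : 0 ≤ a) {p : ℝ × ℝ} (hp : p ∈ strip H) {t : ℝ} (ht : 0 < t) :
    0 ≤ density a κ T Tx Ty p t := by
  have hT := hs.range p.1 p.2 hp.2 t ht.le
  exact add_nonneg (mul_nonneg ha (mul_nonneg hT.1 (sub_nonneg.2 hT.2))) (by positivity)

/-- The dissipation bound carries a term `∫ q` at the final time, so that time is first chosen in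
the last quarter of `[0, τ]` with `∫ q` below average. The energy integral up to it is then at most
`B`, and averaging over two disjoint earlier windows provides `t₀` and `t₁`. -/
lemma StripSol.exists_good_times (hs : StripSol H κ c f u₁ u₂ T Tt Tx Ty Txx Tyy)
    (hu : StripFlow H M u₁ u₂ w) (hH : 0 < H) (hκ : 0 < κ) (hc : 0 < c) (hfc : Continuous f)
    (hMf : 0 < Mf) (hf : ∀ s ∈ Icc (0 : ℝ) 1, 0 ≤ f s ∧ f s ≤ Mf * (s * (1 - s)))
    {τ A lam : ℝ} (hD : Decay H τ A lam T) (hτ : 0 < τ) (hcτ : 1 ≤ 4 * c * τ) {B : ℝ}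
    (hB : B = (3 + Mf / 8) *
      (4 * c * ∫ t in (0 : ℝ)..τ, ∫ p in strip H, T p.1 p.2 t * (1 - T p.1 p.2 t))) :
    ∃ t₀ t₁, 0 < t₀ ∧ τ / 4 ≤ t₁ - t₀ ∧ t₁ ≤ τ ∧
      (∀ R, ∫ t in t₀..t₁, ∫ p in Icc (-R) R ×ˢ Icc (0 : ℝ) H, density (4 * c) κ T Tx Ty p t ≤ B) ∧
      ∀ t, t = t₀ ∨ t = t₁ → IntegrableOn (fun p => density (4 * c) κ T Tx Ty p t) (strip H) ∧
        ∫ p in strip H, density (4 * c) κ T Tx Ty p t ≤ 8 * B / τ := by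
  have hqc : Continuous fun s : ℝ => s * (1 - s) := by fun_prop
  have hqB : ∀ s ∈ Icc (0 : ℝ) 1, |s * (1 - s)| ≤ 1 * (s * (1 - s)) := fun s h => by
    rw [one_mul, abs_of_nonneg (mul_nonneg h.1 (sub_nonneg.2 h.2))]
  have hq0 : ∀ p ∈ strip H, ∀ t, 0 ≤ t → 0 ≤ T p.1 p.2 t * (1 - T p.1 p.2 t) := fun p hp t ht =>
    mul_nonneg (hs.range p.1 p.2 hp.2 t ht).1 (sub_nonneg.2 (hs.range p.1 p.2 hp.2 t ht).2)
  have iq : ∀ t ∈ Icc 0 τ, IntegrableOn (fun p => T p.1 p.2 t * (1 - T p.1 p.2 t)) (strip H) :=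
    fun t ht => hD.integrableOn_comp hs hqc zero_le_one hqB ht
  have hcq : ContinuousOn (fun t => ∫ p in strip H, T p.1 p.2 t * (1 - T p.1 p.2 t)) (Icc 0 τ) :=
    hD.continuousOn_integral_comp hs hqc zero_le_one hqB
  set Q : ℝ → ℝ := fun t => ∫ p in strip H, T p.1 p.2 t * (1 - T p.1 p.2 t) with hQ
  set Λ := ∫ t in (0 : ℝ)..τ, Q t with hΛ
  have hQ0 : ∀ t, 0 ≤ t → 0 ≤ Q t := fun t ht =>
    setIntegral_nonneg (measurableSet_strip H) fun p hp => hq0 p hp t ht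
  have iQ : ∀ a b, 0 ≤ a → a ≤ b → b ≤ τ → IntervalIntegrable Q volume a b := fun a b h1 h2 h3 =>
    ContinuousOn.intervalIntegrable (by
      rw [uIcc_of_le h2]; exact hcq.mono (Icc_subset_Icc h1 h3))
  have hQΛ : ∀ a b, 0 ≤ a → a ≤ b → b ≤ τ → ∫ t in a..b, Q t ≤ Λ := fun a b h1 h2 h3 =>
    intervalIntegral.integral_mono_interval h1 h2 h3 (by
      filter_upwards [ae_restrict_mem measurableSet_Ioc] with t ht using hQ0 t ht.1.le)
      (iQ 0 τ le_rfl hτ.le le_rfl)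
  have hΛ0 : 0 ≤ Λ := intervalIntegral.integral_nonneg hτ.le fun t ht => hQ0 t ht.1
  -- a time with little reaction
  obtain ⟨t₂, ht₂, hmin⟩ := (isCompact_Icc (a := 3 * τ / 4) (b := τ)).exists_isMinOn
    (nonempty_Icc.2 (by linarith)) (hcq.mono (Icc_subset_Icc (by positivity) le_rfl))
  -- The minimum is at most the mean over a window of length `τ/4`, that is `4 Λ / τ`, and `1 ≤ 4 c
  -- τ` replaces `1/τ` by `4 c`.
  have hQ2 : Q t₂ ≤ 4 * (4 * c * Λ) := by
    have h1 : τ / 4 * Q t₂ ≤ Λ := by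
      refine le_trans ?_ (hQΛ (3 * τ / 4) τ (by positivity) (by linarith) le_rfl)
      have h2 := intervalIntegral.integral_mono_on (a := 3 * τ / 4) (b := τ) (by linarith)
        intervalIntegrable_const (iQ (3 * τ / 4) τ (by positivity) (by linarith) le_rfl)
        (fun t ht => isMinOn_iff.1 hmin t ht)
      rw [intervalIntegral.integral_const, smul_eq_mul] at h2
      exact (by ring : τ / 4 * Q t₂ = (τ - 3 * τ / 4) * Q t₂) ▸ h2
    have h3 : 1 * Q t₂ ≤ 4 * c * τ * Q t₂ :=
      mul_le_mul_of_nonneg_right hcτ (hQ0 _ (by linarith [ht₂.1]))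
    have h4 := mul_le_mul_of_nonneg_left h1 (show 0 ≤ 16 * c by positivity)
    linarith
  have cD := hs.continuousOn_density (4 * c)
  have cDR : ∀ R, ContinuousOn (fun t => ∫ p in Icc (-R) R ×ˢ Icc (0 : ℝ) H,
      density (4 * c) κ T Tx Ty p t) (Ioi 0) := fun R =>
    continuousOn_setIntegral_of_isCompact (isCompact_box _ _) isOpen_Ioi
      (cD.mono (prod_mono (box_subset_strip _ _) le_rfl))
  have hmb : ∀ R : ℝ, MeasurableSet (Icc (-R) R ×ˢ Icc (0 : ℝ) H) := fun R =>
    measurableSet_Icc.prod measurableSet_Icc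
  have hc4 : 0 ≤ 4 * c := by positivity
  have key : ∀ a b, 0 < a → a ≤ b → b ≤ t₂ → ∀ R, ∫ t in a..b,
      ∫ p in Icc (-R) R ×ˢ Icc (0 : ℝ) H, density (4 * c) κ T Tx Ty p t ≤ B := by
    intro a b h1 h2 h3 R
    have ha2 := h2.trans h3
    refine (intervalIntegral.integral_mono_interval le_rfl h2 h3 ?_
      (intervalIntegrable_of_Ioi (cDR R) h1 ha2)).trans ?_
    · filter_upwards [ae_restrict_mem measurableSet_Ioc] with t ht
      exact setIntegral_nonneg (hmb R) fun p hp =>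
        hs.density_nonneg hκ hc4 (box_subset_strip _ _ hp) (h1.trans ht.1)
    have cq := hs.cont.mul ((continuousOn_const (c := (1 : ℝ))).sub hs.cont)
    have cg := (hs.cont_x.pow 2).add (hs.cont_y.pow 2)
    have c1 : ContinuousOn (fun t => ∫ p in Icc (-R) R ×ˢ Icc (0 : ℝ) H,
        T p.1 p.2 t * (1 - T p.1 p.2 t)) (Ioi 0) :=
      continuousOn_setIntegral_of_isCompact (isCompact_box _ _) isOpen_Ioi
        (cq.mono (prod_mono (box_subset_strip _ _) le_rfl))
    have c2 : ContinuousOn (fun t => ∫ p in Icc (-R) R ×ˢ Icc (0 : ℝ) H,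
        (Tx p.1 p.2 t ^ 2 + Ty p.1 p.2 t ^ 2)) (Ioi 0) :=
      continuousOn_setIntegral_of_isCompact (isCompact_box _ _) isOpen_Ioi
        (cg.mono (prod_mono (box_subset_strip _ _) le_rfl))
    have e1 : ∫ t in a..t₂, ∫ p in Icc (-R) R ×ˢ Icc (0 : ℝ) H, density (4 * c) κ T Tx Ty p t
        = 4 * c * (∫ t in a..t₂, ∫ p in Icc (-R) R ×ˢ Icc (0 : ℝ) H,
            T p.1 p.2 t * (1 - T p.1 p.2 t))
          + κ * ∫ t in a..t₂, ∫ p in Icc (-R) R ×ˢ Icc (0 : ℝ) H,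
            (Tx p.1 p.2 t ^ 2 + Ty p.1 p.2 t ^ 2) := by
      rw [← intervalIntegral.integral_const_mul, ← intervalIntegral.integral_const_mul,
        ← intervalIntegral.integral_add ((intervalIntegrable_of_Ioi c1 h1 ha2).const_mul _)
          ((intervalIntegrable_of_Ioi c2 h1 ha2).const_mul _)]
      refine intervalIntegral.integral_congr fun t ht => ?_
      rw [uIcc_of_le ha2] at ht
      have htp : t ∈ Ioi (0 : ℝ) := h1.trans_le ht.1
      have k1 : ContinuousOn (fun p : ℝ × ℝ => T p.1 p.2 t * (1 - T p.1 p.2 t)) (strip H) :=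
        hqc.comp_continuousOn' (slice_continuousOn hs.cont htp)
      have k2 : ContinuousOn (fun p : ℝ × ℝ => Tx p.1 p.2 t ^ 2 + Ty p.1 p.2 t ^ 2) (strip H) :=
        ((slice_continuousOn hs.cont_x htp).pow 2).add ((slice_continuousOn hs.cont_y htp).pow 2)
      have j1 := (k1.mono (box_subset_strip R H)).integrableOn_compact (μ := volume)
        (isCompact_box R H)
      have j2 := (k2.mono (box_subset_strip R H)).integrableOn_compact (μ := volume)
        (isCompact_box R H)
      change ∫ p in Icc (-R) R ×ˢ Icc (0 : ℝ) H, (4 * c * (T p.1 p.2 t * (1 - T p.1 p.2 t))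
        + κ * (Tx p.1 p.2 t ^ 2 + Ty p.1 p.2 t ^ 2)) = _
      rw [integral_add (j1.const_mul _) (j2.const_mul _), integral_const_mul, integral_const_mul]
    have e2 := hs.energy_box hu hH hκ hc hfc hf hD h1 ha2 ht₂.2 R
    have e3 : ∫ t in a..t₂, ∫ p in Icc (-R) R ×ˢ Icc (0 : ℝ) H,
        T p.1 p.2 t * (1 - T p.1 p.2 t) ≤ Λ := by
      refine le_trans ?_ (hQΛ a t₂ h1.le ha2 ht₂.2)
      refine intervalIntegral.integral_mono_on ha2 (intervalIntegrable_of_Ioi c1 h1 ha2)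
        (iQ _ _ h1.le ha2 ht₂.2) fun t ht => ?_
      refine setIntegral_mono_set (iq t ⟨h1.le.trans ht.1, ht.2.trans ht₂.2⟩) ?_
        (box_subset_strip _ _).eventuallyLE
      filter_upwards [ae_restrict_mem (measurableSet_strip H)] with p hp
      exact hq0 p hp t (h1.le.trans ht.1)
    have e4 := hQΛ a t₂ h1.le ha2 ht₂.2
    have e5 := mul_le_mul_of_nonneg_left e3 hc4
    have e6 := mul_le_mul_of_nonneg_left e4 (show 0 ≤ c / 2 * Mf by positivity)
    -- In units of `4 c Λ`: the reaction part gives 1, half of `Q t₂` gives 2, and the reaction term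
    -- of the dissipation bound gives `Mf / 8`.
    rw [e1, hB]
    change κ * _ ≤ 1 / 2 * Q t₂ + c / 2 * Mf * ∫ t in a..t₂, Q t at e2
    linarith
  have hnn : ∀ p ∈ strip H, ∀ t > 0, 0 ≤ density (4 * c) κ T Tx Ty p t := fun p hp t ht =>
    hs.density_nonneg hκ hc4 hp ht
  have hB0 : 0 ≤ B := by rw [hB]; positivity
  -- Windows `(τ/8, τ/4]` and `(τ/2, 3τ/4]`: both end before `t₂`, they are at distance `τ/4`, and
  -- the shorter one has length `τ/8`, whence the bound `8 B / τ`.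
  obtain ⟨t₀, h0, i0, l0⟩ := exists_time_le cD hnn (a := τ / 8) (b := τ / 4) (by positivity)
    (by linarith) (key _ _ (by positivity) (by linarith) (by linarith [ht₂.1]))
  obtain ⟨t₁, h1, i1, l1⟩ := exists_time_le cD hnn (a := τ / 2) (b := 3 * τ / 4) (by positivity)
    (by linarith) (key _ _ (by positivity) (by linarith) (by linarith [ht₂.1]))
  refine ⟨t₀, t₁, by linarith [h0.1], by linarith [h0.2, h1.1], by linarith [h1.2],
    key _ _ (by linarith [h0.1]) (by linarith [h0.2, h1.1]) (by linarith [h1.2, ht₂.1]), ?_⟩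
  rintro t (rfl | rfl)
  · refine ⟨i0, l0.trans (le_of_eq ?_)⟩
    field_simp
    ring
  · refine ⟨i1, l1.trans ?_⟩
    rw [show 3 * τ / 4 - τ / 2 = τ / 4 by ring, div_le_div_iff₀ (by positivity) hτ]
    nlinarith

end GoodTimes

/-! ### An L¹ Poincaré inequality on rectangles -/

lemma abs_sub_le_integral_abs_deriv {g g' : ℝ → ℝ} {a b : ℝ}
    (hg : ∀ s ∈ Icc a b, HasDerivWithinAt g (g' s) (Icc a b) s)
    (hc : ContinuousOn g' (Icc a b)) {s s' : ℝ} (hs : s ∈ Icc a b) (hs' : s' ∈ Icc a b) :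
    |g s - g s'| ≤ ∫ r in Icc a b, |g' r| := by
  wlog h : s' ≤ s generalizing s s'
  · rw [abs_sub_comm]; exact this hs' hs (le_of_not_ge h)
  have hsub : Icc s' s ⊆ Icc a b := Icc_subset_Icc hs'.1 hs.2
  have e := intervalIntegral.integral_eq_sub_of_hasDerivAt_of_le h
    (fun r hr => ((hg r (hsub hr)).continuousWithinAt.mono hsub))
    (fun r hr => (hg r (hsub (Ioo_subset_Icc_self hr))).hasDerivAt
      (Icc_mem_nhds (hs'.1.trans_lt hr.1) (hr.2.trans_le hs.2)))
    (ContinuousOn.intervalIntegrable (by rw [uIcc_of_le h]; exact hc.mono hsub))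
  rw [← e]
  refine (intervalIntegral.abs_integral_le_integral_abs h).trans ?_
  rw [intervalIntegral.integral_of_le h]
  exact setIntegral_mono_set (hc.abs.integrableOn_compact isCompact_Icc)
    (Eventually.of_forall fun r => abs_nonneg _) (Ioc_subset_Icc_self.trans hsub).eventuallyLE

/-- Join `(x, y)` to `(x', y)` horizontally and then to `(x', 0)` along one fixed vertical line.
Integrating the two increments over the rectangle gives the bound with explicit constants, as long
as the vertical line is a good one. -/
lemma poincare_box {H a b : ℝ} (hH : 0 < H) (hab : a < b) {Ψ Ψx Ψy : ℝ → ℝ → ℝ}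
    (cΨ : ContinuousOn (fun p : ℝ × ℝ => Ψ p.1 p.2) (strip H))
    (cx : ContinuousOn (fun p : ℝ × ℝ => Ψx p.1 p.2) (strip H))
    (cy : ContinuousOn (fun p : ℝ × ℝ => Ψy p.1 p.2) (strip H))
    (hx : ∀ x, ∀ y ∈ Icc 0 H, HasDerivAt (fun s => Ψ s y) (Ψx x y) x)
    (hy : ∀ x, ∀ y ∈ Icc 0 H, HasDerivWithinAt (fun s => Ψ x s) (Ψy x y) (Icc 0 H) y) :
    ∃ k, ∫ p in Icc a b ×ˢ Icc 0 H, |Ψ p.1 p.2 - k| ≤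
      ∫ p in Icc a b ×ˢ Icc 0 H, ((b - a) * |Ψx p.1 p.2| + H * |Ψy p.1 p.2|) := by
  have hK : IsCompact (Icc a b ×ˢ Icc 0 H) := isCompact_Icc.prod isCompact_Icc
  have hsub : Icc a b ×ˢ Icc 0 H ⊆ strip H := prod_mono (subset_univ _) le_rfl
  have hba : 0 < b - a := sub_pos.2 hab
  set X : ℝ → ℝ := fun y => ∫ s in Icc a b, |Ψx s y| with hX
  set Y : ℝ → ℝ := fun x => ∫ s in Icc 0 H, |Ψy x s| with hY
  have ix := (cx.mono hsub).abs.integrableOn_compact (μ := volume) hK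
  have iy := (cy.mono hsub).abs.integrableOn_compact (μ := volume) hK
  -- Continuity of `Ψy` is known only for `y` in `[0, H]`; clamping `y` to this interval extends it
  -- to the plane without changing the integral.
  have cY : Continuous Y := by
    have h1 : Continuous fun z : ℝ × ℝ => |Ψy z.1 (max 0 (min z.2 H))| :=
      (cy.comp_continuous (f := fun z : ℝ × ℝ => (z.1, max 0 (min z.2 H))) (by fun_prop)
        fun z => ⟨mem_univ _, le_max_left _ _, max_le hH.le (min_le_right _ _)⟩).abs
    have h2 := continuous_parametric_integral_of_continuous (μ := volume)
      (f := fun x s => |Ψy x (max 0 (min s H))|) h1 (isCompact_Icc (a := (0 : ℝ)) (b := H))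
    refine h2.congr fun x => setIntegral_congr_fun measurableSet_Icc fun s hs => ?_
    simp only [min_eq_left hs.2, max_eq_right hs.1]
  -- The vertical line is the one along which the integral of `|Ψy|` is least, hence at most its
  -- average over `x`.
  obtain ⟨x', hx', hmin⟩ := (isCompact_Icc (a := a) (b := b)).exists_isMinOn
    (nonempty_Icc.2 hab.le) cY.continuousOn
  have h0 : (0 : ℝ) ∈ Icc 0 H := ⟨le_rfl, hH.le⟩
  have hpt : ∀ p ∈ Icc a b ×ˢ Icc 0 H, |Ψ p.1 p.2 - Ψ x' 0| ≤ X p.2 + Y x' := by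
    rintro ⟨x, y⟩ ⟨hpx, hpy⟩
    have e1 := abs_sub_le_integral_abs_deriv (a := a) (b := b) (g := fun s => Ψ s y)
      (g' := fun s => Ψx s y) (fun s _ => (hx s y hpy).hasDerivWithinAt)
      (cx.comp (f := fun s : ℝ => (s, y)) (by fun_prop) fun s _ => ⟨mem_univ _, hpy⟩) hpx hx'
    have e2 := abs_sub_le_integral_abs_deriv (a := 0) (b := H) (g := fun s => Ψ x' s)
      (g' := fun s => Ψy x' s) (fun s hs => hy x' s hs)
      (cy.comp (f := fun s : ℝ => (x', s)) (by fun_prop) fun s hs => ⟨mem_univ _, hs⟩) hpy h0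
    calc |Ψ x y - Ψ x' 0| ≤ |Ψ x y - Ψ x' y| + |Ψ x' y - Ψ x' 0| := abs_sub_le _ _ _
      _ ≤ _ := add_le_add e1 e2
  have hprod : (volume : Measure (ℝ × ℝ)).restrict (Icc a b ×ˢ Icc 0 H)
      = (volume.restrict (Icc a b)).prod (volume.restrict (Icc 0 H)) :=
    (Measure.prod_restrict _ _).symm
  have ix' := ix
  have iy' := iy
  rw [IntegrableOn, hprod] at ix' iy'
  have eX : ∫ p in Icc a b ×ˢ Icc 0 H, |Ψx p.1 p.2| = ∫ y in Icc 0 H, X y := by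
    rw [hprod, integral_prod_symm _ ix']
  have eY : ∫ p in Icc a b ×ˢ Icc 0 H, |Ψy p.1 p.2| = ∫ x in Icc a b, Y x := by
    rw [hprod, integral_prod _ iy']
  have iX : IntegrableOn X (Icc 0 H) := ix'.integral_prod_right
  have hYmin : (b - a) * Y x' ≤ ∫ x in Icc a b, Y x := by
    have h1 := setIntegral_mono_on (integrableOn_const (C := Y x') (s := Icc a b) (μ := volume)
      (by simp)) (cY.continuousOn.integrableOn_compact isCompact_Icc) measurableSet_Icc
      (fun t ht => isMinOn_iff.1 hmin t ht)
    rw [setIntegral_const, smul_eq_mul] at h1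
    simpa [Measure.real, Real.volume_Icc, ENNReal.toReal_ofReal hba.le] using h1
  refine ⟨Ψ x' 0, ?_⟩
  have iXp : Integrable (fun p : ℝ × ℝ => X p.2)
      ((volume.restrict (Icc a b)).prod (volume.restrict (Icc 0 H))) := iX.comp_snd _
  have iXY : IntegrableOn (fun p : ℝ × ℝ => X p.2 + Y x') (Icc a b ×ˢ Icc 0 H) := by
    rw [IntegrableOn, hprod]
    exact iXp.add (integrable_const _)
  have iΨ : IntegrableOn (fun p : ℝ × ℝ => |Ψ p.1 p.2 - Ψ x' 0|) (Icc a b ×ˢ Icc 0 H) :=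
    ((cΨ.mono hsub).sub continuousOn_const).abs.integrableOn_compact hK
  refine (setIntegral_mono_on iΨ iXY hK.measurableSet hpt).trans ?_
  rw [integral_add (ix.const_mul _) (iy.const_mul _), integral_const_mul, integral_const_mul,
    eX, eY, hprod, integral_add iXp (integrable_const _), integral_prod _ iXp]
  simp only [integral_const, smul_eq_mul, Measure.real, Measure.restrict_apply_univ,
    Real.volume_Icc, ENNReal.toReal_ofReal hba.le]
  have hprodv : ((volume.restrict (Icc a b)).prod (volume.restrict (Icc (0 : ℝ) H)) univ).toReal
      = (b - a) * H := by
    rw [← univ_prod_univ, Measure.prod_prod]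
    simp [Real.volume_Icc, ENNReal.toReal_ofReal hba.le, hH.le]
  rw [hprodv]
  nlinarith

/-! ### Comparison of the two averaging measures -/

section Partition

variable {H L m₀ : ℝ} {ν₁ ν₂ : Measure (ℝ × ℝ)} {x : ℤ → ℝ}
  {g Ψ Ψx Ψy : ℝ → ℝ → ℝ} {q : ℝ × ℝ → ℝ}

lemma integrable_restrict_of_le {ν : Measure (ℝ × ℝ)} (hν : ν ≤ volume.restrict (strip H))
    {F : ℝ × ℝ → ℝ} (hF : ContinuousOn F (strip H)) (a b : ℝ) :
    IntegrableOn F (Ioc a b ×ˢ univ) ν ∧ IntegrableOn F (Ioc a b ×ˢ univ)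
      (volume.restrict (strip H)) := by
  have h1 : IntegrableOn F (Ioc a b ×ˢ univ) (volume.restrict (strip H)) := by
    rw [IntegrableOn, Measure.restrict_restrict (measurableSet_Ioc.prod MeasurableSet.univ)]
    refine ((hF.mono ?_).integrableOn_compact
      (isCompact_Icc.prod isCompact_Icc : IsCompact (Icc a b ×ˢ Icc 0 H))).mono_set ?_
    · exact prod_mono (subset_univ _) le_rfl
    · rintro p ⟨⟨h1, -⟩, -, h2⟩
      exact ⟨Ioc_subset_Icc_self h1, h2⟩
  exact ⟨Integrable.mono_measure h1 (Measure.restrict_mono_measure hν _), h1⟩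

lemma setIntegral_le_of_le {ν : Measure (ℝ × ℝ)} (hν : ν ≤ volume.restrict (strip H))
    {F : ℝ × ℝ → ℝ} (hF : ContinuousOn F (strip H)) (h0 : ∀ p ∈ strip H, 0 ≤ F p) (a b : ℝ) :
    ∫ p in Ioc a b ×ˢ univ, F p ∂ν ≤ ∫ p in Ioc a b ×ˢ univ, F p ∂(volume.restrict (strip H)) := by
  refine integral_mono_measure (Measure.restrict_mono_measure hν _) ?_
    (integrable_restrict_of_le hν hF a b).2
  refine ae_restrict_of_ae ?_
  filter_upwards [ae_restrict_mem (measurableSet_strip H)] with p hp using h0 p hp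

/-- On a cell the mass of `ν₁` is `m₀` times that of `ν₂`, so any constant `k` may be subtracted
from `g`. What remains is bounded by `|g - Ψ| + |Ψ - k|`. Both measures are dominated by area, so
this is integrated over the cell and the Poincaré inequality applies with its `k`. -/
lemma partition_cell (hH : 0 < H) (hν₁ : ν₁ ≤ volume.restrict (strip H))
    (hν₂ : ν₂ ≤ volume.restrict (strip H)) (hm₀ : 0 ≤ m₀) {a b : ℝ} (hab : a < b) (hL : b - a ≤ L)
    (hm : (ν₁ (Ioc a b ×ˢ univ)).toReal = m₀ * (ν₂ (Ioc a b ×ˢ univ)).toReal)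
    (cg : ContinuousOn (fun p : ℝ × ℝ => g p.1 p.2) (strip H))
    (cΨ : ContinuousOn (fun p : ℝ × ℝ => Ψ p.1 p.2) (strip H))
    (cx : ContinuousOn (fun p : ℝ × ℝ => Ψx p.1 p.2) (strip H))
    (cy : ContinuousOn (fun p : ℝ × ℝ => Ψy p.1 p.2) (strip H)) (cq : ContinuousOn q (strip H))
    (hx : ∀ x, ∀ y ∈ Icc 0 H, HasDerivAt (fun s => Ψ s y) (Ψx x y) x)
    (hy : ∀ x, ∀ y ∈ Icc 0 H, HasDerivWithinAt (fun s => Ψ x s) (Ψy x y) (Icc 0 H) y)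
    (hq : ∀ p ∈ strip H, |g p.1 p.2 - Ψ p.1 p.2| ≤ q p) :
    |(∫ p in Ioc a b ×ˢ univ, g p.1 p.2 ∂ν₁) - m₀ * ∫ p in Ioc a b ×ˢ univ, g p.1 p.2 ∂ν₂|
      ≤ (1 + m₀) * ∫ p in Ioc a b ×ˢ univ,
        (q p + (L + H) * (|Ψx p.1 p.2| + |Ψy p.1 p.2|)) ∂(volume.restrict (strip H)) := by
  obtain ⟨k, hk⟩ := poincare_box hH hab cΨ cx cy hx hy
  have hq0 : ∀ p ∈ strip H, 0 ≤ q p := fun p hp => (abs_nonneg _).trans (hq p hp)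
  have cΨk : ContinuousOn (fun p : ℝ × ℝ => |Ψ p.1 p.2 - k|) (strip H) :=
    (cΨ.sub (continuousOn_const (c := k))).abs
  have cW := cq.add cΨk
  have hrest : ((volume : Measure (ℝ × ℝ)).restrict (strip H)).restrict (Ioc a b ×ˢ univ)
      = volume.restrict (Icc a b ×ˢ Icc 0 H) := by
    rw [Measure.restrict_restrict (measurableSet_Ioc.prod MeasurableSet.univ), prod_inter_prod,
      inter_univ, univ_inter]
    change ((volume : Measure ℝ).prod (volume : Measure ℝ)).restrict _
      = ((volume : Measure ℝ).prod (volume : Measure ℝ)).restrict _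
    rw [← Measure.prod_restrict, ← Measure.prod_restrict, restrict_Ioc_eq_restrict_Icc]
  have hW0 : ∀ p ∈ strip H, 0 ≤ q p + |Ψ p.1 p.2 - k| := fun p hp =>
    add_nonneg (hq0 p hp) (abs_nonneg _)
  have hcell : ∀ ν : Measure (ℝ × ℝ), ν ≤ volume.restrict (strip H) →
      |(∫ p in Ioc a b ×ˢ univ, g p.1 p.2 ∂ν) - k * (ν (Ioc a b ×ˢ univ)).toReal|
      ≤ ∫ p in Ioc a b ×ˢ univ, (q p + |Ψ p.1 p.2 - k|) ∂(volume.restrict (strip H)) := by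
    intro ν hν
    have hmem : ∀ᵐ p ∂(ν.restrict (Ioc a b ×ˢ univ)), p ∈ strip H :=
      ae_restrict_of_ae ((Measure.absolutelyContinuous_of_le hν).ae_le
        (ae_restrict_mem (measurableSet_strip H)))
    have ik := (integrable_restrict_of_le hν (continuousOn_const (c := k)) a b).1
    have ig := (integrable_restrict_of_le hν cg a b).1
    have e : (∫ p in Ioc a b ×ˢ univ, g p.1 p.2 ∂ν) - k * (ν (Ioc a b ×ˢ univ)).toReal
        = ∫ p in Ioc a b ×ˢ univ, (g p.1 p.2 - k) ∂ν := by
      rw [integral_sub ig ik, setIntegral_const, smul_eq_mul, Measure.real, mul_comm k]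
    rw [e, ← Real.norm_eq_abs]
    refine le_trans ?_ (setIntegral_le_of_le hν cW hW0 a b)
    refine norm_integral_le_of_norm_le (integrable_restrict_of_le hν cW a b).1 ?_
    filter_upwards [hmem] with p hp
    rw [Real.norm_eq_abs]
    exact (abs_sub_le _ (Ψ p.1 p.2) _).trans (add_le_add (hq p hp) le_rfl)
  have h1 := hcell ν₁ hν₁
  have h2 := hcell ν₂ hν₂
  have hfin : ∫ p in Ioc a b ×ˢ univ, (q p + |Ψ p.1 p.2 - k|) ∂(volume.restrict (strip H))
      ≤ ∫ p in Ioc a b ×ˢ univ,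
        (q p + (L + H) * (|Ψx p.1 p.2| + |Ψy p.1 p.2|)) ∂(volume.restrict (strip H)) := by
    have hK : IsCompact (Icc a b ×ˢ Icc 0 H) := isCompact_Icc.prod isCompact_Icc
    have hsub : Icc a b ×ˢ Icc 0 H ⊆ strip H := prod_mono (subset_univ _) le_rfl
    rw [hrest]
    have iq := (cq.mono hsub).integrableOn_compact (μ := volume) hK
    have iΨ := (cΨk.mono hsub).integrableOn_compact (μ := volume) hK
    have i1 := (cx.mono hsub).abs.integrableOn_compact (μ := volume) hK
    have i2 := (cy.mono hsub).abs.integrableOn_compact (μ := volume) hK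
    have i3 : IntegrableOn (fun p : ℝ × ℝ => (L + H) * (|Ψx p.1 p.2| + |Ψy p.1 p.2|))
        (Icc a b ×ˢ Icc 0 H) := (i1.add i2).const_mul _
    rw [integral_add iq iΨ, integral_add iq i3]
    refine add_le_add le_rfl (hk.trans ?_)
    refine setIntegral_mono_on ((i1.const_mul _).add (i2.const_mul _)) i3
      hK.measurableSet fun p _ => ?_
    have := abs_nonneg (Ψx p.1 p.2)
    have := abs_nonneg (Ψy p.1 p.2)
    nlinarith
  rw [hm] at h1
  set I₁ := ∫ p in Ioc a b ×ˢ univ, g p.1 p.2 ∂ν₁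
  set I₂ := ∫ p in Ioc a b ×ˢ univ, g p.1 p.2 ∂ν₂
  set V := (ν₂ (Ioc a b ×ˢ univ)).toReal
  -- The ratio hypothesis makes the two multiples of `k` cancel.
  have e : I₁ - m₀ * I₂ = (I₁ - k * (m₀ * V)) - m₀ * (I₂ - k * V) := by ring
  rw [e]
  refine (abs_sub _ _).trans ?_
  rw [abs_mul, abs_of_nonneg hm₀, add_mul, one_mul]
  exact add_le_add (h1.trans hfin) (mul_le_mul_of_nonneg_left (h2.trans hfin) hm₀)

lemma partition_range (hH : 0 < H) (hν₁ : ν₁ ≤ volume.restrict (strip H))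
    (hν₂ : ν₂ ≤ volume.restrict (strip H)) (hm₀ : 0 ≤ m₀) (hp : IsPartition x L)
    (hm : ∀ i, (ν₁ (Ioc (x i) (x (i + 1)) ×ˢ univ)).toReal
      = m₀ * (ν₂ (Ioc (x i) (x (i + 1)) ×ˢ univ)).toReal)
    (cg : ContinuousOn (fun p : ℝ × ℝ => g p.1 p.2) (strip H))
    (cΨ : ContinuousOn (fun p : ℝ × ℝ => Ψ p.1 p.2) (strip H))
    (cx : ContinuousOn (fun p : ℝ × ℝ => Ψx p.1 p.2) (strip H))
    (cy : ContinuousOn (fun p : ℝ × ℝ => Ψy p.1 p.2) (strip H)) (cq : ContinuousOn q (strip H))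
    (hx : ∀ x, ∀ y ∈ Icc 0 H, HasDerivAt (fun s => Ψ s y) (Ψx x y) x)
    (hy : ∀ x, ∀ y ∈ Icc 0 H, HasDerivWithinAt (fun s => Ψ x s) (Ψy x y) (Icc 0 H) y)
    (hq : ∀ p ∈ strip H, |g p.1 p.2 - Ψ p.1 p.2| ≤ q p) (i : ℤ) (n : ℕ) :
    |(∫ p in Ioc (x i) (x (i + n)) ×ˢ univ, g p.1 p.2 ∂ν₁)
        - m₀ * ∫ p in Ioc (x i) (x (i + n)) ×ˢ univ, g p.1 p.2 ∂ν₂|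
      ≤ (1 + m₀) * ∫ p in Ioc (x i) (x (i + n)) ×ˢ univ,
        (q p + (L + H) * (|Ψx p.1 p.2| + |Ψy p.1 p.2|)) ∂(volume.restrict (strip H)) := by
  induction n with
  | zero => simp
  | succ n ih =>
    have cW : ContinuousOn (fun p : ℝ × ℝ => q p + (L + H) * (|Ψx p.1 p.2| + |Ψy p.1 p.2|))
        (strip H) := cq.add (continuousOn_const.mul (cx.abs.add cy.abs))
    have h1 : x i ≤ x (i + n) := hp.strictMono.monotone (by omega)
    have h2 : x (i + n) < x (i + n + 1) := hp.strictMono (by omega)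
    have hc := partition_cell hH hν₁ hν₂ hm₀ h2 (hp.step_le _) (hm _) cg cΨ cx cy cq hx hy hq
    have hU : Ioc (x i) (x (i + (n + 1 : ℕ))) ×ˢ (univ : Set ℝ)
        = Ioc (x i) (x (i + n)) ×ˢ univ ∪ Ioc (x (i + n)) (x (i + n + 1)) ×ˢ univ := by
      rw [← union_prod, Ioc_union_Ioc_eq_Ioc h1 h2.le]
      push_cast
      rw [add_assoc]
    have hd : Disjoint (Ioc (x i) (x (i + n)) ×ˢ (univ : Set ℝ))
        (Ioc (x (i + n)) (x (i + n + 1)) ×ˢ univ) :=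
      Disjoint.set_prod_left (Ioc_disjoint_Ioc_of_le le_rfl) _ _
    have hms : MeasurableSet (Ioc (x (i + n)) (x (i + n + 1)) ×ˢ (univ : Set ℝ)) :=
      measurableSet_Ioc.prod MeasurableSet.univ
    rw [hU, setIntegral_union hd hms (integrable_restrict_of_le hν₁ cg _ _).1
      (integrable_restrict_of_le hν₁ cg _ _).1, setIntegral_union hd hms
      (integrable_restrict_of_le hν₂ cg _ _).1 (integrable_restrict_of_le hν₂ cg _ _).1,
      setIntegral_union hd hms (integrable_restrict_of_le hν₂ cW _ _).2
      (integrable_restrict_of_le hν₂ cW _ _).2, mul_add (1 + m₀)]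
    refine le_trans (le_of_eq ?_) ((abs_add_le _ _).trans (add_le_add ih hc))
    congr 1
    ring

variable {κ c τ A lam : ℝ} {f : ℝ → ℝ} {u₁ u₂ : ℝ → ℝ → ℝ} {T Tt Tx Ty Txx Tyy : ℝ → ℝ → ℝ → ℝ}

/-- The gradient of `T` is controlled only in `L²`, but that of `Φ(T) = 3T² - 2T³` is `6 T (1 - T)
∇T`, which the energy density controls in `L¹`. Moreover `T - Φ(T) = T (1 - T) (1 - 2T)` is
controlled by the density too. The bound does not depend on the number of cells. -/
lemma StripSol.partition_range (hs : StripSol H κ c f u₁ u₂ T Tt Tx Ty Txx Tyy) (hH : 0 < H)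
    (hκ : 0 < κ) (hν₁ : ν₁ ≤ volume.restrict (strip H))
    (hν₂ : ν₂ ≤ volume.restrict (strip H)) (hm₀ : 0 ≤ m₀) (hp : IsPartition x L)
    (hm : ∀ i, (ν₁ (Ioc (x i) (x (i + 1)) ×ˢ univ)).toReal
      = m₀ * (ν₂ (Ioc (x i) (x (i + 1)) ×ˢ univ)).toReal)
    {a v D t : ℝ} (ha : 0 < a) (hv : 0 < v) (hav : v ^ 2 = a * κ) (ht : 0 < t)
    (hQ : IntegrableOn (fun p => density a κ T Tx Ty p t) (strip H))
    (hD : ∫ p in strip H, density a κ T Tx Ty p t ≤ D) (i : ℤ) (n : ℕ) :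
    |(∫ p in Ioc (x i) (x (i + n)) ×ˢ univ, T p.1 p.2 t ∂ν₁)
        - m₀ * ∫ p in Ioc (x i) (x (i + n)) ×ˢ univ, T p.1 p.2 t ∂ν₂|
      ≤ (1 + m₀) * ((1 / a + 6 * (L + H) / v) * D) := by
  have htp : t ∈ Ioi (0 : ℝ) := ht
  have cT := slice_continuousOn hs.cont htp
  have cx := slice_continuousOn hs.cont_x htp
  have cy := slice_continuousOn hs.cont_y htp
  have hL : 0 < L := (sub_pos.2 (hp.strictMono (lt_add_one 0))).trans_le (hp.step_le 0)
  have hqc : Continuous fun s : ℝ => s * (1 - s) := by fun_prop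
  have hΦ : ∀ s : ℝ, HasDerivAt (fun s : ℝ => 3 * s ^ 2 - 2 * s ^ 3) (6 * (s * (1 - s))) s :=
    fun s => by
      refine (((hasDerivAt_pow 2 s).const_mul 3).sub ((hasDerivAt_pow 3 s).const_mul 2)).congr_deriv
        ?_
      push_cast
      ring
  have hΦc : Continuous fun s : ℝ => 3 * s ^ 2 - 2 * s ^ 3 := by fun_prop
  have cq : ContinuousOn (fun p : ℝ × ℝ => T p.1 p.2 t * (1 - T p.1 p.2 t)) (strip H) :=
    hqc.comp_continuousOn' cT
  have hmain := Percolating.partition_range (q := fun p => T p.1 p.2 t * (1 - T p.1 p.2 t))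
    (g := fun x y => T x y t)
    (Ψ := fun x y => 3 * T x y t ^ 2 - 2 * T x y t ^ 3)
    (Ψx := fun x y => 6 * (T x y t * (1 - T x y t)) * Tx x y t)
    (Ψy := fun x y => 6 * (T x y t * (1 - T x y t)) * Ty x y t)
    hH hν₁ hν₂ hm₀ hp hm cT (hΦc.comp_continuousOn' cT) ((continuousOn_const.mul cq).mul cx)
    ((continuousOn_const.mul cq).mul cy) cq
    (fun x y hy => (hΦ _).comp x (hs.has_x x y hy t ht))
    (fun x y hy => (hΦ _).comp_hasDerivWithinAt y (hs.has_y x y hy t ht))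
    (fun p hp => by
      have hT := hs.range p.1 p.2 hp.2 t ht.le
      have e : T p.1 p.2 t - (3 * T p.1 p.2 t ^ 2 - 2 * T p.1 p.2 t ^ 3)
        = T p.1 p.2 t * (1 - T p.1 p.2 t) * (1 - 2 * T p.1 p.2 t) := by ring
      rw [e, abs_mul, abs_of_nonneg (mul_nonneg hT.1 (sub_nonneg.2 hT.2))]
      refine mul_le_of_le_one_right (mul_nonneg hT.1 (sub_nonneg.2 hT.2)) ?_
      rw [abs_le]
      constructor <;> linarith [hT.1, hT.2]) i n
  refine hmain.trans (mul_le_mul_of_nonneg_left ?_ (by linarith))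
  have hk : 0 ≤ 1 / a + 6 * (L + H) / v := by positivity
  have hpt : ∀ p ∈ strip H, T p.1 p.2 t * (1 - T p.1 p.2 t)
      + (L + H) * (|6 * (T p.1 p.2 t * (1 - T p.1 p.2 t)) * Tx p.1 p.2 t|
        + |6 * (T p.1 p.2 t * (1 - T p.1 p.2 t)) * Ty p.1 p.2 t|)
      ≤ (1 / a + 6 * (L + H) / v) * density a κ T Tx Ty p t := by
    intro p hp
    have hT := hs.range p.1 p.2 hp.2 t ht.le
    have hq0 : 0 ≤ T p.1 p.2 t * (1 - T p.1 p.2 t) := mul_nonneg hT.1 (sub_nonneg.2 hT.2)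
    have hq1 : T p.1 p.2 t * (1 - T p.1 p.2 t) ≤ 1 :=
      mul_le_one₀ hT.2 (sub_nonneg.2 hT.2) (by linarith [hT.1])
    unfold density
    set q := T p.1 p.2 t * (1 - T p.1 p.2 t)
    have hqq : q ^ 2 ≤ q := by rw [sq]; exact mul_le_of_le_one_left hq0 hq1
    -- Young's inequality with weights balanced by `v² = a κ`: expand `(v q - κ |X|)²`, divide by
    -- `κ` and use `q² ≤ q`.
    have hyoung : ∀ X : ℝ, v * (q * |X|) ≤ (a * q + κ * X ^ 2) / 2 := fun X => by
      have h1 : 0 ≤ (v * q - κ * |X|) ^ 2 := sq_nonneg _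
      have h2 : (v * q - κ * |X|) ^ 2 = κ * (a * q ^ 2 - 2 * (v * (q * |X|)) + κ * X ^ 2) := by
        rw [← sq_abs X]; linear_combination q ^ 2 * hav
      rw [h2] at h1
      have h3 := nonneg_of_mul_nonneg_right h1 hκ
      have h4 := mul_le_mul_of_nonneg_left hqq ha.le
      linarith
    have hX := hyoung (Tx p.1 p.2 t)
    have hY := hyoung (Ty p.1 p.2 t)
    have e1 : q ≤ 1 / a * (a * q + κ * (Tx p.1 p.2 t ^ 2 + Ty p.1 p.2 t ^ 2)) := by
      rw [one_div, ← div_eq_inv_mul, le_div_iff₀ ha]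
      have : 0 ≤ κ * (Tx p.1 p.2 t ^ 2 + Ty p.1 p.2 t ^ 2) := by positivity
      linarith
    have e2 : (L + H) * (|6 * q * Tx p.1 p.2 t| + |6 * q * Ty p.1 p.2 t|)
        ≤ 6 * (L + H) / v * (a * q + κ * (Tx p.1 p.2 t ^ 2 + Ty p.1 p.2 t ^ 2)) := by
      rw [abs_mul (6 * q), abs_mul (6 * q), abs_of_nonneg (show 0 ≤ 6 * q by positivity),
        div_mul_eq_mul_div,
        le_div_iff₀ hv]
      have h5 : 0 ≤ κ * (Tx p.1 p.2 t ^ 2 + Ty p.1 p.2 t ^ 2) := by positivity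
      calc _ = 6 * (L + H) * (v * (q * |Tx p.1 p.2 t|) + v * (q * |Ty p.1 p.2 t|)) := by ring
        _ ≤ _ := mul_le_mul_of_nonneg_left (by linarith) (by positivity)
    rw [add_mul (1 / a)]
    exact add_le_add e1 e2
  have cW : ContinuousOn (fun p : ℝ × ℝ => T p.1 p.2 t * (1 - T p.1 p.2 t)
      + (L + H) * (|6 * (T p.1 p.2 t * (1 - T p.1 p.2 t)) * Tx p.1 p.2 t|
        + |6 * (T p.1 p.2 t * (1 - T p.1 p.2 t)) * Ty p.1 p.2 t|)) (strip H) :=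
    cq.add (continuousOn_const.mul ((((continuousOn_const.mul cq).mul cx).abs).add
      (((continuousOn_const.mul cq).mul cy).abs)))
  calc _ ≤ ∫ p in Ioc (x i) (x (i + n)) ×ˢ univ,
        (1 / a + 6 * (L + H) / v) * density a κ T Tx Ty p t ∂(volume.restrict (strip H)) := by
        refine integral_mono_ae (integrable_restrict_of_le le_rfl cW _ _).2
          ((hQ.const_mul _).mono_measure Measure.restrict_le_self) ?_
        refine ae_restrict_of_ae ?_
        filter_upwards [ae_restrict_mem (measurableSet_strip H)] with p hp using hpt p hp
    _ ≤ ∫ p in strip H, (1 / a + 6 * (L + H) / v) * density a κ T Tx Ty p t := by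
        refine integral_mono_measure Measure.restrict_le_self ?_ (hQ.const_mul _)
        filter_upwards [ae_restrict_mem (measurableSet_strip H)] with p hp
        exact mul_nonneg hk (hs.density_nonneg hκ ha.le hp ht)
    _ ≤ _ := by
        rw [integral_const_mul]
        exact mul_le_mul_of_nonneg_left hD hk

lemma Decay.integrable_difference (hD : Decay H τ A lam T)
    (hs : StripSol H κ c f u₁ u₂ T Tt Tx Ty Txx Tyy) {t₀ t₁ : ℝ} (h0 : t₀ ∈ Icc 0 τ)
    (h1 : t₁ ∈ Icc 0 τ) :
    IntegrableOn (fun p => T p.1 p.2 t₁ - T p.1 p.2 t₀) (strip H) := by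
  refine Integrable.mono' (((integrableOn_exp_strip H hD.lam_pos).const_mul A).const_mul 2)
    (aestronglyMeasurable_strip ((slice_continuousOn hs.cont₀ (show t₁ ∈ Ici 0 from h1.1)).sub
      (slice_continuousOn hs.cont₀ (show t₀ ∈ Ici 0 from h0.1)))) ?_
  filter_upwards [ae_restrict_mem (measurableSet_strip H)] with p hp
  have e0 := hD.abs_sub_step_le hs hp h0
  have e1 := hD.abs_sub_step_le hs hp h1
  rw [Real.norm_eq_abs]
  refine (abs_sub_le _ ((Iio (0 : ℝ)).indicator 1 p.1) _).trans ?_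
  rw [abs_sub_comm _ (T p.1 p.2 t₀)]
  linarith

/-- Neither `T(t₀)` nor `T(t₁)` need be integrable over the strip, but their difference is, since
both are exponentially close to the same step function. The cell estimates are applied separately at
the two times on finite ranges, and the range is then exhausted. -/
lemma StripSol.difference_le (hs : StripSol H κ c f u₁ u₂ T Tt Tx Ty Txx Tyy) (hH : 0 < H)
    (hκ : 0 < κ) (hDec : Decay H τ A lam T) (hν₁ : ν₁ ≤ volume.restrict (strip H))
    (hν₂ : ν₂ ≤ volume.restrict (strip H)) (hm₀ : 0 ≤ m₀) (hp : IsPartition x L)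
    (hm : ∀ i, (ν₁ (Ioc (x i) (x (i + 1)) ×ˢ univ)).toReal
      = m₀ * (ν₂ (Ioc (x i) (x (i + 1)) ×ˢ univ)).toReal)
    {a v D t₀ t₁ : ℝ} (ha : 0 < a) (hv : 0 < v) (hav : v ^ 2 = a * κ) (h0 : t₀ ∈ Ioc 0 τ)
    (h1 : t₁ ∈ Ioc 0 τ)
    (hQ : ∀ t, t = t₀ ∨ t = t₁ → IntegrableOn (fun p => density a κ T Tx Ty p t) (strip H) ∧
      ∫ p in strip H, density a κ T Tx Ty p t ≤ D) :
    |(∫ p, (T p.1 p.2 t₁ - T p.1 p.2 t₀) ∂ν₁) - m₀ * ∫ p, (T p.1 p.2 t₁ - T p.1 p.2 t₀) ∂ν₂|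
      ≤ (1 + m₀) * (2 * ((1 / a + 6 * (L + H) / v) * D)) := by
  have iΔ := hDec.integrable_difference hs (Ioc_subset_Icc_self h0) (Ioc_subset_Icc_self h1)
  have cT : ∀ t, 0 < t → ContinuousOn (fun p : ℝ × ℝ => T p.1 p.2 t) (strip H) := fun t ht =>
    slice_continuousOn hs.cont (show t ∈ Ioi (0 : ℝ) from ht)
  -- The range of `2n` consecutive cells from `x (-n)` to `x n`.
  set S : ℕ → Set (ℝ × ℝ) := fun n => Ioc (x (-n)) (x (-n + (2 * n : ℕ))) ×ˢ univ with hS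
  have hSm : Monotone S := fun m n h => by
    refine prod_mono (Ioc_subset_Ioc (hp.strictMono.monotone ?_) (hp.strictMono.monotone ?_)) le_rfl
    · omega
    · push_cast; omega
  have hSU : ⋃ n, S n = univ := by
    refine eq_univ_of_forall fun p => ?_
    obtain ⟨i, hi⟩ := ((tendsto_atTop.1 hp.tendsto_right p.1).and (eventually_ge_atTop 0)).exists
    obtain ⟨j, hj⟩ := ((tendsto_atBot.1 hp.tendsto_left (p.1 - 1)).and (eventually_le_atBot 0)).exists
    refine mem_iUnion.2 ⟨i.toNat + j.natAbs, ⟨?_, ?_⟩, mem_univ _⟩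
    · have : x (-((i.toNat + j.natAbs : ℕ) : ℤ)) ≤ x j := hp.strictMono.monotone (by omega)
      linarith [hj.1]
    · refine hi.1.trans (hp.strictMono.monotone ?_)
      push_cast
      have := abs_nonneg j
      omega
  have hlim : ∀ ν : Measure (ℝ × ℝ), ν ≤ volume.restrict (strip H) →
      Tendsto (fun n => ∫ p in S n, (T p.1 p.2 t₁ - T p.1 p.2 t₀) ∂ν) atTop
        (𝓝 (∫ p, (T p.1 p.2 t₁ - T p.1 p.2 t₀) ∂ν)) := by
    intro ν hν
    have := tendsto_setIntegral_of_monotone (μ := ν) (s := S)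
      (f := fun p : ℝ × ℝ => T p.1 p.2 t₁ - T p.1 p.2 t₀)
      (fun n => measurableSet_Ioc.prod MeasurableSet.univ) hSm
      (Integrable.integrableOn (Integrable.mono_measure iΔ hν))
    rwa [hSU, Measure.restrict_univ] at this
  refine le_of_tendsto ((hlim ν₁ hν₁).sub ((hlim ν₂ hν₂).const_mul m₀)).abs
    (Eventually.of_forall fun n => ?_)
  have b0 := hs.partition_range hH hκ hν₁ hν₂ hm₀ hp hm ha hv hav h0.1 (hQ t₀ (Or.inl rfl)).1
    (hQ t₀ (Or.inl rfl)).2 (-n) (2 * n)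
  have b1 := hs.partition_range hH hκ hν₁ hν₂ hm₀ hp hm ha hv hav h1.1 (hQ t₁ (Or.inr rfl)).1
    (hQ t₁ (Or.inr rfl)).2 (-n) (2 * n)
  rw [integral_sub (integrable_restrict_of_le hν₁ (cT _ h1.1) _ _).1
    (integrable_restrict_of_le hν₁ (cT _ h0.1) _ _).1,
    integral_sub (integrable_restrict_of_le hν₂ (cT _ h1.1) _ _).1
    (integrable_restrict_of_le hν₂ (cT _ h0.1) _ _).1]
  refine le_trans (le_of_eq ?_) ((abs_sub _ _).trans ((add_le_add b1 b0).trans (le_of_eq ?_)))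
  · congr 1; ring
  · ring

end Partition

/-! ### Partial derivatives and determinants in the plane -/

lemma det_prod_eq (A : ℝ × ℝ →L[ℝ] ℝ × ℝ) :
    A.det = (A (1, 0)).1 * (A (0, 1)).2 - (A (0, 1)).1 * (A (1, 0)).2 := by
  rw [ContinuousLinearMap.det, ← LinearMap.det_toMatrix (Module.Basis.finTwoProd ℝ),
    Matrix.det_fin_two]
  simp [LinearMap.toMatrix_apply]

lemma clm_apply_prod {E : Type*} [NormedAddCommGroup E] [NormedSpace ℝ E] (A : ℝ × ℝ →L[ℝ] E)
    (a b : ℝ) : A (a, b) = a • A (1, 0) + b • A (0, 1) := by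
  rw [← map_smul, ← map_smul, ← map_add]
  simp

lemma partial_eq_fderiv {F : ℝ → ℝ → ℝ} {p : ℝ × ℝ}
    (h : DifferentiableAt ℝ (fun p : ℝ × ℝ => F p.1 p.2) p) :
    HasDerivAt (fun r => F r p.2) (fderiv ℝ (fun p : ℝ × ℝ => F p.1 p.2) p (1, 0)) p.1 ∧
    HasDerivAt (fun s => F p.1 s) (fderiv ℝ (fun p : ℝ × ℝ => F p.1 p.2) p (0, 1)) p.2 := by
  constructor
  · have e : HasDerivAt (fun r : ℝ => (r, p.2)) ((1 : ℝ), (0 : ℝ)) p.1 :=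
      (hasDerivAt_id p.1).prodMk (hasDerivAt_const p.1 p.2)
    exact h.hasFDerivAt.comp_hasDerivAt p.1 e
  · have e : HasDerivAt (fun r : ℝ => (p.1, r)) ((0 : ℝ), (1 : ℝ)) p.2 :=
      (hasDerivAt_const p.2 p.1).prodMk (hasDerivAt_id p.2)
    exact h.hasFDerivAt.comp_hasDerivAt p.2 e

lemma hasFDerivAt_partial {F : ℝ → ℝ → ℝ} {p : ℝ × ℝ}
    (h : DifferentiableAt ℝ (fun p : ℝ × ℝ => F p.1 p.2) p) :
    fderiv ℝ (fun p : ℝ × ℝ => F p.1 p.2) p (1, 0) = deriv (fun r => F r p.2) p.1 ∧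
    fderiv ℝ (fun p : ℝ × ℝ => F p.1 p.2) p (0, 1) = deriv (fun s => F p.1 s) p.2 :=
  ⟨(partial_eq_fderiv h).1.deriv.symm, (partial_eq_fderiv h).2.deriv.symm⟩

section SecondDerivatives

variable {F : ℝ → ℝ → ℝ} {s : Set (ℝ × ℝ)}

lemma contDiffOn_partial (hs : IsOpen s) (hF : ContDiffOn ℝ 2 (fun p : ℝ × ℝ => F p.1 p.2) s) :
    ContDiffOn ℝ 1 (fun p : ℝ × ℝ => deriv (fun r => F r p.2) p.1) s ∧
    ContDiffOn ℝ 1 (fun p : ℝ × ℝ => deriv (fun r => F p.1 r) p.2) s := by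
  have h1 := hF.fderiv_of_isOpen hs (m := 1) (by norm_num [one_add_one_eq_two])
  have hd : ∀ p ∈ s, DifferentiableAt ℝ (fun p : ℝ × ℝ => F p.1 p.2) p := fun p hp =>
    (hF.contDiffAt (hs.mem_nhds hp)).differentiableAt (by norm_num)
  exact ⟨(h1.clm_apply contDiffOn_const).congr fun p hp => (hasFDerivAt_partial (hd p hp)).1.symm,
    (h1.clm_apply contDiffOn_const).congr fun p hp => (hasFDerivAt_partial (hd p hp)).2.symm⟩

/-- Commuting `∂_ρ` and `∂_θ` on the `C²` parametrization is what makes the flux density constant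
along streamlines. -/
lemma deriv_partial_comm (hs : IsOpen s) (hF : ContDiffOn ℝ 2 (fun p : ℝ × ℝ => F p.1 p.2) s)
    {p : ℝ × ℝ} (hp : p ∈ s) :
    fderiv ℝ (fun p : ℝ × ℝ => deriv (fun r => F r p.2) p.1) p (0, 1)
      = fderiv ℝ (fun p : ℝ × ℝ => deriv (fun r => F p.1 r) p.2) p (1, 0) := by
  have h1 := hF.fderiv_of_isOpen hs (m := 1) (by norm_num [one_add_one_eq_two])
  have hd : ∀ p ∈ s, DifferentiableAt ℝ (fun p : ℝ × ℝ => F p.1 p.2) p := fun p hp =>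
    (hF.contDiffAt (hs.mem_nhds hp)).differentiableAt (by norm_num)
  have h2 : DifferentiableAt ℝ (fderiv ℝ (fun p : ℝ × ℝ => F p.1 p.2)) p :=
    (h1.contDiffAt (hs.mem_nhds hp)).differentiableAt (by norm_num)
  have hsym := (hF.contDiffAt (hs.mem_nhds hp)).isSymmSndFDerivAt (by simp)
  have e1 : (fun p : ℝ × ℝ => deriv (fun r => F r p.2) p.1) =ᶠ[𝓝 p]
      fun p => fderiv ℝ (fun p : ℝ × ℝ => F p.1 p.2) p (1, 0) := by
    filter_upwards [hs.mem_nhds hp] with q hq using (hasFDerivAt_partial (hd q hq)).1.symm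
  have e2 : (fun p : ℝ × ℝ => deriv (fun r => F p.1 r) p.2) =ᶠ[𝓝 p]
      fun p => fderiv ℝ (fun p : ℝ × ℝ => F p.1 p.2) p (0, 1) := by
    filter_upwards [hs.mem_nhds hp] with q hq using (hasFDerivAt_partial (hd q hq)).2.symm
  rw [e1.fderiv_eq, e2.fderiv_eq, fderiv_clm_apply h2 (differentiableAt_const _),
    fderiv_clm_apply h2 (differentiableAt_const _)]
  simpa using hsym (0, 1) (1, 0)

end SecondDerivatives

/-! ### Geometry of the tube coordinates -/

namespace Tube

/-- The parametrization of the tube. -/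
def param (D : Tube) (p : ℝ × ℝ) : ℝ × ℝ := (D.X p.1 p.2, D.Y p.1 p.2)

/-- The flux density `|u| E₁` through the level sets of `θ`. -/
def flux (u₁ u₂ : ℝ → ℝ → ℝ) (D : Tube) (ρ θ : ℝ) : ℝ :=
  √(u₁ (D.X ρ θ) (D.Y ρ θ) ^ 2 + u₂ (D.X ρ θ) (D.Y ρ θ) ^ 2) * D.E₁ ρ θ

lemma isOpen_coords (D : Tube) : IsOpen D.coords := isOpen_Ioo.prod isOpen_univ

namespace IsStreamTube

variable {bc : BC} {H K σ : ℝ} {u₁ u₂ : ℝ → ℝ → ℝ} {D : Tube}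

lemma E₁_pos (hD : D.IsStreamTube bc H u₁ u₂ K σ) (hK : 0 < K) {p : ℝ × ℝ} (hp : p ∈ D.coords) :
    0 < D.E₁ p.1 p.2 := (inv_pos.2 hK).trans_le (hD.bound_E₁ p hp).1

lemma E₂_pos (hD : D.IsStreamTube bc H u₁ u₂ K σ) (hK : 0 < K) {p : ℝ × ℝ} (hp : p ∈ D.coords) :
    0 < D.E₂ p.1 p.2 := (inv_pos.2 hK).trans_le (hD.bound_E₂ p hp).1

lemma E₁_sq (D : Tube) (p : ℝ × ℝ) :
    D.E₁ p.1 p.2 ^ 2 = D.Xρ p.1 p.2 ^ 2 + D.Yρ p.1 p.2 ^ 2 := Real.sq_sqrt (by positivity)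

lemma E₂_sq (D : Tube) (p : ℝ × ℝ) :
    D.E₂ p.1 p.2 ^ 2 = D.Xθ p.1 p.2 ^ 2 + D.Yθ p.1 p.2 ^ 2 := Real.sq_sqrt (by positivity)

lemma contDiffOn_Xρ (hD : D.IsStreamTube bc H u₁ u₂ K σ) :
    ContDiffOn ℝ 1 (fun p : ℝ × ℝ => D.Xρ p.1 p.2) D.coords :=
  (contDiffOn_partial D.isOpen_coords hD.contDiffOn_X).1

lemma contDiffOn_Xθ (hD : D.IsStreamTube bc H u₁ u₂ K σ) :
    ContDiffOn ℝ 1 (fun p : ℝ × ℝ => D.Xθ p.1 p.2) D.coords :=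
  (contDiffOn_partial D.isOpen_coords hD.contDiffOn_X).2

lemma contDiffOn_Yρ (hD : D.IsStreamTube bc H u₁ u₂ K σ) :
    ContDiffOn ℝ 1 (fun p : ℝ × ℝ => D.Yρ p.1 p.2) D.coords :=
  (contDiffOn_partial D.isOpen_coords hD.contDiffOn_Y).1

lemma contDiffOn_Yθ (hD : D.IsStreamTube bc H u₁ u₂ K σ) :
    ContDiffOn ℝ 1 (fun p : ℝ × ℝ => D.Yθ p.1 p.2) D.coords :=
  (contDiffOn_partial D.isOpen_coords hD.contDiffOn_Y).2

lemma contDiffOn_E₁ (hD : D.IsStreamTube bc H u₁ u₂ K σ) (hK : 0 < K) :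
    ContDiffOn ℝ 1 (fun p : ℝ × ℝ => D.E₁ p.1 p.2) D.coords :=
  ((hD.contDiffOn_Xρ.pow 2).add (hD.contDiffOn_Yρ.pow 2)).sqrt fun p hp => by
    have := pow_pos (hD.E₁_pos hK hp) 2
    rw [E₁_sq] at this
    exact this.ne'

lemma contDiffOn_E₂ (hD : D.IsStreamTube bc H u₁ u₂ K σ) (hK : 0 < K) :
    ContDiffOn ℝ 1 (fun p : ℝ × ℝ => D.E₂ p.1 p.2) D.coords :=
  ((hD.contDiffOn_Xθ.pow 2).add (hD.contDiffOn_Yθ.pow 2)).sqrt fun p hp => by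
    have := pow_pos (hD.E₂_pos hK hp) 2
    rw [E₂_sq] at this
    exact this.ne'

lemma contDiffOn_ω (hD : D.IsStreamTube bc H u₁ u₂ K σ) (hK : 0 < K) :
    ContDiffOn ℝ 1 (fun p : ℝ × ℝ => D.ω p.1 p.2) D.coords :=
  (hD.contDiffOn_E₂ hK).div (hD.contDiffOn_E₁ hK) fun _ hp => (hD.E₁_pos hK hp).ne'

lemma contDiffOn_param (hD : D.IsStreamTube bc H u₁ u₂ K σ) : ContDiffOn ℝ 2 D.param D.coords :=
  hD.contDiffOn_X.prodMk hD.contDiffOn_Y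

lemma differentiableAt_X (hD : D.IsStreamTube bc H u₁ u₂ K σ) {p : ℝ × ℝ} (hp : p ∈ D.coords) :
    DifferentiableAt ℝ (fun p : ℝ × ℝ => D.X p.1 p.2) p :=
  (hD.contDiffOn_X.contDiffAt (D.isOpen_coords.mem_nhds hp)).differentiableAt (by norm_num)

lemma differentiableAt_Y (hD : D.IsStreamTube bc H u₁ u₂ K σ) {p : ℝ × ℝ} (hp : p ∈ D.coords) :
    DifferentiableAt ℝ (fun p : ℝ × ℝ => D.Y p.1 p.2) p :=
  (hD.contDiffOn_Y.contDiffAt (D.isOpen_coords.mem_nhds hp)).differentiableAt (by norm_num)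

lemma hasStrictFDerivAt (hD : D.IsStreamTube bc H u₁ u₂ K σ) {p : ℝ × ℝ} (hp : p ∈ D.coords) :
    HasStrictFDerivAt D.param (fderiv ℝ D.param p) p :=
  (hD.contDiffOn_param.contDiffAt (D.isOpen_coords.mem_nhds hp)).hasStrictFDerivAt (by norm_num)

lemma fderiv_apply (hD : D.IsStreamTube bc H u₁ u₂ K σ) {p : ℝ × ℝ} (hp : p ∈ D.coords)
    (a b : ℝ) : fderiv ℝ D.param p (a, b)
      = (a * D.Xρ p.1 p.2 + b * D.Xθ p.1 p.2, a * D.Yρ p.1 p.2 + b * D.Yθ p.1 p.2) := by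
  have hX := hD.differentiableAt_X hp
  have hY := hD.differentiableAt_Y hp
  have e : fderiv ℝ D.param p = (fderiv ℝ (fun p : ℝ × ℝ => D.X p.1 p.2) p).prod
      (fderiv ℝ (fun p : ℝ × ℝ => D.Y p.1 p.2) p) :=
    (hX.hasFDerivAt.prodMk hY.hasFDerivAt).fderiv
  rw [e, ContinuousLinearMap.prod_apply, clm_apply_prod, clm_apply_prod (fderiv ℝ _ p) a b,
    (hasFDerivAt_partial hX).1, (hasFDerivAt_partial hX).2, (hasFDerivAt_partial hY).1,
    (hasFDerivAt_partial hY).2]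
  rfl

/-- Lagrange's identity: the square of the determinant is `E₁² E₂²` minus the square of the scalar
product of the two tangent vectors, which is zero. -/
lemma abs_det (hD : D.IsStreamTube bc H u₁ u₂ K σ) (hK : 0 < K) {p : ℝ × ℝ} (hp : p ∈ D.coords) :
    |(fderiv ℝ D.param p).det| = D.E₁ p.1 p.2 * D.E₂ p.1 p.2 := by
  rw [det_prod_eq, hD.fderiv_apply hp, hD.fderiv_apply hp]
  have h1 := E₁_sq D p
  have h2 := E₂_sq D p
  have ho := hD.orthogonal p hp
  rw [← abs_of_pos (mul_pos (hD.E₁_pos hK hp) (hD.E₂_pos hK hp)), ← sq_eq_sq_iff_abs_eq_abs,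
    mul_pow, h1, h2]
  simp only [one_mul, zero_mul, add_zero, zero_add]
  linear_combination (-(D.Xρ p.1 p.2 * D.Xθ p.1 p.2 + D.Yρ p.1 p.2 * D.Yθ p.1 p.2)) * ho

lemma det_ne_zero (hD : D.IsStreamTube bc H u₁ u₂ K σ) (hK : 0 < K) {p : ℝ × ℝ}
    (hp : p ∈ D.coords) : (fderiv ℝ D.param p).det ≠ 0 := by
  rw [← abs_pos, hD.abs_det hK hp]
  exact mul_pos (hD.E₁_pos hK hp) (hD.E₂_pos hK hp)

lemma injOn_param (hD : D.IsStreamTube bc H u₁ u₂ K σ) : InjOn D.param D.coords := by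
  intro p hp q hq h
  refine hD.injective p hp q hq ?_
  have h1 : D.X p.1 p.2 = D.X q.1 q.2 := congrArg Prod.fst h
  have h2 : D.Y p.1 p.2 = D.Y q.1 q.2 := congrArg Prod.snd h
  cases bc
  · exact ⟨h1, h2⟩
  · exact ⟨h1, 0, by simp [h2]⟩

lemma map_nhds (hD : D.IsStreamTube bc H u₁ u₂ K σ) (hK : 0 < K) {p : ℝ × ℝ}
    (hp : p ∈ D.coords) : map D.param (𝓝 p) = 𝓝 (D.param p) := by
  have h := hD.hasStrictFDerivAt hp
  rw [← ContinuousLinearMap.coe_toContinuousLinearEquivOfDetNeZero _ (hD.det_ne_zero hK hp)] at h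
  exact h.map_nhds_eq_of_equiv

lemma isOpen_image (hD : D.IsStreamTube bc H u₁ u₂ K σ) (hK : 0 < K) :
    IsOpen (D.param '' D.coords) := by
  rw [isOpen_iff_mem_nhds]
  rintro _ ⟨p, hp, rfl⟩
  rw [← hD.map_nhds hK hp]
  exact image_mem_map (D.isOpen_coords.mem_nhds hp)

/-- The image of the open coordinate strip is open, hence lies in the interior of the domain, where
`u` is `C¹`. In the Neumann case the tube might otherwise touch the walls. -/
lemma param_mem (hD : D.IsStreamTube bc H u₁ u₂ K σ) (hK : 0 < K) {p : ℝ × ℝ}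
    (hp : p ∈ D.coords) : D.param p ∈ (univ : Set ℝ) ×ˢ bc.crossInt H := by
  have hsub : D.param '' D.coords ⊆ univ ×ˢ bc.cross H := by
    rintro _ ⟨q, hq, rfl⟩
    exact ⟨mem_univ _, hD.mem_strip q hq⟩
  have h1 := interior_mono hsub
  rw [(hD.isOpen_image hK).interior_eq, interior_prod_eq, interior_univ] at h1
  have h2 := h1 (mem_image_of_mem _ hp)
  cases bc
  · simpa [BC.cross, BC.crossInt, interior_Icc] using h2
  · exact ⟨mem_univ _, mem_univ _⟩

/-- The coordinates `(ρ, θ)` as functions on the tube. -/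
def inv (D : Tube) : ℝ × ℝ → ℝ × ℝ := Function.invFunOn D.param D.coords

lemma inv_param (hD : D.IsStreamTube bc H u₁ u₂ K σ) {p : ℝ × ℝ} (hp : p ∈ D.coords) :
    inv D (D.param p) = p := hD.injOn_param.leftInvOn_invFunOn hp

lemma continuousAt_inv (hD : D.IsStreamTube bc H u₁ u₂ K σ) (hK : 0 < K) {p : ℝ × ℝ}
    (hp : p ∈ D.coords) : ContinuousAt (inv D) (D.param p) := by
  rw [ContinuousAt, hD.inv_param hp, ← hD.map_nhds hK hp, tendsto_map'_iff]
  refine tendsto_id.congr' ?_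
  filter_upwards [D.isOpen_coords.mem_nhds hp] with q hq
  exact (hD.inv_param hq).symm

/-- For orthogonal coordinates `∇ρ` and `∇θ` are the tangent vectors divided by the squares of their
lengths. This allows a test function of `(ρ, θ)` to be differentiated in the plane. -/
lemma hasFDerivAt_inv (hD : D.IsStreamTube bc H u₁ u₂ K σ) (hK : 0 < K) {p : ℝ × ℝ}
    (hp : p ∈ D.coords) : ∃ A : ℝ × ℝ →L[ℝ] ℝ × ℝ, HasFDerivAt (inv D) A (D.param p) ∧
      A (1, 0) = (D.Xρ p.1 p.2 / D.E₁ p.1 p.2 ^ 2, D.Xθ p.1 p.2 / D.E₂ p.1 p.2 ^ 2) ∧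
      A (0, 1) = (D.Yρ p.1 p.2 / D.E₁ p.1 p.2 ^ 2, D.Yθ p.1 p.2 / D.E₂ p.1 p.2 ^ 2) := by
  set e := (fderiv ℝ D.param p).toContinuousLinearEquivOfDetNeZero (hD.det_ne_zero hK hp)
  have he : ∀ v, e v = fderiv ℝ D.param p v := fun v => rfl
  have h1 := E₁_sq D p
  have h2 := E₂_sq D p
  have ho := hD.orthogonal p hp
  have p1 : 0 < D.E₁ p.1 p.2 ^ 2 := pow_pos (hD.E₁_pos hK hp) 2
  have p2 : 0 < D.E₂ p.1 p.2 ^ 2 := pow_pos (hD.E₂_pos hK hp) 2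
  refine ⟨(e.symm : ℝ × ℝ →L[ℝ] ℝ × ℝ), ?_, ?_, ?_⟩
  · refine HasFDerivAt.of_local_left_inverse (hD.continuousAt_inv hK hp) (f := D.param) ?_ ?_
    · rw [hD.inv_param hp]
      exact (hD.hasStrictFDerivAt hp).hasFDerivAt
    · filter_upwards [(hD.isOpen_image hK).mem_nhds (mem_image_of_mem _ hp)] with z hz
      obtain ⟨q, hq, rfl⟩ := hz
      rw [hD.inv_param hq]
  · rw [ContinuousLinearEquiv.coe_coe, ContinuousLinearEquiv.symm_apply_eq, he,
      hD.fderiv_apply hp]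
    rw [h1] at p1 ⊢
    rw [h2] at p2 ⊢
    ext
    · field_simp
      linear_combination (D.Yρ p.1 p.2 * D.Yθ p.1 p.2 - D.Xρ p.1 p.2 * D.Xθ p.1 p.2) * ho
    · field_simp
      linear_combination (-(D.Yρ p.1 p.2 * D.Xθ p.1 p.2 + D.Xρ p.1 p.2 * D.Yθ p.1 p.2)) * ho
  · rw [ContinuousLinearEquiv.coe_coe, ContinuousLinearEquiv.symm_apply_eq, he,
      hD.fderiv_apply hp]
    rw [h1] at p1 ⊢
    rw [h2] at p2 ⊢
    ext
    · field_simp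
      linear_combination (-(D.Yρ p.1 p.2 * D.Xθ p.1 p.2 + D.Xρ p.1 p.2 * D.Yθ p.1 p.2)) * ho
    · field_simp
      linear_combination (D.Xρ p.1 p.2 * D.Xθ p.1 p.2 - D.Yρ p.1 p.2 * D.Yθ p.1 p.2) * ho

/-- Both `u` and `∂_θ` are orthogonal to the nonzero vector `∂_ρ`, so in the plane they are
parallel. -/
lemma cross_eq_zero (hD : D.IsStreamTube bc H u₁ u₂ K σ) (hK : 0 < K) {p : ℝ × ℝ}
    (hp : p ∈ D.coords) : D.Xθ p.1 p.2 * u₂ (D.X p.1 p.2) (D.Y p.1 p.2)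
      - D.Yθ p.1 p.2 * u₁ (D.X p.1 p.2) (D.Y p.1 p.2) = 0 := by
  have h1 := pow_pos (hD.E₁_pos hK hp) 2
  rw [E₁_sq] at h1
  have ho := hD.orthogonal p hp
  have hst := hD.streamline p hp
  have : (D.Xρ p.1 p.2 ^ 2 + D.Yρ p.1 p.2 ^ 2) * (D.Xθ p.1 p.2 * u₂ (D.X p.1 p.2) (D.Y p.1 p.2)
      - D.Yθ p.1 p.2 * u₁ (D.X p.1 p.2) (D.Y p.1 p.2)) = 0 := by
    linear_combination (D.Xρ p.1 p.2 * u₂ (D.X p.1 p.2) (D.Y p.1 p.2)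
      - D.Yρ p.1 p.2 * u₁ (D.X p.1 p.2) (D.Y p.1 p.2)) * ho
      + (D.Yρ p.1 p.2 * D.Xθ p.1 p.2 - D.Xρ p.1 p.2 * D.Yθ p.1 p.2) * hst
  exact (mul_eq_zero.1 this).resolve_left h1.ne'

/-- Since `u` is orthogonal to `∂_ρ`, the product of their lengths is the absolute value of their
cross product. This form has no square roots and can be differentiated along `θ` up to a sign. -/
lemma flux_eq_abs (hD : D.IsStreamTube bc H u₁ u₂ K σ) (hK : 0 < K) {p : ℝ × ℝ}
    (hp : p ∈ D.coords) : D.flux u₁ u₂ p.1 p.2 = |D.Xρ p.1 p.2 * u₂ (D.X p.1 p.2) (D.Y p.1 p.2)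
      - D.Yρ p.1 p.2 * u₁ (D.X p.1 p.2) (D.Y p.1 p.2)| := by
  have h0 : 0 ≤ D.flux u₁ u₂ p.1 p.2 := mul_nonneg (Real.sqrt_nonneg _) (hD.E₁_pos hK hp).le
  rw [← abs_of_nonneg h0, ← sq_eq_sq_iff_abs_eq_abs, flux, mul_pow, Real.sq_sqrt (by positivity),
    E₁_sq]
  linear_combination (D.Xρ p.1 p.2 * u₁ (D.X p.1 p.2) (D.Y p.1 p.2)
    + D.Yρ p.1 p.2 * u₂ (D.X p.1 p.2) (D.Y p.1 p.2)) * hD.streamline p hp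

/-- In the coordinates of the tube, transport is a derivative along `θ` weighted by the flux. -/
lemma transport_eq (hD : D.IsStreamTube bc H u₁ u₂ K σ) (hK : 0 < K) (hσ : σ ^ 2 = 1)
    {p : ℝ × ℝ} (hp : p ∈ D.coords) (a b : ℝ) :
    D.E₁ p.1 p.2 * D.E₂ p.1 p.2 * (u₁ (D.X p.1 p.2) (D.Y p.1 p.2) * a
      + u₂ (D.X p.1 p.2) (D.Y p.1 p.2) * b)
      = σ * D.flux u₁ u₂ p.1 p.2 * (a * D.Xθ p.1 p.2 + b * D.Yθ p.1 p.2) := by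
  have p2 := hD.E₂_pos hK hp
  have h2 := E₂_sq D p
  have hcr := hD.cross_eq_zero hK hp
  have hdir := hD.direction p hp
  unfold flux
  set u := u₁ (D.X p.1 p.2) (D.Y p.1 p.2)
  set v := u₂ (D.X p.1 p.2) (D.Y p.1 p.2)
  set m := D.Xθ p.1 p.2
  set n := D.Yθ p.1 p.2
  set W := √(u ^ 2 + v ^ 2) with hW
  have hW2 : W ^ 2 = u ^ 2 + v ^ 2 := Real.sq_sqrt (by positivity)
  have hσW : σ * (u * m + v * n) = D.E₂ p.1 p.2 * W := by
    have h0 : 0 ≤ D.E₂ p.1 p.2 * W := mul_nonneg p2.le (Real.sqrt_nonneg _)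
    rw [← abs_of_pos hdir, ← abs_of_nonneg h0, ← sq_eq_sq_iff_abs_eq_abs, mul_pow, mul_pow, hσ, h2,
      hW2]
    linear_combination (-(m * v - n * u)) * hcr
  have hσ2 : u * m + v * n = σ * (D.E₂ p.1 p.2 * W) := by
    rw [← hσW]; linear_combination (-(u * m + v * n)) * hσ
  have key : D.E₂ p.1 p.2 * (u * a + v * b) * D.E₂ p.1 p.2
      = σ * W * (a * m + b * n) * D.E₂ p.1 p.2 := by
    have e1 : D.E₂ p.1 p.2 * (u * a + v * b) * D.E₂ p.1 p.2
        = (m ^ 2 + n ^ 2) * (u * a + v * b) := by rw [← h2]; ring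
    have e2 : σ * W * (a * m + b * n) * D.E₂ p.1 p.2
        = (u * m + v * n) * (a * m + b * n) := by rw [hσ2]; ring
    rw [e1, e2]
    linear_combination (b * m - a * n) * hcr
  have := mul_right_cancel₀ p2.ne' key
  linear_combination D.E₁ p.1 p.2 * this

lemma hasDerivAt_flow (hD : D.IsStreamTube bc H u₁ u₂ K σ) {u : ℝ → ℝ → ℝ}
    {p : ℝ × ℝ} (hp : p ∈ D.coords)
    (hu : DifferentiableAt ℝ (fun z : ℝ × ℝ => u z.1 z.2) (D.param p)) :
    HasDerivAt (fun r => u (D.X r p.2) (D.Y r p.2))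
      (deriv (fun x => u x (D.Y p.1 p.2)) (D.X p.1 p.2) * D.Xρ p.1 p.2
        + deriv (fun y => u (D.X p.1 p.2) y) (D.Y p.1 p.2) * D.Yρ p.1 p.2) p.1 ∧
    HasDerivAt (fun s => u (D.X p.1 s) (D.Y p.1 s))
      (deriv (fun x => u x (D.Y p.1 p.2)) (D.X p.1 p.2) * D.Xθ p.1 p.2
        + deriv (fun y => u (D.X p.1 p.2) y) (D.Y p.1 p.2) * D.Yθ p.1 p.2) p.2 := by
  have hX := hD.differentiableAt_X hp
  have hY := hD.differentiableAt_Y hp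
  obtain ⟨e1, e2⟩ := hasFDerivAt_partial hu
  obtain ⟨a1, a2⟩ := partial_eq_fderiv hX
  obtain ⟨b1, b2⟩ := partial_eq_fderiv hY
  rw [(hasFDerivAt_partial hX).1] at a1
  rw [(hasFDerivAt_partial hX).2] at a2
  rw [(hasFDerivAt_partial hY).1] at b1
  rw [(hasFDerivAt_partial hY).2] at b2
  have c1 := hu.hasFDerivAt.comp_hasDerivAt p.1 (a1.prodMk b1)
  have c2 := hu.hasFDerivAt.comp_hasDerivAt p.2 (a2.prodMk b2)
  rw [clm_apply_prod, e1, e2] at c1 c2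
  refine ⟨c1.congr_deriv ?_, c2.congr_deriv ?_⟩
  · simp only [smul_eq_mul, param]
    rw [mul_comm, mul_comm (deriv (fun r => D.Y r p.2) p.1)]
    rfl
  · simp only [smul_eq_mul, param]
    rw [mul_comm, mul_comm (deriv (fun r => D.Y p.1 r) p.2)]
    rfl

/-- Conservation of flux in a stream tube. The `θ`-derivative of the cross product of `∂_ρ` with `u`
differs from the `ρ`-derivative of the cross product of `∂_θ` with `u` by the Jacobian times `div
u`; the latter product vanishes identically. -/
lemma flux_eq (hD : D.IsStreamTube bc H u₁ u₂ K σ) (hK : 0 < K) (hu : IsFlow bc H u₁ u₂)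
    {ρ : ℝ} (hρ : ρ ∈ Ioo (D.c - D.h) (D.c + D.h)) (θ θ' : ℝ) :
    D.flux u₁ u₂ ρ θ = D.flux u₁ u₂ ρ θ' := by
  have hmem : ∀ θ, (ρ, θ) ∈ D.coords := fun θ => ⟨hρ, mem_univ _⟩
  have key : ∀ θ, HasDerivAt (fun s => D.Xρ ρ s * u₂ (D.X ρ s) (D.Y ρ s)
      - D.Yρ ρ s * u₁ (D.X ρ s) (D.Y ρ s)) 0 θ := by
    intro θ
    have hp := hmem θ
    have hW := (bc.isOpen_univ_prod_crossInt H).mem_nhds (hD.param_mem hK hp)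
    have d1 : DifferentiableAt ℝ (fun z : ℝ × ℝ => u₁ z.1 z.2) (D.param (ρ, θ)) :=
      (hu.contDiffOn₁.contDiffAt hW).differentiableAt (by norm_num)
    have d2 : DifferentiableAt ℝ (fun z : ℝ × ℝ => u₂ z.1 z.2) (D.param (ρ, θ)) :=
      (hu.contDiffOn₂.contDiffAt hW).differentiableAt (by norm_num)
    obtain ⟨r1, s1⟩ := hD.hasDerivAt_flow hp d1
    obtain ⟨r2, s2⟩ := hD.hasDerivAt_flow hp d2
    have hdiff : ∀ {F : ℝ → ℝ → ℝ}, ContDiffOn ℝ 1 (fun p : ℝ × ℝ => F p.1 p.2) D.coords →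
        DifferentiableAt ℝ (fun p : ℝ × ℝ => F p.1 p.2) (ρ, θ) := fun h =>
      (h.contDiffAt (D.isOpen_coords.mem_nhds hp)).differentiableAt (by norm_num)
    have X1 := (partial_eq_fderiv (hdiff hD.contDiffOn_Xρ)).2
    have Y1 := (partial_eq_fderiv (hdiff hD.contDiffOn_Yρ)).2
    have X2 := (partial_eq_fderiv (hdiff hD.contDiffOn_Xθ)).1
    have Y2 := (partial_eq_fderiv (hdiff hD.contDiffOn_Yθ)).1
    have eX : fderiv ℝ (fun p : ℝ × ℝ => D.Xρ p.1 p.2) (ρ, θ) (0, 1)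
        = fderiv ℝ (fun p : ℝ × ℝ => D.Xθ p.1 p.2) (ρ, θ) (1, 0) :=
      deriv_partial_comm D.isOpen_coords hD.contDiffOn_X hp
    have eY : fderiv ℝ (fun p : ℝ × ℝ => D.Yρ p.1 p.2) (ρ, θ) (0, 1)
        = fderiv ℝ (fun p : ℝ × ℝ => D.Yθ p.1 p.2) (ρ, θ) (1, 0) :=
      deriv_partial_comm D.isOpen_coords hD.contDiffOn_Y hp
    rw [eX] at X1
    rw [eY] at Y1
    -- Parallelism of `u` and `∂_θ` holds in the whole tube and may therefore be differentiated in
    -- `ρ`.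
    have hz : HasDerivAt (fun r => D.Xθ r θ * u₂ (D.X r θ) (D.Y r θ)
        - D.Yθ r θ * u₁ (D.X r θ) (D.Y r θ)) 0 ρ := by
      refine (hasDerivAt_const ρ (0 : ℝ)).congr_of_eventuallyEq ?_
      filter_upwards [Ioo_mem_nhds hρ.1 hρ.2] with r hr
      exact hD.cross_eq_zero hK (p := (r, θ)) ⟨hr, mem_univ _⟩
    have hz' := ((X2.mul r2).sub (Y2.mul r1)).unique hz
    have hdiv := hu.div_free (D.X ρ θ) (D.Y ρ θ) (hD.param_mem hK hp).2
    refine ((X1.mul s2).sub (Y1.mul s1)).congr_deriv ?_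
    simp only at hz' ⊢
    linear_combination hz' + (D.Xρ ρ θ * D.Yθ ρ θ - D.Xθ ρ θ * D.Yρ ρ θ) * hdiv
  have hconst := is_const_of_deriv_eq_zero (fun θ => (key θ).differentiableAt)
    (fun θ => (key θ).deriv) θ θ'
  rw [hD.flux_eq_abs hK (hmem θ), hD.flux_eq_abs hK (hmem θ')]
  exact congrArg abs hconst

lemma continuousOn_flux (hD : D.IsStreamTube bc H u₁ u₂ K σ) (hK : 0 < K)
    (hu : IsFlow bc H u₁ u₂) : ContinuousOn (fun p : ℝ × ℝ => D.flux u₁ u₂ p.1 p.2) D.coords := by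
  have hm : MapsTo D.param D.coords (univ ×ˢ bc.cross H) := fun p hp =>
    ⟨mem_univ _, hD.mem_strip p hp⟩
  have c1 := hu.continuousOn₁.comp hD.contDiffOn_param.continuousOn hm
  have c2 := hu.continuousOn₂.comp hD.contDiffOn_param.continuousOn hm
  exact ((c1.pow 2).add (c2.pow 2)).sqrt.mul (hD.contDiffOn_E₁ hK).continuousOn

lemma integral_image (hD : D.IsStreamTube bc H u₁ u₂ K σ) (hK : 0 < K) {s : Set (ℝ × ℝ)}
    (hs : MeasurableSet s) (hsub : s ⊆ D.coords) (F : ℝ × ℝ → ℝ) :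
    ∫ z in D.param '' s, F z = ∫ p in s, D.E₁ p.1 p.2 * D.E₂ p.1 p.2 * F (D.param p) := by
  rw [integral_image_eq_integral_abs_det_fderiv_smul volume hs
    (fun p hp => (hD.hasStrictFDerivAt (hsub hp)).hasFDerivAt.hasFDerivWithinAt)
    (hD.injOn_param.mono hsub)]
  refine setIntegral_congr_fun hs fun p hp => ?_
  simp only [hD.abs_det hK (hsub hp), smul_eq_mul]

end IsStreamTube

end Tube

/-! ### Integration by parts in the plane -/

section Plane

variable {k : Set (ℝ × ℝ)} {F F' : ℝ × ℝ → ℝ}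

lemma integrable_of_zero_off (hk : IsCompact k) (hc : ContinuousOn F k) (hz : ∀ z ∉ k, F z = 0) :
    Integrable F := by
  rw [← integrableOn_iff_integrable_of_support_subset (s := k)]
  · exact hc.integrableOn_compact hk
  · intro z h
    by_contra h'
    exact h (hz z h')

lemma exists_bound_of_isCompact (hk : IsCompact k) :
    ∃ R, ∀ z ∈ k, |z.1| ≤ R ∧ |z.2| ≤ R := by
  obtain ⟨R, hR⟩ := hk.isBounded.exists_norm_le
  exact ⟨R, fun z hz => ⟨(norm_fst_le z).trans (hR z hz), (norm_snd_le z).trans (hR z hz)⟩⟩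

lemma integral_plane_dx (hk : IsCompact k)
    (hF : ∀ z : ℝ × ℝ, HasDerivAt (fun x => F (x, z.2)) (F' z) z.1) (hc : ContinuousOn F' k)
    (hz : ∀ z ∉ k, F z = 0 ∧ F' z = 0) : ∫ z, F' z = 0 := by
  have hi := integrable_of_zero_off hk hc fun z h => (hz z h).2
  obtain ⟨R, hR⟩ := exists_bound_of_isCompact hk
  change ∫ z, F' z ∂((volume : Measure ℝ).prod volume) = 0
  rw [integral_prod_symm _ hi]
  refine integral_eq_zero_of_ae (Eventually.of_forall fun y => ?_)
  exact integral_eq_zero_of_hasDerivAt (f := fun x => F (x, y)) (fun x => hF (x, y))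
    fun x hx => (hz _ fun h => absurd (hR _ h).1 (not_le.2 hx)).1

lemma integral_plane_dy (hk : IsCompact k)
    (hF : ∀ z : ℝ × ℝ, HasDerivAt (fun y => F (z.1, y)) (F' z) z.2) (hc : ContinuousOn F' k)
    (hz : ∀ z ∉ k, F z = 0 ∧ F' z = 0) : ∫ z, F' z = 0 := by
  have hi := integrable_of_zero_off hk hc fun z h => (hz z h).2
  obtain ⟨R, hR⟩ := exists_bound_of_isCompact hk
  change ∫ z, F' z ∂((volume : Measure ℝ).prod volume) = 0
  rw [integral_prod _ hi]
  refine integral_eq_zero_of_ae (Eventually.of_forall fun x => ?_)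
  exact integral_eq_zero_of_hasDerivAt (f := fun y => F (x, y)) (fun y => hF (x, y))
    fun y hy => (hz _ fun h => absurd (hR _ h).2 (not_le.2 hy)).1

end Plane

/-- A classical solution on `ℝ × W`, with `W` open. -/
structure PlaneSol (W : Set ℝ) (κ c : ℝ) (f : ℝ → ℝ) (u₁ u₂ : ℝ → ℝ → ℝ)
    (T Tt Tx Ty Txx Tyy : ℝ → ℝ → ℝ → ℝ) : Prop where
  cont : ContinuousOn (fun z : (ℝ × ℝ) × ℝ => T z.1.1 z.1.2 z.2) ((univ ×ˢ W) ×ˢ Ioi 0)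
  cont_t : ContinuousOn (fun z : (ℝ × ℝ) × ℝ => Tt z.1.1 z.1.2 z.2) ((univ ×ˢ W) ×ˢ Ioi 0)
  cont_x : ContinuousOn (fun z : (ℝ × ℝ) × ℝ => Tx z.1.1 z.1.2 z.2) ((univ ×ˢ W) ×ˢ Ioi 0)
  cont_y : ContinuousOn (fun z : (ℝ × ℝ) × ℝ => Ty z.1.1 z.1.2 z.2) ((univ ×ˢ W) ×ˢ Ioi 0)
  cont_xx : ContinuousOn (fun z : (ℝ × ℝ) × ℝ => Txx z.1.1 z.1.2 z.2) ((univ ×ˢ W) ×ˢ Ioi 0)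
  cont_yy : ContinuousOn (fun z : (ℝ × ℝ) × ℝ => Tyy z.1.1 z.1.2 z.2) ((univ ×ˢ W) ×ˢ Ioi 0)
  has_t : ∀ x, ∀ y ∈ W, ∀ t > 0, HasDerivAt (fun s => T x y s) (Tt x y t) t
  has_x : ∀ x, ∀ y ∈ W, ∀ t > 0, HasDerivAt (fun s => T s y t) (Tx x y t) x
  has_xx : ∀ x, ∀ y ∈ W, ∀ t > 0, HasDerivAt (fun s => Tx s y t) (Txx x y t) x
  has_y : ∀ x, ∀ y ∈ W, ∀ t > 0, HasDerivAt (fun s => T x s t) (Ty x y t) y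
  has_yy : ∀ x, ∀ y ∈ W, ∀ t > 0, HasDerivAt (fun s => Ty x s t) (Tyy x y t) y
  range : ∀ x, ∀ y ∈ W, ∀ t > 0, T x y t ∈ Icc (0 : ℝ) 1
  pde : ∀ x, ∀ y ∈ W, ∀ t > 0, Tt x y t + (u₁ x y * Tx x y t + u₂ x y * Ty x y t)
    = κ * (Txx x y t + Tyy x y t) + c * f (T x y t)

/-- In the periodic case a tube may leave `[0, H]`, so in the tubes the equation is used on the
whole plane. In the Neumann case the open strip is enough, because tubes stay inside it. -/
lemma IsSolution.planeSol {bc : BC} {κ v₀ H : ℝ} {f : ℝ → ℝ} {u₁ u₂ : ℝ → ℝ → ℝ}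
    {T : ℝ → ℝ → ℝ → ℝ} (h : IsSolution bc κ v₀ H f u₁ u₂ T) :
    PlaneSol (bc.crossInt H) κ (v₀ ^ 2 / (4 * κ)) f u₁ u₂ T (dt T) (dx T) (dy (bc.cross H) T)
      (dx (dx T)) (dy (bc.cross H) (dy (bc.cross H) T)) := by
  have hsub := bc.crossInt_subset_cross H
  have hn : ∀ y ∈ bc.crossInt H, bc.cross H ∈ 𝓝 y := fun y hy =>
    mem_of_superset ((bc.isOpen_crossInt H).mem_nhds hy) hsub
  have hr := h.regular
  have hcont : JointlyContinuousOn T (bc.cross H) (Ioi 0) :=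
    hr.cont.mono (prod_mono le_rfl (prod_mono le_rfl Ioi_subset_Ici_self))
  exact
  { cont := hcont.strip hsub
    cont_t := hr.cont_t.strip hsub
    cont_x := hr.cont_x.strip hsub
    cont_y := hr.cont_y.strip hsub
    cont_xx := hr.cont_xx.strip hsub
    cont_yy := hr.cont_yy.strip hsub
    has_t := fun x y hy t ht => (hr.diff_t x y (hsub hy) t ht).hasDerivAt
    has_x := fun x y hy t ht => (hr.diff_x x y (hsub hy) t ht).hasDerivAt
    has_xx := fun x y hy t ht => (hr.diff_xx x y (hsub hy) t ht).hasDerivAt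
    has_y := fun x y hy t ht =>
      (hr.diff_y x y (hsub hy) t ht).hasDerivWithinAt.hasDerivAt (hn y hy)
    has_yy := fun x y hy t ht =>
      (hr.diff_yy x y (hsub hy) t ht).hasDerivWithinAt.hasDerivAt (hn y hy)
    range := fun x y hy t ht => h.range x y (hsub hy) t ht.le
    pde := fun x y hy t ht => h.pde x y (hsub hy) t ht }

lemma hasFDerivAt_of_partial {g gx gy : ℝ → ℝ → ℝ} {W : Set (ℝ × ℝ)} (hW : IsOpen W)
    (hx : ∀ z ∈ W, HasDerivAt (fun x => g x z.2) (gx z.1 z.2) z.1)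
    (hy : ∀ z ∈ W, HasDerivAt (fun y => g z.1 y) (gy z.1 z.2) z.2)
    (cx : ContinuousOn (fun z : ℝ × ℝ => gx z.1 z.2) W)
    (cy : ContinuousOn (fun z : ℝ × ℝ => gy z.1 z.2) W) {z : ℝ × ℝ} (hz : z ∈ W) :
    ∃ A : ℝ × ℝ →L[ℝ] ℝ, HasFDerivAt (fun z : ℝ × ℝ => g z.1 z.2) A z ∧
      ∀ a b, A (a, b) = gx z.1 z.2 * a + gy z.1 z.2 * b := by
  have hWn := hW.mem_nhds hz
  have key := hasStrictFDerivAt_uncurry_coprod (𝕜 := ℝ) (u := z) (f := g)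
    (f₁ := fun x y => ContinuousLinearMap.toSpanSingleton ℝ (gx x y))
    (f₂ := fun x y => ContinuousLinearMap.toSpanSingleton ℝ (gy x y))
    (by filter_upwards [hWn] with v hv using (hx v hv).hasFDerivAt)
    (by filter_upwards [hWn] with v hv using (hy v hv).hasFDerivAt)
    (((ContinuousLinearMap.toSpanSingletonCLE (𝕜 := ℝ) (E := ℝ)).continuous.continuousAt).comp
      (cx.continuousAt hWn))
    (((ContinuousLinearMap.toSpanSingletonCLE (𝕜 := ℝ) (E := ℝ)).continuous.continuousAt).comp
      (cy.continuousAt hWn))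
  refine ⟨_, key.hasFDerivAt, fun a b => ?_⟩
  simp [Function.HasUncurry.uncurry, mul_comm]

/-! ### The equation in tube coordinates -/

namespace Tube

/-- Derivative along `ρ` of a function with gradient `(Ax, Ay)`. -/
def dρ (D : Tube) (Ax Ay : ℝ → ℝ → ℝ → ℝ) (p : ℝ × ℝ) (t : ℝ) : ℝ :=
  Ax (D.X p.1 p.2) (D.Y p.1 p.2) t * D.Xρ p.1 p.2 + Ay (D.X p.1 p.2) (D.Y p.1 p.2) t * D.Yρ p.1 p.2

/-- Derivative along `θ` of a function with gradient `(Ax, Ay)`. -/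
def dθ (D : Tube) (Ax Ay : ℝ → ℝ → ℝ → ℝ) (p : ℝ × ℝ) (t : ℝ) : ℝ :=
  Ax (D.X p.1 p.2) (D.Y p.1 p.2) t * D.Xθ p.1 p.2 + Ay (D.X p.1 p.2) (D.Y p.1 p.2) t * D.Yθ p.1 p.2

lemma dρ_sq_le (D : Tube) (Ax Ay : ℝ → ℝ → ℝ → ℝ) (p : ℝ × ℝ) (t : ℝ) :
    D.dρ Ax Ay p t ^ 2 ≤ D.E₁ p.1 p.2 ^ 2 * (Ax (D.X p.1 p.2) (D.Y p.1 p.2) t ^ 2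
      + Ay (D.X p.1 p.2) (D.Y p.1 p.2) t ^ 2) := by
  rw [IsStreamTube.E₁_sq, dρ]
  nlinarith [sq_nonneg (Ax (D.X p.1 p.2) (D.Y p.1 p.2) t * D.Yρ p.1 p.2
    - Ay (D.X p.1 p.2) (D.Y p.1 p.2) t * D.Xρ p.1 p.2)]

lemma dθ_sq_le (D : Tube) (Ax Ay : ℝ → ℝ → ℝ → ℝ) (p : ℝ × ℝ) (t : ℝ) :
    D.dθ Ax Ay p t ^ 2 ≤ D.E₂ p.1 p.2 ^ 2 * (Ax (D.X p.1 p.2) (D.Y p.1 p.2) t ^ 2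
      + Ay (D.X p.1 p.2) (D.Y p.1 p.2) t ^ 2) := by
  rw [IsStreamTube.E₂_sq, dθ]
  nlinarith [sq_nonneg (Ax (D.X p.1 p.2) (D.Y p.1 p.2) t * D.Yθ p.1 p.2
    - Ay (D.X p.1 p.2) (D.Y p.1 p.2) t * D.Xθ p.1 p.2)]

namespace IsStreamTube

variable {bc : BC} {H K σ κ c : ℝ} {f : ℝ → ℝ} {u₁ u₂ : ℝ → ℝ → ℝ} {D : Tube}
  {T Tt Tx Ty Txx Tyy : ℝ → ℝ → ℝ → ℝ}

lemma continuousOn_comp (hD : D.IsStreamTube bc H u₁ u₂ K σ) (hK : 0 < K)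
    {A : ℝ → ℝ → ℝ → ℝ} (hA : ContinuousOn (fun z : (ℝ × ℝ) × ℝ => A z.1.1 z.1.2 z.2)
      ((univ ×ˢ bc.crossInt H) ×ˢ Ioi 0)) :
    ContinuousOn (fun z : (ℝ × ℝ) × ℝ => A (D.X z.1.1 z.1.2) (D.Y z.1.1 z.1.2) z.2)
      (D.coords ×ˢ Ioi 0) := by
  refine hA.comp (f := fun z : (ℝ × ℝ) × ℝ => (D.param z.1, z.2)) ?_
    fun z hz => ⟨hD.param_mem hK hz.1, hz.2⟩
  exact (hD.contDiffOn_param.continuousOn.comp continuousOn_fst fun z hz => hz.1).prodMk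
    continuousOn_snd

lemma continuousOn_coords {A : ℝ × ℝ → ℝ → ℝ} {s : Set (ℝ × ℝ)}
    (hA : ContinuousOn (fun z : (ℝ × ℝ) × ℝ => A z.1 z.2) (s ×ˢ Ioi 0)) {t : ℝ} (ht : 0 < t) :
    ContinuousOn (fun p => A p t) s :=
  hA.comp (f := fun p : ℝ × ℝ => (p, t)) (by fun_prop) fun _ hp => ⟨hp, ht⟩

lemma continuousOn_fst' {A : ℝ × ℝ → ℝ} {s : Set (ℝ × ℝ)} (hA : ContinuousOn A s) :
    ContinuousOn (fun z : (ℝ × ℝ) × ℝ => A z.1) (s ×ˢ Ioi 0) :=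
  hA.comp continuousOn_fst fun _ hz => hz.1

lemma continuousOn_dρ (hD : D.IsStreamTube bc H u₁ u₂ K σ) (hK : 0 < K)
    (hs : PlaneSol (bc.crossInt H) κ c f u₁ u₂ T Tt Tx Ty Txx Tyy) :
    ContinuousOn (fun z : (ℝ × ℝ) × ℝ => D.dρ Tx Ty z.1 z.2) (D.coords ×ˢ Ioi 0) :=
  ((hD.continuousOn_comp hK hs.cont_x).mul (continuousOn_fst' hD.contDiffOn_Xρ.continuousOn)).add
    ((hD.continuousOn_comp hK hs.cont_y).mul (continuousOn_fst' hD.contDiffOn_Yρ.continuousOn))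

lemma continuousOn_dθ (hD : D.IsStreamTube bc H u₁ u₂ K σ) (hK : 0 < K)
    (hs : PlaneSol (bc.crossInt H) κ c f u₁ u₂ T Tt Tx Ty Txx Tyy) :
    ContinuousOn (fun z : (ℝ × ℝ) × ℝ => D.dθ Tx Ty z.1 z.2) (D.coords ×ˢ Ioi 0) :=
  ((hD.continuousOn_comp hK hs.cont_x).mul (continuousOn_fst' hD.contDiffOn_Xθ.continuousOn)).add
    ((hD.continuousOn_comp hK hs.cont_y).mul (continuousOn_fst' hD.contDiffOn_Yθ.continuousOn))

lemma hasDerivAt_comp (hD : D.IsStreamTube bc H u₁ u₂ K σ) (hK : 0 < K)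
    (hs : PlaneSol (bc.crossInt H) κ c f u₁ u₂ T Tt Tx Ty Txx Tyy) {p : ℝ × ℝ} (hp : p ∈ D.coords)
    {t : ℝ} (ht : 0 < t) :
    HasDerivAt (fun r => T (D.X r p.2) (D.Y r p.2) t) (D.dρ Tx Ty p t) p.1 ∧
    HasDerivAt (fun s => T (D.X p.1 s) (D.Y p.1 s) t) (D.dθ Tx Ty p t) p.2 := by
  have htI : t ∈ Ioi (0 : ℝ) := ht
  obtain ⟨A, hA, hAe⟩ := hasFDerivAt_of_partial (g := fun x y => T x y t)
    (gx := fun x y => Tx x y t) (gy := fun x y => Ty x y t) (bc.isOpen_univ_prod_crossInt H)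
    (fun z hz => hs.has_x z.1 z.2 hz.2 t ht) (fun z hz => hs.has_y z.1 z.2 hz.2 t ht)
    (slice_continuousOn hs.cont_x htI) (slice_continuousOn hs.cont_y htI) (hD.param_mem hK hp)
  have hX := hD.differentiableAt_X hp
  have hY := hD.differentiableAt_Y hp
  obtain ⟨a1, a2⟩ := partial_eq_fderiv hX
  obtain ⟨b1, b2⟩ := partial_eq_fderiv hY
  rw [(hasFDerivAt_partial hX).1] at a1
  rw [(hasFDerivAt_partial hX).2] at a2
  rw [(hasFDerivAt_partial hY).1] at b1
  rw [(hasFDerivAt_partial hY).2] at b2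
  have c1 := hA.comp_hasDerivAt p.1 (a1.prodMk b1)
  have c2 := hA.comp_hasDerivAt p.2 (a2.prodMk b2)
  rw [hAe] at c1 c2
  exact ⟨c1, c2⟩

/-- The weak form of the equation in the coordinates of the tube. -/
lemma coord_weak (hD : D.IsStreamTube bc H u₁ u₂ K σ) (hK : 0 < K) (hσ : σ ^ 2 = 1)
    (hu : IsFlow bc H u₁ u₂)
    (hs : PlaneSol (bc.crossInt H) κ c f u₁ u₂ T Tt Tx Ty Txx Tyy) {k : Set (ℝ × ℝ)}
    (hk : IsCompact k) (hkD : k ⊆ D.coords) {g gρ gθ : ℝ × ℝ → ℝ}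
    (hg : ∀ p, HasFDerivAt g (gρ p • ContinuousLinearMap.fst ℝ ℝ ℝ
      + gθ p • ContinuousLinearMap.snd ℝ ℝ ℝ) p) (cρ : Continuous gρ) (cθ : Continuous gθ)
    (hz : ∀ p ∉ k, g p = 0 ∧ gρ p = 0 ∧ gθ p = 0) {t : ℝ} (ht : 0 < t) :
    ∫ p in k, D.E₁ p.1 p.2 * D.E₂ p.1 p.2 * (g p * Tt (D.X p.1 p.2) (D.Y p.1 p.2) t)
      = ∫ p in k, (-(κ * (D.ω p.1 p.2 * gρ p * D.dρ Tx Ty p t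
            + (D.ω p.1 p.2)⁻¹ * gθ p * D.dθ Tx Ty p t))
          + σ * D.flux u₁ u₂ p.1 p.2 * gθ p * T (D.X p.1 p.2) (D.Y p.1 p.2) t
          + c * (D.E₁ p.1 p.2 * D.E₂ p.1 p.2 * g p * f (T (D.X p.1 p.2) (D.Y p.1 p.2) t))) := by
  have htI : t ∈ Ioi (0 : ℝ) := ht
  have cg : Continuous g := continuous_iff_continuousAt.2 fun p => (hg p).continuousAt
  have hΓc : ContinuousOn D.param k := hD.contDiffOn_param.continuousOn.mono hkD
  have hki : IsCompact (D.param '' k) := hk.image_of_continuousOn hΓc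
  have hkm := hk.measurableSet
  -- the test function in the plane
  set V := D.param '' D.coords with hV
  set ψ : ℝ × ℝ → ℝ := V.indicator fun z => g (inv D z) with hψ
  set ψx : ℝ × ℝ → ℝ := V.indicator fun z => gρ (inv D z) *
    (D.Xρ (inv D z).1 (inv D z).2 / D.E₁ (inv D z).1 (inv D z).2 ^ 2) + gθ (inv D z) *
    (D.Xθ (inv D z).1 (inv D z).2 / D.E₂ (inv D z).1 (inv D z).2 ^ 2) with hψx
  set ψy : ℝ × ℝ → ℝ := V.indicator fun z => gρ (inv D z) *
    (D.Yρ (inv D z).1 (inv D z).2 / D.E₁ (inv D z).1 (inv D z).2 ^ 2) + gθ (inv D z) *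
    (D.Yθ (inv D z).1 (inv D z).2 / D.E₂ (inv D z).1 (inv D z).2 ^ 2) with hψy
  have vψ : ∀ p ∈ D.coords, ψ (D.param p) = g p := fun p hp => by
    rw [hψ, indicator_of_mem (mem_image_of_mem _ hp), hD.inv_param hp]
  have vψx : ∀ p ∈ D.coords, ψx (D.param p) = gρ p * (D.Xρ p.1 p.2 / D.E₁ p.1 p.2 ^ 2)
      + gθ p * (D.Xθ p.1 p.2 / D.E₂ p.1 p.2 ^ 2) := fun p hp => by
    rw [hψx, indicator_of_mem (mem_image_of_mem _ hp), hD.inv_param hp]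
  have vψy : ∀ p ∈ D.coords, ψy (D.param p) = gρ p * (D.Yρ p.1 p.2 / D.E₁ p.1 p.2 ^ 2)
      + gθ p * (D.Yθ p.1 p.2 / D.E₂ p.1 p.2 ^ 2) := fun p hp => by
    rw [hψy, indicator_of_mem (mem_image_of_mem _ hp), hD.inv_param hp]
  -- The test function and its derivatives vanish off `k`, so extension by zero from the tube to the
  -- plane is legitimate for the integrations by parts.
  have hoff : ∀ z ∉ D.param '' k, ψ z = 0 ∧ ψx z = 0 ∧ ψy z = 0 := fun z hzk => by
    by_cases hzV : z ∈ V
    · obtain ⟨p, hp, rfl⟩ := hzV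
      have hpk : p ∉ k := fun h => hzk (mem_image_of_mem _ h)
      obtain ⟨z1, z2, z3⟩ := hz p hpk
      rw [vψ p hp, vψx p hp, vψy p hp, z1, z2, z3]
      simp
    · simp [hψ, hψx, hψy, hzV]
  have hVo : IsOpen V := hD.isOpen_image hK
  have cinv : ContinuousOn (inv D) V := by
    rintro _ ⟨p, hp, rfl⟩
    exact (hD.continuousAt_inv hK hp).continuousWithinAt
  have minv : MapsTo (inv D) V D.coords := by
    rintro _ ⟨p, hp, rfl⟩
    rw [hD.inv_param hp]; exact hp
  have comp : ∀ {A : ℝ × ℝ → ℝ}, ContinuousOn A D.coords →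
      ContinuousOn (fun z => A (inv D z)) (D.param '' k) := fun hA =>
    (hA.comp cinv minv).mono (image_mono hkD)
  have hE1 : ∀ p ∈ D.coords, D.E₁ p.1 p.2 ^ 2 ≠ 0 := fun p hp => (pow_pos (hD.E₁_pos hK hp) 2).ne'
  have hE2 : ∀ p ∈ D.coords, D.E₂ p.1 p.2 ^ 2 ≠ 0 := fun p hp => (pow_pos (hD.E₂_pos hK hp) 2).ne'
  have cE1 := (hD.contDiffOn_E₁ hK).continuousOn
  have cE2 := (hD.contDiffOn_E₂ hK).continuousOn
  have cXρ := hD.contDiffOn_Xρ.continuousOn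
  have cYρ := hD.contDiffOn_Yρ.continuousOn
  have cXθ := hD.contDiffOn_Xθ.continuousOn
  have cYθ := hD.contDiffOn_Yθ.continuousOn
  have cψ : ContinuousOn ψ (D.param '' k) :=
    (comp cg.continuousOn).congr fun z hz => indicator_of_mem (image_mono hkD hz) _
  have cψx : ContinuousOn ψx (D.param '' k) :=
    (comp (((cρ.continuousOn).mul (cXρ.div (cE1.pow 2) hE1)).add
      ((cθ.continuousOn).mul (cXθ.div (cE2.pow 2) hE2)))).congr
      fun z hz => indicator_of_mem (image_mono hkD hz) _
  have cψy : ContinuousOn ψy (D.param '' k) :=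
    (comp (((cρ.continuousOn).mul (cYρ.div (cE1.pow 2) hE1)).add
      ((cθ.continuousOn).mul (cYθ.div (cE2.pow 2) hE2)))).congr
      fun z hz => indicator_of_mem (image_mono hkD hz) _
  have hWk : D.param '' k ⊆ univ ×ˢ bc.crossInt H := by
    rintro _ ⟨p, hp, rfl⟩
    exact hD.param_mem hK (hkD hp)
  have dψ : ∀ z ∈ D.param '' k, HasDerivAt (fun x => ψ (x, z.2)) (ψx z) z.1 ∧
      HasDerivAt (fun y => ψ (z.1, y)) (ψy z) z.2 := by
    rintro _ ⟨p, hp, rfl⟩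
    obtain ⟨A, hA, hA1, hA2⟩ := hD.hasFDerivAt_inv hK (hkD hp)
    have hgi : HasFDerivAt g (gρ p • ContinuousLinearMap.fst ℝ ℝ ℝ
      + gθ p • ContinuousLinearMap.snd ℝ ℝ ℝ) (inv D (D.param p)) := by
      rw [hD.inv_param (hkD hp)]; exact hg p
    have hcomp := hgi.comp (D.param p) hA
    have hψd : HasFDerivAt ψ ((gρ p • ContinuousLinearMap.fst ℝ ℝ ℝ
      + gθ p • ContinuousLinearMap.snd ℝ ℝ ℝ).comp A) (D.param p) := by
      refine hcomp.congr_of_eventuallyEq ?_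
      filter_upwards [hVo.mem_nhds (mem_image_of_mem _ (hkD hp))] with z hz
      exact indicator_of_mem hz _
    have ex : HasDerivAt (fun x : ℝ => (x, (D.param p).2)) ((1 : ℝ), (0 : ℝ)) (D.param p).1 :=
      (hasDerivAt_id _).prodMk (hasDerivAt_const _ _)
    have ey : HasDerivAt (fun y : ℝ => ((D.param p).1, y)) ((0 : ℝ), (1 : ℝ)) (D.param p).2 :=
      (hasDerivAt_const _ _).prodMk (hasDerivAt_id _)
    have dx' := hψd.comp_hasDerivAt (D.param p).1 ex
    have dy' := hψd.comp_hasDerivAt (D.param p).2 ey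
    rw [ContinuousLinearMap.comp_apply, hA1] at dx'
    rw [ContinuousLinearMap.comp_apply, hA2] at dy'
    rw [vψx p (hkD hp), vψy p (hkD hp)]
    exact ⟨dx'.congr_deriv (by simp), dy'.congr_deriv (by simp)⟩
  -- integration by parts in the plane
  have c1 := (slice_continuousOn hs.cont_x htI).mono hWk
  have c2 := (slice_continuousOn hs.cont_y htI).mono hWk
  have c11 := (slice_continuousOn hs.cont_xx htI).mono hWk
  have c22 := (slice_continuousOn hs.cont_yy htI).mono hWk
  have hev : ∀ z ∉ D.param '' k, ∀ᶠ w in 𝓝 z, ψ w = 0 := fun z hz => by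
    filter_upwards [hki.isClosed.isOpen_compl.mem_nhds hz] with w hw using (hoff w hw).1
  have ix : ∫ z, (ψx z * Tx z.1 z.2 t + ψ z * Txx z.1 z.2 t) = 0 := by
    refine integral_plane_dx (F := fun z => ψ z * Tx z.1 z.2 t) hki (fun z => ?_)
      ((cψx.mul c1).add (cψ.mul c11)) fun z hz => by simp [hoff z hz]
    by_cases hzk : z ∈ D.param '' k
    · exact (dψ z hzk).1.mul (hs.has_xx z.1 z.2 (hWk hzk).2 t ht)
    · obtain ⟨z1, z2, -⟩ := hoff z hzk
      rw [z1, z2, zero_mul, zero_mul, add_zero]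
      refine (hasDerivAt_const z.1 (0 : ℝ)).congr_of_eventuallyEq ?_
      have hcont : Tendsto (fun x : ℝ => (x, z.2)) (𝓝 z.1) (𝓝 z) :=
        Continuous.tendsto' (by fun_prop) _ _ rfl
      filter_upwards [hcont.eventually (hev z hzk)] with x hx
      rw [hx, zero_mul]
  have iy : ∫ z, (ψy z * Ty z.1 z.2 t + ψ z * Tyy z.1 z.2 t) = 0 := by
    refine integral_plane_dy (F := fun z => ψ z * Ty z.1 z.2 t) hki (fun z => ?_)
      ((cψy.mul c2).add (cψ.mul c22)) fun z hz => by simp [hoff z hz]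
    by_cases hzk : z ∈ D.param '' k
    · exact (dψ z hzk).2.mul (hs.has_yy z.1 z.2 (hWk hzk).2 t ht)
    · obtain ⟨z1, -, z2⟩ := hoff z hzk
      rw [z1, z2, zero_mul, zero_mul, add_zero]
      refine (hasDerivAt_const z.2 (0 : ℝ)).congr_of_eventuallyEq ?_
      have hcont : Tendsto (fun y : ℝ => (z.1, y)) (𝓝 z.2) (𝓝 z) :=
        Continuous.tendsto' (by fun_prop) _ _ rfl
      filter_upwards [hcont.eventually (hev z hzk)] with x hx
      rw [hx, zero_mul]
  rw [← setIntegral_eq_integral_of_forall_compl_eq_zero (s := D.param '' k)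
    (fun z hz => by simp [hoff z hz]), hD.integral_image hK hkm hkD] at ix iy
  -- transport
  have kT : ContinuousOn (fun p : ℝ × ℝ => T (D.X p.1 p.2) (D.Y p.1 p.2) t) k :=
    (continuousOn_coords (hD.continuousOn_comp hK hs.cont) ht).mono hkD
  have kTt : ContinuousOn (fun p : ℝ × ℝ => Tt (D.X p.1 p.2) (D.Y p.1 p.2) t) k :=
    (continuousOn_coords (hD.continuousOn_comp hK hs.cont_t) ht).mono hkD
  have kρ : ContinuousOn (fun p : ℝ × ℝ => D.dρ Tx Ty p t) k :=
    (continuousOn_coords (hD.continuousOn_dρ hK hs) ht).mono hkD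
  have kθ : ContinuousOn (fun p : ℝ × ℝ => D.dθ Tx Ty p t) k :=
    (continuousOn_coords (hD.continuousOn_dθ hK hs) ht).mono hkD
  have kF := (hD.continuousOn_flux hK hu).mono hkD
  have kω := (hD.contDiffOn_ω hK).continuousOn.mono hkD
  have kω' : ContinuousOn (fun p : ℝ × ℝ => (D.ω p.1 p.2)⁻¹) k := kω.inv₀ fun p hp =>
    (div_pos (hD.E₂_pos hK (hkD hp)) (hD.E₁_pos hK (hkD hp))).ne'
  have kE1 := cE1.mono hkD
  have kE2 := cE2.mono hkD
  have it : ∫ z, (D.flux u₁ u₂ z.1 z.2 * (gθ z * T (D.X z.1 z.2) (D.Y z.1 z.2) t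
      + g z * D.dθ Tx Ty z t)) = 0 := by
    refine integral_plane_dy (F := fun z => D.flux u₁ u₂ z.1 z.2 *
      (g z * T (D.X z.1 z.2) (D.Y z.1 z.2) t)) hk (fun z => ?_)
      (kF.mul ((cθ.continuousOn.mul kT).add (cg.continuousOn.mul kθ)))
      fun z hzk => by simp [hz z hzk]
    by_cases hzk : z ∈ k
    · have ey : HasDerivAt (fun y : ℝ => (z.1, y)) ((0 : ℝ), (1 : ℝ)) z.2 :=
        (hasDerivAt_const _ _).prodMk (hasDerivAt_id _)
      have hgθ : HasDerivAt (fun y => g (z.1, y)) (gθ z) z.2 :=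
        ((hg z).comp_hasDerivAt z.2 ey).congr_deriv (by simp)
      have h1 := (hgθ.mul (hD.hasDerivAt_comp hK hs (hkD hzk) ht).2).const_mul
        (D.flux u₁ u₂ z.1 z.2)
      -- As the flux density is constant in `θ`, the derivative falls only on the test function and
      -- on `T`.
      have h2 : (fun y => D.flux u₁ u₂ z.1 y * (g (z.1, y) * T (D.X z.1 y) (D.Y z.1 y) t))
          = fun y => D.flux u₁ u₂ z.1 z.2 * (g (z.1, y) * T (D.X z.1 y) (D.Y z.1 y) t) :=
        funext fun y => by rw [hD.flux_eq hK hu (hkD hzk).1 y z.2]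
      change HasDerivAt (fun y => D.flux u₁ u₂ z.1 y * (g (z.1, y) * T (D.X z.1 y) (D.Y z.1 y) t))
        _ _
      rw [h2]
      exact h1
    · obtain ⟨z1, -, z2⟩ := hz z hzk
      rw [z1, z2, zero_mul, zero_mul, add_zero, mul_zero]
      refine (hasDerivAt_const z.2 (0 : ℝ)).congr_of_eventuallyEq ?_
      have hcont : Tendsto (fun y : ℝ => (z.1, y)) (𝓝 z.2) (𝓝 z) :=
        Continuous.tendsto' (by fun_prop) _ _ rfl
      filter_upwards [hcont.eventually (hk.isClosed.isOpen_compl.mem_nhds hzk)] with y hy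
      rw [(hz _ hy).1, zero_mul, mul_zero]
  rw [← setIntegral_eq_integral_of_forall_compl_eq_zero (s := k)
    (fun z hzk => by simp [hz z hzk])] at it
  -- combination
  have hWk' : MapsTo D.param k (univ ×ˢ bc.crossInt H) := fun p hp => hD.param_mem hK (hkD hp)
  have jx : IntegrableOn (fun p => D.E₁ p.1 p.2 * D.E₂ p.1 p.2 * (ψx (D.param p) *
      Tx (D.param p).1 (D.param p).2 t + ψ (D.param p) * Txx (D.param p).1 (D.param p).2 t)) k :=
    ((kE1.mul kE2).mul (((cψx.mul c1).add (cψ.mul c11)).comp hΓc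
      (mapsTo_image _ _))).integrableOn_compact hk
  have jy : IntegrableOn (fun p => D.E₁ p.1 p.2 * D.E₂ p.1 p.2 * (ψy (D.param p) *
      Ty (D.param p).1 (D.param p).2 t + ψ (D.param p) * Tyy (D.param p).1 (D.param p).2 t)) k :=
    ((kE1.mul kE2).mul (((cψy.mul c2).add (cψ.mul c22)).comp hΓc
      (mapsTo_image _ _))).integrableOn_compact hk
  have jt : IntegrableOn (fun z : ℝ × ℝ => D.flux u₁ u₂ z.1 z.2 *
      (gθ z * T (D.X z.1 z.2) (D.Y z.1 z.2) t + g z * D.dθ Tx Ty z t)) k :=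
    (kF.mul ((cθ.continuousOn.mul kT).add (cg.continuousOn.mul kθ))).integrableOn_compact hk
  have jl : IntegrableOn (fun p : ℝ × ℝ => D.E₁ p.1 p.2 * D.E₂ p.1 p.2 *
      (g p * Tt (D.X p.1 p.2) (D.Y p.1 p.2) t)) k :=
    ((kE1.mul kE2).mul (cg.continuousOn.mul kTt)).integrableOn_compact hk
  have e : ∀ p ∈ k, (-(κ * (D.ω p.1 p.2 * gρ p * D.dρ Tx Ty p t
            + (D.ω p.1 p.2)⁻¹ * gθ p * D.dθ Tx Ty p t))
          + σ * D.flux u₁ u₂ p.1 p.2 * gθ p * T (D.X p.1 p.2) (D.Y p.1 p.2) t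
          + c * (D.E₁ p.1 p.2 * D.E₂ p.1 p.2 * g p * f (T (D.X p.1 p.2) (D.Y p.1 p.2) t)))
      = (D.E₁ p.1 p.2 * D.E₂ p.1 p.2 * (g p * Tt (D.X p.1 p.2) (D.Y p.1 p.2) t)
        + σ * (D.flux u₁ u₂ p.1 p.2 * (gθ p * T (D.X p.1 p.2) (D.Y p.1 p.2) t
          + g p * D.dθ Tx Ty p t)))
        - (κ * (D.E₁ p.1 p.2 * D.E₂ p.1 p.2 * (ψx (D.param p) * Tx (D.param p).1 (D.param p).2 t
          + ψ (D.param p) * Txx (D.param p).1 (D.param p).2 t))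
          + κ * (D.E₁ p.1 p.2 * D.E₂ p.1 p.2 * (ψy (D.param p) * Ty (D.param p).1 (D.param p).2 t
          + ψ (D.param p) * Tyy (D.param p).1 (D.param p).2 t))) := by
    intro p hp
    have hpD := hkD hp
    rw [vψ p hpD, vψx p hpD, vψy p hpD]
    have htr := hD.transport_eq hK hσ hpD (Tx (D.X p.1 p.2) (D.Y p.1 p.2) t)
      (Ty (D.X p.1 p.2) (D.Y p.1 p.2) t)
    have hpde := hs.pde (D.X p.1 p.2) (D.Y p.1 p.2) (hWk' hp).2 t ht
    have q1 := hD.E₁_pos hK hpD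
    have q2 := hD.E₂_pos hK hpD
    -- The Jacobian `E₁ E₂` divided by `E₁²` and by `E₂²` gives the weights `ω` and `ω⁻¹` of the two
    -- directions of diffusion.
    have e1 : D.E₁ p.1 p.2 * D.E₂ p.1 p.2 * ((gρ p * (D.Xρ p.1 p.2 / D.E₁ p.1 p.2 ^ 2)
        + gθ p * (D.Xθ p.1 p.2 / D.E₂ p.1 p.2 ^ 2)) * Tx (D.X p.1 p.2) (D.Y p.1 p.2) t
        + (gρ p * (D.Yρ p.1 p.2 / D.E₁ p.1 p.2 ^ 2)
        + gθ p * (D.Yθ p.1 p.2 / D.E₂ p.1 p.2 ^ 2)) * Ty (D.X p.1 p.2) (D.Y p.1 p.2) t)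
        = D.ω p.1 p.2 * gρ p * D.dρ Tx Ty p t + (D.ω p.1 p.2)⁻¹ * gθ p * D.dθ Tx Ty p t := by
      unfold ω dρ dθ
      field_simp
      ring
    rw [← e1]
    simp only [param, dθ]
    linear_combination g p * htr - D.E₁ p.1 p.2 * D.E₂ p.1 p.2 * g p * hpde
  rw [setIntegral_congr_fun hkm e]
  have es := integral_sub (jl.add (jt.const_mul σ)) ((jx.const_mul κ).add (jy.const_mul κ))
  simp only [Pi.add_apply] at es
  rw [es, integral_add jl (jt.const_mul σ), integral_add (jx.const_mul κ) (jy.const_mul κ),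
    integral_const_mul, integral_const_mul, integral_const_mul, ix, iy, it]
  ring

end IsStreamTube

end Tube

/-! ### Diffusion across a tube -/

namespace Tube

/-- The compact coordinate rectangle `|ρ - c| ≤ h'`, `|θ| ≤ m`. -/
def rect (D : Tube) (h' m : ℝ) : Set (ℝ × ℝ) := Icc (D.c - h') (D.c + h') ×ˢ Icc (-m) m

lemma isCompact_rect (D : Tube) (h' m : ℝ) : IsCompact (D.rect h' m) := isCompact_Icc.prod isCompact_Icc

lemma rect_subset_coords {D : Tube} {h' : ℝ} (hh : h' < D.h) (m : ℝ) : D.rect h' m ⊆ D.coords :=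
  prod_mono (fun ρ hρ => ⟨by linarith [hρ.1], by linarith [hρ.2]⟩) (subset_univ _)

lemma restrict_rect (D : Tube) (h' m : ℝ) : (volume : Measure (ℝ × ℝ)).restrict (D.rect h' m)
    = (volume.restrict (Icc (D.c - h') (D.c + h'))).prod (volume.restrict (Icc (-m) m)) :=
  (Measure.prod_restrict _ _).symm

/-- The cutoff kernel on the tube. -/
def testFn (D : Tube) (h' R : ℝ) (χ : ℝ → ℝ) (p : ℝ × ℝ) : ℝ := G h' (p.1 - D.c) * χ (p.2 / R)

namespace IsStreamTube

variable {bc : BC} {H K σ κ c : ℝ} {f : ℝ → ℝ} {u₁ u₂ : ℝ → ℝ → ℝ} {D : Tube}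
  {T Tt Tx Ty Txx Tyy : ℝ → ℝ → ℝ → ℝ}

lemma ω_pos (hD : D.IsStreamTube bc H u₁ u₂ K σ) (hK : 0 < K) {p : ℝ × ℝ} (hp : p ∈ D.coords) :
    0 < D.ω p.1 p.2 := div_pos (hD.E₂_pos hK hp) (hD.E₁_pos hK hp)

lemma hasDerivAt_ω (hD : D.IsStreamTube bc H u₁ u₂ K σ) (hK : 0 < K) {p : ℝ × ℝ}
    (hp : p ∈ D.coords) : HasDerivAt (fun r => D.ω r p.2) (deriv (fun r => D.ω r p.2) p.1) p.1 :=
  (partial_eq_fderiv (((hD.contDiffOn_ω hK).contDiffAt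
    (D.isOpen_coords.mem_nhds hp)).differentiableAt (by norm_num))).1.differentiableAt.hasDerivAt

lemma continuousOn_deriv_ω (hD : D.IsStreamTube bc H u₁ u₂ K σ) (hK : 0 < K) :
    ContinuousOn (fun p : ℝ × ℝ => deriv (fun r => D.ω r p.2) p.1) D.coords := by
  refine (hasDerivAt_partial D.isOpen_coords (hD.contDiffOn_ω hK)).2.2.1.congr fun p hp => ?_
  exact ((hasDerivAt_partial D.isOpen_coords (hD.contDiffOn_ω hK)).1 p hp).deriv

/-- Integration by parts in `ρ` against the part `S(T)`, `S(s) = s (1 - s) (1 - 2 s)`. -/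
lemma integral_parts_ρ (hD : D.IsStreamTube bc H u₁ u₂ K σ) (hK : 0 < K)
    (hs : PlaneSol (bc.crossInt H) κ c f u₁ u₂ T Tt Tx Ty Txx Tyy) {h' m t : ℝ} (hh : 0 < h')
    (hh' : h' < D.h) (ht : 0 < t) {b : ℝ → ℝ} (cb : Continuous b) :
    IntegrableOn (fun p : ℝ × ℝ =>
      D.ω p.1 p.2 * (Gd h' (p.1 - D.c) * b p.2) * ((1 - 6 * (T (D.X p.1 p.2) (D.Y p.1 p.2) t *
        (1 - T (D.X p.1 p.2) (D.Y p.1 p.2) t))) * D.dρ Tx Ty p t)) (D.rect h' m) ∧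
    IntegrableOn (fun p : ℝ × ℝ => (deriv (fun r => D.ω r p.2) p.1 * Gd h' (p.1 - D.c)
        + D.ω p.1 p.2 * Gdd h' (p.1 - D.c)) * b p.2 *
        (T (D.X p.1 p.2) (D.Y p.1 p.2) t * (1 - T (D.X p.1 p.2) (D.Y p.1 p.2) t) *
          (1 - 2 * T (D.X p.1 p.2) (D.Y p.1 p.2) t))) (D.rect h' m) ∧
    ∫ p in D.rect h' m,
      D.ω p.1 p.2 * (Gd h' (p.1 - D.c) * b p.2) * ((1 - 6 * (T (D.X p.1 p.2) (D.Y p.1 p.2) t *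
        (1 - T (D.X p.1 p.2) (D.Y p.1 p.2) t))) * D.dρ Tx Ty p t)
    = -∫ p in D.rect h' m, (deriv (fun r => D.ω r p.2) p.1 * Gd h' (p.1 - D.c)
        + D.ω p.1 p.2 * Gdd h' (p.1 - D.c)) * b p.2 *
        (T (D.X p.1 p.2) (D.Y p.1 p.2) t * (1 - T (D.X p.1 p.2) (D.Y p.1 p.2) t) *
          (1 - 2 * T (D.X p.1 p.2) (D.Y p.1 p.2) t)) := by
  have hkD := rect_subset_coords hh' m
  have hk := D.isCompact_rect h' m
  set τ : ℝ × ℝ → ℝ := fun p => T (D.X p.1 p.2) (D.Y p.1 p.2) t with hτ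
  have kT : ContinuousOn τ D.coords := continuousOn_coords (hD.continuousOn_comp hK hs.cont) ht
  have kρ : ContinuousOn (fun p : ℝ × ℝ => D.dρ Tx Ty p t) D.coords :=
    continuousOn_coords (hD.continuousOn_dρ hK hs) ht
  have kω := (hD.contDiffOn_ω hK).continuousOn
  have kω' := hD.continuousOn_deriv_ω hK
  have kG : Continuous fun p : ℝ × ℝ => Gd h' (p.1 - D.c) :=
    (continuous_Gd h').comp (by fun_prop)
  have kb : Continuous fun p : ℝ × ℝ => b p.2 := cb.comp continuous_snd
  have Sc : Continuous fun s : ℝ => s * (1 - s) * (1 - 2 * s) := by fun_prop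
  have Sc' : Continuous fun s : ℝ => 1 - 6 * (s * (1 - s)) := by fun_prop
  have kS := Sc.comp_continuousOn' kT
  have kS' := Sc'.comp_continuousOn' kT
  have hSd : ∀ s : ℝ, HasDerivAt (fun s : ℝ => s * (1 - s) * (1 - 2 * s))
      (1 - 6 * (s * (1 - s))) s := fun s =>
    ((((hasDerivAt_id s).mul ((hasDerivAt_id s).const_sub 1)).mul
      (((hasDerivAt_id s).const_mul 2).const_sub 1))).congr_deriv (by
        simp only [id, Pi.mul_apply]; ring)
  have i1 : IntegrableOn (fun p : ℝ × ℝ => D.ω p.1 p.2 * (Gd h' (p.1 - D.c) * b p.2) *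
      ((1 - 6 * (τ p * (1 - τ p))) * D.dρ Tx Ty p t)) (D.rect h' m) :=
    (((kω.mul (kG.continuousOn.mul kb.continuousOn)).mul (kS'.mul kρ)).mono
      hkD).integrableOn_compact hk
  have i2a : IntegrableOn (fun p : ℝ × ℝ => (deriv (fun r => D.ω r p.2) p.1 * Gd h' (p.1 - D.c))
      * b p.2 * (τ p * (1 - τ p) * (1 - 2 * τ p))) (D.rect h' m) :=
    ((((kω'.mul kG.continuousOn).mul kb.continuousOn).mul kS).mono hkD).integrableOn_compact hk
  -- The second derivative of the kernel jumps at the knots; it enters only as a bounded measurable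
  -- factor.
  have i2b : IntegrableOn (fun p : ℝ × ℝ => Gdd h' (p.1 - D.c) * (D.ω p.1 p.2 * b p.2 *
      (τ p * (1 - τ p) * (1 - 2 * τ p)))) (D.rect h' m) := by
    refine Integrable.bdd_mul (c := 1) (f := fun p : ℝ × ℝ => Gdd h' (p.1 - D.c)) ?_ ?_ ?_
    · exact ((((kω.mul kb.continuousOn).mul kS).mono hkD).integrableOn_compact hk)
    · exact ((measurable_Gdd h').comp (measurable_fst.sub_const _)).aestronglyMeasurable
    · exact Eventually.of_forall fun p => by rw [Real.norm_eq_abs]; exact abs_Gdd_le _ _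
  have i2 : IntegrableOn (fun p : ℝ × ℝ => (deriv (fun r => D.ω r p.2) p.1 * Gd h' (p.1 - D.c)
        + D.ω p.1 p.2 * Gdd h' (p.1 - D.c)) * b p.2 * (τ p * (1 - τ p) * (1 - 2 * τ p)))
        (D.rect h' m) := by
    refine (i2a.add i2b).congr (Eventually.of_forall fun p => ?_)
    simp only [Pi.add_apply]
    ring
  refine ⟨i1, i2, ?_⟩
  rw [eq_neg_iff_add_eq_zero, ← integral_add i1 i2]
  have i12 : IntegrableOn (fun p : ℝ × ℝ => D.ω p.1 p.2 * (Gd h' (p.1 - D.c) * b p.2) *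
      ((1 - 6 * (τ p * (1 - τ p))) * D.dρ Tx Ty p t) + (deriv (fun r => D.ω r p.2) p.1 *
        Gd h' (p.1 - D.c) + D.ω p.1 p.2 * Gdd h' (p.1 - D.c)) * b p.2 *
        (τ p * (1 - τ p) * (1 - 2 * τ p))) (D.rect h' m) := i1.add i2
  rw [IntegrableOn, restrict_rect] at i12
  rw [restrict_rect, integral_prod_symm _ i12]
  refine integral_eq_zero_of_ae ?_
  filter_upwards [i12.prod_left_ae] with θ hθ
  set F : ℝ → ℝ := fun r => D.ω r θ * (Gd h' (r - D.c) * b θ) *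
    (τ (r, θ) * (1 - τ (r, θ)) * (1 - 2 * τ (r, θ))) with hF
  set F' : ℝ → ℝ := fun r => D.ω r θ * (Gd h' (r - D.c) * b θ) *
      ((1 - 6 * (τ (r, θ) * (1 - τ (r, θ)))) * D.dρ Tx Ty (r, θ) t)
      + (deriv (fun r => D.ω r θ) r * Gd h' (r - D.c) + D.ω r θ * Gdd h' (r - D.c)) * b θ *
        (τ (r, θ) * (1 - τ (r, θ)) * (1 - 2 * τ (r, θ))) with hF'
  have hle : D.c - h' ≤ D.c + h' := by linarith
  have hmem : ∀ r ∈ Icc (D.c - h') (D.c + h'), (r, θ) ∈ D.coords := fun r hr =>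
    ⟨⟨by linarith [hr.1], by linarith [hr.2]⟩, mem_univ _⟩
  have hsl : ∀ {A : ℝ × ℝ → ℝ}, ContinuousOn A D.coords →
      ContinuousOn (fun r => A (r, θ)) (Icc (D.c - h') (D.c + h')) := fun hA =>
    hA.comp (f := fun r : ℝ => (r, θ)) (by fun_prop) fun r hr => hmem r hr
  have hFc : ContinuousOn F (Icc (D.c - h') (D.c + h')) :=
    hsl ((kω.mul (kG.continuousOn.mul kb.continuousOn)).mul kS)
  -- The fundamental theorem of calculus holds for a continuous function differentiable off a
  -- countable set, here the four knots of the kernel.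
  have hzero : ∫ r in (D.c - h')..(D.c + h'), F' r = F (D.c + h') - F (D.c - h') := by
    refine integral_eq_of_hasDerivAt_off_countable_of_le F F' hle
      (s := {D.c - h', D.c - h' / 2, D.c + h' / 2, D.c + h'}) (by simp) hFc ?_ ?_
    · rintro r ⟨hr, hrs⟩
      simp only [mem_insert_iff, mem_singleton_iff, not_or] at hrs
      obtain ⟨n1, n2, n3, n4⟩ := hrs
      have hp := hmem r (Ioo_subset_Icc_self hr)
      have d1 := hD.hasDerivAt_ω hK hp
      have d2 : HasDerivAt (fun r => Gd h' (r - D.c)) (Gdd h' (r - D.c)) r :=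
        (hasDerivAt_Gd hh (ξ := r - D.c) (fun h => n1 (by linarith)) (fun h => n2 (by linarith))
          (fun h => n3 (by linarith)) (fun h => n4 (by linarith))).comp_sub_const r D.c
      have d3 := (hSd (τ (r, θ))).comp r (hD.hasDerivAt_comp hK hs hp ht).1
      refine ((d1.mul (d2.mul_const (b θ))).mul d3).congr_deriv ?_
      simp only [hF', Pi.mul_apply, Function.comp_apply, hτ]
      ring
    · rw [intervalIntegrable_iff_integrableOn_Icc_of_le hle]
      exact hθ
  have e : ∫ r in Icc (D.c - h') (D.c + h'), F' r = 0 := by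
    rw [integral_Icc_eq_integral_Ioc, ← intervalIntegral.integral_of_le hle, hzero, hF]
    have z1 : Gd h' (D.c + h' - D.c) = 0 := Gd_zero hh (by
      rw [add_sub_cancel_left]; exact le_abs_self _)
    have z2 : Gd h' (D.c - h' - D.c) = 0 := Gd_zero hh (by
      rw [show D.c - h' - D.c = -h' by ring, abs_neg]; exact le_abs_self _)
    simp only [z1, z2]
    ring
  exact e

/-- Insert `1 = (1 - 6q) + 6q` with `q = T (1 - T)`. The first part times `T_ρ` is the derivative of
`S(T)`, and integration by parts moves it onto `ω G'`; since `|S(T)| ≤ q`, only `q` remains. The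
second part is `q |T_ρ|` with coefficient `6 · K · h/2`. Both are controlled by the energy density,
unlike `|T_ρ|` itself. -/
lemma diffusion_ρ_le (hD : D.IsStreamTube bc H u₁ u₂ K σ) (hK : 0 < K)
    (hs : PlaneSol (bc.crossInt H) κ c f u₁ u₂ T Tt Tx Ty Txx Tyy) {h' m t : ℝ} (hh : 0 < h')
    (hh' : h' < D.h) (ht : 0 < t) {b : ℝ → ℝ} (cb : Continuous b) (hb : ∀ θ, |b θ| ≤ 1) :
    |∫ p in D.rect h' m, D.ω p.1 p.2 * (Gd h' (p.1 - D.c) * b p.2) * D.dρ Tx Ty p t|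
      ≤ ∫ p in D.rect h' m, (3 / 2 * K * (T (D.X p.1 p.2) (D.Y p.1 p.2) t *
        (1 - T (D.X p.1 p.2) (D.Y p.1 p.2) t)) + 3 * K * D.h *
        ((T (D.X p.1 p.2) (D.Y p.1 p.2) t * (1 - T (D.X p.1 p.2) (D.Y p.1 p.2) t)) *
          |D.dρ Tx Ty p t|)) := by
  have hkD := rect_subset_coords hh' m
  have hk := D.isCompact_rect h' m
  obtain ⟨i1, i2, e⟩ := hD.integral_parts_ρ hK hs (m := m) hh hh' ht cb
  have kT : ContinuousOn (fun p : ℝ × ℝ => T (D.X p.1 p.2) (D.Y p.1 p.2) t) D.coords :=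
    continuousOn_coords (hD.continuousOn_comp hK hs.cont) ht
  have kρ : ContinuousOn (fun p : ℝ × ℝ => D.dρ Tx Ty p t) D.coords :=
    continuousOn_coords (hD.continuousOn_dρ hK hs) ht
  have kω := (hD.contDiffOn_ω hK).continuousOn
  have kG : Continuous fun p : ℝ × ℝ => Gd h' (p.1 - D.c) :=
    (continuous_Gd h').comp (by fun_prop)
  have kb : Continuous fun p : ℝ × ℝ => b p.2 := cb.comp continuous_snd
  have qc : Continuous fun s : ℝ => s * (1 - s) := by fun_prop
  have kq := qc.comp_continuousOn' kT
  have i3 : IntegrableOn (fun p : ℝ × ℝ => D.ω p.1 p.2 * (Gd h' (p.1 - D.c) * b p.2) *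
      (6 * (T (D.X p.1 p.2) (D.Y p.1 p.2) t * (1 - T (D.X p.1 p.2) (D.Y p.1 p.2) t)) *
        D.dρ Tx Ty p t)) (D.rect h' m) :=
    (((kω.mul (kG.continuousOn.mul kb.continuousOn)).mul ((continuousOn_const.mul kq).mul
      kρ)).mono hkD).integrableOn_compact hk
  have iR : IntegrableOn (fun p : ℝ × ℝ => 3 / 2 * K * (T (D.X p.1 p.2) (D.Y p.1 p.2) t *
        (1 - T (D.X p.1 p.2) (D.Y p.1 p.2) t)) + 3 * K * D.h *
        ((T (D.X p.1 p.2) (D.Y p.1 p.2) t * (1 - T (D.X p.1 p.2) (D.Y p.1 p.2) t)) *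
          |D.dρ Tx Ty p t|)) (D.rect h' m) :=
    (((continuousOn_const.mul kq).add (continuousOn_const.mul (kq.mul kρ.abs))).mono
      hkD).integrableOn_compact hk
  have e2 : ∫ p in D.rect h' m, D.ω p.1 p.2 * (Gd h' (p.1 - D.c) * b p.2) * D.dρ Tx Ty p t
      = ∫ p in D.rect h' m, (D.ω p.1 p.2 * (Gd h' (p.1 - D.c) * b p.2) *
      (6 * (T (D.X p.1 p.2) (D.Y p.1 p.2) t * (1 - T (D.X p.1 p.2) (D.Y p.1 p.2) t)) *
        D.dρ Tx Ty p t) - (deriv (fun r => D.ω r p.2) p.1 * Gd h' (p.1 - D.c)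
        + D.ω p.1 p.2 * Gdd h' (p.1 - D.c)) * b p.2 *
        (T (D.X p.1 p.2) (D.Y p.1 p.2) t * (1 - T (D.X p.1 p.2) (D.Y p.1 p.2) t) *
          (1 - 2 * T (D.X p.1 p.2) (D.Y p.1 p.2) t))) := by
    rw [integral_sub i3 i2, sub_eq_add_neg, ← e, ← integral_add i3 i1]
    refine integral_congr_ae (Eventually.of_forall fun p => ?_)
    simp only
    ring
  rw [e2, ← Real.norm_eq_abs]
  refine norm_integral_le_of_norm_le iR ?_
  filter_upwards [ae_restrict_mem hk.measurableSet] with p hp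
  have hpD := hkD hp
  have hT := hs.range (D.X p.1 p.2) (D.Y p.1 p.2) (hD.param_mem hK hpD).2 t ht
  have hω := (hD.bound_ω p hpD).2
  have hω' := hD.bound_ωρ p hpD
  have hG := abs_Gd_le hh (p.1 - D.c)
  have hG' := abs_Gdd_le h' (p.1 - D.c)
  set s := T (D.X p.1 p.2) (D.Y p.1 p.2) t
  have hq : 0 ≤ s * (1 - s) := mul_nonneg hT.1 (sub_nonneg.2 hT.2)
  have hS : |s * (1 - s) * (1 - 2 * s)| ≤ s * (1 - s) := by
    rw [abs_mul, abs_of_nonneg hq]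
    refine mul_le_of_le_one_right hq (abs_le.2 ⟨?_, ?_⟩) <;> linarith [hT.1, hT.2]
  have hGh : |Gd h' (p.1 - D.c)| ≤ D.h / 2 := hG.trans (by linarith)
  have hhp := hD.h_pos
  rw [Real.norm_eq_abs]
  refine (abs_sub _ _).trans ?_
  have t1 : |D.ω p.1 p.2 * (Gd h' (p.1 - D.c) * b p.2) * (6 * (s * (1 - s)) * D.dρ Tx Ty p t)|
      ≤ 3 * K * D.h * ((s * (1 - s)) * |D.dρ Tx Ty p t|) := by
    rw [abs_mul, abs_mul, abs_mul, abs_mul (6 * _), abs_of_nonneg (show 0 ≤ 6 * (s * (1 - s)) by positivity)]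
    calc _ ≤ K * (D.h / 2 * 1) * (6 * (s * (1 - s)) * |D.dρ Tx Ty p t|) := by
          refine mul_le_mul_of_nonneg_right ?_ (by positivity)
          exact mul_le_mul hω (mul_le_mul hGh (hb _) (abs_nonneg _) (by positivity))
            (by positivity) hK.le
      _ = _ := by ring
  have t2 : |(deriv (fun r => D.ω r p.2) p.1 * Gd h' (p.1 - D.c)
        + D.ω p.1 p.2 * Gdd h' (p.1 - D.c)) * b p.2 * (s * (1 - s) * (1 - 2 * s))|
      ≤ 3 / 2 * K * (s * (1 - s)) := by
    -- `|ω_ρ| ≤ K/h` against `|G'| ≤ h/2` gives `K/2`, and `|ω| ≤ K` against `|G''| ≤ 1` gives `K`.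
    -- This is where the hypothesis on `∂ω/∂ρ` is used.
    have h1 : |deriv (fun r => D.ω r p.2) p.1 * Gd h' (p.1 - D.c)
        + D.ω p.1 p.2 * Gdd h' (p.1 - D.c)| ≤ 3 / 2 * K := by
      refine (abs_add_le _ _).trans ?_
      rw [abs_mul, abs_mul]
      have a1 := mul_le_mul hω' hGh (abs_nonneg _) (by positivity)
      have a2 := mul_le_mul hω hG' (abs_nonneg _) hK.le
      have a3 : K / D.h * (D.h / 2) = K / 2 := by field_simp
      linarith
    rw [abs_mul, abs_mul]
    calc _ ≤ (3 / 2 * K * 1) * (s * (1 - s)) :=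
          mul_le_mul (mul_le_mul h1 (hb _) (abs_nonneg _) (by positivity)) hS (abs_nonneg _)
            (by positivity)
      _ = _ := by ring
  linarith

end IsStreamTube

end Tube

/-! ### Elementary inequalities for the diffusion terms -/

lemma integral_add_three {α : Type*} {_ : MeasurableSpace α} {μ : Measure α} {f g h : α → ℝ}
    (hf : Integrable f μ) (hg : Integrable g μ) (hh : Integrable h μ) :
    (∫ x, f x ∂μ) + (∫ x, g x ∂μ) + ∫ x, h x ∂μ = ∫ x, (f x + g x + h x) ∂μ := by
  have e := integral_add (hf.add hg) hh
  simp only [Pi.add_apply] at e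
  rw [e, integral_add hf hg]

/-- The constant of the tube inequality. -/
def tubeConst (K Mf : ℝ) : ℝ := K ^ 2 * (3 / 2 * K + 3 / 2 * K ^ 2 + K ^ 3 / 4) + Mf / 16

lemma tubeConst_pos {K Mf : ℝ} (hK : 0 < K) (hMf : 0 < Mf) : 0 < tubeConst K Mf := by
  unfold tubeConst; positivity

/-- Young's inequality for transverse diffusion. Since `κ = l² a`, the term `κ q` is covered by the
`l²` part of the weight, and the gradient term by the `h²` part. -/
lemma mul_gradient_le {κ a l h K q N d : ℝ} (hκ : 0 < κ) (hl : l ^ 2 * a = κ) (ha : 0 < a)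
    (hK : 0 < K) (hh : 0 < h) (hq : 0 ≤ q) (hq1 : q ≤ 1) (hN : 0 ≤ N) (hd : d ^ 2 ≤ K ^ 2 * N) :
    κ * (3 / 2 * K * q + 3 * K * h * (q * |d|))
      ≤ (3 / 2 * K + 3 / 2 * K ^ 2) * ((h ^ 2 + l ^ 2) * (a * q + κ * N)) := by
  have h1 : h * (q * |d|) ≤ K / 2 * (q + h ^ 2 * N) := by
    have e : 2 * K * (h * (q * |d|)) ≤ (K * q) ^ 2 + (h * |d|) ^ 2 := by
      nlinarith [sq_nonneg (K * q - h * |d|)]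
    have e2 : (h * |d|) ^ 2 ≤ h ^ 2 * (K ^ 2 * N) := by
      rw [mul_pow, sq_abs]; gcongr
    have e3 : (K * q) ^ 2 ≤ K ^ 2 * q := by
      rw [mul_pow]
      gcongr
      nlinarith
    have e4 : 2 * K * (h * (q * |d|)) ≤ 2 * K * (K / 2 * (q + h ^ 2 * N)) := by nlinarith
    exact le_of_mul_le_mul_left e4 (by positivity)
  have h2 : κ * q ≤ (h ^ 2 + l ^ 2) * (a * q + κ * N) := by
    have : κ * q = l ^ 2 * (a * q) := by rw [← hl]; ring
    rw [this]
    nlinarith [mul_nonneg (sq_nonneg h) (add_nonneg (mul_nonneg ha.le hq) (mul_nonneg hκ.le hN)),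
      mul_nonneg (sq_nonneg l) (mul_nonneg hκ.le hN)]
  have h3 : κ * (q + h ^ 2 * N) ≤ (h ^ 2 + l ^ 2) * (a * q + κ * N) := by
    have : κ * q = l ^ 2 * (a * q) := by rw [← hl]; ring
    nlinarith [mul_nonneg (sq_nonneg h) (mul_nonneg ha.le hq),
      mul_nonneg (sq_nonneg l) (mul_nonneg hκ.le hN)]
  have e : κ * (3 / 2 * K * q + 3 * K * h * (q * |d|))
      = 3 / 2 * K * (κ * q) + 3 * K * (κ * (h * (q * |d|))) := by ring
  rw [e, add_mul]
  refine add_le_add (mul_le_mul_of_nonneg_left h2 (by positivity)) ?_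
  calc 3 * K * (κ * (h * (q * |d|))) ≤ 3 * K * (κ * (K / 2 * (q + h ^ 2 * N))) := by gcongr
    _ = 3 / 2 * K ^ 2 * (κ * (q + h ^ 2 * N)) := by ring
    _ ≤ _ := mul_le_mul_of_nonneg_left h3 (by positivity)

/-- The cutoff has length `r²`, so its derivative is at most `C₀ / r²`. Splitting `|d| / r² ≤ d² / r
+ 1 / r³` leaves a gradient term with a harmless coefficient and a constant of order `r⁻³`, which is
`O(1/r)` after integration over a rectangle of area of order `r²`. -/
lemma mul_longitudinal_le {κ h K N d C₀ r : ℝ} (hκ : 0 < κ) (hK : 0 < K)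
    (hC : 0 < C₀) (hr : C₀ ≤ r) (hN : 0 ≤ N) (hd : d ^ 2 ≤ K ^ 2 * N) :
    κ * (K * (h ^ 2 / 4 * (C₀ / r ^ 2)) * |d|)
      ≤ K ^ 3 / 4 * (h ^ 2 * (κ * N)) + κ * K * h ^ 2 * C₀ / (4 * r ^ 3) := by
  have hr0 : 0 < r := hC.trans_le hr
  have e1 : C₀ / r ^ 2 * |d| ≤ K ^ 2 * N + C₀ / r ^ 3 := by
    have e2 : |d| / r ^ 2 ≤ d ^ 2 / r + 1 / r ^ 3 := by
      rw [div_add_div _ _ hr0.ne' (by positivity), div_le_div_iff₀ (by positivity) (by positivity)]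
      have : 0 ≤ (|d| * r - 1) ^ 2 + (d ^ 2 * r ^ 2 + 1) := by positivity
      have h2 : |d| ^ 2 = d ^ 2 := sq_abs d
      have : |d| * r ≤ d ^ 2 * r ^ 2 + 1 := by
        nlinarith [sq_nonneg (|d| * r - 1), sq_nonneg (|d| * r + 1)]
      calc |d| * (r * r ^ 3) = (|d| * r) * r ^ 3 := by ring
        _ ≤ (d ^ 2 * r ^ 2 + 1) * r ^ 3 := by gcongr
        _ = _ := by ring
    calc C₀ / r ^ 2 * |d| = C₀ * (|d| / r ^ 2) := by ring
      _ ≤ C₀ * (d ^ 2 / r + 1 / r ^ 3) := by gcongr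
      _ = C₀ / r * d ^ 2 + C₀ / r ^ 3 := by ring
      _ ≤ 1 * (K ^ 2 * N) + C₀ / r ^ 3 := by
          gcongr
          exact (div_le_one hr0).2 hr
      _ = _ := by ring
  calc κ * (K * (h ^ 2 / 4 * (C₀ / r ^ 2)) * |d|) = κ * K * h ^ 2 / 4 * (C₀ / r ^ 2 * |d|) := by ring
    _ ≤ κ * K * h ^ 2 / 4 * (K ^ 2 * N + C₀ / r ^ 3) := by gcongr
    _ = _ := by field_simp

/-! ### Advection in a tube at a fixed time: upper bound -/

namespace Tube

/-- Derivative of the cutoff kernel in `ρ`. -/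
def testFnρ (D : Tube) (h' R : ℝ) (χ : ℝ → ℝ) (p : ℝ × ℝ) : ℝ := Gd h' (p.1 - D.c) * χ (p.2 / R)

/-- Derivative of the cutoff kernel in `θ`. -/
def testFnθ (D : Tube) (h' R : ℝ) (χ₁ : ℝ → ℝ) (p : ℝ × ℝ) : ℝ :=
  G h' (p.1 - D.c) * (χ₁ (p.2 / R) / R)

section TestFn

variable {D : Tube} {h' R : ℝ} {χ χ₁ χ₂ : ℝ → ℝ}

lemma hasFDerivAt_testFn (hh : 0 < h') (hχ : IsCutoff χ χ₁ χ₂ 2) (p : ℝ × ℝ) :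
    HasFDerivAt (D.testFn h' R χ) (D.testFnρ h' R χ p • ContinuousLinearMap.fst ℝ ℝ ℝ
      + D.testFnθ h' R χ₁ p • ContinuousLinearMap.snd ℝ ℝ ℝ) p := by
  have h1 : HasFDerivAt (fun p : ℝ × ℝ => G h' (p.1 - D.c))
      (Gd h' (p.1 - D.c) • ContinuousLinearMap.fst ℝ ℝ ℝ) p :=
    ((hasDerivAt_G hh (p.1 - D.c)).comp_sub_const p.1 D.c).comp_hasFDerivAt (f := Prod.fst) p
      hasFDerivAt_fst
  have h2 : HasFDerivAt (fun p : ℝ × ℝ => χ (p.2 / R))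
      ((χ₁ (p.2 / R) / R) • ContinuousLinearMap.snd ℝ ℝ ℝ) p := by
    have e : HasDerivAt (fun θ => χ (θ / R)) (χ₁ (p.2 / R) / R) p.2 :=
      ((hχ.has₁ (p.2 / R)).comp p.2 ((hasDerivAt_id p.2).div_const R)).congr_deriv (by ring)
    exact e.comp_hasFDerivAt (f := Prod.snd) p hasFDerivAt_snd
  refine (h1.mul h2).congr_fderiv ?_
  ext <;> simp [testFnρ, testFnθ, mul_comm]

lemma continuous_testFnρ (hχ : IsCutoff χ χ₁ χ₂ 2) : Continuous (D.testFnρ h' R χ) :=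
  ((continuous_Gd h').comp (by fun_prop)).mul (hχ.cont.comp (by fun_prop))

lemma continuous_testFnθ (hh : 0 < h') (hχ : IsCutoff χ χ₁ χ₂ 2) :
    Continuous (D.testFnθ h' R χ₁) :=
  ((continuous_G hh).comp (by fun_prop)).mul ((hχ.cont₁.comp (by fun_prop)).div_const R)

lemma continuous_testFn (hh : 0 < h') (hχ : IsCutoff χ χ₁ χ₂ 2) :
    Continuous (D.testFn h' R χ) :=
  ((continuous_G hh).comp (by fun_prop)).mul (hχ.cont.comp (by fun_prop))

lemma testFn_zero_off (hh : 0 < h') (hR : 0 < R) (hχ : IsCutoff χ χ₁ χ₂ 2) (p : ℝ × ℝ)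
    (hp : p ∉ D.rect h' (3 * R)) :
    D.testFn h' R χ p = 0 ∧ D.testFnρ h' R χ p = 0 ∧ D.testFnθ h' R χ₁ p = 0 := by
  by_cases h1 : h' ≤ |p.1 - D.c|
  · simp [testFn, testFnρ, testFnθ, G_zero hh h1, Gd_zero hh h1]
  · have h2 : 2 < |p.2 / R| := by
      by_contra h
      rw [abs_div, abs_of_pos hR, not_lt, div_le_iff₀ hR] at h
      rw [not_le] at h1
      obtain ⟨a1, a2⟩ := abs_lt.1 h1
      obtain ⟨b1, b2⟩ := abs_le.1 h
      exact hp ⟨⟨by linarith, by linarith⟩, ⟨by linarith, by linarith⟩⟩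
    simp [testFn, testFnρ, testFnθ, hχ.zero _ h2]

end TestFn

namespace IsStreamTube

variable {bc : BC} {H K σ κ c : ℝ} {f : ℝ → ℝ} {u₁ u₂ : ℝ → ℝ → ℝ} {D : Tube}
  {T Tt Tx Ty Txx Tyy : ℝ → ℝ → ℝ → ℝ}

lemma one_le_mul_E (hD : D.IsStreamTube bc H u₁ u₂ K σ) (hK : 0 < K) {p : ℝ × ℝ}
    (hp : p ∈ D.coords) : 1 ≤ K ^ 2 * (D.E₁ p.1 p.2 * D.E₂ p.1 p.2) := by
  have h1 := (hD.bound_E₁ p hp).1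
  have h2 := (hD.bound_E₂ p hp).1
  calc (1 : ℝ) = K ^ 2 * (K⁻¹ * K⁻¹) := by field_simp
    _ ≤ _ := by
      refine mul_le_mul_of_nonneg_left (mul_le_mul h1 h2 (by positivity) ?_) (by positivity)
      exact (hD.E₁_pos hK hp).le

set_option maxHeartbeats 1000000 in
-- The weak equation is solved for the advective term, using `σ² = 1`, and the diffusion and
-- reaction terms are absorbed into the energy density. The time derivative keeps its sign `σ`: it
-- is the only term that will have to cancel between tubes of opposite direction.
lemma advection_le (hD : D.IsStreamTube bc H u₁ u₂ K σ) (hK : 0 < K) (hσ : |σ| = 1)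
    (hu : IsFlow bc H u₁ u₂)
    (hs : PlaneSol (bc.crossInt H) κ c f u₁ u₂ T Tt Tx Ty Txx Tyy) (hfc : Continuous f) {Mf a l : ℝ}
    (hf : ∀ s ∈ Icc (0 : ℝ) 1, 0 ≤ f s ∧ f s ≤ Mf * (s * (1 - s))) (hκ : 0 < κ) (ha : 0 < a)
    (hMf : 0 < Mf) (hl : l ^ 2 * a = κ) (hc : 4 * c = a) {χ χ₁ χ₂ : ℝ → ℝ} {C₀ : ℝ} (hC : 0 < C₀)
    (hχ : IsCutoff χ χ₁ χ₂ 2) (hχb : ∀ x, 0 ≤ χ x ∧ χ x ≤ 1 ∧ |χ₁ x| ≤ C₀) {h' r t : ℝ}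
    (hh : 0 < h') (hh' : h' < D.h) (hr : C₀ ≤ r) (ht : 0 < t) :
    ∫ p in D.rect h' (3 * r ^ 2), D.flux u₁ u₂ p.1 p.2 *
        (D.testFnθ h' (r ^ 2) χ₁ p * T (D.X p.1 p.2) (D.Y p.1 p.2) t)
      ≤ σ * (∫ p in D.rect h' (3 * r ^ 2), D.E₁ p.1 p.2 * D.E₂ p.1 p.2 *
          (D.testFn h' (r ^ 2) χ p * Tt (D.X p.1 p.2) (D.Y p.1 p.2) t))
        + tubeConst K Mf * (D.h ^ 2 + l ^ 2) * (∫ p in D.rect h' (3 * r ^ 2),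
          D.E₁ p.1 p.2 * D.E₂ p.1 p.2 * density a κ T Tx Ty (D.param p) t)
        + 3 * κ * K * D.h ^ 3 * C₀ / r := by
  have hr0 : 0 < r := hC.trans_le hr
  have hR : 0 < r ^ 2 := by positivity
  set m := 3 * r ^ 2 with hm
  have hkD := rect_subset_coords hh' m
  have hk := D.isCompact_rect h' m
  have hσ2 : σ ^ 2 = 1 := by rw [← sq_abs, hσ, one_pow]
  have hw := hD.coord_weak hK hσ2 hu hs hk hkD (hasFDerivAt_testFn (R := r ^ 2) hh hχ)
    (continuous_testFnρ hχ) (continuous_testFnθ hh hχ) (testFn_zero_off hh hR hχ) ht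
  have hdiff := hD.diffusion_ρ_le hK hs (m := m) hh hh' ht (b := fun θ => χ (θ / r ^ 2))
    (hχ.cont.comp (by fun_prop))
    (fun θ => abs_le.2 ⟨by linarith [(hχb (θ / r ^ 2)).1], (hχb _).2.1⟩)
  have cg := continuous_testFn (D := D) (R := r ^ 2) hh hχ
  have cgρ := continuous_testFnρ (D := D) (h' := h') (R := r ^ 2) hχ
  have cgθ := continuous_testFnθ (D := D) (R := r ^ 2) hh hχ
  have kT : ContinuousOn (fun p : ℝ × ℝ => T (D.X p.1 p.2) (D.Y p.1 p.2) t) D.coords :=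
    continuousOn_coords (hD.continuousOn_comp hK hs.cont) ht
  have kTx : ContinuousOn (fun p : ℝ × ℝ => Tx (D.X p.1 p.2) (D.Y p.1 p.2) t) D.coords :=
    continuousOn_coords (hD.continuousOn_comp hK hs.cont_x) ht
  have kTy : ContinuousOn (fun p : ℝ × ℝ => Ty (D.X p.1 p.2) (D.Y p.1 p.2) t) D.coords :=
    continuousOn_coords (hD.continuousOn_comp hK hs.cont_y) ht
  have kρ : ContinuousOn (fun p : ℝ × ℝ => D.dρ Tx Ty p t) D.coords :=
    continuousOn_coords (hD.continuousOn_dρ hK hs) ht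
  have kθ : ContinuousOn (fun p : ℝ × ℝ => D.dθ Tx Ty p t) D.coords :=
    continuousOn_coords (hD.continuousOn_dθ hK hs) ht
  have kω := (hD.contDiffOn_ω hK).continuousOn
  have kω' : ContinuousOn (fun p : ℝ × ℝ => (D.ω p.1 p.2)⁻¹) D.coords :=
    kω.inv₀ fun p hp => (hD.ω_pos hK hp).ne'
  have kE : ContinuousOn (fun p : ℝ × ℝ => D.E₁ p.1 p.2 * D.E₂ p.1 p.2) D.coords :=
    (hD.contDiffOn_E₁ hK).continuousOn.mul (hD.contDiffOn_E₂ hK).continuousOn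
  have kF := hD.continuousOn_flux hK hu
  have qc : Continuous fun s : ℝ => s * (1 - s) := by fun_prop
  have kq := qc.comp_continuousOn' kT
  have kf := hfc.comp_continuousOn' kT
  have kQ : ContinuousOn (fun p => density a κ T Tx Ty (D.param p) t) D.coords :=
    (continuousOn_const.mul kq).add (continuousOn_const.mul ((kTx.pow 2).add (kTy.pow 2)))
  have int : ∀ {A : ℝ × ℝ → ℝ}, ContinuousOn A D.coords → IntegrableOn A (D.rect h' m) :=
    fun hA => (hA.mono hkD).integrableOn_compact hk
  have i1 : IntegrableOn (fun p : ℝ × ℝ => D.ω p.1 p.2 * D.testFnρ h' (r ^ 2) χ p *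
      D.dρ Tx Ty p t) (D.rect h' m) := int ((kω.mul cgρ.continuousOn).mul kρ)
  have i2 : IntegrableOn (fun p : ℝ × ℝ => (D.ω p.1 p.2)⁻¹ * D.testFnθ h' (r ^ 2) χ₁ p *
      D.dθ Tx Ty p t) (D.rect h' m) := int ((kω'.mul cgθ.continuousOn).mul kθ)
  have i3 : IntegrableOn (fun p : ℝ × ℝ => D.flux u₁ u₂ p.1 p.2 *
      (D.testFnθ h' (r ^ 2) χ₁ p * T (D.X p.1 p.2) (D.Y p.1 p.2) t)) (D.rect h' m) :=
    int (kF.mul (cgθ.continuousOn.mul kT))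
  have i4 : IntegrableOn (fun p : ℝ × ℝ => D.E₁ p.1 p.2 * D.E₂ p.1 p.2 * D.testFn h' (r ^ 2) χ p *
      f (T (D.X p.1 p.2) (D.Y p.1 p.2) t)) (D.rect h' m) :=
    int ((kE.mul cg.continuousOn).mul kf)
  have i5 : IntegrableOn (fun p : ℝ × ℝ => D.E₁ p.1 p.2 * D.E₂ p.1 p.2 *
      density a κ T Tx Ty (D.param p) t) (D.rect h' m) := int (kE.mul kQ)
  have i6 : IntegrableOn (fun p : ℝ × ℝ => 3 / 2 * K * (T (D.X p.1 p.2) (D.Y p.1 p.2) t *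
        (1 - T (D.X p.1 p.2) (D.Y p.1 p.2) t)) + 3 * K * D.h *
        ((T (D.X p.1 p.2) (D.Y p.1 p.2) t * (1 - T (D.X p.1 p.2) (D.Y p.1 p.2) t)) *
          |D.dρ Tx Ty p t|)) (D.rect h' m) :=
    int ((continuousOn_const.mul kq).add (continuousOn_const.mul (kq.mul kρ.abs)))
  set A := ∫ p in D.rect h' m, D.flux u₁ u₂ p.1 p.2 *
      (D.testFnθ h' (r ^ 2) χ₁ p * T (D.X p.1 p.2) (D.Y p.1 p.2) t) with hA
  set I1 := ∫ p in D.rect h' m, D.ω p.1 p.2 * D.testFnρ h' (r ^ 2) χ p * D.dρ Tx Ty p t with hI1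
  set I2 := ∫ p in D.rect h' m, (D.ω p.1 p.2)⁻¹ * D.testFnθ h' (r ^ 2) χ₁ p * D.dθ Tx Ty p t
    with hI2
  set I4 := ∫ p in D.rect h' m, D.E₁ p.1 p.2 * D.E₂ p.1 p.2 * D.testFn h' (r ^ 2) χ p *
      f (T (D.X p.1 p.2) (D.Y p.1 p.2) t) with hI4
  have hsplit : ∫ p in D.rect h' m, D.E₁ p.1 p.2 * D.E₂ p.1 p.2 *
      (D.testFn h' (r ^ 2) χ p * Tt (D.X p.1 p.2) (D.Y p.1 p.2) t)
      = -(κ * (I1 + I2)) + σ * A + c * I4 := by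
    have e := integral_add_three ((i1.add i2).const_mul (-κ)) (i3.const_mul σ) (i4.const_mul c)
    simp only [Pi.add_apply, integral_const_mul] at e
    rw [integral_add i1 i2] at e
    rw [hw, ← neg_mul, e]
    refine integral_congr_ae (Eventually.of_forall fun p => ?_)
    simp only
    ring
  have hA' : A = σ * (∫ p in D.rect h' m, D.E₁ p.1 p.2 * D.E₂ p.1 p.2 *
      (D.testFn h' (r ^ 2) χ p * Tt (D.X p.1 p.2) (D.Y p.1 p.2) t))
      + (σ * (κ * I1) + σ * (κ * I2) - σ * (c * I4)) := by
    rw [hsplit]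
    linear_combination (-A) * hσ2
  rw [hA', add_assoc]
  refine add_le_add_right ?_ _
  have hc0 : 0 < c := by linarith
  have habs : ∀ z : ℝ, |σ * z| = |z| := fun z => by rw [abs_mul, hσ, one_mul]
  have hstep : σ * (κ * I1) + σ * (κ * I2) - σ * (c * I4) ≤ κ * |I1| + κ * |I2| + c * |I4| := by
    have e1 := le_abs_self (σ * (κ * I1))
    have e2 := le_abs_self (σ * (κ * I2))
    have e3 := neg_abs_le (σ * (c * I4))
    rw [habs, abs_mul, abs_of_pos hκ] at e1 e2
    rw [habs, abs_mul, abs_of_pos hc0] at e3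
    linarith
  refine hstep.trans ?_
  have b1 : |I1| ≤ ∫ p in D.rect h' m, (3 / 2 * K * (T (D.X p.1 p.2) (D.Y p.1 p.2) t *
        (1 - T (D.X p.1 p.2) (D.Y p.1 p.2) t)) + 3 * K * D.h *
        ((T (D.X p.1 p.2) (D.Y p.1 p.2) t * (1 - T (D.X p.1 p.2) (D.Y p.1 p.2) t)) *
          |D.dρ Tx Ty p t|)) := hdiff
  have b2 : |I2| ≤ ∫ p in D.rect h' m, |(D.ω p.1 p.2)⁻¹ * D.testFnθ h' (r ^ 2) χ₁ p *
      D.dθ Tx Ty p t| := abs_integral_le_integral_abs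
  have b4 : |I4| ≤ ∫ p in D.rect h' m, |D.E₁ p.1 p.2 * D.E₂ p.1 p.2 * D.testFn h' (r ^ 2) χ p *
      f (T (D.X p.1 p.2) (D.Y p.1 p.2) t)| := abs_integral_le_integral_abs
  have hvol : (volume.real (D.rect h' m)) = 2 * h' * (2 * m) := by
    rw [Measure.real, rect, Measure.volume_eq_prod, Measure.prod_prod, Real.volume_Icc,
      Real.volume_Icc, ENNReal.toReal_mul, ENNReal.toReal_ofReal (by linarith),
      ENNReal.toReal_ofReal (by rw [hm]; nlinarith)]
    ring
  have hhp := hD.h_pos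
  have hfin : volume (D.rect h' m) ≠ ⊤ := hk.measure_lt_top.ne
  have icst : IntegrableOn (fun _ : ℝ × ℝ => κ * K * D.h ^ 2 * C₀ / (4 * r ^ 3)) (D.rect h' m) :=
    integrableOn_const hfin
  -- The comparison is pointwise. The diffusion terms carry no Jacobian, which is inserted by `1 ≤
  -- K² E₁ E₂`, whence the `K²` in `tubeConst`. The reaction term gives `c (h²/4) Mf q`, which is
  -- `(Mf/16) h² a q` because `4 c = a`.
  have hpt : κ * (∫ p in D.rect h' m, (3 / 2 * K * (T (D.X p.1 p.2) (D.Y p.1 p.2) t *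
        (1 - T (D.X p.1 p.2) (D.Y p.1 p.2) t)) + 3 * K * D.h *
        ((T (D.X p.1 p.2) (D.Y p.1 p.2) t * (1 - T (D.X p.1 p.2) (D.Y p.1 p.2) t)) *
          |D.dρ Tx Ty p t|)))
      + κ * (∫ p in D.rect h' m, |(D.ω p.1 p.2)⁻¹ * D.testFnθ h' (r ^ 2) χ₁ p * D.dθ Tx Ty p t|)
      + c * (∫ p in D.rect h' m, |D.E₁ p.1 p.2 * D.E₂ p.1 p.2 * D.testFn h' (r ^ 2) χ p *
        f (T (D.X p.1 p.2) (D.Y p.1 p.2) t)|)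
      ≤ tubeConst K Mf * (D.h ^ 2 + l ^ 2) * (∫ p in D.rect h' m,
          D.E₁ p.1 p.2 * D.E₂ p.1 p.2 * density a κ T Tx Ty (D.param p) t)
        + ∫ p in D.rect h' m, κ * K * D.h ^ 2 * C₀ / (4 * r ^ 3) := by
    rw [← integral_const_mul, ← integral_const_mul, ← integral_const_mul, ← integral_const_mul,
      integral_add_three (i6.const_mul κ) (i2.abs.const_mul κ) (i4.abs.const_mul c),
      ← integral_add (i5.const_mul _) icst]
    refine setIntegral_mono_on (((i6.const_mul κ).add (i2.abs.const_mul κ)).add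
      (i4.abs.const_mul c)) ((i5.const_mul _).add icst) hk.measurableSet fun p hp => ?_
    have hpD := hkD hp
    have hT := hs.range (D.X p.1 p.2) (D.Y p.1 p.2) (hD.param_mem hK hpD).2 t ht
    have hfT := hf _ hT
    have hE := hD.one_le_mul_E hK hpD
    have hE0 := mul_pos (hD.E₁_pos hK hpD) (hD.E₂_pos hK hpD)
    have hω0 := hD.ω_pos hK hpD
    have hω := (hD.bound_ω p hpD).1
    have hd1 := D.dρ_sq_le Tx Ty p t
    have hd2 := D.dθ_sq_le Tx Ty p t
    simp only [density, param]
    set s := T (D.X p.1 p.2) (D.Y p.1 p.2) t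
    set N := Tx (D.X p.1 p.2) (D.Y p.1 p.2) t ^ 2 + Ty (D.X p.1 p.2) (D.Y p.1 p.2) t ^ 2 with hN
    have hN0 : 0 ≤ N := by positivity
    have hq : 0 ≤ s * (1 - s) := mul_nonneg hT.1 (sub_nonneg.2 hT.2)
    have hq1 : s * (1 - s) ≤ 1 := mul_le_one₀ hT.2 (sub_nonneg.2 hT.2) (sub_le_self _ hT.1)
    have hd1' : D.dρ Tx Ty p t ^ 2 ≤ K ^ 2 * N := hd1.trans (mul_le_mul_of_nonneg_right
      (pow_le_pow_left₀ (hD.E₁_pos hK hpD).le (hD.bound_E₁ p hpD).2 2) hN0)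
    have hd2' : D.dθ Tx Ty p t ^ 2 ≤ K ^ 2 * N := hd2.trans (mul_le_mul_of_nonneg_right
      (pow_le_pow_left₀ (hD.E₂_pos hK hpD).le (hD.bound_E₂ p hpD).2 2) hN0)
    have s1 := mul_gradient_le (l := l) hκ hl ha hK hhp hq hq1 hN0 hd1'
    have s2 := mul_longitudinal_le (h := D.h) hκ hK hC hr hN0 hd2'
    have hG0 := G_nonneg hh (p.1 - D.c)
    have hG : G h' (p.1 - D.c) ≤ D.h ^ 2 / 4 := (G_le hh _).trans (by gcongr)
    have hχp := hχb (p.2 / r ^ 2)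
    have s2' : κ * |(D.ω p.1 p.2)⁻¹ * D.testFnθ h' (r ^ 2) χ₁ p * D.dθ Tx Ty p t|
        ≤ κ * (K * (D.h ^ 2 / 4 * (C₀ / r ^ 2)) * |D.dθ Tx Ty p t|) := by
      have hωi : (D.ω p.1 p.2)⁻¹ ≤ K := by
        rw [abs_of_pos hω0] at hω
        exact inv_le_of_inv_le₀ hK hω
      rw [abs_mul, abs_mul, abs_of_pos (inv_pos.2 hω0), testFnθ, abs_mul, abs_of_nonneg hG0,
        abs_div, abs_of_pos hR]
      have := hχp.2.2
      have := inv_pos.2 hω0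
      gcongr
    have s3 : c * |D.E₁ p.1 p.2 * D.E₂ p.1 p.2 * D.testFn h' (r ^ 2) χ p * f s|
        ≤ D.E₁ p.1 p.2 * D.E₂ p.1 p.2 * (Mf / 16 * (D.h ^ 2 * (a * (s * (1 - s))))) := by
      have hg0 : 0 ≤ D.testFn h' (r ^ 2) χ p := mul_nonneg hG0 hχp.1
      have hg : D.testFn h' (r ^ 2) χ p ≤ D.h ^ 2 / 4 := by
        calc D.testFn h' (r ^ 2) χ p ≤ D.h ^ 2 / 4 * 1 :=
              mul_le_mul hG hχp.2.1 hχp.1 (by positivity)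
          _ = _ := mul_one _
      rw [abs_of_nonneg (mul_nonneg (mul_nonneg hE0.le hg0) hfT.1)]
      calc c * (D.E₁ p.1 p.2 * D.E₂ p.1 p.2 * D.testFn h' (r ^ 2) χ p * f s)
          = D.E₁ p.1 p.2 * D.E₂ p.1 p.2 * (c * (D.testFn h' (r ^ 2) χ p * f s)) := by ring
        _ ≤ D.E₁ p.1 p.2 * D.E₂ p.1 p.2 * (c * (D.h ^ 2 / 4 * (Mf * (s * (1 - s))))) := by
            have := mul_le_mul hg hfT.2 hfT.1 (by positivity)
            gcongr
        _ = _ := by rw [← hc]; ring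
    set J := D.E₁ p.1 p.2 * D.E₂ p.1 p.2
    set W := (D.h ^ 2 + l ^ 2) * (a * (s * (1 - s)) + κ * N) with hW
    have hQ0 : 0 ≤ a * (s * (1 - s)) + κ * N := by positivity
    have hW0 : 0 ≤ W := mul_nonneg (by positivity) hQ0
    have w1 : D.h ^ 2 * (κ * N) ≤ W :=
      mul_le_mul (le_add_of_nonneg_right (sq_nonneg _)) (le_add_of_nonneg_left (by positivity))
        (by positivity) (by positivity)
    have w2 : D.h ^ 2 * (a * (s * (1 - s))) ≤ W :=
      mul_le_mul (le_add_of_nonneg_right (sq_nonneg _)) (le_add_of_nonneg_right (by positivity))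
        (by positivity) (by positivity)
    have w3 : (3 / 2 * K + 3 / 2 * K ^ 2) * W + K ^ 3 / 4 * W
        ≤ K ^ 2 * (3 / 2 * K + 3 / 2 * K ^ 2 + K ^ 3 / 4) * (J * W) := by
      have : 1 * ((3 / 2 * K + 3 / 2 * K ^ 2 + K ^ 3 / 4) * W)
          ≤ K ^ 2 * J * ((3 / 2 * K + 3 / 2 * K ^ 2 + K ^ 3 / 4) * W) :=
        mul_le_mul_of_nonneg_right hE (by positivity)
      linarith
    have w4 : K ^ 3 / 4 * (D.h ^ 2 * (κ * N)) ≤ K ^ 3 / 4 * W := by gcongr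
    have w5 : J * (Mf / 16 * (D.h ^ 2 * (a * (s * (1 - s))))) ≤ Mf / 16 * (J * W) := by
      calc _ = Mf / 16 * (J * (D.h ^ 2 * (a * (s * (1 - s))))) := by ring
        _ ≤ _ := by gcongr
    have w6 : tubeConst K Mf * (D.h ^ 2 + l ^ 2) * (J * (a * (s * (1 - s)) + κ * N))
        = K ^ 2 * (3 / 2 * K + 3 / 2 * K ^ 2 + K ^ 3 / 4) * (J * W) + Mf / 16 * (J * W) := by
      rw [tubeConst, hW]; ring
    rw [w6]
    linarith
  have hcst : ∫ p in D.rect h' m, κ * K * D.h ^ 2 * C₀ / (4 * r ^ 3)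
      ≤ 3 * κ * K * D.h ^ 3 * C₀ / r := by
    rw [setIntegral_const, hvol, smul_eq_mul, hm]
    calc 2 * h' * (2 * (3 * r ^ 2)) * (κ * K * D.h ^ 2 * C₀ / (4 * r ^ 3))
        = 3 * κ * K * D.h ^ 2 * C₀ / r * h' := by field_simp; norm_num
      _ ≤ 3 * κ * K * D.h ^ 2 * C₀ / r * D.h := by gcongr
      _ = _ := by ring
  have f1 := mul_le_mul_of_nonneg_left b1 hκ.le
  have f2 := mul_le_mul_of_nonneg_left b2 hκ.le
  have f4 := mul_le_mul_of_nonneg_left b4 hc0.le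
  linarith

end IsStreamTube

end Tube

/-! ### Advection in a tube: lower bound and integration in time -/

namespace Tube

namespace IsStreamTube

variable {bc : BC} {H K σ κ c : ℝ} {f : ℝ → ℝ} {u₁ u₂ : ℝ → ℝ → ℝ} {D : Tube}
  {T Tt Tx Ty Txx Tyy : ℝ → ℝ → ℝ → ℝ}

/-- Since `|X_ρ| ≤ E₁ ≤ K`, a level set of `θ` stays within `K h` of the axis of the tube in the `x`
direction. Escape to `x = ±∞` along the axis is thus uniform over the tube. -/
lemma abs_X_sub_le (hD : D.IsStreamTube bc H u₁ u₂ K σ) {ρ : ℝ}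
    (hρ : ρ ∈ Ioo (D.c - D.h) (D.c + D.h)) (θ : ℝ) : |D.X ρ θ - D.X D.c θ| ≤ K * D.h := by
  have hK : 0 ≤ K := (Real.sqrt_nonneg _).trans (hD.bound_E₁ (ρ, θ) ⟨hρ, mem_univ _⟩).2
  have hc : D.c ∈ Ioo (D.c - D.h) (D.c + D.h) := by constructor <;> linarith [hD.h_pos]
  have h := (convex_Ioo (D.c - D.h) (D.c + D.h)).norm_image_sub_le_of_norm_hasDerivWithin_le
    (f := fun r => D.X r θ) (f' := fun r => D.Xρ r θ) (C := K)
    (fun r hr => ((partial_eq_fderiv (hD.differentiableAt_X (p := (r, θ))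
      ⟨hr, mem_univ _⟩)).1.differentiableAt.hasDerivAt).hasDerivWithinAt)
    (fun r hr => by
      refine le_trans ?_ (hD.bound_E₁ (r, θ) ⟨hr, mem_univ _⟩).2
      rw [Real.norm_eq_abs, ← Real.sqrt_sq_eq_abs]
      exact Real.sqrt_le_sqrt (le_add_of_nonneg_right (sq_nonneg _))) hc hρ
  refine h.trans (mul_le_mul_of_nonneg_left ?_ hK)
  rw [Real.norm_eq_abs, abs_le]
  constructor <;> linarith [hρ.1, hρ.2]

/-- In both kinds of tubes `x` increases from `-∞` to `+∞` with `θ`, so far out `T` is uniformly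
close to 1 for `θ < 0` and to 0 for `θ > 0`, whichever way the flow runs. -/
lemma eventually_near_step (hD : D.IsStreamTube bc H u₁ u₂ K σ) {A lam τ : ℝ} (hlam : 0 < lam)
    (hA : ∀ x, ∀ y ∈ bc.cross H, ∀ t ∈ Icc 0 τ, T x y t ∈ Icc (0 : ℝ) 1 ∧
      T x y t ≤ A * Real.exp (-lam * x) ∧ 1 - T x y t ≤ A * Real.exp (lam * x)) {ε : ℝ}
    (hε : 0 < ε) : ∀ᶠ R in atTop, ∀ p ∈ D.coords, ∀ t ∈ Icc 0 τ, R ≤ |p.2| →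
      |T (D.X p.1 p.2) (D.Y p.1 p.2) t - (Iio (0 : ℝ)).indicator 1 p.2| ≤ ε := by
  have hc : D.c ∈ Ioo (D.c - D.h) (D.c + D.h) := by constructor <;> linarith [hD.h_pos]
  have hexp : ∀ᶠ z in atTop, |A| * Real.exp (-lam * z) ≤ ε := by
    have h1 : Tendsto (fun z => |A| * Real.exp (-lam * z)) atTop (𝓝 (|A| * 0)) := by
      refine (Real.tendsto_exp_atBot.comp ?_).const_mul _
      exact tendsto_id.const_mul_atTop_of_neg (neg_lt_zero.2 hlam)
    rw [mul_zero] at h1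
    exact h1.eventually (eventually_le_nhds hε)
  obtain ⟨Z, hZ⟩ := eventually_atTop.1 hexp
  obtain ⟨R₁, hR₁⟩ := eventually_atTop.1
    ((hD.tendsto_right D.c hc).eventually (eventually_ge_atTop (Z + K * D.h)))
  obtain ⟨R₂, hR₂⟩ := eventually_atBot.1
    ((hD.tendsto_left D.c hc).eventually (eventually_le_atBot (-Z - K * D.h)))
  filter_upwards [eventually_ge_atTop R₁, eventually_ge_atTop (-R₂), eventually_gt_atTop 0]
    with R h1 h2 h3 p hp t ht hR
  have hX := abs_le.1 (hD.abs_X_sub_le hp.1 p.2)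
  obtain ⟨hT, hr, hl⟩ := hA (D.X p.1 p.2) _ (hD.mem_strip p hp) t ht
  rcases lt_or_ge p.2 0 with hneg | hpos
  · rw [indicator_of_mem (show p.2 ∈ Iio 0 from hneg), Pi.one_apply, abs_sub_comm,
      abs_of_nonneg (sub_nonneg.2 hT.2)]
    rw [abs_of_neg hneg] at hR
    have hx := hR₂ p.2 (by linarith)
    refine hl.trans ((mul_le_mul_of_nonneg_right (le_abs_self A) (Real.exp_pos _).le).trans ?_)
    have := hZ (-D.X p.1 p.2) (by linarith)
    rwa [neg_mul_neg] at this
  · rw [indicator_of_notMem (show p.2 ∉ Iio 0 from not_lt.2 hpos), sub_zero, abs_of_nonneg hT.1]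
    rw [abs_of_nonneg hpos] at hR
    have hx := hR₁ p.2 (by linarith)
    refine hr.trans ((mul_le_mul_of_nonneg_right (le_abs_self A) (Real.exp_pos _).le).trans ?_)
    exact hZ (D.X p.1 p.2) (by linarith)

lemma flux_nonneg (hD : D.IsStreamTube bc H u₁ u₂ K σ) (hK : 0 < K) {p : ℝ × ℝ}
    (hp : p ∈ D.coords) : 0 ≤ D.flux u₁ u₂ p.1 p.2 :=
  mul_nonneg (Real.sqrt_nonneg _) (hD.E₁_pos hK hp).le

lemma continuousOn_flux_slice (hD : D.IsStreamTube bc H u₁ u₂ K σ) (hK : 0 < K)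
    (hu : IsFlow bc H u₁ u₂) (s : ℝ) :
    ContinuousOn (fun ρ => D.flux u₁ u₂ ρ s) (Ioo (D.c - D.h) (D.c + D.h)) :=
  (hD.continuousOn_flux hK hu).comp (f := fun ρ : ℝ => (ρ, s)) (by fun_prop)
    fun _ hρ => ⟨hρ, mem_univ _⟩

lemma le_integral_flux_mul_G (hD : D.IsStreamTube bc H u₁ u₂ K σ) (hK : 0 < K)
    (hu : IsFlow bc H u₁ u₂) {h' : ℝ} (hh : D.h / 2 < h') (hh' : h' < D.h) (s : ℝ) :
    (h' - D.h / 2) ^ 2 / 2 * ∫ ρ in (D.c - D.h / 2)..(D.c + D.h / 2), D.flux u₁ u₂ ρ s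
      ≤ ∫ ρ in Icc (D.c - h') (D.c + h'), D.flux u₁ u₂ ρ s * G h' (ρ - D.c) := by
  have hhp := hD.h_pos
  have h0 : 0 < h' := by linarith
  have hsub : Icc (D.c - h') (D.c + h') ⊆ Ioo (D.c - D.h) (D.c + D.h) := fun ρ hρ =>
    ⟨by linarith [hρ.1], by linarith [hρ.2]⟩
  have hsub' : Ioc (D.c - D.h / 2) (D.c + D.h / 2) ⊆ Icc (D.c - h') (D.c + h') := fun ρ hρ =>
    ⟨by linarith [hρ.1], by linarith [hρ.2]⟩
  have kF := (hD.continuousOn_flux_slice hK hu s).mono hsub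
  have hGc : Continuous fun ρ => G h' (ρ - D.c) := (continuous_G h0).comp (by fun_prop)
  have i1 : IntegrableOn (fun ρ => D.flux u₁ u₂ ρ s * G h' (ρ - D.c)) (Icc (D.c - h') (D.c + h')) :=
    (kF.mul hGc.continuousOn).integrableOn_compact isCompact_Icc
  have hF0 : ∀ ρ ∈ Icc (D.c - h') (D.c + h'), 0 ≤ D.flux u₁ u₂ ρ s := fun ρ hρ =>
    hD.flux_nonneg hK (p := (ρ, s)) ⟨hsub hρ, mem_univ _⟩
  rw [intervalIntegral.integral_of_le (by linarith), ← integral_const_mul]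
  refine (setIntegral_mono_on (((kF.integrableOn_compact isCompact_Icc).mono_set
    hsub').const_mul _) (i1.mono_set hsub') measurableSet_Ioc fun ρ hρ => ?_).trans
    (setIntegral_mono_set i1 ?_ hsub'.eventuallyLE)
  · rw [mul_comm]
    refine mul_le_mul_of_nonneg_left (le_G hhp hh hh'.le ?_) (hF0 ρ (hsub' hρ))
    rw [abs_le]
    constructor <;> linarith [hρ.1, hρ.2]
  · filter_upwards [ae_restrict_mem measurableSet_Icc] with ρ hρ
    exact mul_nonneg (hF0 ρ hρ) (G_nonneg h0 _)

/-- The `θ`-derivative of the cutoff lives where `|θ| ≥ R`, where `T` is within `ε` of the step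
function. For the step function itself the integral in `θ` is `χ(0) - χ(-3) = 1`, which leaves the
flux weighted by `G`. -/
lemma le_advection (hD : D.IsStreamTube bc H u₁ u₂ K σ) (hK : 0 < K)
    (hu : IsFlow bc H u₁ u₂)
    (hs : PlaneSol (bc.crossInt H) κ c f u₁ u₂ T Tt Tx Ty Txx Tyy) {χ χ₁ χ₂ : ℝ → ℝ} {C₀ : ℝ}
    (hχ : IsCutoff χ χ₁ χ₂ 2) (hχb : ∀ x, |χ₁ x| ≤ C₀) (hχ1 : ∀ x, |x| ≤ 1 → χ x = 1)
    (hχ0 : ∀ x, |x| < 1 → χ₁ x = 0) {h' R t ε : ℝ} (hR : 0 < R)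
    (hh : D.h / 2 < h') (hh' : h' < D.h) (ht : 0 < t)
    (hε : ∀ p ∈ D.coords, R ≤ |p.2| →
      |T (D.X p.1 p.2) (D.Y p.1 p.2) t - (Iio (0 : ℝ)).indicator 1 p.2| ≤ ε)
    (hε1 : 6 * C₀ * ε ≤ 1) (s : ℝ) :
    (1 - 6 * C₀ * ε) * ((h' - D.h / 2) ^ 2 / 2 *
        ∫ ρ in (D.c - D.h / 2)..(D.c + D.h / 2), D.flux u₁ u₂ ρ s)
      ≤ ∫ p in D.rect h' (3 * R), D.flux u₁ u₂ p.1 p.2 *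
        (D.testFnθ h' R χ₁ p * T (D.X p.1 p.2) (D.Y p.1 p.2) t) := by
  have hhp := hD.h_pos
  have h0 : 0 < h' := by linarith
  have hkD := rect_subset_coords hh' (3 * R)
  have hk := D.isCompact_rect h' (3 * R)
  -- A lower bound for `T` times the derivative of the cutoff: the step function in place of `T`,
  -- minus an error `ε C₀ / R`. Over the length `6R` of the rectangle the error adds up to `6 C₀ ε`.
  set ψ : ℝ → ℝ := fun θ => (Iio (0 : ℝ)).indicator (fun θ => χ₁ (θ / R) / R) θ - ε * C₀ / R
    with hψ
  have cχ : Continuous fun θ : ℝ => χ₁ (θ / R) / R :=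
    (hχ.cont₁.comp (by fun_prop)).div_const R
  have iχ : IntegrableOn ((Iio (0 : ℝ)).indicator (fun θ => χ₁ (θ / R) / R))
      (Icc (-(3 * R)) (3 * R)) :=
    (cχ.continuousOn.integrableOn_compact isCompact_Icc).indicator measurableSet_Iio
  have hfin : volume (Icc (-(3 * R)) (3 * R)) ≠ ⊤ := isCompact_Icc.measure_lt_top.ne
  have iψ : IntegrableOn ψ (Icc (-(3 * R)) (3 * R)) := iχ.sub (integrableOn_const hfin)
  have hψi : ∫ θ in Icc (-(3 * R)) (3 * R), ψ θ = 1 - 6 * C₀ * ε := by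
    rw [hψ, integral_sub iχ (integrableOn_const hfin), setIntegral_const,
      setIntegral_indicator measurableSet_Iio, Measure.real, Real.volume_Icc,
      ENNReal.toReal_ofReal (by linarith), smul_eq_mul]
    have e : Icc (-(3 * R)) (3 * R) ∩ Iio 0 = Ico (-(3 * R)) 0 := by
      ext θ
      simp only [mem_inter_iff, mem_Icc, mem_Iio, mem_Ico]
      exact ⟨fun h => ⟨h.1.1, h.2⟩, fun h => ⟨⟨h.1, by linarith [h.2]⟩, h.2⟩⟩
    have hint : ∫ θ in (-(3 * R))..0, χ₁ (θ / R) / R = χ (0 / R) - χ (-(3 * R) / R) :=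
      intervalIntegral.integral_eq_sub_of_hasDerivAt (f := fun θ => χ (θ / R))
        (fun θ _ => ((hχ.has₁ (θ / R)).comp θ ((hasDerivAt_id θ).div_const R)).congr_deriv
          (by ring)) (cχ.intervalIntegrable _ _)
    rw [e, integral_Ico_eq_integral_Ioo, ← integral_Ioc_eq_integral_Ioo,
      ← intervalIntegral.integral_of_le (by linarith), hint, zero_div, hχ1 0 (by simp),
      show -(3 * R) / R = -3 by field_simp, (hχ.zero (-3) (by norm_num)).1]
    field_simp
    ring
  have cGc : Continuous fun ρ => G h' (ρ - D.c) := (continuous_G h0).comp (by fun_prop)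
  have hsub : Icc (D.c - h') (D.c + h') ⊆ Ioo (D.c - D.h) (D.c + D.h) := fun ρ hρ =>
    ⟨by linarith [hρ.1], by linarith [hρ.2]⟩
  have iF : IntegrableOn (fun ρ => D.flux u₁ u₂ ρ s * G h' (ρ - D.c)) (Icc (D.c - h') (D.c + h')) :=
    (((hD.continuousOn_flux_slice hK hu s).mono hsub).mul
      cGc.continuousOn).integrableOn_compact isCompact_Icc
  have hprod : ∫ p in D.rect h' (3 * R), (D.flux u₁ u₂ p.1 s * G h' (p.1 - D.c)) * ψ p.2
      = (∫ ρ in Icc (D.c - h') (D.c + h'), D.flux u₁ u₂ ρ s * G h' (ρ - D.c)) *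
        (1 - 6 * C₀ * ε) := by
    rw [← hψi]
    exact setIntegral_prod_mul (fun ρ => D.flux u₁ u₂ ρ s * G h' (ρ - D.c)) ψ _ _
  calc _ ≤ (1 - 6 * C₀ * ε) * ∫ ρ in Icc (D.c - h') (D.c + h'),
        D.flux u₁ u₂ ρ s * G h' (ρ - D.c) :=
        mul_le_mul_of_nonneg_left (hD.le_integral_flux_mul_G hK hu hh hh' s) (by linarith)
    _ = ∫ p in D.rect h' (3 * R), (D.flux u₁ u₂ p.1 s * G h' (p.1 - D.c)) * ψ p.2 := by
        rw [hprod, mul_comm]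
    _ ≤ _ := by
      refine setIntegral_mono_on ?_ ?_ hk.measurableSet fun p hp => ?_
      · have := iF.mul_prod iψ
        rwa [← restrict_rect] at this
      · exact ((((hD.continuousOn_flux hK hu).mul ((continuous_testFnθ h0 hχ).continuousOn.mul
          (continuousOn_coords (hD.continuousOn_comp hK hs.cont) ht))).mono
          hkD)).integrableOn_compact hk
      · have hpD := hkD hp
        rw [hD.flux_eq hK hu hpD.1 s p.2, mul_assoc]
        refine mul_le_mul_of_nonneg_left ?_ (hD.flux_nonneg hK hpD)
        rw [testFnθ, mul_assoc]
        refine mul_le_mul_of_nonneg_left ?_ (G_nonneg h0 _)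
        have hC : 0 ≤ C₀ := (abs_nonneg _).trans (hχb 0)
        rcases lt_or_ge |p.2| R with hlt | hge
        · have hz : χ₁ (p.2 / R) = 0 := hχ0 _ (by rwa [abs_div, abs_of_pos hR, div_lt_one hR])
          have hε0 : 0 ≤ ε := (abs_nonneg _).trans (hε (p.1, R) ⟨hpD.1, mem_univ _⟩ (le_abs_self R))
          have : 0 ≤ ε * C₀ / R := by positivity
          simp only [hψ, indicator_apply, hz]
          simp [this]
        · have h1 := hε p hpD hge
          have e : (Iio (0 : ℝ)).indicator (fun θ => χ₁ (θ / R) / R) p.2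
              = χ₁ (p.2 / R) / R * (Iio (0 : ℝ)).indicator 1 p.2 := by
            simp [indicator_apply]
          have h2 : |χ₁ (p.2 / R) / R * (T (D.X p.1 p.2) (D.Y p.1 p.2) t
              - (Iio (0 : ℝ)).indicator 1 p.2)| ≤ C₀ / R * ε := by
            rw [abs_mul, abs_div, abs_of_pos hR]
            have := hχb (p.2 / R)
            gcongr
          have h3 := (abs_le.1 h2).1
          have h4 : ε * C₀ / R = C₀ / R * ε := by ring
          rw [mul_sub] at h3
          simp only [hψ, e]
          linarith

lemma continuousOn_integral_density (hD : D.IsStreamTube bc H u₁ u₂ K σ) (hK : 0 < K)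
    (hs : PlaneSol (bc.crossInt H) κ c f u₁ u₂ T Tt Tx Ty Txx Tyy) (a : ℝ) {k : Set (ℝ × ℝ)}
    (hk : IsCompact k) (hkD : k ⊆ D.coords) : ContinuousOn (fun t => ∫ p in k,
      D.E₁ p.1 p.2 * D.E₂ p.1 p.2 * density a κ T Tx Ty (D.param p) t) (Ioi 0) := by
  have cT := hD.continuousOn_comp hK hs.cont
  refine continuousOn_setIntegral_of_isCompact hk isOpen_Ioi
    (F := fun p t => D.E₁ p.1 p.2 * D.E₂ p.1 p.2 * density a κ T Tx Ty (D.param p) t) ?_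
  refine ContinuousOn.mono ?_ (prod_mono_left hkD)
  exact (continuousOn_fst' ((hD.contDiffOn_E₁ hK).continuousOn.mul
    (hD.contDiffOn_E₂ hK).continuousOn)).mul
    ((continuousOn_const.mul (cT.mul (continuousOn_const.sub cT))).add
    (continuousOn_const.mul (((hD.continuousOn_comp hK hs.cont_x).pow 2).add
      ((hD.continuousOn_comp hK hs.cont_y).pow 2))))

/-- The tube inequality between two times. -/
lemma flux_mul_le (hD : D.IsStreamTube bc H u₁ u₂ K σ) (hK : 0 < K) (hσ : |σ| = 1)
    (hu : IsFlow bc H u₁ u₂)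
    (hs : PlaneSol (bc.crossInt H) κ c f u₁ u₂ T Tt Tx Ty Txx Tyy) (hfc : Continuous f) {Mf a l : ℝ}
    (hf : ∀ s ∈ Icc (0 : ℝ) 1, 0 ≤ f s ∧ f s ≤ Mf * (s * (1 - s))) (hκ : 0 < κ) (ha : 0 < a)
    (hMf : 0 < Mf) (hl : l ^ 2 * a = κ) (hc : 4 * c = a) {χ χ₁ χ₂ : ℝ → ℝ} {C₀ : ℝ} (hC : 0 < C₀)
    (hχ : IsCutoff χ χ₁ χ₂ 2) (hχb : ∀ x, 0 ≤ χ x ∧ χ x ≤ 1 ∧ |χ₁ x| ≤ C₀)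
    (hχ1 : ∀ x, |x| ≤ 1 → χ x = 1) (hχ0 : ∀ x, |x| < 1 → χ₁ x = 0) {h' r ε t₀ t₁ : ℝ}
    (hh : D.h / 2 < h') (hh' : h' < D.h) (hr : C₀ ≤ r) (ht₀ : 0 < t₀) (ht : t₀ ≤ t₁)
    (hε : ∀ p ∈ D.coords, ∀ t ∈ Icc t₀ t₁, r ^ 2 ≤ |p.2| →
      |T (D.X p.1 p.2) (D.Y p.1 p.2) t - (Iio (0 : ℝ)).indicator 1 p.2| ≤ ε)
    (hε1 : 6 * C₀ * ε ≤ 1) (s : ℝ) :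
    (t₁ - t₀) * ((1 - 6 * C₀ * ε) * ((h' - D.h / 2) ^ 2 / 2 *
        ∫ ρ in (D.c - D.h / 2)..(D.c + D.h / 2), D.flux u₁ u₂ ρ s))
      ≤ σ * (∫ p in D.rect h' (3 * r ^ 2), D.E₁ p.1 p.2 * D.E₂ p.1 p.2 * (D.testFn h' (r ^ 2) χ p *
          (T (D.X p.1 p.2) (D.Y p.1 p.2) t₁ - T (D.X p.1 p.2) (D.Y p.1 p.2) t₀)))
        + tubeConst K Mf * (D.h ^ 2 + l ^ 2) * (∫ t in t₀..t₁, ∫ p in D.rect h' (3 * r ^ 2),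
          D.E₁ p.1 p.2 * D.E₂ p.1 p.2 * density a κ T Tx Ty (D.param p) t)
        + (t₁ - t₀) * (3 * κ * K * D.h ^ 3 * C₀ / r) := by
  have hhp := hD.h_pos
  have h0 : 0 < h' := by linarith
  have hr0 : 0 < r := hC.trans_le hr
  have hkD := rect_subset_coords hh' (3 * r ^ 2)
  have hk := D.isCompact_rect h' (3 * r ^ 2)
  have cg := continuous_testFn (D := D) (R := r ^ 2) h0 hχ
  have kE : ContinuousOn (fun p : ℝ × ℝ => D.E₁ p.1 p.2 * D.E₂ p.1 p.2) D.coords :=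
    (hD.contDiffOn_E₁ hK).continuousOn.mul (hD.contDiffOn_E₂ hK).continuousOn
  have mono : ∀ {A : (ℝ × ℝ) × ℝ → ℝ}, ContinuousOn A (D.coords ×ˢ Ioi 0) →
      ContinuousOn A (D.rect h' (3 * r ^ 2) ×ˢ Ioi 0) := fun hA => hA.mono (prod_mono_left hkD)
  have cT := hD.continuousOn_comp hK hs.cont
  have cF := (continuousOn_fst' kE).mul ((continuousOn_fst' cg.continuousOn).mul cT)
  have cF' := (continuousOn_fst' kE).mul ((continuousOn_fst' cg.continuousOn).mul
    (hD.continuousOn_comp hK hs.cont_t))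
  have dP : ∀ t > 0, HasDerivAt (fun t => ∫ p in D.rect h' (3 * r ^ 2), D.E₁ p.1 p.2 *
      D.E₂ p.1 p.2 * (D.testFn h' (r ^ 2) χ p * T (D.X p.1 p.2) (D.Y p.1 p.2) t))
      (∫ p in D.rect h' (3 * r ^ 2), D.E₁ p.1 p.2 * D.E₂ p.1 p.2 * (D.testFn h' (r ^ 2) χ p *
        Tt (D.X p.1 p.2) (D.Y p.1 p.2) t)) t := fun t ht =>
    hasDerivAt_setIntegral_of_isCompact hk isOpen_Ioi
      (F := fun p t => D.E₁ p.1 p.2 * D.E₂ p.1 p.2 * (D.testFn h' (r ^ 2) χ p *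
        T (D.X p.1 p.2) (D.Y p.1 p.2) t))
      (F' := fun p t => D.E₁ p.1 p.2 * D.E₂ p.1 p.2 * (D.testFn h' (r ^ 2) χ p *
        Tt (D.X p.1 p.2) (D.Y p.1 p.2) t)) (mono cF) (mono cF')
      (fun p hp t ht => ((hs.has_t _ _ (hD.param_mem hK (hkD hp)).2 t ht).const_mul _).const_mul _)
      ht
  have cP' := continuousOn_setIntegral_of_isCompact hk isOpen_Ioi
    (F := fun p t => D.E₁ p.1 p.2 * D.E₂ p.1 p.2 * (D.testFn h' (r ^ 2) χ p *
        Tt (D.X p.1 p.2) (D.Y p.1 p.2) t)) (mono cF')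
  have cE := hD.continuousOn_integral_density hK hs a hk hkD
  have iP := intervalIntegrable_of_Ioi cP' ht₀ ht
  have iE := intervalIntegrable_of_Ioi cE ht₀ ht
  -- The lower and upper bounds of the advective term are chained at each time and integrated from
  -- `t₀` to `t₁`.
  have hI := intervalIntegral.integral_mono_on ht intervalIntegrable_const
    (((iP.const_mul σ).add (iE.const_mul (tubeConst K Mf * (D.h ^ 2 + l ^ 2)))).add
      (intervalIntegrable_const (c := 3 * κ * K * D.h ^ 3 * C₀ / r)))
    fun t htt => (hD.le_advection hK hu hs hχ (fun x => (hχb x).2.2) hχ1 hχ0 (R := r ^ 2)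
      (by positivity) hh hh' (ht₀.trans_le htt.1) (fun p hp => hε p hp t htt) hε1 s).trans
      (hD.advection_le hK hσ hu hs hfc hf hκ ha hMf hl hc hC hχ hχb h0 hh' hr
        (ht₀.trans_le htt.1))
  rw [intervalIntegral.integral_const, intervalIntegral.integral_add ((iP.const_mul σ).add
    (iE.const_mul _)) intervalIntegrable_const, intervalIntegral.integral_add (iP.const_mul σ)
    (iE.const_mul _), intervalIntegral.integral_const_mul, intervalIntegral.integral_const_mul,
    intervalIntegral.integral_const, integral_deriv_Ioi dP cP' ht₀ ht, smul_eq_mul, smul_eq_mul]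
    at hI
  have hint : ∀ t, 0 < t → IntegrableOn (fun p : ℝ × ℝ => D.E₁ p.1 p.2 * D.E₂ p.1 p.2 *
      (D.testFn h' (r ^ 2) χ p * T (D.X p.1 p.2) (D.Y p.1 p.2) t)) (D.rect h' (3 * r ^ 2)) :=
    fun t ht => ((kE.mul (cg.continuousOn.mul (continuousOn_coords cT ht))).mono
      hkD).integrableOn_compact hk
  have e : ∫ p in D.rect h' (3 * r ^ 2), D.E₁ p.1 p.2 * D.E₂ p.1 p.2 * (D.testFn h' (r ^ 2) χ p *
          (T (D.X p.1 p.2) (D.Y p.1 p.2) t₁ - T (D.X p.1 p.2) (D.Y p.1 p.2) t₀))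
      = (∫ p in D.rect h' (3 * r ^ 2), D.E₁ p.1 p.2 * D.E₂ p.1 p.2 *
          (D.testFn h' (r ^ 2) χ p * T (D.X p.1 p.2) (D.Y p.1 p.2) t₁))
        - ∫ p in D.rect h' (3 * r ^ 2), D.E₁ p.1 p.2 * D.E₂ p.1 p.2 *
          (D.testFn h' (r ^ 2) χ p * T (D.X p.1 p.2) (D.Y p.1 p.2) t₀) := by
    rw [← integral_sub (hint t₁ (ht₀.trans_le ht)) (hint t₀ ht₀)]
    refine integral_congr_ae (Eventually.of_forall fun p => ?_)
    simp only
    ring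
  rw [e]
  exact hI

end IsStreamTube

end Tube

/-! ### Exhaustion of a tube by rectangles -/

namespace Tube

/-- Half-widths increasing to that of the tube. -/
def width (D : Tube) (n : ℕ) : ℝ := D.h - D.h / (n + 3)

/-- Compact rectangles exhausting the tube. -/
def level (D : Tube) (n : ℕ) : Set (ℝ × ℝ) := D.rect (D.width n) (3 * (n : ℝ) ^ 2)

lemma tendsto_width (D : Tube) : Tendsto D.width atTop (𝓝 D.h) := by
  have h1 : Tendsto (fun n : ℕ => D.h / ((n : ℝ) + 3)) atTop (𝓝 0) :=
    (tendsto_natCast_atTop_atTop.atTop_add tendsto_const_nhds).const_div_atTop _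
  have h2 := h1.const_sub D.h
  rw [sub_zero] at h2
  exact h2

lemma width_lt {D : Tube} (hh : 0 < D.h) (n : ℕ) : D.width n < D.h := by
  unfold width; have : 0 < D.h / ((n : ℝ) + 3) := by positivity
  linarith

/-- The shift by 3 keeps the half-width above `h/2` from `n = 0` on, so the middle half always lies
inside the rectangle. -/
lemma lt_width {D : Tube} (hh : 0 < D.h) (n : ℕ) : D.h / 2 < D.width n := by
  unfold width
  have : D.h / ((n : ℝ) + 3) < D.h / 2 := by
    gcongr
    linarith [(n.cast_nonneg : (0 : ℝ) ≤ n)]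
  linarith

lemma level_subset_coords {D : Tube} (hh : 0 < D.h) (n : ℕ) : D.level n ⊆ D.coords :=
  rect_subset_coords (width_lt hh n) _

lemma isCompact_level (D : Tube) (n : ℕ) : IsCompact (D.level n) := D.isCompact_rect _ _

lemma eventually_mem_level {D : Tube} {p : ℝ × ℝ} (hp : p ∈ D.coords) :
    ∀ᶠ n : ℕ in atTop, p ∈ D.level n ∧ |p.2 / (n : ℝ) ^ 2| ≤ 1 := by
  have h1 : |p.1 - D.c| < D.h := abs_lt.2 ⟨by linarith [hp.1.1], by linarith [hp.1.2]⟩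
  filter_upwards [D.tendsto_width.eventually (lt_mem_nhds h1), eventually_ge_atTop 1,
    tendsto_natCast_atTop_atTop.eventually (eventually_ge_atTop |p.2|)] with n hn hn1 hn2
  have hn1' : (1 : ℝ) ≤ n := by exact_mod_cast hn1
  have hsq : |p.2| ≤ (n : ℝ) ^ 2 := hn2.trans (by nlinarith)
  obtain ⟨a1, a2⟩ := abs_lt.1 hn
  obtain ⟨b1, b2⟩ := abs_le.1 hsq
  refine ⟨⟨⟨by linarith, by linarith⟩, ⟨by nlinarith, by nlinarith⟩⟩, ?_⟩
  rw [abs_div, abs_of_nonneg (sq_nonneg (n : ℝ))]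
  exact div_le_one_of_le₀ hsq (sq_nonneg _)

lemma measurableSet_coords (D : Tube) : MeasurableSet D.coords := D.isOpen_coords.measurableSet

/-- Kernel and cutoff are at most `h²/4` and converge pointwise, so dominated convergence applies as
soon as `J Δ` is integrable on the tube, as it is for the increment of `T`. -/
lemma tendsto_integral_level {D : Tube} (hh : 0 < D.h) {χ : ℝ → ℝ} (hχc : Continuous χ)
    (hχb : ∀ x, 0 ≤ χ x ∧ χ x ≤ 1) (hχ1 : ∀ x, |x| ≤ 1 → χ x = 1) {J Δ : ℝ × ℝ → ℝ}
    (hi : IntegrableOn (fun p => J p * Δ p) D.coords) :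
    Tendsto (fun n : ℕ => ∫ p in D.level n, J p * (D.testFn (D.width n) ((n : ℝ) ^ 2) χ p * Δ p))
      atTop (𝓝 (∫ p in D.coords, J p * (G D.h (p.1 - D.c) * Δ p))) := by
  have e : ∀ n : ℕ, ∫ p in D.level n, J p * (D.testFn (D.width n) ((n : ℝ) ^ 2) χ p * Δ p)
      = ∫ p in D.coords, (D.level n).indicator
        (fun p => D.testFn (D.width n) ((n : ℝ) ^ 2) χ p * (J p * Δ p)) p := fun n => by
    rw [setIntegral_indicator (D.isCompact_level n).measurableSet,
      inter_eq_right.2 (level_subset_coords hh n)]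
    exact integral_congr_ae (Eventually.of_forall fun p => by ring)
  simp only [e]
  have hw : ∀ n, 0 < D.width n := fun n => by linarith [lt_width hh n]
  refine tendsto_integral_of_dominated_convergence (fun p => D.h ^ 2 / 4 * |J p * Δ p|)
    (fun n => ?_) (hi.abs.const_mul _) (fun n => Eventually.of_forall fun p => ?_) ?_
  · refine AEStronglyMeasurable.indicator ?_ (D.isCompact_level n).measurableSet
    refine AEStronglyMeasurable.mul ?_ hi.aestronglyMeasurable
    exact (((continuous_G (hw n)).comp (by fun_prop)).mul
      (hχc.comp (by fun_prop))).aestronglyMeasurable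
  · rw [Real.norm_eq_abs]
    by_cases hpn : p ∈ D.level n
    · rw [indicator_of_mem hpn]
      have hG0 := G_nonneg (hw n) (p.1 - D.c)
      have hG : G (D.width n) (p.1 - D.c) ≤ D.h ^ 2 / 4 :=
        (G_le (hw n) _).trans (by gcongr; exacts [(hw n).le, (width_lt hh n).le])
      obtain ⟨x0, x1⟩ := hχb (p.2 / (n : ℝ) ^ 2)
      rw [abs_mul, testFn, abs_of_nonneg (mul_nonneg hG0 x0)]
      refine mul_le_mul_of_nonneg_right ?_ (abs_nonneg _)
      calc _ ≤ D.h ^ 2 / 4 * 1 := mul_le_mul hG x1 x0 (by positivity)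
        _ = _ := mul_one _
    · rw [indicator_of_notMem hpn, abs_zero]; positivity
  · filter_upwards [ae_restrict_mem D.measurableSet_coords] with p hp
    have h1 : Tendsto (fun n => G (D.width n) (p.1 - D.c)) atTop (𝓝 (G D.h (p.1 - D.c))) :=
      (continuousAt_G_left hh (p.1 - D.c)).tendsto.comp D.tendsto_width
    have h2 := h1.mul_const (J p * Δ p)
    rw [show J p * (G D.h (p.1 - D.c) * Δ p) = G D.h (p.1 - D.c) * (J p * Δ p) by ring]
    refine h2.congr' ?_
    filter_upwards [eventually_mem_level hp] with n hn
    rw [indicator_of_mem hn.1, testFn, hχ1 _ hn.2, mul_one]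

namespace IsStreamTube

variable {bc : BC} {H K σ κ c : ℝ} {f : ℝ → ℝ} {u₁ u₂ : ℝ → ℝ → ℝ} {D : Tube}
  {T Tt Tx Ty Txx Tyy : ℝ → ℝ → ℝ → ℝ}

/-- The flux through a tube is controlled, in the limit, by the increment of the temperature
and by the dissipation. -/
lemma eventually_flux_le (hD : D.IsStreamTube bc H u₁ u₂ K σ) (hK : 0 < K) (hσ : |σ| = 1)
    (hu : IsFlow bc H u₁ u₂)
    (hs : PlaneSol (bc.crossInt H) κ c f u₁ u₂ T Tt Tx Ty Txx Tyy) (hfc : Continuous f) {Mf a l : ℝ}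
    (hf : ∀ s ∈ Icc (0 : ℝ) 1, 0 ≤ f s ∧ f s ≤ Mf * (s * (1 - s))) (hκ : 0 < κ) (ha : 0 < a)
    (hMf : 0 < Mf) (hl : l ^ 2 * a = κ) (hc : 4 * c = a) {t₀ t₁ : ℝ} (ht₀ : 0 < t₀) (ht : t₀ ≤ t₁)
    (hstep : ∀ ε > 0, ∀ᶠ R in atTop, ∀ p ∈ D.coords, ∀ t ∈ Icc t₀ t₁, R ≤ |p.2| →
      |T (D.X p.1 p.2) (D.Y p.1 p.2) t - (Iio (0 : ℝ)).indicator 1 p.2| ≤ ε)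
    (hi : IntegrableOn (fun p : ℝ × ℝ => D.E₁ p.1 p.2 * D.E₂ p.1 p.2 *
      (T (D.X p.1 p.2) (D.Y p.1 p.2) t₁ - T (D.X p.1 p.2) (D.Y p.1 p.2) t₀)) D.coords)
    (s : ℝ) {δ : ℝ} (hδ : 0 < δ) :
    ∀ᶠ n : ℕ in atTop, (t₁ - t₀) / 8 * ((1 + l ^ 2 / D.h ^ 2)⁻¹ *
        ∫ ρ in (D.c - D.h / 2)..(D.c + D.h / 2), D.flux u₁ u₂ ρ s)
      ≤ σ * (∫ p in D.coords, D.E₁ p.1 p.2 * D.E₂ p.1 p.2 * (G D.h (p.1 - D.c) /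
          (D.h ^ 2 + l ^ 2) * (T (D.X p.1 p.2) (D.Y p.1 p.2) t₁ - T (D.X p.1 p.2) (D.Y p.1 p.2) t₀)))
        + tubeConst K Mf * (∫ t in t₀..t₁, ∫ p in D.level n,
          D.E₁ p.1 p.2 * D.E₂ p.1 p.2 * density a κ T Tx Ty (D.param p) t) + δ := by
  obtain ⟨χ, χ₁, χ₂, C₀, hC, hχ, hχb, hχ1, hχ0⟩ := exists_bump
  have hhp := hD.h_pos
  set F := ∫ ρ in (D.c - D.h / 2)..(D.c + D.h / 2), D.flux u₁ u₂ ρ s with hF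
  have hF0 : 0 ≤ F := intervalIntegral.integral_nonneg (by linarith) fun ρ hρ =>
    hD.flux_nonneg hK (p := (ρ, s)) ⟨⟨by linarith [hρ.1], by linarith [hρ.2]⟩, mem_univ _⟩
  set P := ∫ p in D.coords, D.E₁ p.1 p.2 * D.E₂ p.1 p.2 * (G D.h (p.1 - D.c) *
    (T (D.X p.1 p.2) (D.Y p.1 p.2) t₁ - T (D.X p.1 p.2) (D.Y p.1 p.2) t₀)) with hP
  set w := D.h ^ 2 + l ^ 2 with hw
  have hw0 : 0 < w := by positivity
  set X := (t₁ - t₀) * (D.h ^ 2 / 8 * F) with hX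
  have hX0 : 0 ≤ X := mul_nonneg (sub_nonneg.2 ht) (by positivity)
  -- The loss `6 C₀ ε = η` in the lower bound is chosen so that `η X ≤ δ w / 2` and `6 C₀ ε ≤ 1`;
  -- the other half of `δ w` makes the limiting inequality strict.
  set η := min 1 (δ * w / (2 * (X + 1))) with hη
  have hη0 : 0 < η := by rw [hη]; positivity
  have hηX : η * X ≤ δ * w / 2 := by
    calc η * X ≤ δ * w / (2 * (X + 1)) * (X + 1) :=
          mul_le_mul (min_le_right _ _) (by linarith) hX0 (by positivity)
      _ = _ := by field_simp
  set ε := η / (6 * C₀) with hε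
  have hε0 : 0 < ε := by positivity
  have hCε : 6 * C₀ * ε = η := by rw [hε]; field_simp
  have hsq : Tendsto (fun n : ℕ => (n : ℝ) ^ 2) atTop atTop :=
    (tendsto_pow_atTop two_ne_zero).comp tendsto_natCast_atTop_atTop
  have lim1 : Tendsto (fun n : ℕ => (t₁ - t₀) * ((1 - 6 * C₀ * ε) *
      ((D.width n - D.h / 2) ^ 2 / 2 * F))) atTop
      (𝓝 ((t₁ - t₀) * ((1 - 6 * C₀ * ε) * ((D.h - D.h / 2) ^ 2 / 2 * F)))) :=
    ((((((D.tendsto_width.sub_const _).pow 2).div_const 2).mul_const F).const_mul _).const_mul _)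
  have lim2 := (tendsto_integral_level hhp hχ.cont (fun x => ⟨(hχb x).1, (hχb x).2.1⟩) hχ1
    hi).const_mul σ
  have lim3 : Tendsto (fun n : ℕ => (t₁ - t₀) * (3 * κ * K * D.h ^ 3 * C₀ / (n : ℝ))) atTop
      (𝓝 ((t₁ - t₀) * 0)) :=
    (tendsto_natCast_atTop_atTop.const_div_atTop _).const_mul _
  have lim := (lim1.sub lim2).sub lim3
  have hlow : X - σ * P - δ * w < (t₁ - t₀) * ((1 - 6 * C₀ * ε) * ((D.h - D.h / 2) ^ 2 / 2 * F))
      - σ * P - (t₁ - t₀) * 0 := by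
    have : (t₁ - t₀) * ((1 - 6 * C₀ * ε) * ((D.h - D.h / 2) ^ 2 / 2 * F)) = X - η * X := by
      rw [hCε, hX]; ring
    rw [this]
    have : 0 < δ * w := by positivity
    linarith
  filter_upwards [lim.eventually (lt_mem_nhds hlow), hsq.eventually (hstep ε hε0),
    tendsto_natCast_atTop_atTop.eventually (eventually_ge_atTop C₀)] with n h1 h2 h3
  have h4 := hD.flux_mul_le hK hσ hu hs hfc hf hκ ha hMf hl hc hC hχ
    (fun x => ⟨(hχb x).1, (hχb x).2.1, (hχb x).2.2.1⟩) hχ1 hχ0 (lt_width hhp n) (width_lt hhp n) h3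
    ht₀ ht h2 (hCε.trans_le (min_le_left _ _)) s
  change _ ≤ σ * (∫ p in D.level n, _) + _ * (∫ t in t₀..t₁, ∫ p in D.level n, _) + _ at h4
  set En := ∫ t in t₀..t₁, ∫ p in D.level n,
    D.E₁ p.1 p.2 * D.E₂ p.1 p.2 * density a κ T Tx Ty (D.param p) t
  have h5 : X ≤ σ * P + tubeConst K Mf * w * En + δ * w := by linarith
  -- In the limit the kernel bound is `(h/2)²/2 = h²/8`. Divided by `w = h² + l²` it becomes `(1 +
  -- l²/h²)⁻¹ / 8`.
  have e1 : (t₁ - t₀) / 8 * ((1 + l ^ 2 / D.h ^ 2)⁻¹ * F) = X / w := by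
    rw [hX, hw]; field_simp
  have e2 : (∫ p in D.coords, D.E₁ p.1 p.2 * D.E₂ p.1 p.2 * (G D.h (p.1 - D.c) / w *
      (T (D.X p.1 p.2) (D.Y p.1 p.2) t₁ - T (D.X p.1 p.2) (D.Y p.1 p.2) t₀))) = P / w := by
    rw [hP, ← integral_div]
    exact integral_congr_ae (Eventually.of_forall fun p => by ring)
  rw [e1, e2, div_le_iff₀ hw0]
  refine h5.trans (le_of_eq ?_)
  field_simp

end IsStreamTube

end Tube

/-- The representative in the strip of a point of the domain. -/
def BC.fold (bc : BC) (H : ℝ) (z : ℝ × ℝ) : ℝ × ℝ :=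
  match bc with
  | .neumann => z
  | .periodic => (z.1, z.2 - ⌊z.2 / H⌋ * H)

/-! ### Folding the plane onto the strip -/

section Fold

variable {bc : BC} {H : ℝ}

lemma BC.fold_fst (z : ℝ × ℝ) : (bc.fold H z).1 = z.1 := by cases bc <;> rfl

lemma BC.measurable_fold : Measurable (bc.fold H) := by
  cases bc
  · exact measurable_id
  · exact measurable_fst.prodMk (measurable_snd.sub
      ((measurable_from_top.comp (Int.measurable_floor.comp (measurable_snd.div_const H))).mul_const H))

lemma BC.fold_mem (hH : 0 < H) {z : ℝ × ℝ} (hz : z.2 ∈ bc.cross H) : bc.fold H z ∈ strip H := by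
  cases bc
  · exact ⟨mem_univ _, hz⟩
  · refine ⟨mem_univ _, ?_, ?_⟩
    · have := mul_le_mul_of_nonneg_right (Int.floor_le (z.2 / H)) hH.le
      rw [div_mul_cancel₀ _ hH.ne'] at this
      exact sub_nonneg.2 this
    · have := mul_le_mul_of_nonneg_right (Int.lt_floor_add_one (z.2 / H)).le hH.le
      rw [div_mul_cancel₀ _ hH.ne', add_mul, one_mul] at this
      exact sub_le_iff_le_add'.2 this

lemma BC.samePoint_of_fold_eq {z w : ℝ × ℝ} (h : bc.fold H z = bc.fold H w) :
    bc.SamePoint H z.1 z.2 w.1 w.2 := by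
  cases bc
  · exact ⟨congrArg Prod.fst h, congrArg Prod.snd h⟩
  · have h1 := congrArg Prod.fst h
    rw [BC.fold_fst, BC.fold_fst] at h1
    refine ⟨h1, ⌊w.2 / H⌋ - ⌊z.2 / H⌋, ?_⟩
    have : z.2 - ⌊z.2 / H⌋ * H = w.2 - ⌊w.2 / H⌋ * H := congrArg Prod.snd h
    push_cast
    linarith

lemma BC.apply_fold {g : ℝ × ℝ → ℝ} (hg : bc = .periodic → ∀ x y, g (x, y + H) = g (x, y))
    (z : ℝ × ℝ) : g (bc.fold H z) = g z := by
  cases bc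
  · rfl
  · have hp : Function.Periodic (fun y => g (z.1, y)) H := fun y => hg rfl z.1 y
    exact hp.sub_int_mul_eq ⌊z.2 / H⌋

/-- In the periodic case cut `A` into countably many pieces according to the period containing `y`
and translate each into the strip. Injectivity of the folding makes the translates disjoint, and
translation preserves area. -/
lemma BC.volume_le_of_injOn_fold (hH : 0 < H) {A S : Set (ℝ × ℝ)} (hA : MeasurableSet A)
    (hS : MeasurableSet S) (hAc : ∀ z ∈ A, z.2 ∈ bc.cross H) (hi : InjOn (bc.fold H) A)
    (hAS : ∀ z ∈ A, bc.fold H z ∈ S) : volume A ≤ volume.restrict (strip H) S := by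
  rw [Measure.restrict_apply hS]
  cases bc
  · exact measure_mono fun z hz => ⟨hAS z hz, mem_univ _, hAc z hz⟩
  · have hfl : Measurable fun z : ℝ × ℝ => ⌊z.2 / H⌋ :=
      Int.measurable_floor.comp (measurable_snd.div_const H)
    set a : ℤ → Set (ℝ × ℝ) := fun k => A ∩ {z | ⌊z.2 / H⌋ = k} with ha
    have ham : ∀ k, MeasurableSet (a k) := fun k => hA.inter (hfl (measurableSet_singleton k))
    have hU : A = ⋃ k, a k := by
      ext z
      simp [ha]
    have hfold : ∀ k : ℤ, ∀ z : ℝ × ℝ, z + (0, k * H) ∈ a k →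
        BC.periodic.fold H (z + (0, k * H)) = z := fun k z hz => by
      have h1 : ⌊(z + (0, (k : ℝ) * H)).2 / H⌋ = k := hz.2
      simp only [BC.fold, h1]
      ext <;> simp
    have hvol : ∀ k : ℤ, volume (a k) = volume ((fun z => z + (0, (k : ℝ) * H)) ⁻¹' a k) := fun k =>
      (measure_preimage_add_right volume _ _).symm
    calc volume A ≤ ∑' k, volume (a k) := by
          conv_lhs => rw [hU]
          exact measure_iUnion_le _
      _ = ∑' k : ℤ, volume ((fun z => z + (0, (k : ℝ) * H)) ⁻¹' a k) := tsum_congr hvol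
      _ = volume (⋃ k : ℤ, (fun z : ℝ × ℝ => z + (0, (k : ℝ) * H)) ⁻¹' a k) := by
          refine (measure_iUnion ?_ fun k => (measurable_add_const _) (ham k)).symm
          intro k l hkl
          refine Set.disjoint_left.2 fun z hk hl => hkl ?_
          have e := hi hk.1 hl.1 ((hfold k z hk).trans (hfold l z hl).symm)
          have e2 : z.2 + k * H = z.2 + l * H := congrArg Prod.snd e
          have e3 : (k : ℝ) = l := mul_right_cancel₀ hH.ne' (by linarith)
          exact_mod_cast e3
      _ ≤ _ := by
          refine measure_mono (iUnion_subset fun k z hz => ?_)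
          have h1 := hAS _ hz.1
          have h2 := BC.fold_mem hH (hAc _ hz.1)
          rw [hfold k z hz] at h1 h2
          exact ⟨h1, h2⟩

end Fold

/-! ### Areas of tubes as measures on the strip -/

namespace Tube

/-- The area of the tube, weighted by `w`, as a measure on the strip. -/
def area (bc : BC) (H : ℝ) (D : Tube) (w : ℝ × ℝ → ℝ) : Measure (ℝ × ℝ) :=
  ((volume.restrict D.coords).withDensity
    fun p => ENNReal.ofReal (D.E₁ p.1 p.2 * D.E₂ p.1 p.2 * w p)).map fun p => bc.fold H (D.param p)

namespace IsStreamTube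

variable {bc : BC} {H K σ : ℝ} {u₁ u₂ : ℝ → ℝ → ℝ} {D : Tube} {w : ℝ × ℝ → ℝ}

lemma continuousOn_mul_E (hD : D.IsStreamTube bc H u₁ u₂ K σ) (hK : 0 < K) :
    ContinuousOn (fun p : ℝ × ℝ => D.E₁ p.1 p.2 * D.E₂ p.1 p.2) D.coords :=
  (hD.contDiffOn_E₁ hK).continuousOn.mul (hD.contDiffOn_E₂ hK).continuousOn

lemma aemeasurable_weight (hD : D.IsStreamTube bc H u₁ u₂ K σ) (hK : 0 < K) (hw : Measurable w) :
    AEMeasurable (fun p : ℝ × ℝ => ENNReal.ofReal (D.E₁ p.1 p.2 * D.E₂ p.1 p.2 * w p))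
      (volume.restrict D.coords) :=
  (((hD.continuousOn_mul_E hK).aemeasurable D.measurableSet_coords).mul
    hw.aemeasurable).ennreal_ofReal

lemma aemeasurable_fold_param (hD : D.IsStreamTube bc H u₁ u₂ K σ) :
    AEMeasurable (fun p => bc.fold H (D.param p)) ((volume.restrict D.coords).withDensity
      fun p => ENNReal.ofReal (D.E₁ p.1 p.2 * D.E₂ p.1 p.2 * w p)) :=
  (BC.measurable_fold.comp_aemeasurable
    (hD.contDiffOn_param.continuousOn.aemeasurable D.measurableSet_coords)).mono_ac
    (withDensity_absolutelyContinuous _ _)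

/-- With weight 1 the image of `E₁ E₂ dρ dθ` is area in the plane, by the change of variables
formula. A weight at most 1 only decreases it. -/
lemma area_apply_le (hD : D.IsStreamTube bc H u₁ u₂ K σ) (hK : 0 < K) (hw1 : ∀ p, w p ≤ 1)
    {S : Set (ℝ × ℝ)} (hS : MeasurableSet S) : ∃ A ⊆ D.param '' D.coords, MeasurableSet A ∧
      (∀ z ∈ A, bc.fold H z ∈ S) ∧ D.area bc H w S ≤ volume A := by
  classical
  -- The parametrization is arbitrary outside the coordinate strip; setting it to zero there makes
  -- it measurable everywhere.
  set φ : ℝ × ℝ → ℝ × ℝ := D.coords.piecewise D.param 0 with hφ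
  have hφm : Measurable φ := hD.contDiffOn_param.continuousOn.measurable_piecewise
    continuousOn_const D.measurableSet_coords
  set B := (fun p => bc.fold H (φ p)) ⁻¹' S ∩ D.coords with hB
  have hm : Measurable fun p => bc.fold H (φ p) := BC.measurable_fold.comp hφm
  have hBm : MeasurableSet B := (hm hS).inter D.measurableSet_coords
  have hφe : ∀ p ∈ D.coords, φ p = D.param p := fun p hp => piecewise_eq_of_mem _ _ _ hp
  have hae : (fun p => bc.fold H (D.param p)) =ᵐ[(volume.restrict D.coords).withDensity
      fun p => ENNReal.ofReal (D.E₁ p.1 p.2 * D.E₂ p.1 p.2 * w p)] fun p => bc.fold H (φ p) := by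
    refine (withDensity_absolutelyContinuous _ _).ae_le ?_
    filter_upwards [ae_restrict_mem D.measurableSet_coords] with p hp
    rw [hφe p hp]
  have hBc : B ⊆ D.coords := inter_subset_right
  have hinj : InjOn D.param B := hD.injOn_param.mono hBc
  refine ⟨D.param '' B, image_mono hBc, ?_, ?_, ?_⟩
  · exact hBm.image_of_continuousOn_injOn (hD.contDiffOn_param.continuousOn.mono hBc) hinj
  · rintro _ ⟨p, hp, rfl⟩
    have := hp.1
    rwa [mem_preimage, hφe p hp.2] at this
  · rw [area, Measure.map_congr hae, Measure.map_apply hm hS, withDensity_apply _ (hm hS),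
      Measure.restrict_restrict (hm hS), ← lintegral_abs_det_fderiv_eq_addHaar_image volume hBm
      (fun p hp => (hD.hasStrictFDerivAt (hBc hp)).hasFDerivAt.hasFDerivWithinAt) hinj]
    refine setLIntegral_mono' hBm fun p hp => ENNReal.ofReal_le_ofReal ?_
    rw [hD.abs_det hK (hBc hp)]
    exact mul_le_of_le_one_right (mul_pos (hD.E₁_pos hK (hBc hp)) (hD.E₂_pos hK (hBc hp))).le
      (hw1 p)

lemma integrable_area (hD : D.IsStreamTube bc H u₁ u₂ K σ) (hK : 0 < K) (hw : Measurable w)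
    (hw0 : ∀ p, 0 ≤ w p) {g : ℝ × ℝ → ℝ} (hg : Integrable g (D.area bc H w)) :
    IntegrableOn (fun p => D.E₁ p.1 p.2 * D.E₂ p.1 p.2 * (w p * g (bc.fold H (D.param p))))
      D.coords ∧
    ∫ z, g z ∂(D.area bc H w) = ∫ p in D.coords, D.E₁ p.1 p.2 * D.E₂ p.1 p.2 *
      (w p * g (bc.fold H (D.param p))) := by
  have hwm := hD.aemeasurable_weight hK hw
  have hlt : ∀ᵐ p ∂(volume.restrict D.coords),
      ENNReal.ofReal (D.E₁ p.1 p.2 * D.E₂ p.1 p.2 * w p) < ⊤ :=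
    Eventually.of_forall fun p => ENNReal.ofReal_lt_top
  have e : ∀ p ∈ D.coords, (ENNReal.ofReal (D.E₁ p.1 p.2 * D.E₂ p.1 p.2 * w p)).toReal •
      g (bc.fold H (D.param p)) = D.E₁ p.1 p.2 * D.E₂ p.1 p.2 *
      (w p * g (bc.fold H (D.param p))) := fun p hp => by
    rw [ENNReal.toReal_ofReal (mul_nonneg (mul_pos (hD.E₁_pos hK hp) (hD.E₂_pos hK hp)).le
      (hw0 p)), smul_eq_mul, mul_assoc]
  constructor
  · have h1 := hg.comp_aemeasurable hD.aemeasurable_fold_param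
    rw [integrable_withDensity_iff_integrable_smul₀' hwm hlt] at h1
    exact IntegrableOn.congr_fun h1 e D.measurableSet_coords
  · rw [area, integral_map hD.aemeasurable_fold_param hg.aestronglyMeasurable,
      integral_withDensity_eq_integral_toReal_smul₀ hwm hlt]
    exact setIntegral_congr_fun D.measurableSet_coords e

end IsStreamTube

section Family

variable {ι : Type*} [Fintype ι] {bc : BC} {H K : ℝ} {σ : ι → ℝ} {u₁ u₂ : ℝ → ℝ → ℝ} {D : ι → Tube}
  {w : ι → ℝ × ℝ → ℝ}

/-- After folding, points of distinct tubes remain distinct because the tubes are apart, and points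
of one tube because its coordinates are one-to-one modulo the period. The folded tubes therefore do
not overlap, and their total area is at most that of the strip. The weights will be the averaging
kernel, the constant 1, and indicators of compact sets. -/
lemma sum_area_le (hH : 0 < H) (hK : 0 < K) (hD : ∀ i, (D i).IsStreamTube bc H u₁ u₂ K (σ i))
    (hA : ∀ i j, i ≠ j → (D i).Apart bc H (D j)) (hw1 : ∀ i p, w i p ≤ 1) :
    ∑ i, (D i).area bc H (w i) ≤ volume.restrict (strip H) := by
  refine Measure.le_iff.2 fun S hS => ?_
  choose A hAs hAm hAS hA' using fun i => (hD i).area_apply_le hK (hw1 i) hS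
  have hfold : ∀ i j, ∀ z ∈ A i, ∀ z' ∈ A j, bc.fold H z = bc.fold H z' → i = j ∧ z = z' := by
    intro i j z hz z' hz' h
    obtain ⟨p, hp, rfl⟩ := hAs i hz
    obtain ⟨q, hq, rfl⟩ := hAs j hz'
    have hsp := BC.samePoint_of_fold_eq h
    by_cases hij : i = j
    · subst hij
      exact ⟨rfl, by rw [(hD i).injective p hp q hq hsp]⟩
    · exact absurd hsp (hA i j hij p hp q hq)
  rw [Measure.finsetSum_apply]
  calc ∑ i, (D i).area bc H (w i) S ≤ ∑ i, volume (A i) := Finset.sum_le_sum fun i _ => hA' i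
    _ = volume (⋃ i, A i) := by
        rw [measure_iUnion (fun i j hij => Set.disjoint_left.2 fun z hz hz' =>
          hij (hfold i j z hz z hz' rfl).1) hAm, tsum_fintype]
    _ ≤ _ := by
        refine BC.volume_le_of_injOn_fold (bc := bc) hH (MeasurableSet.iUnion hAm) hS ?_ ?_ ?_
        · intro z hz
          obtain ⟨i, hi⟩ := mem_iUnion.1 hz
          obtain ⟨p, hp, rfl⟩ := hAs i hi
          exact (hD i).mem_strip p hp
        · intro z hz z' hz' h
          obtain ⟨i, hi⟩ := mem_iUnion.1 hz
          obtain ⟨j, hj⟩ := mem_iUnion.1 hz'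
          exact (hfold i j z hi z' hj h).2
        · intro z hz
          obtain ⟨i, hi⟩ := mem_iUnion.1 hz
          exact hAS i z hi

lemma area_le_sum (i : ι) : (D i).area bc H (w i) ≤ ∑ j, (D j).area bc H (w j) :=
  Finset.single_le_sum (f := fun j => (D j).area bc H (w j)) (fun _ _ => Measure.zero_le _)
    (Finset.mem_univ i)

lemma integral_sum_area (hK : 0 < K) (hD : ∀ i, (D i).IsStreamTube bc H u₁ u₂ K (σ i)) (hwm : ∀ i, Measurable (w i))
    (hw0 : ∀ i p, 0 ≤ w i p) {g : ℝ × ℝ → ℝ}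
    (hg : Integrable g (∑ i, (D i).area bc H (w i))) :
    ∫ z, g z ∂(∑ i, (D i).area bc H (w i)) = ∑ i, ∫ p in (D i).coords,
      (D i).E₁ p.1 p.2 * (D i).E₂ p.1 p.2 * (w i p * g (bc.fold H ((D i).param p))) := by
  rw [integral_finsetSum_measure fun i _ => hg.mono_measure (area_le_sum i)]
  exact Finset.sum_congr rfl fun i _ =>
    ((hD i).integrable_area hK (hwm i) (hw0 i) (hg.mono_measure (area_le_sum i))).2

/-- Energy in disjoint tubes is counted once. The box is chosen independently of `g`, so it can be
the same for all times. -/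
lemma sum_integral_le (hH : 0 < H) (hK : 0 < K)
    (hD : ∀ i, (D i).IsStreamTube bc H u₁ u₂ K (σ i))
    (hA : ∀ i j, i ≠ j → (D i).Apart bc H (D j)) {k : ι → Set (ℝ × ℝ)}
    (hk : ∀ i, IsCompact (k i)) (hkD : ∀ i, k i ⊆ (D i).coords) :
    ∃ R, ∀ g : ℝ × ℝ → ℝ, ContinuousOn g (strip H) → (∀ z ∈ strip H, 0 ≤ g z) →
      ∑ i, ∫ p in k i, (D i).E₁ p.1 p.2 * (D i).E₂ p.1 p.2 * g (bc.fold H ((D i).param p))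
        ≤ ∫ z in Icc (-R) R ×ˢ Icc 0 H, g z := by
  have hb : ∀ i, ∃ R, ∀ p ∈ k i, |(D i).X p.1 p.2| ≤ R := fun i =>
    (hk i).exists_bound_of_continuousOn ((hD i).contDiffOn_X.continuousOn.mono (hkD i))
  choose r hr using hb
  obtain ⟨R, hR⟩ : ∃ R, ∀ i, r i ≤ R := by
    obtain ⟨R, hR⟩ := (finite_range r).bddAbove
    exact ⟨R, fun i => hR (mem_range_self i)⟩
  refine ⟨R, fun g hg hg0 => ?_⟩
  have hbox : Icc (-R) R ×ˢ Icc 0 H ⊆ strip H := prod_mono_left (subset_univ _)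
  set g' := (Icc (-R) R ×ˢ Icc 0 H).indicator g with hg'
  have hbm : MeasurableSet (Icc (-R) R ×ˢ Icc 0 H) := measurableSet_Icc.prod measurableSet_Icc
  have hig : Integrable g' (volume.restrict (strip H)) :=
    (((hg.mono hbox).integrableOn_compact (isCompact_Icc.prod isCompact_Icc)).integrable_indicator
      hbm).integrableOn
  set w : ι → ℝ × ℝ → ℝ := fun i => (k i).indicator 1 with hw
  have hle := sum_area_le (w := w) hH hK hD hA fun i p =>
    indicator_le_self' (fun _ _ => zero_le_one) p |>.trans le_rfl
  have e := integral_sum_area (w := w) hK hD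
    (fun i => measurable_one.indicator (hk i).measurableSet)
    (fun i p => indicator_nonneg (fun _ _ => zero_le_one) p) (hig.mono_measure hle)
  have e1 : ∀ i, ∫ p in (D i).coords, (D i).E₁ p.1 p.2 * (D i).E₂ p.1 p.2 *
      (w i p * g' (bc.fold H ((D i).param p)))
      = ∫ p in k i, (D i).E₁ p.1 p.2 * (D i).E₂ p.1 p.2 * g (bc.fold H ((D i).param p)) := by
    intro i
    have e2 : ∀ p, (D i).E₁ p.1 p.2 * (D i).E₂ p.1 p.2 * (w i p * g' (bc.fold H ((D i).param p)))
        = (k i).indicator (fun p => (D i).E₁ p.1 p.2 * (D i).E₂ p.1 p.2 *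
          g (bc.fold H ((D i).param p))) p := by
      intro p
      by_cases hp : p ∈ k i
      · have hm : bc.fold H ((D i).param p) ∈ Icc (-R) R ×ˢ Icc 0 H := by
          refine ⟨?_, (BC.fold_mem hH ((hD i).mem_strip p (hkD i hp))).2⟩
          rw [BC.fold_fst]
          exact abs_le.1 ((hr i p hp).trans (hR i))
        simp only [hw, hg', indicator_of_mem hp, indicator_of_mem hm, Pi.one_apply, one_mul]
      · simp only [hw, indicator_of_notMem hp, zero_mul, mul_zero]
    simp only [e2]
    rw [setIntegral_indicator (hk i).measurableSet, inter_eq_right.2 (hkD i)]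
  rw [← Finset.sum_congr rfl fun i _ => e1 i, ← e]
  calc ∫ z, g' z ∂(∑ i, (D i).area bc H (w i)) ≤ ∫ z in strip H, g' z := by
        refine integral_mono_measure hle ?_ hig
        refine Eventually.of_forall fun z => indicator_nonneg (fun z hz => hg0 z (hbox hz)) z
    _ = _ := by rw [hg', setIntegral_indicator hbm, inter_eq_right.2 hbox]

end Family

end Tube

/-! ### The averaging weights -/

namespace Tube

/-- The weight of the averaging kernel on the tube. -/
def weight (l : ℝ) (D : Tube) (p : ℝ × ℝ) : ℝ := G D.h (p.1 - D.c) / (D.h ^ 2 + l ^ 2)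

/-- The part of the tube in `a ≤ x ≤ b`. -/
def slab (D : Tube) (a b : ℝ) : Set (ℝ × ℝ) := {p ∈ D.coords | D.X p.1 p.2 ∈ Icc a b}

section Weight

variable {D : Tube} {l : ℝ}

lemma measurable_weight (hh : 0 < D.h) : Measurable (D.weight l) :=
  (((continuous_G hh).comp (by fun_prop)).div_const _).measurable

lemma weight_nonneg (hh : 0 < D.h) (p : ℝ × ℝ) : 0 ≤ D.weight l p :=
  div_nonneg (G_nonneg hh _) (by positivity)

lemma weight_le_one (hh : 0 < D.h) (p : ℝ × ℝ) : D.weight l p ≤ 1 := by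
  refine div_le_one_of_le₀ ((G_le hh _).trans ?_) (by positivity)
  nlinarith [sq_nonneg l, sq_nonneg D.h]

lemma weight_pos (hh : 0 < D.h) {p : ℝ × ℝ} (hp : p ∈ D.coords) : 0 < D.weight l p :=
  div_pos (G_pos hh (abs_lt.2 ⟨by linarith [hp.1.1], by linarith [hp.1.2]⟩)) (by positivity)

end Weight

end Tube

/-! ### The averaging measures of a family of tubes -/

section Measures

variable {N : ℕ} {bc : BC} {H K σ l : ℝ} {u₁ u₂ : ℝ → ℝ → ℝ} {D : Fin N → Tube}

/-- The averaging measure of a family of tubes. -/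
def tubesMeasure (bc : BC) (H l : ℝ) (D : Fin N → Tube) : Measure (ℝ × ℝ) :=
  ∑ j, (D j).area bc H ((D j).weight l)

lemma tubesMeasure_le (hH : 0 < H) (hK : 0 < K) (hD : ∀ j, (D j).IsStreamTube bc H u₁ u₂ K σ)
    (hA : ∀ i j, i ≠ j → (D i).Apart bc H (D j)) :
    tubesMeasure bc H l D ≤ volume.restrict (strip H) :=
  Tube.sum_area_le (σ := fun _ => σ) hH hK hD hA fun j => Tube.weight_le_one (hD j).h_pos

lemma integral_tubesMeasure (hK : 0 < K) (hD : ∀ j, (D j).IsStreamTube bc H u₁ u₂ K σ)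
    {g : ℝ × ℝ → ℝ} (hg : Integrable g (tubesMeasure bc H l D)) :
    ∫ z, g z ∂(tubesMeasure bc H l D) = ∑ j, ∫ p in (D j).coords,
      (D j).E₁ p.1 p.2 * (D j).E₂ p.1 p.2 *
        ((D j).weight l p * g (bc.fold H ((D j).param p))) :=
  Tube.integral_sum_area (σ := fun _ => σ) hK hD (fun j => Tube.measurable_weight (hD j).h_pos)
    (fun j => Tube.weight_nonneg (hD j).h_pos) hg

lemma volume_restrict_strip_lt_top (H a b : ℝ) :
    volume.restrict (strip H) (Icc a b ×ˢ univ) < ⊤ := by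
  rw [Measure.restrict_apply (measurableSet_Icc.prod MeasurableSet.univ)]
  have hsub : (Icc a b ×ˢ univ) ∩ strip H ⊆ Icc a b ×ˢ Icc 0 H := fun z hz => ⟨hz.1.1, hz.2.2⟩
  exact (measure_mono hsub).trans_lt (isCompact_Icc.prod isCompact_Icc).measure_lt_top

lemma integrable_indicator_slab {ν : Measure (ℝ × ℝ)} (hν : ν ≤ volume.restrict (strip H))
    (a b : ℝ) : Integrable ((Icc a b ×ˢ (univ : Set ℝ)).indicator (1 : ℝ × ℝ → ℝ)) ν :=
  (integrable_indicator_iff (measurableSet_Icc.prod MeasurableSet.univ)).2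
    (integrableOn_const (C := (1 : ℝ)) ((hν _).trans_lt (volume_restrict_strip_lt_top H a b)).ne)

lemma slab_param {D : Tube} (a b : ℝ) {p : ℝ × ℝ} (hp : p ∈ D.coords) :
    (Icc a b ×ˢ (univ : Set ℝ)).indicator (1 : ℝ × ℝ → ℝ) (bc.fold H (D.param p))
      = (D.slab a b).indicator 1 p := by
  have h1 : bc.fold H (D.param p) ∈ Icc a b ×ˢ (univ : Set ℝ) ↔ p ∈ D.slab a b := by
    rw [mem_prod, BC.fold_fst]
    exact ⟨fun h => ⟨hp, h.1⟩, fun h => ⟨h.2, mem_univ _⟩⟩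
  by_cases h : p ∈ D.slab a b
  · rw [indicator_of_mem (h1.2 h), indicator_of_mem h]
    rfl
  · rw [indicator_of_notMem fun h' => h (h1.1 h'), indicator_of_notMem h]

lemma Tube.IsStreamTube.measurableSet_slab {D : Tube} (hD : D.IsStreamTube bc H u₁ u₂ K σ)
    (a b : ℝ) : MeasurableSet (D.slab a b) := by
  obtain ⟨v, hv, e⟩ := continuousOn_iff_isClosed.1 hD.contDiffOn_X.continuousOn (Icc a b)
    isClosed_Icc
  have : D.slab a b = v ∩ D.coords := by
    rw [← e]; ext p; exact and_comm
  rw [this]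
  exact hv.measurableSet.inter D.measurableSet_coords

lemma setIntegral_slab {D : Tube} (hD : D.IsStreamTube bc H u₁ u₂ K σ) (a b : ℝ) (A : ℝ × ℝ → ℝ) :
    ∫ p in D.coords, D.E₁ p.1 p.2 * D.E₂ p.1 p.2 * (A p *
      (Icc a b ×ˢ (univ : Set ℝ)).indicator (1 : ℝ × ℝ → ℝ) (bc.fold H (D.param p)))
    = ∫ p in D.slab a b, D.E₁ p.1 p.2 * D.E₂ p.1 p.2 * A p := by
  have e : EqOn (fun p => D.E₁ p.1 p.2 * D.E₂ p.1 p.2 * (A p *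
      (Icc a b ×ˢ (univ : Set ℝ)).indicator (1 : ℝ × ℝ → ℝ) (bc.fold H (D.param p))))
      ((D.slab a b).indicator fun p => D.E₁ p.1 p.2 * D.E₂ p.1 p.2 * A p) D.coords := by
    intro p hp
    simp only [slab_param a b hp]
    by_cases h : p ∈ D.slab a b
    · rw [indicator_of_mem h, indicator_of_mem h, Pi.one_apply, mul_one]
    · rw [indicator_of_notMem h, indicator_of_notMem h, mul_zero, mul_zero]
  rw [setIntegral_congr_fun D.measurableSet_coords e,
    setIntegral_indicator (hD.measurableSet_slab a b), inter_eq_right.2 fun p hp => hp.1]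

/-- The weight here omits the factor `1/H`, to be dominated by area. Closed and half-open slabs have
the same mass because vertical lines are null sets; half-open ones are disjoint. -/
lemma toReal_tubesMeasure (hH : 0 < H) (hK : 0 < K)
    (hD : ∀ j, (D j).IsStreamTube bc H u₁ u₂ K σ)
    (hA : ∀ i j, i ≠ j → (D i).Apart bc H (D j)) (a b : ℝ) :
    (tubesMeasure bc H l D (Ioc a b ×ˢ univ)).toReal = H * tubeMeasure H l D a b := by
  have hle := tubesMeasure_le (l := l) hH hK hD hA
  have hae : (Ioc a b ×ˢ (univ : Set ℝ) : Set (ℝ × ℝ)) =ᵐ[tubesMeasure bc H l D]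
      Icc a b ×ˢ (univ : Set ℝ) := by
    refine (Measure.absolutelyContinuous_of_le (hle.trans Measure.restrict_le_self)).ae_eq ?_
    exact Measure.set_prod_ae_eq Ioc_ae_eq_Icc (ae_eq_refl _)
  have hI := integral_tubesMeasure hK hD (integrable_indicator_slab hle a b)
  rw [integral_indicator_one (measurableSet_Icc.prod MeasurableSet.univ)] at hI
  rw [measure_congr hae]
  change (tubesMeasure bc H l D).real _ = _
  rw [hI, tubeMeasure, Finset.mul_sum]
  refine Finset.sum_congr rfl fun j _ => ?_
  rw [setIntegral_slab (hD j), ← integral_const_mul]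
  refine integral_congr_ae (Eventually.of_forall fun p => ?_)
  simp only [Tube.weight]
  field_simp

/-- Division by zero gives zero, so positivity is needed to turn the hypothesis on ratios into a
proportionality with `m₀ > 0`. Every tube contributes: by the intermediate value theorem its axis
crosses each slab, and the weight is positive on a nonempty open set. -/
lemma tubeMeasure_pos (hH : 0 < H) (hK : 0 < K)
    (hD : ∀ j, (D j).IsStreamTube bc H u₁ u₂ K σ)
    (hA : ∀ i j, i ≠ j → (D i).Apart bc H (D j)) (hN : 0 < N) {a b : ℝ} (hab : a < b) :
    0 < tubeMeasure H l D a b := by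
  have hle := tubesMeasure_le (l := l) hH hK hD hA
  have hpos : ∀ j, 0 < ∫ p in (D j).slab a b, (D j).E₁ p.1 p.2 * (D j).E₂ p.1 p.2
        * (G (D j).h (p.1 - (D j).c) / (H * ((D j).h ^ 2 + l ^ 2))) := by
    intro j
    have hh := (hD j).h_pos
    have hm := (hD j).measurableSet_slab a b
    have hw : ∀ p : ℝ × ℝ, G (D j).h (p.1 - (D j).c) / (H * ((D j).h ^ 2 + l ^ 2))
        = H⁻¹ * (D j).weight l p := fun p => by
      rw [Tube.weight]; field_simp
    simp only [hw]
    have hpt : ∀ p ∈ (D j).coords, 0 < (D j).E₁ p.1 p.2 * (D j).E₂ p.1 p.2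
        * (H⁻¹ * (D j).weight l p) := fun p hp =>
      mul_pos (mul_pos ((hD j).E₁_pos hK hp) ((hD j).E₂_pos hK hp))
        (mul_pos (inv_pos.2 hH) (Tube.weight_pos hh hp))
    have hle' : (D j).area bc H ((D j).weight l) ≤ volume.restrict (strip H) :=
      le_trans (Tube.area_le_sum (D := D) (w := fun j => (D j).weight l) j) hle
    have hint := ((hD j).integrable_area hK (Tube.measurable_weight (l := l) hh)
      (Tube.weight_nonneg hh) (integrable_indicator_slab hle' a b)).1
    have hint2 : IntegrableOn (fun p => (D j).E₁ p.1 p.2 * (D j).E₂ p.1 p.2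
        * (H⁻¹ * (D j).weight l p)) ((D j).slab a b) := by
      refine ((hint.mono_set (s := (D j).slab a b) fun p hp => hp.1).const_mul H⁻¹).congr ?_
      filter_upwards [ae_restrict_mem hm] with p hp
      rw [slab_param a b hp.1, indicator_of_mem hp, Pi.one_apply]
      ring
    refine (setIntegral_pos_iff_support_of_nonneg_ae ?_ hint2).2 ?_
    · filter_upwards [ae_restrict_mem hm] with p hp using (hpt p hp.1).le
    · have hsub : {p ∈ (D j).coords | (D j).X p.1 p.2 ∈ Ioo a b} ⊆
          Function.support (fun p : ℝ × ℝ => (D j).E₁ p.1 p.2 * (D j).E₂ p.1 p.2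
            * (H⁻¹ * (D j).weight l p)) ∩ (D j).slab a b := fun p hp =>
        ⟨(hpt p hp.1).ne', hp.1, Ioo_subset_Icc_self hp.2⟩
      refine lt_of_lt_of_le ?_ (measure_mono hsub)
      have ho : IsOpen {p ∈ (D j).coords | (D j).X p.1 p.2 ∈ Ioo a b} :=
        (hD j).contDiffOn_X.continuousOn.isOpen_inter_preimage (D j).isOpen_coords isOpen_Ioo
      refine ho.measure_pos _ ?_
      have hc : (D j).c ∈ Ioo ((D j).c - (D j).h) ((D j).c + (D j).h) := by
        constructor <;> linarith
      have hcont : Continuous ((D j).X (D j).c) := continuousOn_univ.1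
        ((hD j).contDiffOn_X.continuousOn.comp (f := fun s : ℝ => ((D j).c, s)) (by fun_prop)
          fun s _ => ⟨hc, mem_univ _⟩)
      obtain ⟨s, hs⟩ := hcont.surjective ((hD j).tendsto_right _ hc) ((hD j).tendsto_left _ hc)
        ((a + b) / 2)
      refine ⟨((D j).c, s), ⟨hc, mem_univ _⟩, ?_⟩
      simp only [hs]
      constructor <;> linarith
  exact Finset.sum_pos (fun j _ => hpos j) ⟨⟨0, hN⟩, Finset.mem_univ _⟩

end Measures

/-! ### Summation of the tube inequalities -/

section Solution

variable {N : ℕ} {bc : BC} {H K σ l κ v₀ τ A lam : ℝ} {f : ℝ → ℝ} {u₁ u₂ : ℝ → ℝ → ℝ}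
  {D : Fin N → Tube} {T : ℝ → ℝ → ℝ → ℝ}

lemma IsSolution.apply_fold (h : IsSolution bc κ v₀ H f u₁ u₂ T) {t : ℝ} (ht : 0 ≤ t) (z : ℝ × ℝ) :
    T (bc.fold H z).1 (bc.fold H z).2 t = T z.1 z.2 t :=
  BC.apply_fold (g := fun z => T z.1 z.2 t) (fun hbc x y => by
    subst hbc; exact h.boundary x y t ht) z

lemma IsSolution.density_fold (h : IsSolution bc κ v₀ H f u₁ u₂ T) (a : ℝ) {t : ℝ} (ht : 0 < t)
    (z : ℝ × ℝ) : density a κ T (dx T) (dy (bc.cross H) T) (bc.fold H z) t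
      = density a κ T (dx T) (dy (bc.cross H) T) z t := by
  refine BC.apply_fold (g := fun z => density a κ T (dx T) (dy (bc.cross H) T) z t)
    (fun hbc x y => ?_) z
  subst hbc
  have hp : ∀ x y, T x (y + H) t = T x y t := fun x y => h.boundary x y t ht.le
  have h1 : dx T x (y + H) t = dx T x y t := by simp only [dx, hp]
  have h2 : dy (BC.periodic.cross H) T x (y + H) t = dy (BC.periodic.cross H) T x y t := by
    simp only [dy, BC.cross, derivWithin_univ]
    rw [← deriv_comp_add_const]
    simp only [hp]
  simp only [density, hp, h1, h2]

/-- Transfers the decay from the strip to tubes that leave it, by periodicity; the folding does not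
change `x`. -/
lemma IsSolution.decay_cross (h : IsSolution bc κ v₀ H f u₁ u₂ T) (hH : 0 < H)
    (hDec : Decay H τ A lam T) : ∀ x, ∀ y ∈ bc.cross H, ∀ t ∈ Icc 0 τ, T x y t ∈ Icc (0 : ℝ) 1 ∧
      T x y t ≤ A * Real.exp (-lam * x) ∧ 1 - T x y t ≤ A * Real.exp (lam * x) := by
  intro x y hy t ht
  have hm := (BC.fold_mem (z := (x, y)) hH hy).2
  have e := h.apply_fold ht.1 (x, y)
  have h1 := hDec.right x _ hm t ht
  have h2 := hDec.left x _ hm t ht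
  rw [BC.fold_fst] at e
  rw [e] at h1 h2
  exact ⟨h.range x y hy t ht.1, h1, h2⟩

/-- The flux through a family of tubes is controlled by the increment of the temperature and by the
dissipation. -/
lemma IsSolution.sum_flux_le (h : IsSolution bc κ v₀ H f u₁ u₂ T) (hu : IsFlow bc H u₁ u₂)
    (hH : 0 < H) (hK : 0 < K) (hκ : 0 < κ) (hv : 0 < v₀) (hfc : Continuous f) {Mf : ℝ} (hMf : 0 < Mf)
    (hf : ∀ s ∈ Icc (0 : ℝ) 1, 0 ≤ f s ∧ f s ≤ Mf * (s * (1 - s))) (hDec : Decay H τ A lam T)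
    (hD : ∀ j, (D j).IsStreamTube bc H u₁ u₂ K σ) (hσ : |σ| = 1)
    (hA : ∀ i j, i ≠ j → (D i).Apart bc H (D j)) {t₀ t₁ B : ℝ} (ht₀ : 0 < t₀) (ht : t₀ ≤ t₁)
    (ht₁ : t₁ ≤ τ) (hB : ∀ R, ∫ t in t₀..t₁, ∫ p in Icc (-R) R ×ˢ Icc (0 : ℝ) H,
      density (4 * (v₀ ^ 2 / (4 * κ))) κ T (dx T) (dy (bc.cross H) T) p t ≤ B) (s : Fin N → ℝ) :
    (t₁ - t₀) / 8 * (H * fluxSum H (κ / v₀) u₁ u₂ D s)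
      ≤ σ * (∫ p, (T p.1 p.2 t₁ - T p.1 p.2 t₀) ∂(tubesMeasure bc H (κ / v₀) D))
        + tubeConst K Mf * B := by
  set l := κ / v₀ with hl
  set a := 4 * (v₀ ^ 2 / (4 * κ)) with ha
  have ha0 : 0 < a := by positivity
  have hs := h.planeSol
  have hS := h.stripSol hu
  have hle := tubesMeasure_le (l := l) hH hK hD hA
  have iΔ : Integrable (fun p : ℝ × ℝ => T p.1 p.2 t₁ - T p.1 p.2 t₀) (volume.restrict (strip H)) :=
    hDec.integrable_difference hS ⟨ht₀.le, ht.trans ht₁⟩ ⟨(ht₀.trans_le ht).le, ht₁⟩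
  have hfold : ∀ z : ℝ × ℝ, T (bc.fold H z).1 (bc.fold H z).2 t₁ -
      T (bc.fold H z).1 (bc.fold H z).2 t₀ = T z.1 z.2 t₁ - T z.1 z.2 t₀ := fun z => by
    rw [h.apply_fold ht₀.le, h.apply_fold (ht₀.trans_le ht).le]
  -- The family with weight 1 transfers the integrability of the increment of `T` from the strip to
  -- each whole tube, as the limit in the rectangles requires.
  have hone : ∑ j, (D j).area bc H (fun _ => 1) ≤ volume.restrict (strip H) :=
    Tube.sum_area_le (σ := fun _ => σ) hH hK hD hA fun _ _ => le_rfl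
  have hi : ∀ j, IntegrableOn (fun p : ℝ × ℝ => (D j).E₁ p.1 p.2 * (D j).E₂ p.1 p.2 *
      (T ((D j).X p.1 p.2) ((D j).Y p.1 p.2) t₁ - T ((D j).X p.1 p.2) ((D j).Y p.1 p.2) t₀))
      (D j).coords := fun j => by
    have := ((hD j).integrable_area hK measurable_const (fun _ => zero_le_one)
      (iΔ.mono_measure (le_trans (Tube.area_le_sum (D := D) (w := fun _ _ => 1) j) hone))).1
    simp only [hfold, one_mul] at this
    exact this
  rw [integral_tubesMeasure hK hD (iΔ.mono_measure hle), Finset.mul_sum]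
  simp only [hfold]
  refine le_of_forall_pos_le_add fun ε hε => ?_
  have hdec := h.decay_cross hH hDec
  have key : ∀ᶠ n : ℕ in atTop, ∀ j, (t₁ - t₀) / 8 * ((1 + l ^ 2 / (D j).h ^ 2)⁻¹ *
        ∫ ρ in ((D j).c - (D j).h / 2)..((D j).c + (D j).h / 2), (D j).flux u₁ u₂ ρ (s j))
      ≤ σ * (∫ p in (D j).coords, (D j).E₁ p.1 p.2 * (D j).E₂ p.1 p.2 * ((D j).weight l p *
          (T ((D j).X p.1 p.2) ((D j).Y p.1 p.2) t₁ - T ((D j).X p.1 p.2) ((D j).Y p.1 p.2) t₀)))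
        + tubeConst K Mf * (∫ t in t₀..t₁, ∫ p in (D j).level n, (D j).E₁ p.1 p.2 *
          (D j).E₂ p.1 p.2 * density a κ T (dx T) (dy (bc.cross H) T) ((D j).param p) t)
        + ε / (N + 1) := by
    refine eventually_all.2 fun j => ?_
    refine (hD j).eventually_flux_le hK hσ hu hs hfc hf hκ ha0 hMf ?_ ha.symm ht₀ ht
      (fun ε hε => ?_) (hi j) (s j) (by positivity)
    · rw [hl, ha]; field_simp
    · filter_upwards [(hD j).eventually_near_step hDec.lam_pos hdec hε] with R hR p hp t htt
      exact hR p hp t ⟨(ht₀.trans_le htt.1).le, htt.2.trans ht₁⟩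
  -- A single `n` serves all tubes since they are finitely many; the errors `ε / (N + 1)` add up to
  -- at most `ε`.
  obtain ⟨n, hn⟩ := key.exists
  obtain ⟨R, hR⟩ := Tube.sum_integral_le (σ := fun _ => σ) (k := fun j => (D j).level n) hH hK hD hA
    (fun j => (D j).isCompact_level n) fun j => Tube.level_subset_coords (hD j).h_pos n
  have hint : ∀ j, IntervalIntegrable (fun t => ∫ p in (D j).level n, (D j).E₁ p.1 p.2 *
      (D j).E₂ p.1 p.2 * density a κ T (dx T) (dy (bc.cross H) T) ((D j).param p) t) volume t₀ t₁ :=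
    fun j => intervalIntegrable_of_Ioi ((hD j).continuousOn_integral_density hK hs a
      ((D j).isCompact_level n) (Tube.level_subset_coords (hD j).h_pos n)) ht₀ ht
  have hE : ∑ j, (∫ t in t₀..t₁, ∫ p in (D j).level n, (D j).E₁ p.1 p.2 *
      (D j).E₂ p.1 p.2 * density a κ T (dx T) (dy (bc.cross H) T) ((D j).param p) t) ≤ B := by
    rw [← intervalIntegral.integral_finsetSum fun j _ => hint j]
    refine (intervalIntegral.integral_mono_on ht ?_ ?_ fun t htt => ?_).trans (hB R)
    · have e := IntervalIntegrable.sum Finset.univ fun j _ => hint j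
      rwa [Finset.sum_fn] at e
    · exact intervalIntegrable_of_Ioi (continuousOn_setIntegral_of_isCompact (isCompact_box R H)
        isOpen_Ioi (F := fun p t => density a κ T (dx T) (dy (bc.cross H) T) p t)
        ((hS.continuousOn_density a).mono (prod_mono_left (box_subset_strip R H)))) ht₀ ht
    · have htp : 0 < t := ht₀.trans_le htt.1
      have := hR (fun p => density a κ T (dx T) (dy (bc.cross H) T) p t)
        ((hS.continuousOn_density a).comp (f := fun p : ℝ × ℝ => (p, t)) (by fun_prop)
          fun p hp => ⟨hp, htp⟩) fun z hz => hS.density_nonneg hκ ha0.le hz htp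
      simp only [h.density_fold a htp] at this
      exact this
  have hflux : H * fluxSum H l u₁ u₂ D s = ∑ j, (1 + l ^ 2 / (D j).h ^ 2)⁻¹ *
      ∫ ρ in ((D j).c - (D j).h / 2)..((D j).c + (D j).h / 2), (D j).flux u₁ u₂ ρ (s j) := by
    rw [fluxSum, Finset.mul_sum]
    refine Finset.sum_congr rfl fun j _ => ?_
    rw [intervalIntegral.integral_div]
    simp only [Tube.flux]
    field_simp
  rw [hflux, Finset.mul_sum]
  have hsum := Finset.sum_le_sum fun j (_ : j ∈ Finset.univ) => hn j
  rw [Finset.sum_add_distrib, Finset.sum_add_distrib, ← Finset.mul_sum (a := tubeConst K Mf),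
    Finset.sum_const, Finset.card_univ, Fintype.card_fin, nsmul_eq_mul] at hsum
  have h1 : (N : ℝ) * (ε / (N + 1)) ≤ ε := by
    rw [mul_div_assoc', div_le_iff₀ (by positivity)]
    nlinarith
  have h2 := mul_le_mul_of_nonneg_left hE (tubeConst_pos hK hMf).le
  exact hsum.trans (by
    simp only [Tube.param] at *
    linarith)

end Solution

/-! ### The lower bound for the mean bulk rate -/

section Main

variable {bc : BC} {H K κ v₀ τ A lam L m₀ : ℝ} {f : ℝ → ℝ} {u₁ u₂ : ℝ → ℝ → ℝ} {Np Nm : ℕ}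
  {Dp : Fin Np → Tube} {Dm : Fin Nm → Tube} {x : ℤ → ℝ} {T : ℝ → ℝ → ℝ → ℝ}

/-- The fluxes are controlled by the total reaction. -/
lemma IsSolution.flux_le (h : IsSolution bc κ v₀ H f u₁ u₂ T) (hu : IsFlow bc H u₁ u₂)
    (hH : 0 < H) (hK : 0 < K) (hκ : 0 < κ) (hv : 0 < v₀) (hfc : Continuous f) {Mf : ℝ} (hMf : 0 < Mf)
    (hf : ∀ s ∈ Icc (0 : ℝ) 1, 0 ≤ f s ∧ f s ≤ Mf * (s * (1 - s))) (hDec : Decay H τ A lam T)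
    (hP : IsPercolating bc H u₁ u₂ K Dp Dm) (hx : IsPartition x L) (hm₀ : 0 < m₀)
    (hm : ∀ i : ℤ, tubeMeasure H (κ / v₀) Dp (x i) (x (i + 1))
      = m₀ * tubeMeasure H (κ / v₀) Dm (x i) (x (i + 1)))
    (hτ : max (κ / v₀ ^ 2) ((H + L) / v₀) ≤ τ) (sp : Fin Np → ℝ) (sm : Fin Nm → ℝ) :
    τ * (H * fluxSum H (κ / v₀) u₁ u₂ Dp sp + m₀ * (H * fluxSum H (κ / v₀) u₁ u₂ Dm sm))
      ≤ 32 * (1 + m₀) * ((112 + tubeConst K Mf) * ((3 + Mf / 8) * (v₀ ^ 2 / κ *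
        ∫ t in (0 : ℝ)..τ, ∫ p in strip H, T p.1 p.2 t * (1 - T p.1 p.2 t)))) := by
  obtain ⟨M, -, hF⟩ := hu.stripFlow hH
  have hS := h.stripSol hu
  have hc : 0 < v₀ ^ 2 / (4 * κ) := by positivity
  have ha : 4 * (v₀ ^ 2 / (4 * κ)) = v₀ ^ 2 / κ := by field_simp
  have hτ1 := (le_max_left _ _).trans hτ
  have hτ2 := (le_max_right _ _).trans hτ
  have hτ0 : 0 < τ := lt_of_lt_of_le (by positivity) hτ1
  have hcτ : 1 ≤ 4 * (v₀ ^ 2 / (4 * κ)) * τ := by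
    rw [ha]
    calc (1 : ℝ) = v₀ ^ 2 / κ * (κ / v₀ ^ 2) := by field_simp
      _ ≤ _ := by gcongr
  obtain ⟨t₀, t₁, ht₀, htt, ht₁, hbox, hgood⟩ := hS.exists_good_times hF hH hκ hc hfc hMf hf hDec
    hτ0 hcτ rfl
  set B := (3 + Mf / 8) * (4 * (v₀ ^ 2 / (4 * κ)) *
    ∫ t in (0 : ℝ)..τ, ∫ p in strip H, T p.1 p.2 t * (1 - T p.1 p.2 t)) with hB
  have ht : t₀ ≤ t₁ := by linarith
  have fp := h.sum_flux_le hu hH hK hκ hv hfc hMf hf hDec hP.tube_p (by simp) hP.apart_p ht₀ ht ht₁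
    hbox sp
  have fm := h.sum_flux_le hu hH hK hκ hv hfc hMf hf hDec hP.tube_m (by simp) hP.apart_m ht₀ ht ht₁
    hbox sm
  have hdiff := hS.difference_le (a := 4 * (v₀ ^ 2 / (4 * κ))) (v := v₀) hH hκ hDec
    (tubesMeasure_le (l := κ / v₀) hH hK hP.tube_p hP.apart_p)
    (tubesMeasure_le (l := κ / v₀) hH hK hP.tube_m hP.apart_m) hm₀.le hx
    (fun i => by
      rw [toReal_tubesMeasure hH hK hP.tube_p hP.apart_p,
        toReal_tubesMeasure hH hK hP.tube_m hP.apart_m, hm i]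
      ring) (by positivity) hv (by field_simp) ⟨ht₀, ht.trans ht₁⟩ ⟨ht₀.trans_le ht, ht₁⟩ hgood
  have hB0 : 0 ≤ B := by
    refine mul_nonneg (by positivity) (mul_nonneg (by positivity)
      (intervalIntegral.integral_nonneg hτ0.le fun t htt => integral_nonneg_of_ae ?_))
    filter_upwards [ae_restrict_mem (measurableSet_strip H)] with p hp
    have := hS.range p.1 p.2 hp.2 t htt.1
    exact mul_nonneg this.1 (sub_nonneg.2 this.2)
  -- Both `κ / v₀²` and `(H + L) / v₀` are at most `τ`, so the bracket is at most `7 τ`, and `2 · 7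
  -- · 8 = 112`. This is where the lower bound on `τ` cancels the `1/τ` gained at the good times.
  have hD : 2 * ((1 / (4 * (v₀ ^ 2 / (4 * κ))) + 6 * (L + H) / v₀) * (8 * B / τ)) ≤ 112 * B := by
    have h1 : 1 / (4 * (v₀ ^ 2 / (4 * κ))) = κ / v₀ ^ 2 := by rw [ha, one_div_div]
    have h2 : 6 * (L + H) / v₀ = 6 * ((H + L) / v₀) := by ring
    calc _ ≤ 2 * ((7 * τ) * (8 * B / τ)) := by
          rw [h1, h2]
          gcongr
          linarith
      _ = _ := by field_simp; ring
  rw [← ha, ← hB]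
  have hm1 : 0 < 1 + m₀ := by linarith
  have hd := (le_abs_self _).trans hdiff
  have hd2 := mul_le_mul_of_nonneg_left hD hm1.le
  set P := ∫ p, (T p.1 p.2 t₁ - T p.1 p.2 t₀) ∂tubesMeasure bc H (κ / v₀) Dp
  set Q := ∫ p, (T p.1 p.2 t₁ - T p.1 p.2 t₀) ∂tubesMeasure bc H (κ / v₀) Dm
  set S := H * fluxSum H (κ / v₀) u₁ u₂ Dp sp
  set S' := H * fluxSum H (κ / v₀) u₁ u₂ Dm sm
  have fm' := mul_le_mul_of_nonneg_left fm hm₀.le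
  -- The inequality for `D⁺` plus `m₀` times that for `D⁻`: the signs `σ = ±1` leave exactly `P - m₀
  -- Q`.
  have hsum : (t₁ - t₀) / 8 * (S + m₀ * S') ≤ (1 + m₀) * ((112 + tubeConst K Mf) * B) := by
    linarith
  have hR : 0 ≤ (1 + m₀) * ((112 + tubeConst K Mf) * B) := by
    have := tubeConst_pos hK hMf
    positivity
  -- Replacing `t₁ - t₀` by its lower bound `τ/4` is legitimate for a positive sum, and the other
  -- case is trivial. The factor 32 is `4 · 8`.
  rcases le_or_gt (S + m₀ * S') 0 with hneg | hpos
  · exact (mul_nonpos_of_nonneg_of_nonpos hτ0.le hneg).trans (by linarith)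
  · have : τ / 4 / 8 * (S + m₀ * S') ≤ (t₁ - t₀) / 8 * (S + m₀ * S') := by gcongr
    linarith

lemma IsSolution.mean_bulk_rate (h : IsSolution bc κ v₀ H f u₁ u₂ T) (hu : IsFlow bc H u₁ u₂)
    (hH : 0 < H) (hK : 0 < K) (hκ : 0 < κ) (hv : 0 < v₀) (hfc : Continuous f) {m Mf : ℝ} (hm : 0 < m)
    (hMf : 0 < Mf)
    (hfb : ∀ s ∈ Icc (0 : ℝ) 1, m * (s * (1 - s)) ≤ f s ∧ f s ≤ Mf * (s * (1 - s)))
    (hP : IsPercolating bc H u₁ u₂ K Dp Dm) (hx : IsPartition x L)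
    (hm₀ : ∀ i : ℤ, tubeMeasure H (κ / v₀) Dp (x i) (x (i + 1))
      / tubeMeasure H (κ / v₀) Dm (x i) (x (i + 1)) = m₀)
    (hτ : max (κ / v₀ ^ 2) ((H + L) / v₀) ≤ τ) :
    (∀ᵐ t ∂(volume.restrict (Ioc 0 τ)), IntegrableOn
      (fun p : ℝ × ℝ => dt T p.1 p.2 t) (univ ×ˢ Icc 0 H)) ∧
    IntervalIntegrable (bulkRate H T) volume 0 τ ∧
    ∀ (sp : Fin Np → ℝ) (sm : Fin Nm → ℝ),
      m / (128 * (112 + tubeConst K Mf) * (3 + Mf / 8)) *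
        (1 / (1 + m₀) * fluxSum H (κ / v₀) u₁ u₂ Dp sp
          + 1 / (1 + m₀⁻¹) * fluxSum H (κ / v₀) u₁ u₂ Dm sm) ≤ meanBulkRate H T τ := by
  have hq : ∀ s ∈ Icc (0 : ℝ) 1, 0 ≤ s * (1 - s) := fun s hs =>
    mul_nonneg hs.1 (sub_nonneg.2 hs.2)
  have hf : ∀ s ∈ Icc (0 : ℝ) 1, 0 ≤ f s ∧ f s ≤ Mf * (s * (1 - s)) := fun s hs =>
    ⟨(mul_nonneg hm.le (hq s hs)).trans (hfb s hs).1, (hfb s hs).2⟩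
  obtain ⟨M, -, hF⟩ := hu.stripFlow hH
  have hS := h.stripSol hu
  have hc : 0 < v₀ ^ 2 / (4 * κ) := by positivity
  have hτ0 : 0 < τ := lt_of_lt_of_le (by positivity) ((le_max_left _ _).trans hτ)
  obtain ⟨lam, hlam, A, hloc⟩ := h.localized
  obtain ⟨A, lam, hDec⟩ := hS.exists_decay hF hH hκ hc hMf hf
    ⟨lam, hlam, A, fun x y hy => hloc x y (bc.Icc_subset_cross H hy)⟩ τ
  obtain ⟨hI, hE⟩ := hS.bulk hF hH hκ hc hfc hMf hf hDec hτ0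
  refine ⟨hS.ae_integrable_time_deriv hF hH hκ hc hfc hMf hf hDec hτ0, hI, fun sp sm => ?_⟩
  have hpp : ∀ i, 0 < tubeMeasure H (κ / v₀) Dp (x i) (x (i + 1)) := fun i =>
    tubeMeasure_pos hH hK hP.tube_p hP.apart_p hP.Np_pos (hx.strictMono (lt_add_one i))
  have hpm : ∀ i, 0 < tubeMeasure H (κ / v₀) Dm (x i) (x (i + 1)) := fun i =>
    tubeMeasure_pos hH hK hP.tube_m hP.apart_m hP.Nm_pos (hx.strictMono (lt_add_one i))
  have hm0 : 0 < m₀ := hm₀ 0 ▸ div_pos (hpp 0) (hpm 0)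
  have hfl := h.flux_le hu hH hK hκ hv hfc hMf hf hDec hP hx hm0
    (fun i => (div_eq_iff (hpm i).ne').1 (hm₀ i)) hτ sp sm
  have hTC := tubeConst_pos hK hMf
  have hqc : Continuous fun s : ℝ => s * (1 - s) := by fun_prop
  have hqB : ∀ s ∈ Icc (0 : ℝ) 1, |s * (1 - s)| ≤ 1 * (s * (1 - s)) := fun s hs => by
    rw [one_mul, abs_of_nonneg (hq s hs)]
  have hfB : ∀ s ∈ Icc (0 : ℝ) 1, |f s| ≤ Mf * (s * (1 - s)) := fun s hs => by
    rw [abs_of_nonneg (hf s hs).1]; exact (hf s hs).2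
  have hge : m * (∫ t in (0 : ℝ)..τ, ∫ p in strip H, T p.1 p.2 t * (1 - T p.1 p.2 t))
      ≤ ∫ t in (0 : ℝ)..τ, ∫ p in strip H, f (T p.1 p.2 t) := by
    rw [← intervalIntegral.integral_const_mul]
    refine intervalIntegral.integral_mono_on hτ0.le
      ((ContinuousOn.intervalIntegrable ?_).const_mul m) (ContinuousOn.intervalIntegrable ?_)
      fun t ht => ?_
    · rw [uIcc_of_le hτ0.le]; exact hDec.continuousOn_integral_comp hS hqc zero_le_one hqB
    · rw [uIcc_of_le hτ0.le]; exact hDec.continuousOn_integral_comp hS hfc hMf.le hfB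
    · rw [← integral_const_mul]
      refine setIntegral_mono_on ((hDec.integrableOn_comp hS hqc zero_le_one hqB ht).const_mul m)
        (hDec.integrableOn_comp hS hfc hMf.le hfB ht) (measurableSet_strip H) fun p hp => ?_
      exact (hfb _ (hS.range p.1 p.2 hp.2 t ht.1)).1
  set Λ := ∫ t in (0 : ℝ)..τ, ∫ p in strip H, T p.1 p.2 t * (1 - T p.1 p.2 t)
  have hmean : m / (128 * (112 + tubeConst K Mf) * (3 + Mf / 8)) * (32 * ((112 + tubeConst K Mf) *
      ((3 + Mf / 8) * (v₀ ^ 2 / κ * Λ)))) ≤ τ * H * meanBulkRate H T τ := by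
    have e : meanBulkRate H T τ = 1 / τ * (v₀ ^ 2 / (4 * κ) / H *
      ∫ t in (0 : ℝ)..τ, ∫ p in strip H, f (T p.1 p.2 t)) := by rw [← hE]; rfl
    rw [e]
    -- The factor 128 is `4 · 32`: the reaction rate is `v₀² / (4κ)`, while the energy bound was
    -- written with `v₀² / κ`.
    calc _ = v₀ ^ 2 / (4 * κ) * (m * Λ) := by field_simp; ring
      _ ≤ v₀ ^ 2 / (4 * κ) * ∫ t in (0 : ℝ)..τ, ∫ p in strip H, f (T p.1 p.2 t) := by gcongr
      _ = _ := by field_simp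
  set S := fluxSum H (κ / v₀) u₁ u₂ Dp sp
  set S' := fluxSum H (κ / v₀) u₁ u₂ Dm sm
  have hτH : 0 < τ * H := by positivity
  refine le_of_mul_le_mul_left (le_trans ?_ hmean) hτH
  have hm1 : 0 < 1 + m₀ := by linarith
  have e : τ * H * (m / (128 * (112 + tubeConst K Mf) * (3 + Mf / 8)) *
        (1 / (1 + m₀) * S + 1 / (1 + m₀⁻¹) * S'))
      = m / (128 * (112 + tubeConst K Mf) * (3 + Mf / 8)) *
        ((τ * (H * S + m₀ * (H * S'))) / (1 + m₀)) := by
    -- The two weights are `1 / (1 + m₀)` and `m₀ / (1 + m₀)`, so the combination in the theorem is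
    -- the sum bounded above divided by `1 + m₀`.
    have : 1 / (1 + m₀⁻¹) = m₀ / (1 + m₀) := by field_simp; ring
    rw [this]
    ring
  rw [e]
  refine mul_le_mul_of_nonneg_left ?_ (by positivity)
  rw [div_le_iff₀ hm1]
  refine hfl.trans (le_of_eq ?_)
  ring

end Main

end Percolating

end

/-! ### The theorem -/

theorem theorem6 (f : ℝ → ℝ) (hf : Percolating.IsKPP f) (K : ℝ) (hK : 0 < K) :
    ∃ C > 0, ∀ (bc : Percolating.BC) (κ v₀ H : ℝ), 0 < κ → 0 < v₀ → 0 < H →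
      ∀ u₁ u₂ : ℝ → ℝ → ℝ, Percolating.IsFlow bc H u₁ u₂ →
      ∀ T : ℝ → ℝ → ℝ → ℝ, Percolating.IsSolution bc κ v₀ H f u₁ u₂ T →
      ∀ (Np Nm : ℕ) (Dp : Fin Np → Percolating.Tube) (Dm : Fin Nm → Percolating.Tube),
        Percolating.IsPercolating bc H u₁ u₂ K Dp Dm →
      ∀ (x : ℤ → ℝ) (L m₀ : ℝ), Percolating.IsPartition x L →
        (∀ i : ℤ, Percolating.tubeMeasure H (κ / v₀) Dp (x i) (x (i + 1))
          / Percolating.tubeMeasure H (κ / v₀) Dm (x i) (x (i + 1)) = m₀) →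
      ∀ τ : ℝ, max (κ / v₀ ^ 2) ((H + L) / v₀) ≤ τ →
        (∀ᵐ t ∂(volume.restrict (Ioc 0 τ)), IntegrableOn
          (fun p : ℝ × ℝ => Percolating.dt T p.1 p.2 t) (univ ×ˢ Icc 0 H)) ∧
        IntervalIntegrable (Percolating.bulkRate H T) volume 0 τ ∧
        ∀ (sp : Fin Np → ℝ) (sm : Fin Nm → ℝ),
          C * (1 / (1 + m₀) * Percolating.fluxSum H (κ / v₀) u₁ u₂ Dp sp
              + 1 / (1 + m₀⁻¹) * Percolating.fluxSum H (κ / v₀) u₁ u₂ Dm sm)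
            ≤ Percolating.meanBulkRate H T τ := by
  obtain ⟨m, hm, Mf, hMf, hfb⟩ := hf.exists_bounds
  have hQ := Percolating.tubeConst_pos hK hMf
  refine ⟨m / (128 * (112 + Percolating.tubeConst K Mf) * (3 + Mf / 8)), by positivity, ?_⟩
  intro bc κ v₀ H hκ hv hH u₁ u₂ hu T hT Np Nm Dp Dm hP x L m₀ hx hm₀ τ hτ
  exact hT.mean_bulk_rate hu hH hK hκ hv hf.contDiff.continuous hm hMf hfb hP hx hm₀ hτ
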